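/- **Setting.** Let $d\ge 1$, $\alpha,\beta>0$ with $\frac{\alpha+\beta}{2}<\frac d4$. Fix an integer $S>\max(\alpha,\beta,\gamma)$ and a Cohen–Daubechies–Vial wavelet basis of $L^2([0,1])$ of regularity $S$ (built from a compactly supported $C^S$ Daubechies scaling function with $N\ge S$ vanishing moments, its interior translates, and $N$ edge functions at each end point; $V_j\subset V_{j+1}$, and $V_j$ contains the polynomials of degree less than $S$ for all levels $j\ge J_0$). Let $\Phi_{j\boldsymbol m}$, $\Psi^{\boldsymbol\iota}_{l\boldsymbol m}$ ($\boldsymbol\iota\in\{0,1\}^d\setminus\{\boldsymbol 0\}$) be the tensor-product functions on $[0,1]^d$. The Hölder ball $H(a,M)$ is the set of uniformly continuous $h:[0,1]^d\to\mathbb R$ with $$\|h\|_{(a)}:=2^{J_0(a+d/2)}\max_{\boldsymbol m}|\langle h,\Phi_{J_0\boldsymbol m}\rangle|+\sup_{l\ge J_0,\boldsymbol m,\boldsymbol\iota}2^{l(a+d/2)}|\langle h,\Psi^{\boldsymbol\iota}_{l\boldsymbol m}\rangle|\le M .$$ A resolution is a number $k=2^{jd}$ with $j\ge J_0$; write $K_k(\boldsymbol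 x,\boldsymbol y)=\sum_{\boldsymbol m}\Phi_{j\boldsymbol m}(\boldsymbol x)\Phi_{j\boldsymbol m}(\boldsymbol y)$. **Model.** Given constants $C_1,C_2,M,M_1,M_2$, let $\mathcal P$ be the set of laws $\mathbb P$ of $(\boldsymbol X,A,Y)\in[0,1]^d\times\mathbb R^2$ such that $A,Y\in[C_1,C_2]$ a.s., $\boldsymbol X$ has a density $f\in H(\gamma,M)$ on $[0,1]^d$ with $M_1\le f\le M_2$, and $p(\boldsymbol x)=\mathbb E[A|\boldsymbol X=\boldsymbol x]\in H(\alpha,M)$, $b(\boldsymbol x)=\mathbb E[Y|\boldsymbol X=\boldsymbol x]\in H(\beta,M)$. The constants are assumed non-degenerate: $C_1<C_2$, $0<M_1\le 1\le M_2$, $\|1\|_{(\gamma)}\le M$, and there is $c\in(C_1,C_2)$ whose constant function satisfies $\|c\|_{(\alpha)}<M$ and $\|c\|_{(\beta)}<M$. The target is $\psi(\mathbb P)=\mathbb E_{\mathbb P}[\mathrm{Cov}_{\mathbb P}(A,Y|\boldsymbol X)]$. **Estimators.** The sample consists of $m$ independent subsamples $\mathcal D_1,\dots,\mathcal D_m$,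 each of $n$ i.i.d. observations from $\mathbb P$ ($m=6$ for INT and MC, $m=3$ for NR, $m=5$ for IF). Let $\hat f$ be a (jointly measurable) density estimator with $0<c_1\le\hat f\le c_2<\infty$ on $[0,1]^d$ for constants $c_1,c_2$, and $$\sup_{\mathbb P\in\mathcal P}\mathbb E_{\mathbb P}\big[\|\hat f-f\|_\infty^2\big]\lesssim\Big(\frac{n}{\log n}\Big)^{-\frac{2\gamma}{2\gamma+d}} ;$$ $\hat f^{(j)}$ is $\hat f$ computed from $\mathcal D_j$. Put $$\hat p_k^{(i,j)}(\boldsymbol x)=\frac1n\sum_{r\in\mathcal D_i}\frac{A_rK_k(\boldsymbol X_r,\boldsymbol x)}{\hat f^{(j)}(\boldsymbol X_r)},\qquad \hat b_k^{(i,j)}(\boldsymbol x)=\frac1n\sum_{r\in\mathcal D_i}\frac{Y_rK_k(\boldsymbol X_r,\boldsymbol x)}{\hat f^{(j)}(\boldsymbol X_r)},$$ $$\hat\psi^{\rm INT}_{k_1,k_2}=\frac1n\sum_{i\in\mathcal D_5}A_iY_i-\int_{[0,1]^d}\hat p^{(1,2)}_{k_1}\hat b^{(3,4)}_{k_2}\hat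 f^{(6)}\,d\boldsymbol x,\qquad \hat\psi^{\rm MC}_{k_1,k_2}=\frac1n\sum_{i\in\mathcal D_5}A_iY_i-\frac1n\sum_{i\in\mathcal D_6}\hat p^{(1,2)}_{k_1}(\boldsymbol X_i)\hat b^{(3,4)}_{k_2}(\boldsymbol X_i),$$ $$\hat\psi^{\rm NR}_{k}=\frac1n\sum_{i\in\mathcal D_3}A_i\big(Y_i-\hat b^{(1,2)}_{k}(\boldsymbol X_i)\big),\qquad \hat\psi^{\rm IF}_{k_1,k_2}=\frac1n\sum_{i\in\mathcal D_5}\big(A_i-\hat p^{(1,2)}_{k_1}(\boldsymbol X_i)\big)\big(Y_i-\hat b^{(3,4)}_{k_2}(\boldsymbol X_i)\big).$$ The rate of an estimator $\hat\psi$ is the order in $n$ of its maximal risk $\sup_{\mathbb P\in\mathcal P}\mathbb E_{\mathbb P}[(\hat\psi-\psi(\mathbb P))^2]$. It is *rate optimal* if its maximal risk is $\asymp$ the minimax risk $\inf_T\sup_{\mathbb P\in\mathcal P}\mathbb E_{\mathbb P}[(T-\psi(\mathbb P))^2]$ over all measurable estimators $T$ from the same number $mn$ of observations. **Statement.** There is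 $\gamma_0=\gamma_0(\alpha,\beta,d)$ such that for every $\gamma>\max(\gamma_0,0)$, every basis, all constants and every $\hat f$ as above: 1. If $k_1\wedge k_2\asymp n^{\frac{2d}{2\alpha+2\beta+d}}$, then $\hat\psi^{\rm INT}_{k_1,k_2}$ is rate optimal, with rate $n^{-\frac{4\alpha+4\beta}{2\alpha+2\beta+d}}$. 2. For no choice of sequences $k_1,k_2$ is $\hat\psi^{\rm MC}_{k_1,k_2}$ rate optimal. For every choice its maximal risk is $\gtrsim n^{-\frac{3\alpha+3\beta}{\alpha+\beta+d}}$, and it is $\asymp n^{-\frac{3\alpha+3\beta}{\alpha+\beta+d}}$ when $k_\ell\asymp n^{\frac{3d}{2\alpha+2\beta+2d}}$ for $\ell=1,2$. 3. If $k\asymp n^{\frac{2d}{2\alpha+2\beta+d}}$, then $\hat\psi^{\rm NR}_{k}$ is rate optimal, with rate $n^{-\frac{4\alpha+4\beta}{2\alpha+2\beta+d}}$. 4. If $k_1\vee k_2\asymp n^{\frac{2d}{2\alpha+2\beta+d}}$ and $k_1\wedge k_2\lesssim n$, then $\hat\psi^{\rm IF}_{k_1,k_2}$ is rate optimal, with rate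 $n^{-\frac{4\alpha+4\beta}{2\alpha+2\beta+d}}$. -/

import Mathlib

open MeasureTheory Filter
open scoped ENNReal NNReal Topology

noncomputable section

/-! ### Asymptotic comparison of `[0, ∞]`-valued sequences -/

/-- `a ≲ b`: `a n ≤ C * b n` for all large `n`, with a finite constant `C > 0`. -/
def AsympLE (a b : ℕ → ℝ≥0∞) : Prop :=
  ∃ C : ℝ≥0, 0 < C ∧ ∀ᶠ n in atTop, a n ≤ (C : ℝ≥0∞) * b n

/-- `a ≍ b`. -/
def AsympEq (a b : ℕ → ℝ≥0∞) : Prop :=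
  AsympLE a b ∧ AsympLE b a

/-- The sequence `n ^ r`, as a `[0, ∞]`-valued sequence. -/
def powSeq (r : ℝ) (n : ℕ) : ℝ≥0∞ := ENNReal.ofReal ((n : ℝ) ^ r)

/-! ### Cohen-Daubechies-Vial wavelets on the unit interval -/

/-- The functions from which a Cohen-Daubechies-Vial basis is built: a scaling function `φ` on the
line with its filter, and `N` scaling edge functions and `N` wavelet edge functions at each of the
two end points (the right ones are placed at the end point `0` of the half-line `(-∞, 0]`). -/
structure CDVData where
  N : ℕ
  J₀ : ℕ
  φ : ℝ → ℝ
  filter : ℤ → ℝ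
  φL : Fin N → ℝ → ℝ
  φR : Fin N → ℝ → ℝ
  ψL : Fin N → ℝ → ℝ
  ψR : Fin N → ℝ → ℝ

namespace CDVData

variable (W : CDVData)

/-- The wavelet function on the line. -/
def ψ (x : ℝ) : ℝ :=
  √2 * ∑ k ∈ Finset.Icc (1 - (W.N : ℤ)) W.N, (-1 : ℝ) ^ k * W.filter (1 - k) * W.φ (2 * x - k)

/-- The `2 ^ j` functions at level `j` on `[0, 1]` that come from a function `g` on the line (used
in the interior) and edge functions `gL`, `gR`. -/
def level (g : ℝ → ℝ) (gL gR : Fin W.N → ℝ → ℝ) (j : ℕ) (m : Fin (2 ^ j)) (x : ℝ) : ℝ :=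
  √(2 ^ j) *
    if hL : (m : ℕ) < W.N then gL ⟨m, hL⟩ (2 ^ j * x)
    else if hR : 2 ^ j - 1 - (m : ℕ) < W.N then gR ⟨2 ^ j - 1 - (m : ℕ), hR⟩ (2 ^ j * (x - 1))
    else g (2 ^ j * x - (m : ℕ))

/-- The scaling functions `φ_{jm}` on `[0, 1]`. -/
def scal (j : ℕ) (m : Fin (2 ^ j)) : ℝ → ℝ := W.level W.φ W.φL W.φR j m

/-- The wavelets `ψ_{jm}` on `[0, 1]`. -/
def wav (j : ℕ) (m : Fin (2 ^ j)) : ℝ → ℝ := W.level W.ψ W.ψL W.ψR j m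

/-- On `[0, 1]`, `g` lies in the span of the scaling functions of level `j`. -/
def InSpan (j : ℕ) (g : ℝ → ℝ) : Prop :=
  ∃ c : Fin (2 ^ j) → ℝ, ∀ x ∈ Set.Icc (0 : ℝ) 1, g x = ∑ m, c m * W.scal j m x

end CDVData

/-- A Cohen-Daubechies-Vial wavelet basis of `L²([0,1])` of regularity `S`: built from a Daubechies
scaling function with `N ≥ S` vanishing moments that is `S` times continuously differentiable,
its interior translates, and edge functions made of truncated translates. -/
structure CDVBasis (S : ℕ) extends CDVData where
  one_le_S : 1 ≤ S
  S_le_N : S ≤ N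
  one_le_J₀ : 1 ≤ J₀
  two_N_le : 2 * N ≤ 2 ^ J₀
  /- the Daubechies scaling function -/
  contDiff_φ : ContDiff ℝ S φ
  support_φ : Function.support φ ⊆ Set.Icc (1 - (N : ℝ)) N
  integral_φ : ∫ x, φ x = 1
  refinement : ∀ x, φ x = √2 * ∑ k ∈ Finset.Icc (1 - (N : ℤ)) N, filter k * φ (2 * x - k)
  orthonormal_translates : ∀ m : ℤ, ∫ x, φ x * φ (x - m) = if m = 0 then 1 else 0
  vanishing_moments : ∀ r < N, ∫ x, x ^ r * toCDVData.ψ x = 0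
  /- the edge functions -/
  edge_φL : ∀ i, ∃ c : ℤ → ℝ, ∀ x, φL i x =
    if 0 ≤ x then ∑ m ∈ Finset.Icc (1 - (N : ℤ)) (N - 1), c m * φ (x - m) else 0
  edge_φR : ∀ i, ∃ c : ℤ → ℝ, ∀ x, φR i x =
    if x ≤ 0 then ∑ m ∈ Finset.Icc (-(N : ℤ)) (N - 2), c m * φ (x - m) else 0
  edge_ψL : ∀ i, ∃ c : ℤ → ℝ, ∀ x, ψL i x =
    if 0 ≤ x then ∑ m ∈ Finset.Icc (1 - (N : ℤ)) (3 * N - 2), c m * φ (2 * x - m) else 0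
  edge_ψR : ∀ i, ∃ c : ℤ → ℝ, ∀ x, ψR i x =
    if x ≤ 0 then ∑ m ∈ Finset.Icc (1 - 3 * (N : ℤ)) (N - 2), c m * φ (2 * x - m) else 0
  /- orthonormality on the unit interval -/
  scal_scal : ∀ j ≥ J₀, ∀ m m', ∫ x in Set.Icc (0 : ℝ) 1,
    toCDVData.scal j m x * toCDVData.scal j m' x = if m = m' then 1 else 0
  scal_wav : ∀ j ≥ J₀, ∀ m m', ∫ x in Set.Icc (0 : ℝ) 1,
    toCDVData.scal j m x * toCDVData.wav j m' x = 0
  wav_wav : ∀ j ≥ J₀, ∀ m m', ∫ x in Set.Icc (0 : ℝ) 1,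
    toCDVData.wav j m x * toCDVData.wav j m' x = if m = m' then 1 else 0
  /- multiresolution analysis -/
  scal_mem : ∀ j ≥ J₀, ∀ m, toCDVData.InSpan (j + 1) (toCDVData.scal j m)
  wav_mem : ∀ j ≥ J₀, ∀ m, toCDVData.InSpan (j + 1) (toCDVData.wav j m)
  /- polynomials of degree less than `S` are reproduced on `[0, 1]` -/
  polynomial_mem : ∀ j ≥ J₀, ∀ r < S, toCDVData.InSpan j (fun x => x ^ r)

/-! ### Tensor product basis, projection kernel and Hölder balls on the unit cube -/

/-- The unit cube `[0,1]^d`. -/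
def cube (d : ℕ) : Set (Fin d → ℝ) := Set.Icc 0 1

namespace CDVData

variable (W : CDVData) {d : ℕ}

/-- `Φ_{jm}` on `[0,1]^d`. -/
def Phi (j : ℕ) (m : Fin d → Fin (2 ^ j)) (x : Fin d → ℝ) : ℝ := ∏ i, W.scal j (m i) (x i)

/-- `Ψ^ι_{jm}` on `[0,1]^d`; it is a wavelet when `ι` is not identically `false`. -/
def Psi (j : ℕ) (ι : Fin d → Bool) (m : Fin d → Fin (2 ^ j)) (x : Fin d → ℝ) : ℝ :=
  ∏ i, if ι i then W.wav j (m i) (x i) else W.scal j (m i) (x i)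

/-- The kernel of the orthogonal projection onto `V_k = span {Φ_{jm}}`, `k = 2^{jd}`. -/
def kernel (j : ℕ) (x y : Fin d → ℝ) : ℝ :=
  ∑ m : Fin d → Fin (2 ^ j), W.Phi j m x * W.Phi j m y

/-- The wavelet (Besov `B^a_{∞∞}`) norm that defines the Hölder balls. -/
def holderNorm (a : ℝ) (h : (Fin d → ℝ) → ℝ) : ℝ≥0∞ :=
  (⨆ m : Fin d → Fin (2 ^ W.J₀),
    ENNReal.ofReal (2 ^ ((W.J₀ : ℝ) * (a + d / 2)) * |∫ x in cube d, h x * W.Phi W.J₀ m x|)) +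
  ⨆ (l : ℕ) (_ : W.J₀ ≤ l) (ι : Fin d → Bool) (_ : ι ≠ fun _ => false)
    (m : Fin d → Fin (2 ^ l)),
    ENNReal.ofReal (2 ^ ((l : ℝ) * (a + d / 2)) * |∫ x in cube d, h x * W.Psi l ι m x|)

/-- The Hölder ball `H(a, M)` of functions on `[0,1]^d`. -/
def HolderBall (d : ℕ) (a M : ℝ) : Set ((Fin d → ℝ) → ℝ) :=
  {h | UniformContinuousOn h (cube d) ∧ W.holderNorm a h ≤ ENNReal.ofReal M}

end CDVData

/-! ### The statistical model and the functional -/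

/-- An observation `(X, A, Y)`. -/
abbrev Obs (d : ℕ) : Type := (Fin d → ℝ) × ℝ × ℝ

namespace Obs

/-- The covariates. -/
def X {d : ℕ} (o : Obs d) : Fin d → ℝ := o.1

/-- The treatment. -/
def A {d : ℕ} (o : Obs d) : ℝ := o.2.1

/-- The outcome. -/
def Y {d : ℕ} (o : Obs d) : ℝ := o.2.2

/-- The σ-algebra generated by the covariates. -/
abbrev sigmaX (d : ℕ) : MeasurableSpace (Obs d) := MeasurableSpace.comap Obs.X inferInstance

end Obs

/-- Smoothness indices and known constants of the model. -/
structure ModelParams where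
  α : ℝ
  β : ℝ
  γ : ℝ
  C₁ : ℝ
  C₂ : ℝ
  M : ℝ
  M₁ : ℝ
  M₂ : ℝ

/-- `P` belongs to the model, `p` and `b` being its regression functions `E[A | X = x]`,
`E[Y | X = x]`, and `f` its covariate density. -/
structure InModel {d : ℕ} (W : CDVData) (θ : ModelParams) (P : Measure (Obs d))
    (p b f : (Fin d → ℝ) → ℝ) : Prop where
  prob : IsProbabilityMeasure P
  bounded : ∀ᵐ o ∂P, o.A ∈ Set.Icc θ.C₁ θ.C₂ ∧ o.Y ∈ Set.Icc θ.C₁ θ.C₂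
  density : P.map Obs.X = (volume.restrict (cube d)).withDensity (fun x => ENNReal.ofReal (f x))
  reg_p : P[Obs.A | Obs.sigmaX d] =ᵐ[P] fun o => p o.X
  reg_b : P[Obs.Y | Obs.sigmaX d] =ᵐ[P] fun o => b o.X
  holder_p : p ∈ W.HolderBall d θ.α θ.M
  holder_b : b ∈ W.HolderBall d θ.β θ.M
  holder_f : f ∈ W.HolderBall d θ.γ θ.M
  bounded_f : ∀ x ∈ cube d, f x ∈ Set.Icc θ.M₁ θ.M₂

/-- The model: all laws of an observation that satisfy the constraints. -/
def model (d : ℕ) (W : CDVData) (θ : ModelParams) : Set (Measure (Obs d)) :=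
  {P | ∃ p b f, InModel W θ P p b f}

/-- The conditional covariance `Cov(A, Y | X)`. -/
def condCovAY {d : ℕ} (P : Measure (Obs d)) : Obs d → ℝ :=
  P[fun o => (o.A - (P[Obs.A | Obs.sigmaX d]) o) * (o.Y - (P[Obs.Y | Obs.sigmaX d]) o)
    | Obs.sigmaX d]

/-- The functional `ψ(P) = E[Cov(A, Y | X)]`. -/
def psi {d : ℕ} (P : Measure (Obs d)) : ℝ := ∫ o, condCovAY P o ∂P

/-- Non-degeneracy of the constants: the outcome range is a proper interval, the uniform covariate
density is allowed, and some constant regression function strictly inside the range is an interior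
point of both Hölder balls. -/
structure NonDegenerate (d : ℕ) (W : CDVData) (θ : ModelParams) : Prop where
  range : θ.C₁ < θ.C₂
  M₁_pos : 0 < θ.M₁
  M₁_le : θ.M₁ ≤ 1
  le_M₂ : 1 ≤ θ.M₂
  uniform : W.holderNorm θ.γ (fun _ : Fin d → ℝ => 1) ≤ ENNReal.ofReal θ.M
  regression : ∃ c, θ.C₁ < c ∧ c < θ.C₂ ∧
    W.holderNorm θ.α (fun _ : Fin d → ℝ => c) < ENNReal.ofReal θ.M ∧
    W.holderNorm θ.β (fun _ : Fin d → ℝ => c) < ENNReal.ofReal θ.M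

/-! ### Risk -/

/-- Mean squared error of the estimator `T` under i.i.d. observations from `P`. -/
def mse {d : ℕ} {ι : Type} [Fintype ι] (T : (ι → Obs d) → ℝ) (P : Measure (Obs d)) : ℝ≥0∞ :=
  ∫⁻ D, ENNReal.ofReal ((T D - psi P) ^ 2) ∂(Measure.pi fun _ : ι => P)

/-- Maximal mean squared error of `T` over the model. -/
def maxRisk {d : ℕ} {ι : Type} [Fintype ι] (W : CDVData) (θ : ModelParams)
    (T : (ι → Obs d) → ℝ) : ℝ≥0∞ :=
  ⨆ P ∈ model d W θ, mse T P

/-- Minimax mean squared error, over all measurable estimators based on a sample indexed by `ι`. -/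
def minimaxRisk (d : ℕ) (ι : Type) [Fintype ι] (W : CDVData) (θ : ModelParams) : ℝ≥0∞ :=
  ⨅ (T : (ι → Obs d) → ℝ) (_ : Measurable T), maxRisk W θ T

/-- A sample split into `m` subsamples of size `n`. -/
abbrev Sample (d m n : ℕ) : Type := Fin m × Fin n → Obs d

/-- The subsample with label `j` (counted from `0`). -/
def subsample {d m n : ℕ} (D : Sample d m n) (j : Fin m) : Fin n → Obs d := fun i => D (j, i)

/-- A sequence of estimators based on `m` subsamples of size `n` is rate optimal: its maximal risk
is of the order of the minimax risk for the same total sample size. -/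
def RateOptimal {d m : ℕ} (W : CDVData) (θ : ModelParams) (T : ∀ n, Sample d m n → ℝ) : Prop :=
  AsympEq (fun n => maxRisk W θ (T n)) (fun n => minimaxRisk d (Fin m × Fin n) W θ)

/-- The maximal risk of the sequence of estimators is exactly of order `n ^ r`. -/
def HasRate {d m : ℕ} (W : CDVData) (θ : ModelParams) (T : ∀ n, Sample d m n → ℝ)
    (r : ℝ) : Prop :=
  AsympEq (fun n => maxRisk W θ (T n)) (powSeq r)

/-! ### Estimators -/

/-- A density estimator: from `n` observations to a function on the cube. -/
abbrev DensityEstimator (d : ℕ) : Type := ∀ n : ℕ, (Fin n → Obs d) → (Fin d → ℝ) → ℝ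

/-- Supremum norm on the unit cube. -/
def cubeSupNorm {d : ℕ} (h : (Fin d → ℝ) → ℝ) : ℝ≥0∞ := ⨆ x ∈ cube d, ENNReal.ofReal |h x|

/-- `fhat` is bounded away from zero and infinity, and is rate optimal in supremum norm, with
mean square error of order `(n / log n)^{-2γ/(2γ+d)}` uniformly over the model. -/
structure IsDensityEstimator {d : ℕ} (W : CDVData) (θ : ModelParams)
    (fhat : DensityEstimator d) : Prop where
  measurable : ∀ n, Measurable fun q : (Fin n → Obs d) × (Fin d → ℝ) => fhat n q.1 q.2
  bounded : ∃ c₁ c₂ : ℝ, 0 < c₁ ∧ ∀ n D, ∀ x ∈ cube d, fhat n D x ∈ Set.Icc c₁ c₂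
  rate : AsympLE
    (fun n => ⨆ (P : Measure (Obs d)) (p) (b) (f) (_ : InModel W θ P p b f),
      ∫⁻ D, cubeSupNorm (fun x => fhat n D x - f x) ^ 2 ∂(Measure.pi fun _ : Fin n => P))
    (fun n => ENNReal.ofReal (((n : ℝ) / Real.log n) ^ (-(2 * θ.γ / (2 * θ.γ + d)))))

/-- The resolution `k = 2^{jd}`. -/
def res (d j : ℕ) : ℝ := 2 ^ (j * d)

section Estimators

variable {d n : ℕ} (W : CDVData) (fhat : DensityEstimator d)

/-- Wavelet projection estimator of the regression function of `Z` on the covariates, from the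
subsample `D`, with the density estimated from the subsample `D'`. -/
def nuisance (Z : Obs d → ℝ) (j : ℕ) (D D' : Fin n → Obs d) (x : Fin d → ℝ) : ℝ :=
  (1 / (n : ℝ)) * ∑ i, Z (D i) * W.kernel j (D i).X x / fhat n D' (D i).X

/-- The integral-based plug-in estimator. -/
def psiINT (j₁ j₂ : ℕ) (D : Sample d 6 n) : ℝ :=
  (1 / (n : ℝ)) * ∑ i, (subsample D 4 i).A * (subsample D 4 i).Y -
  ∫ x in cube d, nuisance W fhat Obs.A j₁ (subsample D 0) (subsample D 1) x *
    nuisance W fhat Obs.Y j₂ (subsample D 2) (subsample D 3) x * fhat n (subsample D 5) x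

/-- The Monte Carlo-based plug-in estimator. -/
def psiMC (j₁ j₂ : ℕ) (D : Sample d 6 n) : ℝ :=
  (1 / (n : ℝ)) * ∑ i, (subsample D 4 i).A * (subsample D 4 i).Y -
  (1 / (n : ℝ)) * ∑ i, nuisance W fhat Obs.A j₁ (subsample D 0) (subsample D 1)
      (subsample D 5 i).X *
    nuisance W fhat Obs.Y j₂ (subsample D 2) (subsample D 3) (subsample D 5 i).X

/-- The Newey and Robins plug-in estimator. -/
def psiNR (j : ℕ) (D : Sample d 3 n) : ℝ :=
  (1 / (n : ℝ)) * ∑ i, (subsample D 2 i).A *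
    ((subsample D 2 i).Y -
      nuisance W fhat Obs.Y j (subsample D 0) (subsample D 1) (subsample D 2 i).X)

/-- The first-order bias-corrected estimator. -/
def psiIF (j₁ j₂ : ℕ) (D : Sample d 5 n) : ℝ :=
  (1 / (n : ℝ)) * ∑ i,
    ((subsample D 4 i).A -
      nuisance W fhat Obs.A j₁ (subsample D 0) (subsample D 1) (subsample D 4 i).X) *
    ((subsample D 4 i).Y -
      nuisance W fhat Obs.Y j₂ (subsample D 2) (subsample D 3) (subsample D 4 i).X)

end Estimators

end

/-!
Write `s = α + β` and `k = 2 ^ (j d)` for the resolution of level `j`.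

**Upper bounds.** Given the density estimates, the mean of `p̂` is the projection of `p f / f̂`.
Replacing `f̂` by `f` costs at most the `L²` distance of the two; its mean square is of smaller order
than every rate in question, since `γ > γ₀ = 2 s d / (d - 2 s)` is equivalent to
`2γ / (2γ + d) > 4 s / (2 s + d)`. What remains are integrals of a projection error `b - Π b` against
a product `p f`. Wavelet coefficients of a product of Hölder functions decay like those of the
rougher factor (`CDVBasis.exists_abs_integral_mul_mul_Psi_le`), so these integrals are
`O(k ^ (-s / d))` (`CDVBasis.exists_abs_integral_bias_le`). The coarser of the two projections
matters for plug-in estimators, the finer one for the first-order corrected estimator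
(`exists_abs_bias_plugin_le`, `exists_abs_bias_corrected_le`). Second moments are computed one
subsample at a time. An integral of `p̂ b̂` is bilinear in two samples, and its variance is governed by
the Hilbert-Schmidt norm of a product of projections, whence the smaller resolution alone enters, as
`(1 + k / n) / n` (`Regr.lintegral_bilinear_sq_le`). Averaging `p̂ b̂` over a further subsample costs
`(1 + k₁ / n) (1 + k₂ / n) / n`.

**Minimax lower bound** (`CDVBasis.Room.le_maxRisk`). The covariates are uniform, `A` and `Y` take
the values `c ± h`, and the regression functions are `c` plus wavelets of one level. The cube is cut
into cells, and a random sign in each cell multiplies both perturbations; `ψ` depends on the relative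
sign of the two only. That sign is invisible in cells with less than two observations, so the
Hellinger affinity of the two mixtures (`cell_affinity_ge`, `sum_min_signMix_ge`) stays bounded below
as long as `2 ^ j` is at least of order `n ^ (2 / (2 s + d))`.

**Monte Carlo estimator** (`CDVBasis.Room.asympLE_maxRisk_psiMC`). Perturbations at the coarser of
the two levels are invisible to one projection, which gives a squared bias of order
`k ^ (-2 s / d)`, `k` the smaller resolution (`CDVBasis.Room.exists_bias_le`). With constant
regression functions the variance contains `k₁ k₂ / n ^ 3` (`CDVBasis.Room.exists_variance_le`). As
`k₁ k₂ ≥ k ^ 2`, the two balance at `k ≍ n ^ (3 d / (2 s + 2 d))`, which is worse than minimax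
because `2 s < d`.
-/

noncomputable section

open ENNReal (ofReal ofReal_le_ofReal ofReal_mul ofReal_add)
open Finset (sum_congr sum_le_sum mul_sum prod_congr sum_mul prod_le_prod abs_sum_le_sum_abs sum_nonneg sum_eq_zero
  sum_const sum_add_distrib prod_mul_distrib prod_const abs_prod)

/-- The law of `n` independent observations from `P`. -/
notation:max P:max "^⊗" n:max => Measure.pi fun _ : Fin n => P

/-- A basis may be used where its underlying functions are expected. -/
instance {S : ℕ} : CoeOut (CDVBasis S) CDVData := ⟨CDVBasis.toCDVData⟩

/-! ### Smooth extensions of the one-dimensional wavelets -/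

theorem exists_bound_iteratedDeriv {S : ℕ} {e : ℝ → ℝ} (he : ContDiff ℝ S e) {R : ℝ}
    (hR : ∀ t, R < |t| → e t = 0) :
    ∃ B, 0 < B ∧ ∀ r ≤ S, ∀ t, |iteratedDeriv r e t| ≤ B ∧ (R < |t| → iteratedDeriv r e t = 0) := by
  have hzero : ∀ r, ∀ t, R < |t| → iteratedDeriv r e t = 0 := by
    intro r t ht
    have hopen : IsOpen {t : ℝ | R < |t|} := isOpen_lt continuous_const continuous_abs
    have h := Set.EqOn.iteratedDeriv_of_isOpen (f := e) (g := fun _ => (0 : ℝ))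
      (fun x hx => hR x hx) hopen r (show t ∈ {t : ℝ | R < |t|} from ht)
    rw [h]
    simp
  have hb : ∀ r, ∃ B, ∀ t, r ≤ S → |iteratedDeriv r e t| ≤ B := by
    intro r
    by_cases hr : r ≤ S
    · have hc : Continuous (iteratedDeriv r e) :=
        he.continuous_iteratedDeriv r (by exact_mod_cast hr)
      obtain ⟨B, hB⟩ := (isCompact_Icc (a := -R) (b := R)).exists_bound_of_continuousOn
        hc.continuousOn
      refine ⟨max B 0, fun t _ => ?_⟩
      by_cases ht : R < |t|
      · rw [hzero r t ht]; simp
      · exact (hB t (abs_le.1 (not_lt.1 ht))).trans (le_max_left _ _)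
    · exact ⟨0, fun t h => absurd h hr⟩
  choose B hB using hb
  refine ⟨1 + ∑ r ∈ Finset.range (S + 1), |B r|, by positivity, fun r hr t => ⟨?_, hzero r t⟩⟩
  have h1 : |B r| ≤ ∑ r ∈ Finset.range (S + 1), |B r| :=
    Finset.single_le_sum (f := fun r => |B r|) (fun _ _ => abs_nonneg _)
      (Finset.mem_range.2 (by omega))
  linarith [hB r t hr, le_abs_self (B r)]

/-- `ρ` is an `S` times continuously differentiable extension to the line of the function `w` on
`[0, 1]`, which has the size, the scale and the location of a wavelet at level `j` and position
`m`. -/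
structure IsDyadicExtension (S : ℕ) (R B : ℝ) (j m : ℕ) (w ρ : ℝ → ℝ) : Prop where
  contDiff : ContDiff ℝ S ρ
  eq_on : ∀ t ∈ Set.Icc (0 : ℝ) 1, w t = ρ t
  bound : ∀ r ≤ S, ∀ t, |iteratedDeriv r ρ t| ≤ B * √(2 ^ j) * (2 ^ j) ^ r
  zero : ∀ r ≤ S, ∀ t : ℝ, R < |2 ^ j * t - m| → iteratedDeriv r ρ t = 0

theorem IsDyadicExtension.mono {S : ℕ} {R B R' B' : ℝ} {j m : ℕ} {w ρ : ℝ → ℝ}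
    (h : IsDyadicExtension S R B j m w ρ) (hR : R ≤ R') (hB : B ≤ B') :
    IsDyadicExtension S R' B' j m w ρ where
  contDiff := h.contDiff
  eq_on := h.eq_on
  bound r hr t := (h.bound r hr t).trans (by gcongr)
  zero r hr t ht := h.zero r hr t (hR.trans_lt ht)

theorem isDyadicExtension_of_profile {S : ℕ} {e w : ℝ → ℝ} {R₀ R B b : ℝ} {j m : ℕ}
    (he : ContDiff ℝ S e)
    (heB : ∀ r ≤ S, ∀ t, |iteratedDeriv r e t| ≤ B ∧ (R₀ < |t| → iteratedDeriv r e t = 0))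
    (hR : ∀ t : ℝ, R < |2 ^ j * t - m| → R₀ < |2 ^ j * t + b|)
    (hw : ∀ t ∈ Set.Icc (0 : ℝ) 1, w t = √(2 ^ j) * e (2 ^ j * t + b)) :
    IsDyadicExtension S R B j m w (fun t => √(2 ^ j) * e (2 ^ j * t + b)) := by
  have hd : ∀ r ≤ S, ∀ t, iteratedDeriv r (fun t => √(2 ^ j) * e (2 ^ j * t + b)) t =
      √(2 ^ j) * ((2 ^ j) ^ r * iteratedDeriv r e (2 ^ j * t + b)) := by
    intro r hr t
    rw [iteratedDeriv_const_mul_field]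
    have h1 : ContDiff ℝ r (fun z => e (z + b)) :=
      (he.of_le (by exact_mod_cast hr)).comp (contDiff_id.add contDiff_const)
    have h2 := iteratedDeriv_comp_const_mul (𝕜 := ℝ) (n := r) h1 (2 ^ j)
    rw [h2, iteratedDeriv_comp_add_const]
  refine ⟨?_, hw, fun r hr t => ?_, fun r hr t ht => ?_⟩
  · exact contDiff_const.mul (he.comp ((contDiff_const.mul contDiff_id).add contDiff_const))
  · rw [hd r hr t, abs_mul, abs_mul, abs_of_nonneg (Real.sqrt_nonneg _),
      abs_of_nonneg (by positivity : (0 : ℝ) ≤ (2 ^ j) ^ r)]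
    have := (heB r hr (2 ^ j * t + b)).1
    have h3 : (0 : ℝ) ≤ √(2 ^ j) * (2 ^ j) ^ r := by positivity
    nlinarith [mul_le_mul_of_nonneg_left this h3]
  · rw [hd r hr t, (heB r hr _).2 (hR t ht), mul_zero, mul_zero]

theorem CDVData.exists_isDyadicExtension_level (W : CDVData) {S : ℕ} {g : ℝ → ℝ}
    {gL gR : Fin W.N → ℝ → ℝ} {R₀ : ℝ} (hR₀ : 0 ≤ R₀)
    (hg : ContDiff ℝ S g) (hgs : ∀ t, R₀ < |t| → g t = 0)
    (hL : ∀ i, ∃ e : ℝ → ℝ, ContDiff ℝ S e ∧ (∀ t, R₀ < |t| → e t = 0) ∧ ∀ t, 0 ≤ t → gL i t = e t)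
    (hR : ∀ i, ∃ e : ℝ → ℝ, ContDiff ℝ S e ∧ (∀ t, R₀ < |t| → e t = 0) ∧
      ∀ t, t ≤ 0 → gR i t = e t) :
    ∃ R B : ℝ, 0 < R ∧ 0 < B ∧ ∀ j (m : Fin (2 ^ j)), ∃ ρ,
      IsDyadicExtension S R B j m (W.level g gL gR j m) ρ := by
  choose eL hL1 hL2 hL3 using hL
  choose eR hR1 hR2 hR3 using hR
  obtain ⟨B, hB0, hB⟩ := exists_bound_iteratedDeriv hg hgs
  choose BL hBL0 hBL using fun i => exists_bound_iteratedDeriv (hL1 i) (hL2 i)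
  choose BR hBR0 hBR using fun i => exists_bound_iteratedDeriv (hR1 i) (hR2 i)
  have hsL : ∀ i, BL i ≤ ∑ i, BL i := fun i =>
    Finset.single_le_sum (f := BL) (fun i _ => (hBL0 i).le) (Finset.mem_univ i)
  have hsR : ∀ i, BR i ≤ ∑ i, BR i := fun i =>
    Finset.single_le_sum (f := BR) (fun i _ => (hBR0 i).le) (Finset.mem_univ i)
  have hsL0 : 0 ≤ ∑ i, BL i := sum_nonneg fun i _ => (hBL0 i).le
  have hsR0 : 0 ≤ ∑ i, BR i := sum_nonneg fun i _ => (hBR0 i).le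
  refine ⟨R₀ + W.N + 1, B + ∑ i, BL i + ∑ i, BR i, by positivity, by positivity, fun j m => ?_⟩
  by_cases h1 : (m : ℕ) < W.N
  · have h1' : ((m : ℕ) : ℝ) ≤ W.N := by exact_mod_cast h1.le
    refine ⟨_, (isDyadicExtension_of_profile (R := R₀ + W.N + 1) (b := 0)
      (hL1 ⟨m, h1⟩) (hBL ⟨m, h1⟩) ?_ ?_).mono le_rfl (by linarith [hsL ⟨m, h1⟩])⟩
    · intro t ht
      have h2 : |2 ^ j * t - ((m : ℕ) : ℝ)| ≤ |2 ^ j * t + 0| + |((m : ℕ) : ℝ)| := by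
        rw [add_zero]; exact abs_sub _ _
      rw [abs_of_nonneg (Nat.cast_nonneg (m : ℕ) : (0 : ℝ) ≤ ((m : ℕ) : ℝ))] at h2
      linarith
    · intro t ht
      have : (0 : ℝ) ≤ 2 ^ j * t := mul_nonneg (by positivity) ht.1
      simp [CDVData.level, h1, hL3 _ _ this]
  · by_cases h2 : 2 ^ j - 1 - (m : ℕ) < W.N
    · refine ⟨_, (isDyadicExtension_of_profile (R := R₀ + W.N + 1) (b := -2 ^ j)
        (hR1 ⟨_, h2⟩) (hBR ⟨_, h2⟩) ?_ ?_).mono le_rfl (by linarith [hsR ⟨_, h2⟩])⟩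
      · intro t ht
        have h3 : |2 ^ j * t - ((m : ℕ) : ℝ)| ≤
            |2 ^ j * t + -2 ^ j| + |2 ^ j - ((m : ℕ) : ℝ)| := by
          have := abs_add_le (2 ^ j * t + -2 ^ j) (2 ^ j - ((m : ℕ) : ℝ))
          rwa [show 2 ^ j * t + -2 ^ j + (2 ^ j - ((m : ℕ) : ℝ)) = 2 ^ j * t - (m : ℕ) by ring] at this
        have hm : (m : ℕ) + 1 ≤ 2 ^ j := m.2
        have hm' : ((m : ℕ) : ℝ) + 1 ≤ 2 ^ j := by exact_mod_cast hm
        have h4 : 2 ^ j ≤ W.N + (m : ℕ) := by omega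
        have h4' : (2 : ℝ) ^ j ≤ W.N + (m : ℕ) := by exact_mod_cast h4
        rw [abs_of_nonneg (by linarith : (0 : ℝ) ≤ 2 ^ j - ((m : ℕ) : ℝ))] at h3
        linarith
      · intro t ht
        have : (2 : ℝ) ^ j * (t - 1) ≤ 0 :=
          mul_nonpos_of_nonneg_of_nonpos (by positivity) (by linarith [ht.2])
        simp only [CDVData.level, h1, h2, dite_true, dite_false, hR3 _ _ this]
        ring_nf
    · refine ⟨_, (isDyadicExtension_of_profile (R := R₀ + W.N + 1) (b := -(m : ℕ))
        hg hB ?_ ?_).mono le_rfl (by linarith)⟩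
      · intro t ht
        rw [← sub_eq_add_neg]
        linarith
      · intro t _
        simp [CDVData.level, h1, h2, sub_eq_add_neg]

section

variable {S : ℕ} (W : CDVBasis S)

theorem CDVBasis.φ_eq_zero {t : ℝ} (ht : (W.N : ℝ) < |t|) : W.φ t = 0 := by
  by_contra h
  have h1 := W.support_φ (Function.mem_support.2 h)
  have : |t| ≤ W.N := abs_le.2 ⟨by linarith [h1.1], h1.2⟩
  linarith

theorem CDVBasis.contDiff_ψ : ContDiff ℝ S W.ψ := by
  unfold CDVData.ψ
  refine contDiff_const.mul (ContDiff.sum fun k _ => contDiff_const.mul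
    (W.contDiff_φ.comp ((contDiff_const.mul contDiff_id).sub contDiff_const)))

theorem CDVBasis.contDiff_sum_translates (s : Finset ℤ) (c : ℤ → ℝ) (a : ℝ) :
    ContDiff ℝ S fun x => ∑ m ∈ s, c m * W.φ (a * x - m) :=
  ContDiff.sum fun _ _ => contDiff_const.mul
    (W.contDiff_φ.comp ((contDiff_const.mul contDiff_id).sub contDiff_const))

theorem CDVBasis.sum_translates_eq_zero (s : Finset ℤ) (c : ℤ → ℝ) {a : ℝ} (ha : 1 ≤ a)
    (hs : ∀ m ∈ s, |m| ≤ 3 * (W.N : ℤ)) {x : ℝ} (hx : 4 * (W.N : ℝ) < |x|) :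
    ∑ m ∈ s, c m * W.φ (a * x - m) = 0 := by
  refine sum_eq_zero fun m hm => ?_
  rw [W.φ_eq_zero, mul_zero]
  have h1 : |(m : ℝ)| ≤ 3 * W.N := by exact_mod_cast hs m hm
  have h2 : |a * x| ≤ |a * x - m| + |(m : ℝ)| := by
    have := abs_add_le (a * x - m) m
    simpa using this
  have h3 : |x| ≤ |a * x| := by
    rw [abs_mul, abs_of_nonneg (by linarith : 0 ≤ a)]
    nlinarith [abs_nonneg x]
  linarith

theorem CDVBasis.exists_extension_scal : ∃ R B : ℝ, 0 < R ∧ 0 < B ∧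
    ∀ j (m : Fin (2 ^ j)), ∃ ρ, IsDyadicExtension S R B j m (W.scal j m) ρ := by
  have h1N : 1 ≤ W.N := W.one_le_S.trans W.S_le_N
  refine W.exists_isDyadicExtension_level (R₀ := 4 * W.N) (by positivity) W.contDiff_φ
    (fun t ht => W.φ_eq_zero (by linarith)) (fun i => ?_) (fun i => ?_)
  · obtain ⟨c, hc⟩ := W.edge_φL i
    refine ⟨_, W.contDiff_sum_translates (Finset.Icc (1 - (W.N : ℤ)) (W.N - 1)) c 1, fun t ht =>
      W.sum_translates_eq_zero _ c le_rfl (fun m hm => ?_) ht, fun t ht => ?_⟩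
    · rw [Finset.mem_Icc] at hm; rw [abs_le]; omega
    · rw [hc, if_pos ht]; simp
  · obtain ⟨c, hc⟩ := W.edge_φR i
    refine ⟨_, W.contDiff_sum_translates (Finset.Icc (-(W.N : ℤ)) (W.N - 2)) c 1, fun t ht =>
      W.sum_translates_eq_zero _ c le_rfl (fun m hm => ?_) ht, fun t ht => ?_⟩
    · rw [Finset.mem_Icc] at hm; rw [abs_le]; omega
    · rw [hc, if_pos ht]; simp

theorem CDVBasis.exists_extension_wav : ∃ R B : ℝ, 0 < R ∧ 0 < B ∧
    ∀ j (m : Fin (2 ^ j)), ∃ ρ, IsDyadicExtension S R B j m (W.wav j m) ρ := by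
  have h1N : 1 ≤ W.N := W.one_le_S.trans W.S_le_N
  refine W.exists_isDyadicExtension_level (R₀ := 4 * W.N) (by positivity) W.contDiff_ψ
    (fun t ht => ?_) (fun i => ?_) (fun i => ?_)
  · rw [CDVData.ψ, W.sum_translates_eq_zero _ (fun k => (-1 : ℝ) ^ k * W.filter (1 - k))
      one_le_two _ ht, mul_zero]
    intro m hm
    rw [Finset.mem_Icc] at hm; rw [abs_le]; omega
  · obtain ⟨c, hc⟩ := W.edge_ψL i
    refine ⟨_, W.contDiff_sum_translates (Finset.Icc (1 - (W.N : ℤ)) (3 * W.N - 2)) c 2,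
      fun t ht => W.sum_translates_eq_zero _ c one_le_two (fun m hm => ?_) ht, fun t ht => ?_⟩
    · rw [Finset.mem_Icc] at hm; rw [abs_le]; omega
    · rw [hc, if_pos ht]
  · obtain ⟨c, hc⟩ := W.edge_ψR i
    refine ⟨_, W.contDiff_sum_translates (Finset.Icc (1 - 3 * (W.N : ℤ)) (W.N - 2)) c 2,
      fun t ht => W.sum_translates_eq_zero _ c one_le_two (fun m hm => ?_) ht, fun t ht => ?_⟩
    · rw [Finset.mem_Icc] at hm; rw [abs_le]; omega
    · rw [hc, if_pos ht]

theorem measurable_of_edge {g f : ℝ → ℝ} {p : ℝ → Prop} [DecidablePred p]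
    (hp : MeasurableSet {x | p x}) (hf : Continuous f) (h : ∀ x, g x = if p x then f x else 0) :
    Measurable g := by
  rw [funext h]
  exact Measurable.ite hp hf.measurable measurable_const

theorem CDVBasis.continuous_φ : Continuous W.φ := W.contDiff_φ.continuous

/-- The one-dimensional wavelets (`b = true`) and scaling functions (`b = false`). -/
def CDVData.fn (W : CDVData) (b : Bool) (j : ℕ) (m : Fin (2 ^ j)) : ℝ → ℝ :=
  if b then W.wav j m else W.scal j m

theorem CDVData.measurable_level (W : CDVData) {g : ℝ → ℝ} {gL gR : Fin W.N → ℝ → ℝ}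
    (hg : Measurable g) (hL : ∀ i, Measurable (gL i)) (hR : ∀ i, Measurable (gR i)) (j : ℕ)
    (m : Fin (2 ^ j)) : Measurable (W.level g gL gR j m) := by
  unfold CDVData.level
  by_cases h1 : (m : ℕ) < W.N
  · simp only [h1, dite_true]
    exact ((hL _).comp (measurable_id.const_mul _)).const_mul _
  · by_cases h2 : 2 ^ j - 1 - (m : ℕ) < W.N
    · simp only [h1, h2, dite_true, dite_false]
      exact ((hR _).comp ((measurable_id.sub_const _).const_mul _)).const_mul _
    · simp only [h1, h2, dite_false]
      exact (hg.comp ((measurable_id.const_mul _).sub_const _)).const_mul _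

theorem CDVBasis.measurable_fn (b : Bool) (j : ℕ) (m : Fin (2 ^ j)) :
    Measurable (W.fn b j m) := by
  have hc : ∀ (s : Finset ℤ) (c : ℤ → ℝ) (a : ℝ),
      Continuous fun x => ∑ m ∈ s, c m * W.φ (a * x - m) := fun s c a =>
    (W.contDiff_sum_translates s c a).continuous
  cases b
  · refine W.measurable_level W.continuous_φ.measurable (fun i => ?_) (fun i => ?_) j m
    · obtain ⟨c, h⟩ := W.edge_φL i
      exact measurable_of_edge measurableSet_Ici (by simpa using hc _ c 1) h
    · obtain ⟨c, h⟩ := W.edge_φR i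
      exact measurable_of_edge measurableSet_Iic (by simpa using hc _ c 1) h
  · refine W.measurable_level W.contDiff_ψ.continuous.measurable
      (fun i => ?_) (fun i => ?_) j m
    · obtain ⟨c, h⟩ := W.edge_ψL i
      exact measurable_of_edge measurableSet_Ici (hc _ c 2) h
    · obtain ⟨c, h⟩ := W.edge_ψR i
      exact measurable_of_edge measurableSet_Iic (hc _ c 2) h

theorem CDVBasis.exists_extension : ∃ R B : ℝ, 1 ≤ R ∧ 1 ≤ B ∧
    ∀ b j (m : Fin (2 ^ j)), ∃ ρ, IsDyadicExtension S R B j m (W.fn b j m) ρ := by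
  obtain ⟨R, B, -, -, h⟩ := W.exists_extension_scal
  obtain ⟨R', B', -, -, h'⟩ := W.exists_extension_wav
  refine ⟨max 1 (max R R'), max 1 (max B B'), le_max_left _ _, le_max_left _ _, fun b j m => ?_⟩
  cases b
  · obtain ⟨ρ, hρ⟩ := h j m
    exact ⟨ρ, hρ.mono ((le_max_left _ _).trans (le_max_right _ _))
      ((le_max_left _ _).trans (le_max_right _ _))⟩
  · obtain ⟨ρ, hρ⟩ := h' j m
    exact ⟨ρ, hρ.mono ((le_max_right _ _).trans (le_max_right _ _))
      ((le_max_right _ _).trans (le_max_right _ _))⟩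

/-- The radius, in units of the grid, of the supports of the wavelets and scaling functions. -/
def CDVBasis.R : ℝ := W.exists_extension.choose

/-- A bound for the wavelets, the scaling functions and their derivatives, up to scaling. -/
def CDVBasis.B : ℝ := W.exists_extension.choose_spec.choose

theorem CDVBasis.one_le_R : 1 ≤ W.R := W.exists_extension.choose_spec.choose_spec.1

theorem CDVBasis.one_le_B : 1 ≤ W.B := W.exists_extension.choose_spec.choose_spec.2.1

/-- A smooth extension of `fn b j m` from `[0, 1]` to the line. -/
def CDVBasis.ext (b : Bool) (j : ℕ) (m : Fin (2 ^ j)) : ℝ → ℝ :=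
  (W.exists_extension.choose_spec.choose_spec.2.2 b j m).choose

theorem CDVBasis.ext_spec (b : Bool) (j : ℕ) (m : Fin (2 ^ j)) :
    IsDyadicExtension S W.R W.B j m (W.fn b j m) (W.ext b j m) :=
  (W.exists_extension.choose_spec.choose_spec.2.2 b j m).choose_spec

/-- Only boundedly many wavelets of a level overlap at a point. -/
theorem CDVBasis.sum_abs_iteratedDeriv_ext_le (b : Bool) (j : ℕ) {r : ℕ} (hr : r ≤ S) (t : ℝ) :
    ∑ m, |iteratedDeriv r (W.ext b j m) t| ≤ 3 * W.R * W.B * √(2 ^ j) * (2 ^ j) ^ r := by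
  classical
  have hR := W.one_le_R
  have hB := W.one_le_B
  set s : Finset (Fin (2 ^ j)) :=
    Finset.univ.filter fun m => |2 ^ j * t - ((m : ℕ) : ℝ)| ≤ W.R with hs
  have h1 : ∑ m, |iteratedDeriv r (W.ext b j m) t| =
      ∑ m ∈ s, |iteratedDeriv r (W.ext b j m) t| := by
    symm
    refine Finset.sum_subset (Finset.subset_univ _) fun m _ hm => ?_
    rw [(W.ext_spec b j m).zero r hr t, abs_zero]
    simpa [hs] using hm
  have h2 : (s.card : ℝ) ≤ 3 * W.R := by
    have h3 : s.card ≤ (Finset.Icc ⌈2 ^ j * t - W.R⌉ ⌊2 ^ j * t + W.R⌋).card := by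
      refine Finset.card_le_card_of_injOn (fun m => ((m : ℕ) : ℤ)) (fun m hm => ?_) ?_
      · have hm' : |2 ^ j * t - ((m : ℕ) : ℝ)| ≤ W.R := by simpa [hs] using hm
        rw [abs_le] at hm'
        simp only [Finset.coe_Icc, Set.mem_Icc]
        exact ⟨Int.ceil_le.2 (by push_cast; linarith), Int.le_floor.2 (by push_cast; linarith)⟩
      · intro a _ b _ hab
        exact Fin.ext (by simpa using hab)
    rw [Int.card_Icc] at h3
    have h4 : ((⌊2 ^ j * t + W.R⌋ + 1 - ⌈2 ^ j * t - W.R⌉).toNat : ℝ) ≤ 3 * W.R := by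
      rcases le_total 0 (⌊2 ^ j * t + W.R⌋ + 1 - ⌈2 ^ j * t - W.R⌉) with h | h
      · have h5 : (((⌊2 ^ j * t + W.R⌋ + 1 - ⌈2 ^ j * t - W.R⌉).toNat : ℤ) : ℝ) =
          ((⌊2 ^ j * t + W.R⌋ + 1 - ⌈2 ^ j * t - W.R⌉ : ℤ) : ℝ) := by rw [Int.toNat_of_nonneg h]
        rw [Int.cast_natCast] at h5
        rw [h5]
        push_cast
        linarith [Int.floor_le (2 ^ j * t + W.R), Int.le_ceil (2 ^ j * t - W.R)]
      · rw [Int.toNat_of_nonpos h]; simp; linarith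
    exact le_trans (by exact_mod_cast h3) h4
  rw [h1]
  calc ∑ m ∈ s, |iteratedDeriv r (W.ext b j m) t|
      ≤ ∑ m ∈ s, W.B * √(2 ^ j) * (2 ^ j) ^ r :=
        sum_le_sum fun m _ => (W.ext_spec b j m).bound r hr t
    _ = s.card * (W.B * √(2 ^ j) * (2 ^ j) ^ r) := by rw [sum_const, nsmul_eq_mul]
    _ ≤ 3 * W.R * (W.B * √(2 ^ j) * (2 ^ j) ^ r) := by
        gcongr
    _ = _ := by ring

theorem CDVBasis.abs_fn_le (b : Bool) (j : ℕ) (m : Fin (2 ^ j)) {t : ℝ}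
    (ht : t ∈ Set.Icc (0 : ℝ) 1) : |W.fn b j m t| ≤ W.B * √(2 ^ j) := by
  have := (W.ext_spec b j m).bound 0 (Nat.zero_le _) t
  rw [(W.ext_spec b j m).eq_on t ht]
  simpa using this

theorem CDVBasis.fn_eq_zero (b : Bool) (j : ℕ) (m : Fin (2 ^ j)) {t : ℝ}
    (ht : t ∈ Set.Icc (0 : ℝ) 1) (h : W.R < |2 ^ j * t - ((m : ℕ) : ℝ)|) :
    W.fn b j m t = 0 := by
  have := (W.ext_spec b j m).zero 0 (Nat.zero_le _) t h
  rw [(W.ext_spec b j m).eq_on t ht]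
  simpa using this

theorem CDVBasis.sum_abs_fn_le (b : Bool) (j : ℕ) {t : ℝ} (ht : t ∈ Set.Icc (0 : ℝ) 1) :
    ∑ m, |W.fn b j m t| ≤ 3 * W.R * W.B * √(2 ^ j) := by
  have := W.sum_abs_iteratedDeriv_ext_le b j (Nat.zero_le S) t
  simp only [iteratedDeriv_zero, pow_zero, mul_one] at this
  convert this using 3 with m
  rw [(W.ext_spec b j m).eq_on t ht]

end

/-! ### Integration over the unit cube -/

/-- Lebesgue measure on the unit cube. -/
abbrev cubeMeasure (d : ℕ) : Measure (Fin d → ℝ) := volume.restrict (cube d)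

theorem mem_cube {d : ℕ} {x : Fin d → ℝ} : x ∈ cube d ↔ ∀ i, x i ∈ Set.Icc (0 : ℝ) 1 :=
  ⟨fun h i => ⟨h.1 i, h.2 i⟩, fun h => ⟨fun i => (h i).1, fun i => (h i).2⟩⟩

theorem measurableSet_cube (d : ℕ) : MeasurableSet (cube d) := measurableSet_Icc

theorem cube_eq_pi (d : ℕ) : cube d = Set.univ.pi fun _ => Set.Icc (0 : ℝ) 1 := by
  ext x
  rw [mem_cube]
  exact ⟨fun h i _ => h i, fun h i => h i trivial⟩

theorem cubeMeasure_eq_pi (d : ℕ) :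
    cubeMeasure d = Measure.pi fun _ : Fin d => volume.restrict (Set.Icc (0 : ℝ) 1) := by
  rw [cubeMeasure, cube_eq_pi, volume_pi, Measure.restrict_pi_pi]

instance isProbabilityMeasure_Icc :
    IsProbabilityMeasure (volume.restrict (Set.Icc (0 : ℝ) 1)) := ⟨by simp⟩

instance isProbabilityMeasure_cubeMeasure (d : ℕ) : IsProbabilityMeasure (cubeMeasure d) := by
  rw [cubeMeasure_eq_pi]; infer_instance

theorem integral_cube_prod {d : ℕ} (g : Fin d → ℝ → ℝ) :
    ∫ x in cube d, ∏ i, g i (x i) = ∏ i, ∫ t in Set.Icc (0 : ℝ) 1, g i t := by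
  change ∫ x, ∏ i, g i (x i) ∂cubeMeasure d = _
  rw [cubeMeasure_eq_pi, integral_fintype_prod_eq_prod]

theorem ae_mem_cube (d : ℕ) : ∀ᵐ x ∂cubeMeasure d, x ∈ cube d :=
  ae_restrict_mem (measurableSet_cube d)

theorem integral_cube_congr {d : ℕ} {g h : (Fin d → ℝ) → ℝ} (H : ∀ x ∈ cube d, g x = h x) :
    ∫ x in cube d, g x = ∫ x in cube d, h x :=
  setIntegral_congr_fun (measurableSet_cube d) H

/-- Measurable functions that are bounded on the unit cube. -/
structure CubeBdd {d : ℕ} (g : (Fin d → ℝ) → ℝ) : Prop where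
  meas : Measurable g
  bdd : ∃ B, ∀ x ∈ cube d, |g x| ≤ B

namespace CubeBdd

variable {d : ℕ} {g h : (Fin d → ℝ) → ℝ}

theorem integrable (hg : CubeBdd g) : Integrable g (cubeMeasure d) := by
  obtain ⟨B, hB⟩ := hg.bdd
  exact Integrable.of_bound hg.meas.aestronglyMeasurable B
    ((ae_mem_cube d).mono fun x hx => hB x hx)

theorem const (c : ℝ) : CubeBdd fun _ : Fin d → ℝ => c :=
  ⟨measurable_const, |c|, fun _ _ => le_rfl⟩

theorem add (hg : CubeBdd g) (hh : CubeBdd h) : CubeBdd fun x => g x + h x := by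
  obtain ⟨B, hB⟩ := hg.bdd
  obtain ⟨C, hC⟩ := hh.bdd
  exact ⟨hg.meas.add hh.meas, B + C, fun x hx => (abs_add_le _ _).trans
    (add_le_add (hB x hx) (hC x hx))⟩

theorem mul (hg : CubeBdd g) (hh : CubeBdd h) : CubeBdd fun x => g x * h x := by
  obtain ⟨B, hB⟩ := hg.bdd
  obtain ⟨C, hC⟩ := hh.bdd
  refine ⟨hg.meas.mul hh.meas, B * C, fun x hx => ?_⟩
  rw [abs_mul]
  exact mul_le_mul (hB x hx) (hC x hx) (abs_nonneg _) ((abs_nonneg _).trans (hB x hx))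

theorem const_mul (c : ℝ) (hg : CubeBdd g) : CubeBdd fun x => c * g x := (const c).mul hg

theorem neg (hg : CubeBdd g) : CubeBdd fun x => -g x := by
  simpa using hg.const_mul (-1)

theorem sub (hg : CubeBdd g) (hh : CubeBdd h) : CubeBdd fun x => g x - h x := by
  simpa [sub_eq_add_neg] using hg.add hh.neg

theorem pow (hg : CubeBdd g) : CubeBdd fun x => g x ^ 2 := by
  simpa [sq] using hg.mul hg

theorem sum {κ : Type*} {s : Finset κ} {e : κ → (Fin d → ℝ) → ℝ} (he : ∀ k ∈ s, CubeBdd (e k)) :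
    CubeBdd fun x => ∑ k ∈ s, e k x := by
  classical
  induction s using Finset.induction_on with
  | empty => simpa using const (d := d) 0
  | insert a s ha ih =>
    simp only [Finset.sum_insert ha]
    exact (he a (Finset.mem_insert_self a s)).add
      (ih fun k hk => he k (Finset.mem_insert_of_mem hk))

/-- Division by a function that is bounded away from zero on the cube. -/
theorem div (hg : CubeBdd g) (hm : Measurable h) {c : ℝ} (hc : 0 < c)
    (hh : ∀ x ∈ cube d, c ≤ h x) : CubeBdd fun x => g x / h x := by
  obtain ⟨B, hB⟩ := hg.bdd
  refine ⟨hg.meas.div hm, B / c, fun x hx => ?_⟩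
  have h1 := hh x hx
  rw [abs_div, abs_of_pos (hc.trans_le h1)]
  exact div_le_div₀ ((abs_nonneg _).trans (hB x hx)) (hB x hx) hc h1

theorem indicator (hg : ContinuousOn g (cube d)) : CubeBdd ((cube d).indicator g) := by
  obtain ⟨B, hB⟩ := (isCompact_Icc : IsCompact (cube d)).exists_bound_of_continuousOn hg
  refine ⟨?_, B, fun x hx => ?_⟩
  · classical
    have h1 : (cube d).indicator g = (cube d).piecewise g (fun _ => 0) := by
      ext x; simp [Set.indicator, Set.piecewise]
    rw [h1]
    exact hg.measurable_piecewise continuousOn_const (measurableSet_cube d)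
  · rw [Set.indicator_of_mem hx]; exact hB x hx

end CubeBdd

/-! ### Finite orthonormal families on the cube -/

/-- A finite orthonormal family in `L²([0,1]^d)`. -/
structure OrthoFamily {d : ℕ} {κ : Type*} [DecidableEq κ] (e : κ → (Fin d → ℝ) → ℝ) : Prop where
  bdd : ∀ k, CubeBdd (e k)
  ortho : ∀ k k', ∫ x in cube d, e k x * e k' x = if k = k' then 1 else 0

/-- The orthogonal projection on the span of a finite orthonormal family. -/
def projOn {d : ℕ} {κ : Type*} [Fintype κ] (e : κ → (Fin d → ℝ) → ℝ) (u : (Fin d → ℝ) → ℝ)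
    (x : Fin d → ℝ) : ℝ :=
  ∑ k, (∫ y in cube d, u y * e k y) * e k x

section OrthoFamily

variable {d : ℕ} {κ : Type*} [Fintype κ] [DecidableEq κ] {e : κ → (Fin d → ℝ) → ℝ}
  {u v : (Fin d → ℝ) → ℝ}

theorem CubeBdd.integral_sum_mul (he : ∀ k, CubeBdd (e k)) (hu : CubeBdd u) (c : κ → ℝ) :
    ∫ x in cube d, u x * ∑ k, c k * e k x = ∑ k, c k * ∫ x in cube d, u x * e k x := by
  simp_rw [mul_sum]
  rw [integral_finsetSum _ fun k _ => (hu.mul ((he k).const_mul (c k))).integrable]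
  refine sum_congr rfl fun k _ => ?_
  rw [← integral_const_mul]
  exact integral_congr_ae (ae_of_all _ fun x => by ring)

theorem OrthoFamily.integral_sum_mul_self (he : OrthoFamily e) (c : κ → ℝ) (k : κ) :
    ∫ x in cube d, (∑ k', c k' * e k' x) * e k x = c k := by
  have := CubeBdd.integral_sum_mul he.bdd (he.bdd k) c
  rw [integral_cube_congr (h := fun x => e k x * ∑ k', c k' * e k' x) fun x _ => by ring, this]
  simp [he.ortho]

theorem OrthoFamily.integral_sum_sq (he : OrthoFamily e) (c : κ → ℝ) :
    ∫ x in cube d, (∑ k, c k * e k x) ^ 2 = ∑ k, c k ^ 2 := by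
  have h1 : CubeBdd fun x => ∑ k, c k * e k x := CubeBdd.sum fun k _ => (he.bdd k).const_mul _
  simp_rw [sq]
  rw [CubeBdd.integral_sum_mul he.bdd h1 c]
  simp_rw [he.integral_sum_mul_self]

theorem OrthoFamily.cubeBdd_projOn (he : OrthoFamily e) (u : (Fin d → ℝ) → ℝ) :
    CubeBdd (projOn e u) :=
  CubeBdd.sum fun k _ => (he.bdd k).const_mul _

theorem OrthoFamily.integral_projOn_mul (he : OrthoFamily e) (hv : CubeBdd v) :
    ∫ x in cube d, projOn e u x * v x =
      ∑ k, (∫ x in cube d, u x * e k x) * ∫ x in cube d, v x * e k x := by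
  rw [integral_cube_congr (h := fun x => v x * projOn e u x) fun x _ => by ring]
  exact CubeBdd.integral_sum_mul he.bdd hv _

theorem OrthoFamily.integral_projOn_mul_comm (he : OrthoFamily e) (hu : CubeBdd u)
    (hv : CubeBdd v) :
    ∫ x in cube d, projOn e u x * v x = ∫ x in cube d, u x * projOn e v x := by
  rw [he.integral_projOn_mul hv,
    integral_cube_congr (h := fun x => projOn e v x * u x) fun x _ => by ring,
    he.integral_projOn_mul hu]
  exact sum_congr rfl fun k _ => by ring

theorem OrthoFamily.integral_projOn_sq (he : OrthoFamily e) (u : (Fin d → ℝ) → ℝ) :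
    ∫ x in cube d, projOn e u x ^ 2 = ∑ k, (∫ x in cube d, u x * e k x) ^ 2 :=
  he.integral_sum_sq _

/-- Bessel's inequality. -/
theorem OrthoFamily.integral_projOn_sq_le (he : OrthoFamily e) (hu : CubeBdd u) :
    ∫ x in cube d, projOn e u x ^ 2 ≤ ∫ x in cube d, u x ^ 2 := by
  have hp := he.cubeBdd_projOn u
  have h0 : 0 ≤ ∫ x in cube d, (u x - projOn e u x) ^ 2 :=
    integral_nonneg fun x => sq_nonneg _
  have h1 : ∫ x in cube d, (u x - projOn e u x) ^ 2 =
      ∫ x in cube d, u x ^ 2 - (2 * (projOn e u x * u x) - projOn e u x ^ 2) :=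
    integral_cube_congr fun x _ => by ring
  have h2 : ∫ x in cube d, projOn e u x * u x = ∫ x in cube d, projOn e u x ^ 2 := by
    rw [he.integral_projOn_mul hu, he.integral_projOn_sq]
    exact sum_congr rfl fun k _ => by ring
  rw [h1, integral_sub hu.pow.integrable
      (((hp.mul hu).const_mul 2).sub hp.pow).integrable,
    integral_sub ((hp.mul hu).const_mul 2).integrable hp.pow.integrable,
    integral_const_mul, h2] at h0
  linarith

theorem OrthoFamily.sum_sq_le (he : OrthoFamily e) (hu : CubeBdd u) :
    ∑ k, (∫ x in cube d, u x * e k x) ^ 2 ≤ ∫ x in cube d, u x ^ 2 := by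
  rw [← he.integral_projOn_sq]; exact he.integral_projOn_sq_le hu

theorem projOn_add (he : ∀ k, CubeBdd (e k)) (hu : CubeBdd u) (hv : CubeBdd v) (x : Fin d → ℝ) :
    projOn e (fun y => u y + v y) x = projOn e u x + projOn e v x := by
  simp only [projOn, ← sum_add_distrib, ← add_mul]
  refine sum_congr rfl fun k _ => ?_
  rw [← integral_add (hu.mul (he k)).integrable (hv.mul (he k)).integrable]
  simp_rw [add_mul]

theorem projOn_const_mul (c : ℝ) (u : (Fin d → ℝ) → ℝ) (x : Fin d → ℝ) :
    projOn e (fun y => c * u y) x = c * projOn e u x := by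
  simp only [projOn, mul_sum]
  refine sum_congr rfl fun k _ => ?_
  rw [← mul_assoc, ← integral_const_mul]
  simp_rw [mul_assoc]

theorem projOn_sub (he : ∀ k, CubeBdd (e k)) (hu : CubeBdd u) (hv : CubeBdd v) (x : Fin d → ℝ) :
    projOn e (fun y => u y - v y) x = projOn e u x - projOn e v x := by
  have h1 := projOn_add he hu (hv.const_mul (-1)) x
  rw [projOn_const_mul] at h1
  simpa [sub_eq_add_neg] using h1

/-- The Cauchy-Schwarz inequality on the cube. -/
theorem CubeBdd.abs_integral_mul_le (hu : CubeBdd u) (hv : CubeBdd v) :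
    |∫ x in cube d, u x * v x| ≤ √(∫ x in cube d, u x ^ 2) * √(∫ x in cube d, v x ^ 2) := by
  have h0 : ∀ s t : ℝ, 0 ≤ s ^ 2 * (∫ x in cube d, u x ^ 2) +
      2 * s * t * (∫ x in cube d, u x * v x) + t ^ 2 * ∫ x in cube d, v x ^ 2 := by
    intro s t
    have h1 : 0 ≤ ∫ x in cube d, (s * u x + t * v x) ^ 2 := integral_nonneg fun x => sq_nonneg _
    have h2 : ∫ x in cube d, (s * u x + t * v x) ^ 2 =
        ∫ x in cube d, (s ^ 2 * u x ^ 2 + 2 * s * t * (u x * v x)) + t ^ 2 * v x ^ 2 :=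
      integral_cube_congr fun x _ => by ring
    rw [h2, integral_add ((hu.pow.const_mul _).add ((hu.mul hv).const_mul _)).integrable
      (hv.pow.const_mul _).integrable, integral_add (hu.pow.const_mul _).integrable
      ((hu.mul hv).const_mul _).integrable, integral_const_mul, integral_const_mul,
      integral_const_mul] at h1
    exact h1
  set a := ∫ x in cube d, u x ^ 2
  set b := ∫ x in cube d, u x * v x
  set c := ∫ x in cube d, v x ^ 2
  have ha : 0 ≤ a := integral_nonneg fun x => sq_nonneg _
  have hd : b ^ 2 ≤ a * c := by
    have h3 := discrim_le_zero (a := a) (b := 2 * b) (c := c) fun s => by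
      have := h0 s 1
      linarith
    rw [discrim] at h3
    nlinarith
  rw [← Real.sqrt_mul ha]
  exact Real.abs_le_sqrt hd

end OrthoFamily

theorem CubeBdd.integral_sq_le {d : ℕ} {u : (Fin d → ℝ) → ℝ} (hu : CubeBdd u) {B : ℝ}
    (hB : ∀ x ∈ cube d, |u x| ≤ B) : ∫ x in cube d, u x ^ 2 ≤ B ^ 2 := by
  have h1 : ∫ x in cube d, u x ^ 2 ≤ ∫ x in cube d, B ^ 2 := by
    refine setIntegral_mono_on hu.pow.integrable (CubeBdd.const _).integrable
      (measurableSet_cube d) fun x hx => ?_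
    rw [← sq_abs]
    exact pow_le_pow_left₀ (abs_nonneg _) (hB x hx) 2
  simpa using h1

theorem CubeBdd.integral_mono {d : ℕ} {u v : (Fin d → ℝ) → ℝ} (hu : CubeBdd u) (hv : CubeBdd v)
    (h : ∀ x ∈ cube d, u x ≤ v x) : ∫ x in cube d, u x ≤ ∫ x in cube d, v x :=
  setIntegral_mono_on hu.integrable hv.integrable (measurableSet_cube d) h

theorem CubeBdd.abs_integral_le {d : ℕ} {u : (Fin d → ℝ) → ℝ} (hu : CubeBdd u) {B : ℝ}
    (hB : ∀ x ∈ cube d, |u x| ≤ B) : |∫ x in cube d, u x| ≤ B := by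
  have h1 := CubeBdd.integral_mono hu (CubeBdd.const B) fun x hx => (abs_le.1 (hB x hx)).2
  have h2 := CubeBdd.integral_mono (CubeBdd.const (-B)) hu fun x hx => (abs_le.1 (hB x hx)).1
  simp only [integral_const, probReal_univ, smul_eq_mul, one_mul] at h1 h2
  exact abs_le.2 ⟨h2, h1⟩

/-! ### The one-dimensional multiresolution analysis -/

section OneDim

variable {S : ℕ} (W : CDVBasis S)

theorem CDVBasis.integrable_of_bound {g : ℝ → ℝ} (hg : Measurable g) {B : ℝ}
    (hB : ∀ t ∈ Set.Icc (0 : ℝ) 1, |g t| ≤ B) :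
    Integrable g (volume.restrict (Set.Icc (0 : ℝ) 1)) :=
  Integrable.of_bound hg.aestronglyMeasurable B
    ((ae_restrict_mem measurableSet_Icc).mono fun t ht => hB t ht)

theorem CDVBasis.integrable_fn_mul_fn (b b' : Bool) (j j' : ℕ) (m : Fin (2 ^ j))
    (m' : Fin (2 ^ j')) :
    Integrable (fun t => W.fn b j m t * W.fn b' j' m' t)
      (volume.restrict (Set.Icc (0 : ℝ) 1)) := by
  refine CDVBasis.integrable_of_bound ((W.measurable_fn b j m).mul (W.measurable_fn b' j' m'))
    (B := (W.B * √(2 ^ j)) * (W.B * √(2 ^ j'))) fun t ht => ?_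
  rw [abs_mul]
  exact mul_le_mul (W.abs_fn_le b j m ht) (W.abs_fn_le b' j' m' ht) (abs_nonneg _)
    ((abs_nonneg _).trans (W.abs_fn_le b j m ht))

theorem CDVBasis.integrable_fn (b : Bool) (j : ℕ) (m : Fin (2 ^ j)) :
    Integrable (W.fn b j m) (volume.restrict (Set.Icc (0 : ℝ) 1)) :=
  CDVBasis.integrable_of_bound (W.measurable_fn b j m) fun _ ht => W.abs_fn_le b j m ht

theorem CDVBasis.integral_fn_mul_fn {j : ℕ} (hj : W.J₀ ≤ j) (b b' : Bool) (m m' : Fin (2 ^ j)) :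
    ∫ t in Set.Icc (0 : ℝ) 1, W.fn b j m t * W.fn b' j m' t = if b = b' ∧ m = m' then 1 else 0 := by
  cases b <;> cases b' <;> simp only [CDVData.fn, if_true, Bool.false_eq_true, if_false]
  · simp [W.scal_scal j hj]
  · simp [W.scal_wav j hj]
  · simp_rw [mul_comm (W.wav j m _)]
    simp [W.scal_wav j hj]
  · simp [W.wav_wav j hj]

theorem CDVBasis.inSpan_fn_succ {j : ℕ} (hj : W.J₀ ≤ j) (b : Bool) (m : Fin (2 ^ j)) :
    W.InSpan (j + 1) (W.fn b j m) := by
  cases b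
  · exact W.scal_mem j hj m
  · exact W.wav_mem j hj m

theorem CDVData.InSpan.sum {W : CDVData} {j : ℕ} {κ : Type*} [Fintype κ] {g : κ → ℝ → ℝ}
    (hg : ∀ k, W.InSpan j (g k)) (c : κ → ℝ) : W.InSpan j fun x => ∑ k, c k * g k x := by
  choose a ha using hg
  refine ⟨fun m => ∑ k, c k * a k m, fun x hx => ?_⟩
  simp_rw [ha _ x hx, mul_sum, sum_mul]
  rw [Finset.sum_comm]
  simp_rw [mul_assoc]

theorem CDVData.InSpan.congr {W : CDVData} {j : ℕ} {g h : ℝ → ℝ} (hg : W.InSpan j g)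
    (H : ∀ x ∈ Set.Icc (0 : ℝ) 1, h x = g x) : W.InSpan j h := by
  obtain ⟨c, hc⟩ := hg
  exact ⟨c, fun x hx => (H x hx).trans (hc x hx)⟩

theorem CDVBasis.inSpan_mono {i j : ℕ} (hi : W.J₀ ≤ i) (hij : i ≤ j) {g : ℝ → ℝ}
    (hg : W.InSpan i g) : W.InSpan j g := by
  induction j, hij using Nat.le_induction with
  | base => exact hg
  | succ j hij ih =>
    obtain ⟨c, hc⟩ := ih
    exact (CDVData.InSpan.sum (fun m => W.scal_mem j (hi.trans hij) m) c).congr hc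

theorem CDVBasis.inSpan_fn {j l : ℕ} (hj : W.J₀ ≤ j) (hl : j < l) (b : Bool) (m : Fin (2 ^ j)) :
    W.InSpan l (W.fn b j m) :=
  W.inSpan_mono (hj.trans (Nat.le_succ j)) hl (W.inSpan_fn_succ hj b m)

theorem CDVBasis.inSpan_scal {j l : ℕ} (hj : W.J₀ ≤ j) (hl : j ≤ l) (m : Fin (2 ^ j)) :
    W.InSpan l (W.fn false j m) := by
  refine W.inSpan_mono hj hl ⟨fun m' => if m' = m then 1 else 0, fun x _ => ?_⟩
  simp [CDVData.fn]

/-- Wavelets are orthogonal to the scaling space of their level. -/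
theorem CDVBasis.integral_mul_wav_eq_zero {l : ℕ} (hl : W.J₀ ≤ l) {g : ℝ → ℝ}
    (hg : W.InSpan l g) (m : Fin (2 ^ l)) :
    ∫ t in Set.Icc (0 : ℝ) 1, g t * W.fn true l m t = 0 := by
  obtain ⟨c, hc⟩ := hg
  have h1 : ∫ t in Set.Icc (0 : ℝ) 1, g t * W.fn true l m t = ∫ t in Set.Icc (0 : ℝ) 1, ∑ k, c k *
        (W.fn false l k t * W.fn true l m t) :=
    setIntegral_congr_fun measurableSet_Icc fun t ht => by
      simp only [hc t ht, sum_mul, mul_assoc]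
      rfl
  rw [h1, integral_finsetSum _ fun k _ => (W.integrable_fn_mul_fn false true l l k m).const_mul _]
  refine sum_eq_zero fun k _ => ?_
  rw [integral_const_mul, W.integral_fn_mul_fn hl]
  simp

/-- The reproducing kernel of level `j` (for `b = false`), or of the detail space of level `j`. -/
def CDVData.kap (W : CDVData) (b : Bool) (j : ℕ) (s t : ℝ) : ℝ :=
  ∑ m, W.fn b j m s * W.fn b j m t

/-- The kernel of level `j` reproduces the functions in the span of that level. -/
theorem CDVBasis.integral_kap_mul {j : ℕ} (hj : W.J₀ ≤ j) {g : ℝ → ℝ}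
    (hg : W.InSpan j g) {s : ℝ} (hs : s ∈ Set.Icc (0 : ℝ) 1) :
    ∫ t in Set.Icc (0 : ℝ) 1, W.kap false j s t * g t = g s := by
  obtain ⟨c, hc⟩ := hg
  have h1 : ∫ t in Set.Icc (0 : ℝ) 1, W.kap false j s t * g t =
      ∫ t in Set.Icc (0 : ℝ) 1, ∑ m, ∑ k, (W.fn false j m s * c k) *
        (W.fn false j m t * W.fn false j k t) :=
    setIntegral_congr_fun measurableSet_Icc fun t ht => by
      simp only [hc t ht, CDVData.kap, Finset.sum_mul_sum]
      refine sum_congr rfl fun m _ => sum_congr rfl fun k _ => ?_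
      simp only [CDVData.fn, Bool.false_eq_true, if_false]
      ring
  rw [h1, integral_finsetSum _ fun m _ => integrable_finsetSum _ fun k _ =>
    (W.integrable_fn_mul_fn false false j j m k).const_mul _, hc s hs]
  refine sum_congr rfl fun m _ => ?_
  rw [integral_finsetSum _ fun k _ => (W.integrable_fn_mul_fn false false j j m k).const_mul _]
  simp_rw [integral_const_mul, W.integral_fn_mul_fn hj]
  simp [CDVData.fn, mul_comm]

/-- The scaling functions of level `j + 1` and the scaling functions and wavelets of level `j` are
orthonormal bases of the same space. -/
theorem CDVBasis.kap_succ {j : ℕ} (hj : W.J₀ ≤ j) {s t : ℝ} (hs : s ∈ Set.Icc (0 : ℝ) 1)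
    (ht : t ∈ Set.Icc (0 : ℝ) 1) :
    W.kap false (j + 1) s t = W.kap false j s t + W.kap true j s t := by
  choose c hc using fun b m => W.inSpan_fn_succ hj b m
  let U : Matrix (Bool × Fin (2 ^ j)) (Fin (2 ^ (j + 1))) ℝ := fun p k => c p.1 p.2 k
  -- orthonormality of the finer basis and of the coarser one makes `U` a square isometry
  have hU : U * U.transpose = 1 := by
    ext p q
    have h1 : ∫ t in Set.Icc (0 : ℝ) 1, W.fn p.1 j p.2 t * W.fn q.1 j q.2 t =
        ∫ t in Set.Icc (0 : ℝ) 1, ∑ k, ∑ k', (c p.1 p.2 k * c q.1 q.2 k') *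
          (W.fn false (j + 1) k t * W.fn false (j + 1) k' t) :=
      setIntegral_congr_fun measurableSet_Icc fun t ht => by
        simp only [hc _ _ t ht, Finset.sum_mul_sum]
        refine sum_congr rfl fun m _ => sum_congr rfl fun k _ => ?_
        simp only [CDVData.fn, Bool.false_eq_true, if_false]
        ring
    rw [W.integral_fn_mul_fn hj, integral_finsetSum _ fun m _ => integrable_finsetSum _ fun k _ =>
      (W.integrable_fn_mul_fn false false (j + 1) (j + 1) m k).const_mul _] at h1
    rw [Matrix.mul_apply, Matrix.one_apply]
    simp only [Prod.ext_iff]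
    rw [h1]
    refine sum_congr rfl fun k _ => ?_
    rw [integral_finsetSum _ fun k' _ =>
      (W.integrable_fn_mul_fn false false (j + 1) (j + 1) k k').const_mul _]
    simp_rw [integral_const_mul, W.integral_fn_mul_fn (hj.trans (Nat.le_succ j))]
    simp only [true_and, mul_ite, mul_one, mul_zero, Finset.sum_ite_eq, Finset.mem_univ, if_true]
    rfl
  have hU' : U.transpose * U = 1 :=
    (Matrix.mul_eq_one_comm_of_card_eq _ _ _ (by simp [pow_succ, mul_comm])).1 hU
  have key : ∀ k k', ∑ p : Bool × Fin (2 ^ j), c p.1 p.2 k * c p.1 p.2 k' =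
      if k = k' then 1 else 0 := by
    intro k k'
    have := congrFun (congrFun hU' k) k'
    rwa [Matrix.mul_apply, Matrix.one_apply] at this
  have h2 : W.kap false j s t + W.kap true j s t =
      ∑ p : Bool × Fin (2 ^ j), W.fn p.1 j p.2 s * W.fn p.1 j p.2 t := by
    rw [Fintype.sum_prod_type, Fintype.sum_bool, add_comm]; rfl
  rw [h2]
  have h3 : ∀ p : Bool × Fin (2 ^ j), W.fn p.1 j p.2 s * W.fn p.1 j p.2 t =
      ∑ k, ∑ k', (c p.1 p.2 k * c p.1 p.2 k') * (W.scal (j + 1) k s * W.scal (j + 1) k' t) := by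
    intro p
    rw [hc _ _ s hs, hc _ _ t ht, Finset.sum_mul_sum]
    exact sum_congr rfl fun m _ => sum_congr rfl fun k _ => by ring
  simp_rw [h3]
  rw [Finset.sum_comm]
  simp_rw [Finset.sum_comm (s := (Finset.univ : Finset (Bool × Fin (2 ^ j)))), ← sum_mul, key]
  simp [CDVData.kap, CDVData.fn]

theorem CDVBasis.integral_abs_fn_le (b : Bool) (j : ℕ) (m : Fin (2 ^ j)) :
    ∫ t in Set.Icc (0 : ℝ) 1, |W.fn b j m t| ≤ 2 * W.R * W.B / √(2 ^ j) := by
  have hR := W.one_le_R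
  have hB := W.one_le_B
  set I : Set ℝ := Set.Icc ((m - W.R) / 2 ^ j) ((m + W.R) / 2 ^ j)
  have h2 : (0 : ℝ) < 2 ^ j := by positivity
  have h1 : ∀ t ∈ Set.Icc (0 : ℝ) 1,
      |W.fn b j m t| ≤ I.indicator (fun _ => W.B * √(2 ^ j)) t := by
    intro t ht
    by_cases h : t ∈ I
    · rw [Set.indicator_of_mem h]; exact W.abs_fn_le b j m ht
    · rw [Set.indicator_of_notMem h, W.fn_eq_zero b j m ht, abs_zero]
      by_contra h'
      rw [not_lt, abs_le] at h'
      refine h ⟨?_, ?_⟩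
      · rw [div_le_iff₀ h2]; linarith
      · rw [le_div_iff₀ h2]; linarith
  have hIi : Integrable (I.indicator fun _ => W.B * √(2 ^ j)) volume :=
    (integrable_indicator_iff measurableSet_Icc).2 continuousOn_const.integrableOn_Icc
  calc ∫ t in Set.Icc (0 : ℝ) 1, |W.fn b j m t|
      ≤ ∫ t in Set.Icc (0 : ℝ) 1, I.indicator (fun _ => W.B * √(2 ^ j)) t :=
        setIntegral_mono_on (W.integrable_fn b j m).abs hIi.integrableOn measurableSet_Icc h1
    _ ≤ ∫ t, I.indicator (fun _ => W.B * √(2 ^ j)) t :=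
        setIntegral_le_integral hIi (ae_of_all _ fun t =>
          Set.indicator_nonneg (fun _ _ => by positivity) t)
    _ = 2 * W.R * W.B / √(2 ^ j) := by
        rw [integral_indicator measurableSet_Icc, setIntegral_const, Real.volume_real_Icc,
          max_eq_left (by rw [← sub_div]; apply div_nonneg <;> linarith), smul_eq_mul]
        have h3 : √(2 ^ j : ℝ) * √(2 ^ j) = 2 ^ j := Real.mul_self_sqrt h2.le
        field_simp
        nlinarith

theorem CDVBasis.kap_eq_zero (b : Bool) (j : ℕ) {s t : ℝ} (hs : s ∈ Set.Icc (0 : ℝ) 1)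
    (ht : t ∈ Set.Icc (0 : ℝ) 1) (h : 2 * W.R / 2 ^ j < |s - t|) :
    W.kap b j s t = 0 := by
  have h2 : (0 : ℝ) < 2 ^ j := by positivity
  refine sum_eq_zero fun m _ => ?_
  by_cases h1 : W.R < |2 ^ j * s - ((m : ℕ) : ℝ)|
  · rw [W.fn_eq_zero b j m hs h1, zero_mul]
  · rw [W.fn_eq_zero b j m ht, mul_zero]
    rw [div_lt_iff₀ h2] at h
    have h3 : |s - t| * 2 ^ j = |(2 ^ j * s - ((m : ℕ) : ℝ)) - (2 ^ j * t - ((m : ℕ) : ℝ))| := by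
      rw [← abs_of_pos h2, ← abs_mul, abs_of_pos h2]; congr 1; ring
    have h4 := abs_sub (2 ^ j * s - ((m : ℕ) : ℝ)) (2 ^ j * t - ((m : ℕ) : ℝ))
    linarith

theorem CDVBasis.integral_kap_sq {j : ℕ} (hj : W.J₀ ≤ j) {s : ℝ} (hs : s ∈ Set.Icc (0 : ℝ) 1) :
    ∫ t in Set.Icc (0 : ℝ) 1, W.kap false j s t ^ 2 = W.kap false j s s := by
  have := W.integral_kap_mul hj (g := fun t => W.kap false j s t)
    ⟨fun m => W.fn false j m s, fun x _ => rfl⟩ hs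
  simpa only [sq] using this

theorem CDVBasis.kap_self_le (b : Bool) (j : ℕ) {t : ℝ} (ht : t ∈ Set.Icc (0 : ℝ) 1) :
    W.kap b j t t ≤ 3 * W.R * W.B ^ 2 * 2 ^ j := by
  have hB := W.one_le_B
  have h3 : √(2 ^ j : ℝ) * √(2 ^ j) = 2 ^ j := Real.mul_self_sqrt (by positivity)
  calc W.kap b j t t
      ≤ ∑ m, (W.B * √(2 ^ j)) * |W.fn b j m t| := by
        refine sum_le_sum fun m _ => ?_
        rw [← abs_mul_abs_self]
        exact mul_le_mul_of_nonneg_right (W.abs_fn_le b j m ht) (abs_nonneg _)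
    _ = (W.B * √(2 ^ j)) * ∑ m, |W.fn b j m t| := by rw [mul_sum]
    _ ≤ (W.B * √(2 ^ j)) * (3 * W.R * W.B * √(2 ^ j)) :=
        mul_le_mul_of_nonneg_left (W.sum_abs_fn_le b j ht) (by positivity)
    _ = 3 * W.R * W.B ^ 2 * (√(2 ^ j) * √(2 ^ j)) := by ring
    _ = _ := by rw [h3]

theorem CDVBasis.inSpan_one {j : ℕ} (hj : W.J₀ ≤ j) :
    W.InSpan j fun _ => 1 := by
  simpa using W.polynomial_mem j hj 0 W.one_le_S

theorem CDVBasis.integrable_kap (b : Bool) (j : ℕ) (s : ℝ) :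
    Integrable (W.kap b j s) (volume.restrict (Set.Icc (0 : ℝ) 1)) := by
  unfold CDVData.kap
  exact integrable_finsetSum _ fun m _ => (W.integrable_fn b j m).const_mul _

theorem CDVBasis.integrable_kap_sq (b : Bool) (j : ℕ) (s : ℝ) :
    Integrable (fun t => W.kap b j s t ^ 2) (volume.restrict (Set.Icc (0 : ℝ) 1)) := by
  simp only [CDVData.kap, sq, Finset.sum_mul_sum]
  refine integrable_finsetSum _ fun m _ => integrable_finsetSum _ fun m' _ => ?_
  have := (W.integrable_fn_mul_fn b b j j m m').const_mul
    (W.fn b j m s * W.fn b j m' s)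
  refine this.congr (ae_of_all _ fun t => ?_)
  change _ = _ * _
  ring

/-- Since constants are reproduced by a kernel that is concentrated near the diagonal, the kernel
is large on the diagonal. -/
theorem CDVBasis.le_kap_self {j : ℕ} (hj : W.J₀ ≤ j) {s : ℝ} (hs : s ∈ Set.Icc (0 : ℝ) 1) :
    2 ^ j / (4 * W.R) ≤ W.kap false j s s := by
  have hR := W.one_le_R
  have h2 : (0 : ℝ) < 2 ^ j := by positivity
  set a : ℝ := 4 * W.R / 2 ^ j with ha
  have ha0 : 0 < a := by positivity
  set I : Set ℝ := Set.Icc (s - 2 * W.R / 2 ^ j) (s + 2 * W.R / 2 ^ j)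
  have hIi : Integrable (I.indicator fun _ => (1 : ℝ)) volume :=
    (integrable_indicator_iff measurableSet_Icc).2 continuousOn_const.integrableOn_Icc
  have h1 := W.integral_kap_mul hj (W.inSpan_one hj) hs
  simp only [mul_one] at h1
  -- the weighted inequality `2 K 1_I ≤ a K² + 1_I / a`, integrated
  have h3 : ∀ t ∈ Set.Icc (0 : ℝ) 1, W.kap false j s t ≤
      a / 2 * W.kap false j s t ^ 2 + (2 * a)⁻¹ * I.indicator (fun _ => (1 : ℝ)) t := by
    intro t ht
    by_cases h : t ∈ I
    · rw [Set.indicator_of_mem h]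
      have : 0 ≤ (a * W.kap false j s t - 1) ^ 2 / (2 * a) := by positivity
      have h5 : (a * W.kap false j s t - 1) ^ 2 / (2 * a) =
        a / 2 * W.kap false j s t ^ 2 + (2 * a)⁻¹ * 1 - W.kap false j s t := by
        field_simp; ring
      linarith
    · rw [Set.indicator_of_notMem h, W.kap_eq_zero false j hs ht]
      · simp
      · by_contra h'
        rw [not_lt, abs_le] at h'
        exact h ⟨by linarith, by linarith⟩
  have h4 := setIntegral_mono_on (W.integrable_kap false j s)
    (((W.integrable_kap_sq false j s).const_mul (a / 2)).add
      ((hIi.integrableOn (s := Set.Icc (0 : ℝ) 1)).const_mul (2 * a)⁻¹)) measurableSet_Icc h3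
  simp only [Pi.add_apply] at h4
  rw [h1, integral_add ((W.integrable_kap_sq false j s).const_mul (a / 2))
    ((hIi.integrableOn (s := Set.Icc (0 : ℝ) 1)).const_mul (2 * a)⁻¹), integral_const_mul,
    integral_const_mul, W.integral_kap_sq hj hs] at h4
  have h6 : ∫ t in Set.Icc (0 : ℝ) 1, I.indicator (fun _ => (1 : ℝ)) t ≤ a := by
    refine (setIntegral_le_integral hIi (ae_of_all _ fun t =>
          Set.indicator_nonneg (fun _ _ => zero_le_one) t)).trans ?_
    rw [integral_indicator measurableSet_Icc, setIntegral_const, Real.volume_real_Icc,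
      smul_eq_mul, mul_one]
    refine max_le (le_of_eq ?_) ha0.le
    rw [ha]; ring
  have h7 : (2 * a)⁻¹ * ∫ t in Set.Icc (0 : ℝ) 1, I.indicator (fun _ => (1 : ℝ)) t ≤ 1 / 2 := by
    refine (mul_le_mul_of_nonneg_left h6 (by positivity)).trans (le_of_eq ?_)
    field_simp
  have h8 : 1 ≤ a * W.kap false j s s := by linarith
  rw [div_le_iff₀ (by positivity)]
  rw [ha, div_mul_eq_mul_div, le_div_iff₀ h2] at h8
  linarith

theorem CDVBasis.integral_abs_kap_le (b : Bool) (j : ℕ) {s : ℝ} (hs : s ∈ Set.Icc (0 : ℝ) 1) :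
    ∫ t in Set.Icc (0 : ℝ) 1, |W.kap b j s t| ≤ 6 * W.R ^ 2 * W.B ^ 2 := by
  have hR := W.one_le_R
  have hB := W.one_le_B
  calc ∫ t in Set.Icc (0 : ℝ) 1, |W.kap b j s t|
      ≤ ∫ t in Set.Icc (0 : ℝ) 1, ∑ m, |W.fn b j m s| * |W.fn b j m t| := by
        refine setIntegral_mono_on (W.integrable_kap b j s).abs (integrable_finsetSum _ fun m _ =>
          (W.integrable_fn b j m).abs.const_mul _) measurableSet_Icc fun t _ => ?_
        simp_rw [← abs_mul]
        exact abs_sum_le_sum_abs _ _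
    _ = ∑ m, |W.fn b j m s| * ∫ t in Set.Icc (0 : ℝ) 1, |W.fn b j m t| := by
        rw [integral_finsetSum _ fun m _ => (W.integrable_fn b j m).abs.const_mul _]
        simp_rw [integral_const_mul]
    _ ≤ ∑ m, |W.fn b j m s| * (2 * W.R * W.B / √(2 ^ j)) :=
        sum_le_sum fun m _ => mul_le_mul_of_nonneg_left (W.integral_abs_fn_le b j m) (abs_nonneg _)
    _ = (∑ m, |W.fn b j m s|) * (2 * W.R * W.B / √(2 ^ j)) := by rw [sum_mul]
    _ ≤ (3 * W.R * W.B * √(2 ^ j)) * (2 * W.R * W.B / √(2 ^ j)) :=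
        mul_le_mul_of_nonneg_right (W.sum_abs_fn_le b j hs) (by positivity)
    _ = _ := by field_simp; ring

end OneDim

/-! ### The tensor product multiresolution analysis -/

section Tensor

variable {S d : ℕ} (W : CDVBasis S)

theorem CDVData.Psi_eq (W : CDVData) (j : ℕ) (ι : Fin d → Bool) (m : Fin d → Fin (2 ^ j))
    (x : Fin d → ℝ) : W.Psi j ι m x = ∏ i, W.fn (ι i) j (m i) (x i) := by
  refine prod_congr rfl fun i _ => ?_
  cases h : ι i <;> simp [CDVData.fn]

theorem CDVData.Phi_eq (W : CDVData) (j : ℕ) (m : Fin d → Fin (2 ^ j)) :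
    W.Phi j m = W.Psi j (fun _ => false) m := by
  ext x; simp [CDVData.Phi, CDVData.Psi]

theorem CDVBasis.abs_Psi_le (j : ℕ) (ι : Fin d → Bool) (m : Fin d → Fin (2 ^ j))
    {x : Fin d → ℝ} (hx : x ∈ cube d) : |W.Psi j ι m x| ≤ (W.B * √(2 ^ j)) ^ d := by
  rw [CDVData.Psi_eq, abs_prod]
  refine (prod_le_prod (fun _ _ => abs_nonneg _)
    fun i _ => W.abs_fn_le (ι i) j (m i) (mem_cube.1 hx i)).trans (le_of_eq ?_)
  simp

theorem CDVBasis.cubeBdd_Psi (j : ℕ) (ι : Fin d → Bool) (m : Fin d → Fin (2 ^ j)) :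
    CubeBdd (W.Psi j ι m) := by
  refine ⟨?_, _, fun x hx => W.abs_Psi_le j ι m hx⟩
  rw [funext (W.Psi_eq j ι m)]
  exact Finset.measurable_fun_prod _ fun i _ => (W.measurable_fn _ _ _).comp (measurable_pi_apply i)

theorem CDVBasis.cubeBdd_Phi (j : ℕ) (m : Fin d → Fin (2 ^ j)) :
    CubeBdd (W.Phi j m) := by
  rw [CDVData.Phi_eq]; exact W.cubeBdd_Psi _ _ _

theorem CDVBasis.sum_abs_Psi_le (j : ℕ) (ι : Fin d → Bool) {x : Fin d → ℝ} (hx : x ∈ cube d) :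
    ∑ m, |W.Psi j ι m x| ≤ (3 * W.R * W.B * √(2 ^ j)) ^ d := by
  simp_rw [CDVData.Psi_eq, abs_prod]
  rw [← Fintype.prod_sum fun i k => |W.fn (ι i) j k (x i)|]
  refine (prod_le_prod (fun _ _ => sum_nonneg fun _ _ => abs_nonneg _)
    fun i _ => W.sum_abs_fn_le (ι i) j (mem_cube.1 hx i)).trans (le_of_eq ?_)
  simp

theorem CDVBasis.integral_abs_Psi_le (j : ℕ) (ι : Fin d → Bool) (m : Fin d → Fin (2 ^ j)) :
    ∫ x in cube d, |W.Psi j ι m x| ≤ (2 * W.R * W.B / √(2 ^ j)) ^ d := by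
  simp_rw [CDVData.Psi_eq, abs_prod]
  rw [integral_cube_prod fun i t => |W.fn (ι i) j (m i) t|]
  refine (prod_le_prod (fun _ _ => integral_nonneg fun _ => abs_nonneg _)
    fun i _ => W.integral_abs_fn_le (ι i) j (m i)).trans (le_of_eq ?_)
  simp [div_pow]

theorem CDVBasis.integral_Psi_mul_Psi (j l : ℕ) (ι ι' : Fin d → Bool) (m : Fin d → Fin (2 ^ j))
    (m' : Fin d → Fin (2 ^ l)) :
    ∫ x in cube d, W.Psi j ι m x * W.Psi l ι' m' x = ∏ i, ∫ t in Set.Icc (0 : ℝ) 1,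
        W.fn (ι i) j (m i) t * W.fn (ι' i) l (m' i) t := by
  simp_rw [CDVData.Psi_eq, ← prod_mul_distrib]
  exact integral_cube_prod fun i t => W.fn (ι i) j (m i) t * W.fn (ι' i) l (m' i) t

theorem CDVBasis.orthoFamily_Psi {j : ℕ} (hj : W.J₀ ≤ j) :
    OrthoFamily fun p : (Fin d → Bool) × (Fin d → Fin (2 ^ j)) => W.Psi j p.1 p.2 where
  bdd p := W.cubeBdd_Psi j p.1 p.2
  ortho p q := by
    rw [W.integral_Psi_mul_Psi]
    simp_rw [W.integral_fn_mul_fn hj]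
    by_cases h : p = q
    · subst h; simp
    · rw [if_neg h]
      have : ∃ i, ¬ (p.1 i = q.1 i ∧ p.2 i = q.2 i) := by
        by_contra hc
        push Not at hc
        exact h (Prod.ext (funext fun i => (hc i).1) (funext fun i => (hc i).2))
      obtain ⟨i, hi⟩ := this
      exact Finset.prod_eq_zero (Finset.mem_univ i) (if_neg hi)

theorem CDVBasis.orthoFamily_Phi {j : ℕ} (hj : W.J₀ ≤ j) :
    OrthoFamily (W.Phi (d := d) j) where
  bdd := W.cubeBdd_Phi j
  ortho m m' := by
    have := (W.orthoFamily_Psi (d := d) hj).ortho (fun _ => false, m) (fun _ => false, m')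
    simpa [CDVData.Phi_eq] using this

/-- Wavelets are orthogonal to everything coarser. -/
theorem CDVBasis.integral_Psi_mul_Psi_eq_zero {j l : ℕ} (hj : W.J₀ ≤ j) {ι ι' : Fin d → Bool}
    (h : j < l ∨ j = l ∧ ι = fun _ => false) (hι' : ι' ≠ fun _ => false)
    (m : Fin d → Fin (2 ^ j)) (m' : Fin d → Fin (2 ^ l)) :
    ∫ x in cube d, W.Psi j ι m x * W.Psi l ι' m' x = 0 := by
  obtain ⟨i, hi⟩ : ∃ i, ι' i = true := by
    by_contra hc
    push Not at hc
    exact hι' (funext fun i => by simpa using hc i)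
  rw [W.integral_Psi_mul_Psi]
  refine Finset.prod_eq_zero (Finset.mem_univ i) ?_
  rw [hi]
  rcases h with h | ⟨rfl, rfl⟩
  · exact W.integral_mul_wav_eq_zero (hj.trans h.le) (W.inSpan_fn hj h _ _) _
  · exact W.integral_mul_wav_eq_zero hj (W.inSpan_scal hj le_rfl _) _

theorem CDVData.sum_Psi_mul_Psi (W : CDVData) (j : ℕ) (ι : Fin d → Bool) (x y : Fin d → ℝ) :
    ∑ m, W.Psi j ι m x * W.Psi j ι m y = ∏ i, W.kap (ι i) j (x i) (y i) := by
  simp_rw [CDVData.Psi_eq, ← prod_mul_distrib]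
  rw [← Fintype.prod_sum fun i k => W.fn (ι i) j k (x i) * W.fn (ι i) j k (y i)]
  rfl

theorem CDVData.kernel_eq_prod (W : CDVData) (j : ℕ) (x y : Fin d → ℝ) :
    W.kernel j x y = ∏ i, W.kap false j (x i) (y i) := by
  simp only [CDVData.kernel, CDVData.Phi_eq]
  exact W.sum_Psi_mul_Psi j (fun _ => false) x y

theorem CDVBasis.kernel_succ {j : ℕ} (hj : W.J₀ ≤ j) {x y : Fin d → ℝ} (hx : x ∈ cube d)
    (hy : y ∈ cube d) :
    W.kernel (j + 1) x y = ∑ ι : Fin d → Bool, ∑ m, W.Psi j ι m x * W.Psi j ι m y := by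
  simp_rw [CDVData.sum_Psi_mul_Psi, CDVData.kernel_eq_prod]
  rw [← Fintype.prod_sum fun i b => W.kap b j (x i) (y i)]
  refine prod_congr rfl fun i _ => ?_
  rw [Fintype.sum_bool, add_comm (W.kap true _ _ _), W.kap_succ hj (mem_cube.1 hx i) (mem_cube.1 hy i)]

/-- The orthogonal projection on the scaling space of level `j`. -/
def CDVData.proj (W : CDVData) (j : ℕ) (u : (Fin d → ℝ) → ℝ) (x : Fin d → ℝ) : ℝ :=
  projOn (W.Phi j) u x

/-- The component of `u` in the wavelet space of level `j`. -/
def CDVData.detail (W : CDVData) (j : ℕ) (u : (Fin d → ℝ) → ℝ) (x : Fin d → ℝ) : ℝ :=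
  ∑ ι : Fin d → Bool with ι ≠ fun _ => false, ∑ m,
    (∫ y in cube d, u y * W.Psi j ι m y) * W.Psi j ι m x

theorem CDVBasis.cubeBdd_proj (j : ℕ) (u : (Fin d → ℝ) → ℝ) :
    CubeBdd (W.proj j u) :=
  CubeBdd.sum fun m _ => (W.cubeBdd_Phi j m).const_mul _

theorem CDVBasis.cubeBdd_kernel (j : ℕ) (x : Fin d → ℝ) :
    CubeBdd (W.kernel j x) :=
  CubeBdd.sum fun m _ => (W.cubeBdd_Phi j m).const_mul _

theorem CDVData.kernel_comm (W : CDVData) (j : ℕ) (x y : Fin d → ℝ) :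
    W.kernel j x y = W.kernel j y x :=
  sum_congr rfl fun _ _ => mul_comm _ _

theorem CDVBasis.proj_eq_integral_kernel (j : ℕ) {u : (Fin d → ℝ) → ℝ} (hu : CubeBdd u)
    (x : Fin d → ℝ) :
    W.proj j u x = ∫ y in cube d, W.kernel j x y * u y := by
  have := CubeBdd.integral_sum_mul (fun m => W.cubeBdd_Phi (d := d) j m) hu
    (fun m => W.Phi j m x)
  simp only [CDVData.kernel]
  rw [integral_cube_congr
    (h := fun y => u y * ∑ m, W.Phi j m x * W.Phi j m y) fun y _ => mul_comm _ _, this]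
  exact sum_congr rfl fun m _ => mul_comm _ _

theorem CDVBasis.proj_succ {j : ℕ} (hj : W.J₀ ≤ j) {u : (Fin d → ℝ) → ℝ} (hu : CubeBdd u)
    {x : Fin d → ℝ} (hx : x ∈ cube d) :
    W.proj (j + 1) u x = W.proj j u x + W.detail j u x := by
  have h1 : W.proj (j + 1) u x = ∑ ι : Fin d → Bool, ∑ m,
      (∫ y in cube d, u y * W.Psi j ι m y) * W.Psi j ι m x := by
    have h2 := CubeBdd.integral_sum_mul (fun p : (Fin d → Bool) × (Fin d → Fin (2 ^ j)) =>
      W.cubeBdd_Psi (d := d) j p.1 p.2) hu (fun p => W.Psi j p.1 p.2 x)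
    rw [W.proj_eq_integral_kernel _ hu, integral_cube_congr (h := fun y => u y *
      ∑ p : (Fin d → Bool) × (Fin d → Fin (2 ^ j)),
        W.Psi j p.1 p.2 x * W.Psi j p.1 p.2 y), h2, Fintype.sum_prod_type]
    · exact sum_congr rfl fun ι _ => sum_congr rfl fun m _ => mul_comm _ _
    · intro y hy
      rw [W.kernel_succ hj hx hy, mul_comm, Fintype.sum_prod_type]
  rw [h1, ← Finset.sum_filter_not_add_sum_filter _ fun ι : Fin d → Bool => ι ≠ fun _ => false,
    CDVData.detail]
  congr 1
  have h3 : (Finset.univ.filter fun ι : Fin d → Bool => ¬ (ι ≠ fun _ => false)) =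
      {fun _ => false} := by ext ι; simp
  rw [h3, Finset.sum_singleton, CDVData.proj, projOn]
  simp_rw [CDVData.Phi_eq]

theorem CDVBasis.proj_prod {j : ℕ} (hj : W.J₀ ≤ j) {g : Fin d → ℝ → ℝ}
    (hg : ∀ i, W.InSpan j (g i)) (hb : CubeBdd fun x : Fin d → ℝ => ∏ i, g i (x i))
    {x : Fin d → ℝ} (hx : x ∈ cube d) :
    W.proj j (fun x : Fin d → ℝ => ∏ i, g i (x i)) x = ∏ i, g i (x i) := by
  rw [W.proj_eq_integral_kernel _ hb]
  simp_rw [CDVData.kernel_eq_prod, ← prod_mul_distrib]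
  rw [integral_cube_prod fun i t => W.kap false j (x i) t * g i t]
  exact prod_congr rfl fun i _ => W.integral_kap_mul hj (hg i) (mem_cube.1 hx i)

theorem CDVBasis.proj_const {j : ℕ} (hj : W.J₀ ≤ j) (c : ℝ) {x : Fin d → ℝ} (hx : x ∈ cube d) :
    W.proj j (fun _ => c) x = c := by
  have h1 := W.proj_prod hj (g := fun _ : Fin d => fun _ => (1 : ℝ)) (fun _ => W.inSpan_one hj)
    (by simpa using CubeBdd.const 1) hx
  have h2 := projOn_const_mul (e := W.Phi j) c
    (fun x : Fin d → ℝ => ∏ i : Fin d, (fun _ => (1 : ℝ)) (x i)) x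
  simp only [Finset.prod_const_one, mul_one] at h1 h2
  rw [CDVData.proj] at h1 ⊢
  rw [h2, h1, mul_one]

theorem CDVBasis.proj_Psi {j l : ℕ} (hl : W.J₀ ≤ l) {ι : Fin d → Bool}
    (h : l < j ∨ l = j ∧ ι = fun _ => false) (m : Fin d → Fin (2 ^ l)) {x : Fin d → ℝ}
    (hx : x ∈ cube d) : W.proj j (W.Psi l ι m) x = W.Psi l ι m x := by
  have hj : W.J₀ ≤ j := by rcases h with h | ⟨h, -⟩ <;> omega
  rw [funext (W.Psi_eq l ι m)]
  refine W.proj_prod hj (fun i => ?_) ?_ hx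
  · rcases h with h | ⟨rfl, rfl⟩
    · exact W.inSpan_fn hl h _ _
    · exact W.inSpan_scal hl le_rfl _
  · rw [← funext (W.Psi_eq l ι m)]; exact W.cubeBdd_Psi _ _ _

/-- The norm of the projections as operators on bounded functions is at most this constant. -/
def CDVBasis.A (W : CDVBasis S) (d : ℕ) : ℝ := (6 * W.R ^ 2 * W.B ^ 2) ^ d

theorem CDVBasis.A_pos (d : ℕ) : 0 < W.A d := by
  have hR := W.one_le_R
  have hB := W.one_le_B
  unfold CDVBasis.A; positivity

theorem CDVBasis.integral_abs_kernel_le (j : ℕ) {x : Fin d → ℝ} (hx : x ∈ cube d) :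
    ∫ y in cube d, |W.kernel j x y| ≤ W.A d := by
  simp_rw [CDVData.kernel_eq_prod, abs_prod]
  rw [integral_cube_prod fun i t => |W.kap false j (x i) t|]
  refine (prod_le_prod (fun _ _ => integral_nonneg fun _ => abs_nonneg _)
    fun i _ => W.integral_abs_kap_le false j (mem_cube.1 hx i)).trans (le_of_eq ?_)
  simp [CDVBasis.A]

theorem CubeBdd.abs {d : ℕ} {g : (Fin d → ℝ) → ℝ} (hg : CubeBdd g) : CubeBdd fun x => |g x| := by
  obtain ⟨B, hB⟩ := hg.bdd
  exact ⟨hg.meas.abs, B, fun x hx => by rw [abs_abs]; exact hB x hx⟩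

theorem CubeBdd.abs_integral_mul_le_integral_abs {d : ℕ} {g u : (Fin d → ℝ) → ℝ} (hg : CubeBdd g)
    (hu : CubeBdd u) {B : ℝ} (hB : ∀ y ∈ cube d, g y ≠ 0 → |u y| ≤ B) :
    |∫ y in cube d, g y * u y| ≤ (∫ y in cube d, |g y|) * B := by
  rw [← integral_mul_const]
  refine (abs_integral_le_integral_abs).trans ?_
  refine CubeBdd.integral_mono (hg.mul hu).abs (hg.abs.mul (CubeBdd.const B)) fun y hy => ?_
  rw [abs_mul]
  by_cases h : g y = 0
  · simp [h]
  · exact mul_le_mul_of_nonneg_left (hB y hy h) (abs_nonneg _)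

theorem CDVBasis.abs_proj_le (j : ℕ) {u : (Fin d → ℝ) → ℝ} (hu : CubeBdd u) {B : ℝ}
    (hB : ∀ x ∈ cube d, |u x| ≤ B) {x : Fin d → ℝ} (hx : x ∈ cube d) :
    |W.proj j u x| ≤ W.A d * B := by
  rw [W.proj_eq_integral_kernel _ hu]
  refine (CubeBdd.abs_integral_mul_le_integral_abs (W.cubeBdd_kernel j x) hu
    fun y hy _ => hB y hy).trans ?_
  exact mul_le_mul_of_nonneg_right (W.integral_abs_kernel_le j hx)
    ((abs_nonneg _).trans (hB x hx))

theorem CDVBasis.kernel_self_le (j : ℕ) {x : Fin d → ℝ} (hx : x ∈ cube d) :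
    W.kernel j x x ≤ (3 * W.R * W.B ^ 2) ^ d * 2 ^ (j * d) := by
  rw [CDVData.kernel_eq_prod]
  refine (prod_le_prod (fun i _ => sum_nonneg fun _ _ => mul_self_nonneg _)
    fun i _ => W.kap_self_le false j (mem_cube.1 hx i)).trans (le_of_eq ?_)
  simp [mul_pow, pow_mul]

theorem CDVBasis.le_kernel_self {j : ℕ} (hj : W.J₀ ≤ j) {x : Fin d → ℝ} (hx : x ∈ cube d) :
    2 ^ (j * d) / (4 * W.R) ^ d ≤ W.kernel j x x := by
  have hR := W.one_le_R
  rw [CDVData.kernel_eq_prod]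
  refine le_trans (le_of_eq ?_) (prod_le_prod (fun i _ => ?_)
    fun i _ => W.le_kap_self hj (mem_cube.1 hx i))
  · simp [div_pow, pow_mul]
  · positivity

theorem CDVBasis.integral_kernel_sq {j : ℕ} (hj : W.J₀ ≤ j) (x : Fin d → ℝ) :
    ∫ y in cube d, W.kernel j x y ^ 2 = W.kernel j x x := by
  have := (W.orthoFamily_Phi (d := d) hj).integral_sum_sq fun m => W.Phi j m x
  simp only [CDVData.kernel]
  rw [this]
  exact sum_congr rfl fun m _ => sq _

/-- The projections of a uniformly continuous function converge uniformly. -/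
theorem CDVBasis.eventually_abs_proj_sub_le {h : (Fin d → ℝ) → ℝ} (hh : CubeBdd h)
    (hu : UniformContinuousOn h (cube d)) {ε : ℝ} (hε : 0 < ε) :
    ∀ᶠ j in atTop, ∀ x ∈ cube d, |W.proj j h x - h x| ≤ ε := by
  have hA := W.A_pos d
  obtain ⟨δ, hδ, H⟩ := Metric.uniformContinuousOn_iff_le.1 hu (ε / W.A d) (by positivity)
  have h1 : Tendsto (fun j : ℕ => 2 * W.R / (2 : ℝ) ^ j) atTop (𝓝 0) :=
    tendsto_const_nhds.div_atTop (tendsto_pow_atTop_atTop_of_one_lt one_lt_two)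
  filter_upwards [h1.eventually_lt_const hδ, eventually_ge_atTop W.J₀] with j hj hj' x hx
  have h2 : W.proj j h x - h x = ∫ y in cube d, W.kernel j x y * (h y - h x) := by
    have h3 := W.proj_const hj' (h x) hx
    conv_lhs => rw [← h3]
    rw [CDVData.proj, CDVData.proj, ← projOn_sub (W.cubeBdd_Phi j) hh (CubeBdd.const (h x))]
    exact W.proj_eq_integral_kernel j (hh.sub (CubeBdd.const (h x))) x
  rw [h2]
  refine (CubeBdd.abs_integral_mul_le_integral_abs (W.cubeBdd_kernel j x)
    (hh.sub (CubeBdd.const (h x))) (B := ε / W.A d) fun y hy hne => ?_).trans ?_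
  · rw [← Real.dist_eq]
    refine H y hy x hx ((dist_pi_le_iff hδ.le).2 fun i => ?_)
    by_contra hc
    refine hne ?_
    rw [CDVData.kernel_eq_prod]
    refine Finset.prod_eq_zero (Finset.mem_univ i)
      (W.kap_eq_zero false j (mem_cube.1 hx i) (mem_cube.1 hy i) (hj.trans ?_))
    rw [not_le, dist_comm, Real.dist_eq] at hc
    exact hc
  · refine (mul_le_mul_of_nonneg_right (W.integral_abs_kernel_le j hx) (by positivity)).trans
      (le_of_eq ?_)
    field_simp

end Tensor

/-! ### Wavelet coefficients of functions that are smooth in one direction -/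

theorem measurePreserving_update_cube {d : ℕ} (i : Fin d) :
    MeasurePreserving (fun p : (Fin d → ℝ) × ℝ => Function.update p.1 i p.2)
      ((cubeMeasure d).prod (volume.restrict (Set.Icc (0 : ℝ) 1))) (cubeMeasure d) := by
  have hm : Measurable (fun p : (Fin d → ℝ) × ℝ => Function.update p.1 i p.2) := by
    refine measurable_pi_lambda _ fun k => ?_
    by_cases h : k = i
    · subst h; simpa using measurable_snd
    · simp only [Function.update_of_ne h]
      exact (measurable_pi_apply k).comp measurable_fst
  refine ⟨hm, ?_⟩
  rw [cubeMeasure_eq_pi]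
  symm
  refine Measure.pi_eq fun s hs => ?_
  rw [Measure.map_apply hm (MeasurableSet.univ_pi hs)]
  have h1 : (fun p : (Fin d → ℝ) × ℝ => Function.update p.1 i p.2) ⁻¹' Set.univ.pi s =
      (Set.univ.pi (Function.update s i Set.univ)) ×ˢ s i := by
    ext p
    simp only [Set.mem_preimage, Set.mem_pi, Set.mem_univ, true_implies, Set.mem_prod]
    constructor
    · intro h
      refine ⟨fun k => ?_, by simpa using h i⟩
      by_cases hk : k = i
      · subst hk; simp
      · simpa [Function.update_of_ne hk] using h k
    · rintro ⟨h, h'⟩ k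
      by_cases hk : k = i
      · subst hk; simpa using h'
      · simpa [Function.update_of_ne hk] using h k
  rw [h1, Measure.prod_prod, Measure.pi_pi, ← Finset.mul_prod_erase _ _ (Finset.mem_univ i),
    ← Finset.mul_prod_erase _ (fun k => (volume.restrict (Set.Icc (0 : ℝ) 1)) (s k))
      (Finset.mem_univ i)]
  simp only [Function.update_self, measure_univ, one_mul]
  rw [mul_comm]
  congr 1
  refine prod_congr rfl fun k hk => ?_
  rw [Function.update_of_ne (Finset.ne_of_mem_erase hk)]

/-- Integration over the cube, the `i`-th coordinate first. -/
theorem CubeBdd.integral_update {d : ℕ} {F : (Fin d → ℝ) → ℝ} (hF : CubeBdd F) (i : Fin d) :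
    Integrable (fun x => ∫ t in Set.Icc (0 : ℝ) 1, F (Function.update x i t)) (cubeMeasure d) ∧
    ∫ x in cube d, F x = ∫ x in cube d, ∫ t in Set.Icc (0 : ℝ) 1, F (Function.update x i t) := by
  have h := measurePreserving_update_cube i
  have h1 : Integrable (fun p : (Fin d → ℝ) × ℝ => F (Function.update p.1 i p.2))
      ((cubeMeasure d).prod (volume.restrict (Set.Icc (0 : ℝ) 1))) :=
    h.integrable_comp_of_integrable hF.integrable
  refine ⟨h1.integral_prod_left, ?_⟩
  have h2 : ∫ x, F x ∂(cubeMeasure d) = ∫ p, F (Function.update p.1 i p.2)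
      ∂((cubeMeasure d).prod (volume.restrict (Set.Icc (0 : ℝ) 1))) := by
    have h3 := integral_map h.measurable.aemeasurable (f := F)
      (by rw [h.map_eq]; exact hF.meas.aestronglyMeasurable)
    rwa [h.map_eq] at h3
  exact h2.trans (integral_prod _ h1)

section

variable {S : ℕ} (W : CDVBasis S)

theorem CDVBasis.inSpan_sub_pow {l : ℕ} (hl : W.J₀ ≤ l) (t₀ : ℝ) {k : ℕ} (hk : k < S) :
    W.InSpan l fun t => (t - t₀) ^ k := by
  have h := CDVData.InSpan.sum (κ := Fin (k + 1)) (g := fun r t => t ^ (r : ℕ))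
    (fun r => W.polynomial_mem l hl r (by omega)) (fun r => (-t₀) ^ (k - r) * (k.choose r))
  refine h.congr fun t _ => ?_
  rw [sub_eq_add_neg, add_pow, Finset.sum_range]
  exact sum_congr rfl fun r _ => by ring

/-- A wavelet annihilates the Taylor polynomial of a smooth function, so that its coefficient is
governed by the derivative of order `S`. -/
theorem CDVBasis.abs_integral_mul_wav_le {l : ℕ} (hl : W.J₀ ≤ l) (m : Fin (2 ^ l)) {E : ℝ → ℝ}
    (hE : ContDiff ℝ S E) {K lam : ℝ} (hK : 0 ≤ K) (hlam : 0 ≤ lam)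
    (hb : ∀ t, |iteratedDeriv S E t| ≤ K * lam ^ S) :
    |∫ t in Set.Icc (0 : ℝ) 1, E t * W.fn true l m t| ≤
      2 * W.R * W.B / √(2 ^ l) * (K * (2 * W.R * lam / 2 ^ l) ^ S) := by
  have hR := W.one_le_R
  have h2 : (0 : ℝ) < 2 ^ l := by positivity
  obtain ⟨n, hn⟩ : ∃ n, S = n + 1 := ⟨S - 1, by have := W.one_le_S; omega⟩
  -- the Taylor polynomial at the left end of the support is in the span of the scaling functions
  set t₀ : ℝ := max 0 ((m - W.R) / 2 ^ l)
  set P : ℝ → ℝ := fun t => taylorWithinEval E n (Set.Icc t₀ (t₀ + 1)) t₀ t with hP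
  have hPspan : W.InSpan l P := by
    have h := CDVData.InSpan.sum (κ := Fin (n + 1)) (g := fun r t => (t - t₀) ^ (r : ℕ))
      (fun r => W.inSpan_sub_pow hl t₀ (by omega : (r : ℕ) < S))
      (fun r => ((r : ℕ).factorial : ℝ)⁻¹ * iteratedDerivWithin r E (Set.Icc t₀ (t₀ + 1)) t₀)
    refine h.congr fun t _ => ?_
    rw [hP]
    simp only [taylor_within_apply, Finset.sum_range, smul_eq_mul]
    exact sum_congr rfl fun r _ => by ring
  have hPc : Continuous P := by
    rw [hP]
    simp only [taylor_within_apply]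
    fun_prop
  have hint : ∀ {g : ℝ → ℝ}, Continuous g → Integrable (fun t => g t * W.fn true l m t)
      (volume.restrict (Set.Icc (0 : ℝ) 1)) := by
    intro g hg
    obtain ⟨C, hC⟩ := (isCompact_Icc (a := (0 : ℝ)) (b := 1)).exists_bound_of_continuousOn
      hg.continuousOn
    refine CDVBasis.integrable_of_bound (hg.measurable.mul (W.measurable_fn true l m))
      (B := C * (W.B * √(2 ^ l))) fun t ht => ?_
    rw [abs_mul]
    exact mul_le_mul (hC t ht) (W.abs_fn_le true l m ht) (abs_nonneg _)
      ((norm_nonneg _).trans (hC t ht))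
  have h1 : ∫ t in Set.Icc (0 : ℝ) 1, E t * W.fn true l m t =
      ∫ t in Set.Icc (0 : ℝ) 1, (E t - P t) * W.fn true l m t := by
    simp_rw [sub_mul]
    rw [integral_sub (hint hE.continuous) (hint hPc), W.integral_mul_wav_eq_zero hl hPspan,
      sub_zero]
  have h3 : ∀ t ∈ Set.Icc (0 : ℝ) 1, |(E t - P t) * W.fn true l m t| ≤
      |W.fn true l m t| * (K * (2 * W.R * lam / 2 ^ l) ^ S) := by
    intro t ht
    by_cases hz : W.fn true l m t = 0
    · rw [hz]; simp
    have hloc : |2 ^ l * t - ((m : ℕ) : ℝ)| ≤ W.R := by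
      by_contra hc
      exact hz (W.fn_eq_zero true l m ht (not_le.1 hc))
    rw [abs_le] at hloc
    have ht1 : t₀ ≤ t := max_le ht.1 (by rw [div_le_iff₀ h2]; linarith)
    have ht2 : t - t₀ ≤ 2 * W.R / 2 ^ l := by
      have h4 : (m - W.R) / 2 ^ l ≤ t₀ := le_max_right _ _
      have h5 : t ≤ (m + W.R) / 2 ^ l := by rw [le_div_iff₀ h2]; linarith
      have h6 : (m + W.R) / 2 ^ l - (m - W.R) / 2 ^ l = 2 * W.R / 2 ^ l := by ring
      linarith
    have ht3 : t ≤ t₀ + 1 := by linarith [ht.2, le_max_left 0 ((m - W.R) / 2 ^ l)]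
    have h7 := taylor_mean_remainder_bound (f := E) (a := t₀) (b := t₀ + 1) (n := n)
      (C := K * lam ^ S) (x := t) (by linarith) (by
        have := hE.contDiffOn (s := Set.Icc t₀ (t₀ + 1))
        rw [hn] at this
        exact_mod_cast this) ⟨ht1, ht3⟩ (fun y hy => by
        rw [iteratedDerivWithin_eq_iteratedDeriv (uniqueDiffOn_Icc (by linarith)) _ hy, ← hn]
        · exact hb y
        · have := hE.contDiffAt (x := y)
          rw [hn] at this
          exact_mod_cast this)
    rw [Real.norm_eq_abs, ← hn] at h7
    have hf : (1 : ℝ) ≤ (n.factorial : ℝ) := by exact_mod_cast n.factorial_pos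
    have h8 : |E t - P t| ≤ K * (2 * W.R * lam / 2 ^ l) ^ S := by
      refine h7.trans ((div_le_self (by
        positivity) hf).trans ?_)
      rw [mul_assoc, ← mul_pow]
      refine mul_le_mul_of_nonneg_left (pow_le_pow_left₀ ?_ ?_ _) hK
      · have : 0 ≤ t - t₀ := by linarith
        positivity
      · calc lam * (t - t₀) ≤ lam * (2 * W.R / 2 ^ l) := mul_le_mul_of_nonneg_left ht2 hlam
          _ = _ := by ring
    rw [abs_mul, mul_comm]
    exact mul_le_mul_of_nonneg_left h8 (abs_nonneg _)
  rw [h1]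
  refine abs_integral_le_integral_abs.trans ((setIntegral_mono_on
    (hint (hE.continuous.sub hPc)).abs ((W.integrable_fn true l m).abs.mul_const _)
    measurableSet_Icc h3).trans ?_)
  rw [integral_mul_const]
  exact mul_le_mul_of_nonneg_right (W.integral_abs_fn_le true l m) (by positivity)

end

/-- `F` is, on the cube and in the direction `i`, `S` times continuously differentiable with
derivatives of order `r` of size at most `K * lam ^ r`. -/
def DirSmooth {d : ℕ} (S : ℕ) (i : Fin d) (K lam : ℝ) (F : (Fin d → ℝ) → ℝ) : Prop :=
  ∀ x ∈ cube d, ∃ E : ℝ → ℝ, ContDiff ℝ S E ∧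
    (∀ t ∈ Set.Icc (0 : ℝ) 1, F (Function.update x i t) = E t) ∧
    ∀ r ≤ S, ∀ t, |iteratedDeriv r E t| ≤ K * lam ^ r

theorem DirSmooth.mul {d S : ℕ} {i : Fin d} {K K' lam lam' : ℝ} {F F' : (Fin d → ℝ) → ℝ}
    (hF : DirSmooth S i K lam F) (hF' : DirSmooth S i K' lam' F')
    (hK : 0 ≤ K) (hlam : 0 ≤ lam) :
    DirSmooth S i (K * K') (lam + lam') fun x => F x * F' x := by
  intro x hx
  obtain ⟨E, hE, hE1, hE2⟩ := hF x hx
  obtain ⟨E', hE', hE1', hE2'⟩ := hF' x hx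
  refine ⟨fun t => E t * E' t, hE.mul hE', fun t ht => by simp only [hE1 t ht, hE1' t ht],
    fun r hr t => ?_⟩
  have h1 := norm_iteratedFDeriv_mul_le hE hE' t (n := r) (by exact_mod_cast hr)
  simp only [norm_iteratedFDeriv_eq_norm_iteratedDeriv, Real.norm_eq_abs] at h1
  refine h1.trans ?_
  rw [add_pow, mul_sum]
  refine sum_le_sum fun k hk => ?_
  have hk' : k ≤ r := by simpa [Nat.lt_succ_iff] using hk
  calc (r.choose k : ℝ) * |iteratedDeriv k E t| * |iteratedDeriv (r - k) E' t|
      ≤ (r.choose k : ℝ) * (K * lam ^ k) * (K' * lam' ^ (r - k)) := by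
        gcongr
        · exact hE2 k (hk'.trans hr) t
        · exact hE2' (r - k) ((Nat.sub_le _ _).trans hr) t
    _ = _ := by ring

section

variable {S d : ℕ} (W : CDVBasis S)

theorem CDVBasis.dirSmooth_sum_Psi (l : ℕ) (i : Fin d) (s : Finset (Fin d → Bool))
    (c : (Fin d → Bool) → (Fin d → Fin (2 ^ l)) → ℝ) {K : ℝ} (hK : 0 ≤ K)
    (hc : ∀ ι ∈ s, ∀ m, |c ι m| ≤ K) :
    DirSmooth S i (2 ^ d * K * (3 * W.R * W.B * √(2 ^ l)) ^ d) (2 ^ l)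
      fun x => ∑ ι ∈ s, ∑ m, c ι m * W.Psi l ι m x := by
  intro x hx
  have hR := W.one_le_R
  have hB := W.one_le_B
  refine ⟨fun t => ∑ ι ∈ s, ∑ m, (c ι m * ∏ k ∈ Finset.univ.erase i,
    W.fn (ι k) l (m k) (x k)) * W.ext (ι i) l (m i) t, ?_, fun t ht => ?_, fun r hr t => ?_⟩
  · exact ContDiff.sum fun ι _ => ContDiff.sum fun m _ =>
      contDiff_const.mul (W.ext_spec _ _ _).contDiff
  · refine sum_congr rfl fun ι _ => sum_congr rfl fun m _ => ?_
    rw [CDVData.Psi_eq, ← Finset.mul_prod_erase _ _ (Finset.mem_univ i), Function.update_self,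
      (W.ext_spec _ _ _).eq_on t ht, prod_congr rfl fun k hk => by
        rw [Function.update_of_ne (Finset.ne_of_mem_erase hk)]]
    ring
  · have hcd : ∀ (ι : Fin d → Bool) (m : Fin d → Fin (2 ^ l)),
        ContDiffAt ℝ r (W.ext (ι i) l (m i)) t := fun ι m =>
      ((W.ext_spec _ _ _).contDiff.of_le (by exact_mod_cast hr)).contDiffAt
    rw [iteratedDeriv_fun_sum fun ι _ => ContDiffAt.sum fun m _ => contDiffAt_const.mul (hcd ι m)]
    have h1 : ∀ ι ∈ s, |iteratedDeriv r (fun t => ∑ m, (c ι m * ∏ k ∈ Finset.univ.erase i,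
        W.fn (ι k) l (m k) (x k)) * W.ext (ι i) l (m i) t) t| ≤
        K * (3 * W.R * W.B * √(2 ^ l)) ^ d * (2 ^ l) ^ r := by
      intro ι hι
      rw [iteratedDeriv_fun_sum fun m _ => contDiffAt_const.mul (hcd ι m)]
      simp_rw [iteratedDeriv_const_mul_field]
      let a : Fin d → Fin (2 ^ l) → ℝ := fun k m' =>
        if k = i then |iteratedDeriv r (W.ext (ι i) l m') t|
        else |W.fn (ι k) l m' (x k)|
      have h2 : ∀ m : Fin d → Fin (2 ^ l), |c ι m * (∏ k ∈ Finset.univ.erase i,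
          W.fn (ι k) l (m k) (x k)) * iteratedDeriv r (W.ext (ι i) l (m i)) t| ≤
          K * ∏ k, a k (m k) := by
        intro m
        rw [← Finset.mul_prod_erase _ _ (Finset.mem_univ i), abs_mul, abs_mul, abs_prod]
        have h3 : ∏ k ∈ Finset.univ.erase i, a k (m k) =
            ∏ k ∈ Finset.univ.erase i, |W.fn (ι k) l (m k) (x k)| :=
          prod_congr rfl fun k hk => by simp [a, Finset.ne_of_mem_erase hk]
        have h4 : a i (m i) = |iteratedDeriv r (W.ext (ι i) l (m i)) t| := by simp [a]
        rw [h3, h4, mul_assoc, mul_comm (∏ k ∈ Finset.univ.erase i, _)]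
        exact mul_le_mul_of_nonneg_right (hc ι hι m)
          (mul_nonneg (abs_nonneg _) (Finset.prod_nonneg fun _ _ => abs_nonneg _))
      refine (abs_sum_le_sum_abs _ _).trans ((sum_le_sum fun m _ => h2 m).trans ?_)
      rw [← mul_sum, ← Fintype.prod_sum, mul_assoc]
      refine mul_le_mul_of_nonneg_left ?_ hK
      have h5 : ∀ k, ∑ m', a k m' ≤
          3 * W.R * W.B * √(2 ^ l) * (if k = i then (2 ^ l) ^ r else 1) := by
        intro k
        by_cases hk : k = i
        · simp only [a, hk, if_true]
          exact W.sum_abs_iteratedDeriv_ext_le _ _ hr t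
        · simp only [a, hk, if_false, mul_one]
          exact W.sum_abs_fn_le _ _ (mem_cube.1 hx k)
      refine (prod_le_prod (fun k _ => sum_nonneg fun m' _ => ?_)
        fun k _ => h5 k).trans (le_of_eq ?_)
      · by_cases hk : k = i <;> simp [a, hk]
      · rw [prod_mul_distrib]
        simp
    refine (abs_sum_le_sum_abs _ _).trans ((sum_le_sum h1).trans ?_)
    rw [sum_const, nsmul_eq_mul]
    have h6 : (s.card : ℝ) ≤ 2 ^ d := by
      have := Finset.card_le_univ s
      simp only [Fintype.card_pi, Fintype.card_bool, prod_const, Finset.card_univ,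
        Fintype.card_fin] at this
      exact_mod_cast this
    calc (s.card : ℝ) * (K * (3 * W.R * W.B * √(2 ^ l)) ^ d * (2 ^ l) ^ r)
        ≤ 2 ^ d * (K * (3 * W.R * W.B * √(2 ^ l)) ^ d * (2 ^ l) ^ r) := by gcongr
      _ = _ := by ring

/-- Wavelet coefficients of functions that are smooth in a direction in which the wavelet
oscillates. -/
theorem CDVBasis.abs_integral_mul_Psi_le {l : ℕ} (hl : W.J₀ ≤ l) {ι : Fin d → Bool} {i : Fin d}
    (hi : ι i = true) (m : Fin d → Fin (2 ^ l)) {F : (Fin d → ℝ) → ℝ} (hFb : CubeBdd F)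
    {K lam : ℝ} (hK : 0 ≤ K) (hlam : 0 ≤ lam) (hF : DirSmooth S i K lam F) :
    |∫ x in cube d, F x * W.Psi l ι m x| ≤
      (2 * W.R * W.B / √(2 ^ l)) ^ d * (K * (2 * W.R * lam / 2 ^ l) ^ S) := by
  have hR := W.one_le_R
  have hB := W.one_le_B
  set δ : ℝ := K * (2 * W.R * lam / 2 ^ l) ^ S
  have hδ0 : 0 ≤ δ := by positivity
  set g : Fin d → ℝ → ℝ := fun k t =>
    if k = i then 2 * W.R * W.B / √(2 ^ l) else |W.fn (ι k) l (m k) t| with hg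
  obtain ⟨hint, heq⟩ := (hFb.mul (W.cubeBdd_Psi l ι m)).integral_update i
  have h1 : ∀ x ∈ cube d, |∫ t in Set.Icc (0 : ℝ) 1, F (Function.update x i t) *
      W.Psi l ι m (Function.update x i t)| ≤ (∏ k, g k (x k)) * δ := by
    intro x hx
    obtain ⟨E, hE, hE1, hE2⟩ := hF x hx
    have h2 : ∫ t in Set.Icc (0 : ℝ) 1, F (Function.update x i t) *
        W.Psi l ι m (Function.update x i t) =
        (∏ k ∈ Finset.univ.erase i, W.fn (ι k) l (m k) (x k)) *
          ∫ t in Set.Icc (0 : ℝ) 1, E t * W.fn true l (m i) t := by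
      rw [← integral_const_mul]
      refine setIntegral_congr_fun measurableSet_Icc fun t ht => ?_
      rw [hE1 t ht, CDVData.Psi_eq, ← Finset.mul_prod_erase _ _ (Finset.mem_univ i),
        Function.update_self, hi, prod_congr rfl fun k hk => by
        rw [Function.update_of_ne (Finset.ne_of_mem_erase hk)]]
      ring
    have h3 : ∏ k, g k (x k) = (2 * W.R * W.B / √(2 ^ l)) *
        ∏ k ∈ Finset.univ.erase i, |W.fn (ι k) l (m k) (x k)| := by
      rw [← Finset.mul_prod_erase _ _ (Finset.mem_univ i)]
      congr 1
      · simp [hg]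
      · exact prod_congr rfl fun k hk => by simp [hg, Finset.ne_of_mem_erase hk]
    rw [h2, h3, abs_mul, abs_prod, mul_comm]
    have h4 := W.abs_integral_mul_wav_le hl (m i) hE hK hlam (hE2 S le_rfl)
    calc _ ≤ (2 * W.R * W.B / √(2 ^ l) * δ) *
          ∏ k ∈ Finset.univ.erase i, |W.fn (ι k) l (m k) (x k)| :=
        mul_le_mul_of_nonneg_right h4 (Finset.prod_nonneg fun _ _ => abs_nonneg _)
      _ = _ := by ring
  have hgb : CubeBdd fun x : Fin d → ℝ => ∏ k, g k (x k) := by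
    refine ⟨Finset.measurable_fun_prod _ fun k _ => ?_,
      ∏ k : Fin d, max (2 * W.R * W.B / √(2 ^ l)) (W.B * √(2 ^ l)), fun x hx => ?_⟩
    · by_cases hk : k = i
      · simp only [hg, hk, if_true]; exact measurable_const
      · simp only [hg, hk, if_false]
        exact ((W.measurable_fn _ _ _).comp (measurable_pi_apply k)).abs
    · rw [abs_prod]
      refine prod_le_prod (fun _ _ => abs_nonneg _) fun k _ => ?_
      by_cases hk : k = i
      · simp only [hg, hk, if_true]
        rw [abs_of_nonneg (by positivity)]
        exact le_max_left _ _
      · simp only [hg, hk, if_false]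
        rw [abs_abs]
        exact (W.abs_fn_le _ _ _ (mem_cube.1 hx k)).trans (le_max_right _ _)
  rw [heq]
  refine abs_integral_le_integral_abs.trans ((setIntegral_mono_on hint.abs
    (hgb.integrable.mul_const δ) (measurableSet_cube d) h1).trans ?_)
  rw [integral_mul_const, integral_cube_prod g]
  refine mul_le_mul_of_nonneg_right ?_ hδ0
  refine (prod_le_prod (g := fun _ => 2 * W.R * W.B / √(2 ^ l)) (fun k _ => ?_)
    fun k _ => ?_).trans (le_of_eq (by simp [div_pow]))
  · refine integral_nonneg fun t => ?_
    by_cases hk : k = i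
    · simp only [hg, hk, if_true]; change 0 ≤ _; positivity
    · simp only [hg, hk, if_false]; exact abs_nonneg _
  · by_cases hk : k = i
    · simp [hg, hk]
    · simp only [hg, hk, if_false]; exact W.integral_abs_fn_le _ _ _

end

/-! ### Hölder balls -/

/-- The dyadic weight `2 ^ (-l a)`. -/
def dw (l : ℕ) (a : ℝ) : ℝ := 2 ^ (-((l : ℝ) * a))

theorem dw_pos (l : ℕ) (a : ℝ) : 0 < dw l a := Real.rpow_pos_of_pos two_pos _

theorem dw_add (l : ℕ) (a b : ℝ) : dw l (a + b) = dw l a * dw l b := by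
  rw [dw, dw, dw, ← Real.rpow_add two_pos]; congr 1; ring

theorem dw_le_one (l : ℕ) {a : ℝ} (ha : 0 ≤ a) : dw l a ≤ 1 :=
  Real.rpow_le_one_of_one_le_of_nonpos one_le_two (by simpa using by positivity)

theorem dw_anti_right (l : ℕ) {a b : ℝ} (h : a ≤ b) : dw l b ≤ dw l a :=
  Real.rpow_le_rpow_of_exponent_le one_le_two
    (neg_le_neg (mul_le_mul_of_nonneg_left h (Nat.cast_nonneg l)))

theorem dw_anti_left {l l' : ℕ} (h : l ≤ l') {a : ℝ} (ha : 0 ≤ a) : dw l' a ≤ dw l a :=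
  Real.rpow_le_rpow_of_exponent_le one_le_two
    (neg_le_neg (mul_le_mul_of_nonneg_right (by exact_mod_cast h) ha))

theorem dw_succ (l : ℕ) (a : ℝ) : dw (l + 1) a = dw l a * 2 ^ (-a) := by
  rw [dw, dw, ← Real.rpow_add two_pos]; congr 1; push_cast; ring

theorem dw_neg_nat (l S : ℕ) : dw l (-(S : ℝ)) = ((2 : ℝ) ^ l) ^ S := by
  rw [dw, mul_neg, neg_neg, Real.rpow_mul two_pos.le, Real.rpow_natCast, Real.rpow_natCast]

theorem dw_nat (l S : ℕ) : dw l (S : ℝ) = (((2 : ℝ) ^ l) ^ S)⁻¹ := by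
  rw [← dw_neg_nat, dw, dw, mul_neg, neg_neg, Real.rpow_neg two_pos.le]

/-- The factor `1 / (1 - 2 ^ (-a))` of a geometric series. -/
def geo (a : ℝ) : ℝ := (1 - 2 ^ (-a))⁻¹

theorem geo_pos {a : ℝ} (ha : 0 < a) : 0 < geo a := by
  have : (2 : ℝ) ^ (-a) < 1 := Real.rpow_lt_one_of_one_lt_of_neg one_lt_two (by linarith)
  exact inv_pos.2 (by linarith)

theorem dw_eq_geo_mul (l : ℕ) {a : ℝ} (ha : 0 < a) :
    dw l a = geo a * (dw l a - dw (l + 1) a) := by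
  have : (2 : ℝ) ^ (-a) < 1 := Real.rpow_lt_one_of_one_lt_of_neg one_lt_two (by linarith)
  have h : (1 : ℝ) - 2 ^ (-a) ≠ 0 := by linarith
  rw [dw_succ, geo]
  field_simp

/-- A sequence with increments of size `2 ^ (-l a)` that converges to `z` up to `ε`. -/
theorem abs_sub_le_of_dyadic_increments {v : ℕ → ℝ} {z K a : ℝ} {j : ℕ} (ha : 0 < a)
    (hK : 0 ≤ K) (hv : ∀ l, j ≤ l → |v (l + 1) - v l| ≤ K * dw l a)
    (hz : ∀ ε > 0, ∀ᶠ l in atTop, |v l - z| ≤ ε) : |z - v j| ≤ K * geo a * dw j a := by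
  have h1 : ∀ L, j ≤ L → |v L - v j| ≤ K * geo a * (dw j a - dw L a) := by
    intro L hL
    induction L, hL using Nat.le_induction with
    | base => simp
    | succ L hL ih =>
      have h2 := abs_add_le (v (L + 1) - v L) (v L - v j)
      rw [sub_add_sub_cancel] at h2
      have h3 := hv L hL
      rw [dw_eq_geo_mul L ha] at h3
      nlinarith
  refine le_of_forall_pos_le_add fun ε hε => ?_
  obtain ⟨L, hL1, hL2⟩ := ((hz ε hε).and (eventually_ge_atTop j)).exists
  have h4 := abs_sub (v L - v j) (v L - z)
  rw [sub_sub_sub_cancel_left] at h4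
  have h5 := h1 L hL2
  have h6 : 0 ≤ K * geo a * dw L a := by
    have := geo_pos ha; have := dw_pos L a; positivity
  nlinarith

theorem sqrt_pow_mul_self (l d : ℕ) : √(2 ^ l : ℝ) ^ d * √(2 ^ l) ^ d = 2 ^ (l * d) := by
  rw [← mul_pow, Real.mul_self_sqrt (by positivity), ← pow_mul]

theorem sqrt_two_pow_pos (l : ℕ) : 0 < √(2 ^ l : ℝ) := Real.sqrt_pos.2 (by positivity)

theorem holder_weight (l d : ℕ) (a : ℝ) :
    (2 : ℝ) ^ ((l : ℝ) * (a + d / 2)) = √(2 ^ l) ^ d / dw l a := by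
  rw [eq_div_iff (dw_pos l a).ne', dw, ← Real.rpow_add two_pos, Real.sqrt_eq_rpow,
    ← Real.rpow_natCast 2 l, ← Real.rpow_mul two_pos.le, ← Real.rpow_natCast _ d,
    ← Real.rpow_mul two_pos.le]
  congr 1
  ring

section

variable {S d : ℕ} (W : CDVBasis S)

/-- A bound for the number of overlapping wavelets, up to scaling. -/
def CDVBasis.D (W : CDVBasis S) (d : ℕ) : ℝ := (6 * W.R * W.B) ^ d

theorem CDVBasis.D_pos (d : ℕ) : 0 < W.D d := by
  have hR := W.one_le_R
  have hB := W.one_le_B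
  unfold CDVBasis.D; positivity

/-- The Hölder condition in terms of wavelet coefficients. -/
structure CDVBasis.HolderCoef (W : CDVBasis S) (a M : ℝ) (h : (Fin d → ℝ) → ℝ) : Prop where
  phi : ∀ m, |∫ x in cube d, h x * W.Phi W.J₀ m x| ≤ M * dw W.J₀ a / √(2 ^ W.J₀) ^ d
  psi : ∀ l, W.J₀ ≤ l → ∀ ι ≠ (fun _ => false), ∀ m,
    |∫ x in cube d, h x * W.Psi l ι m x| ≤ M * dw l a / √(2 ^ l) ^ d

theorem holder_weight_mul_le_iff (l : ℕ) (a c M : ℝ) :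
    2 ^ ((l : ℝ) * (a + d / 2)) * |c| ≤ M ↔ |c| ≤ M * dw l a / √(2 ^ l) ^ d := by
  have h1 := dw_pos l a
  have h2 := pow_pos (sqrt_two_pow_pos l) d
  rw [holder_weight, le_div_iff₀ h2, div_mul_eq_mul_div, div_le_iff₀ h1, mul_comm |c|]

theorem CDVBasis.holderCoef_of_holderNorm_le {a M : ℝ} (hM : 0 ≤ M) {h : (Fin d → ℝ) → ℝ}
    (hh : W.holderNorm a h ≤ ofReal M) : W.HolderCoef a M h where
  phi m := by
    rw [← holder_weight_mul_le_iff, ← ENNReal.ofReal_le_ofReal_iff hM]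
    exact (le_iSup (fun m => ofReal (2 ^ ((W.J₀ : ℝ) * (a + d / 2)) *
      |∫ x in cube d, h x * W.Phi W.J₀ m x|)) m).trans (le_self_add.trans hh)
  psi l hl ι hι m := by
    rw [← holder_weight_mul_le_iff, ← ENNReal.ofReal_le_ofReal_iff hM]
    refine le_trans ?_ (le_add_self.trans hh)
    exact le_iSup_of_le l (le_iSup_of_le hl (le_iSup_of_le ι (le_iSup_of_le hι
      (le_iSup_of_le m le_rfl))))

theorem card_le_two_pow (s : Finset (Fin d → Bool)) : (s.card : ℝ) ≤ 2 ^ d := by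
  have := Finset.card_le_univ s
  simp only [Fintype.card_pi, Fintype.card_bool, prod_const, Finset.card_univ,
    Fintype.card_fin] at this
  exact_mod_cast this

theorem CDVBasis.abs_sum_Psi_le {l : ℕ} {s : Finset (Fin d → Bool)}
    {c : (Fin d → Bool) → (Fin d → Fin (2 ^ l)) → ℝ} {K : ℝ} (hK : 0 ≤ K)
    (hc : ∀ ι ∈ s, ∀ m, |c ι m| ≤ K) {x : Fin d → ℝ} (hx : x ∈ cube d) :
    |∑ ι ∈ s, ∑ m, c ι m * W.Psi l ι m x| ≤ 2 ^ d * K * (3 * W.R * W.B * √(2 ^ l)) ^ d := by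
  have hR := W.one_le_R
  have hB := W.one_le_B
  have h1 : ∀ ι ∈ s, |∑ m, c ι m * W.Psi l ι m x| ≤ K * (3 * W.R * W.B * √(2 ^ l)) ^ d := by
    intro ι hι
    calc |∑ m, c ι m * W.Psi l ι m x|
        ≤ ∑ m, |c ι m * W.Psi l ι m x| := abs_sum_le_sum_abs _ _
      _ ≤ ∑ m, K * |W.Psi l ι m x| := sum_le_sum fun m _ => by
          rw [abs_mul]; exact mul_le_mul_of_nonneg_right (hc ι hι m) (abs_nonneg _)
      _ = K * ∑ m, |W.Psi l ι m x| := by rw [mul_sum]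
      _ ≤ _ := mul_le_mul_of_nonneg_left (W.sum_abs_Psi_le l ι hx) hK
  refine (abs_sum_le_sum_abs _ _).trans ((sum_le_sum h1).trans ?_)
  rw [sum_const, nsmul_eq_mul, mul_assoc (2 ^ d) K]
  exact mul_le_mul_of_nonneg_right (card_le_two_pow s) (by positivity)

theorem CDVBasis.scale_eq (l : ℕ) (K : ℝ) :
    2 ^ d * (K / √(2 ^ l) ^ d) * (3 * W.R * W.B * √(2 ^ l)) ^ d = K * W.D d := by
  have h3 : (6 : ℝ) ^ d = 2 ^ d * 3 ^ d := by rw [← mul_pow]; norm_num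
  rw [CDVBasis.D]
  simp only [mul_pow, h3]
  field_simp

theorem CDVBasis.abs_detail_le {a M : ℝ} (hM : 0 ≤ M) {h : (Fin d → ℝ) → ℝ}
    (hh : W.HolderCoef a M h) {l : ℕ} (hl : W.J₀ ≤ l) {x : Fin d → ℝ} (hx : x ∈ cube d) :
    |W.detail l h x| ≤ M * dw l a * W.D d := by
  have h0 := dw_pos l a
  rw [← W.scale_eq l]
  exact W.abs_sum_Psi_le (by positivity) (fun ι hι m => hh.psi l hl ι (by simpa using hι) m) hx

theorem CDVBasis.abs_proj_J₀_le {a M : ℝ} (hM : 0 ≤ M) {h : (Fin d → ℝ) → ℝ}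
    (hh : W.HolderCoef a M h) {x : Fin d → ℝ} (hx : x ∈ cube d) :
    |W.proj W.J₀ h x| ≤ M * dw W.J₀ a * W.D d := by
  have h0 := dw_pos W.J₀ a
  rw [← W.scale_eq W.J₀]
  have := W.abs_sum_Psi_le (l := W.J₀) (s := {fun _ => false})
    (c := fun ι m => ∫ y in cube d, h y * W.Psi W.J₀ ι m y)
    (K := M * dw W.J₀ a / √(2 ^ W.J₀) ^ d) (by positivity) (fun ι hι m => by
      rw [Finset.mem_singleton] at hι
      subst hι
      rw [← CDVData.Phi_eq]; exact hh.phi m) hx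
  rw [Finset.sum_singleton] at this
  simp only [← CDVData.Phi_eq] at this
  exact this

/-- Continuous functions in a Hölder ball, in a form that is convenient for estimates. -/
structure CDVBasis.HolderFn (W : CDVBasis S) (a M : ℝ) (h : (Fin d → ℝ) → ℝ) : Prop where
  bdd : CubeBdd h
  unif : UniformContinuousOn h (cube d)
  coef : W.HolderCoef a M h

theorem CDVBasis.HolderFn.abs_sub_proj_le {W : CDVBasis S} {a M : ℝ} (ha : 0 < a) (hM : 0 ≤ M)
    {h : (Fin d → ℝ) → ℝ} (hh : W.HolderFn a M h) {j : ℕ} (hj : W.J₀ ≤ j) {x : Fin d → ℝ}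
    (hx : x ∈ cube d) : |h x - W.proj j h x| ≤ M * W.D d * geo a * dw j a := by
  have hD := W.D_pos d
  refine abs_sub_le_of_dyadic_increments (v := fun l => W.proj l h x) ha (by positivity)
    (fun l hl => ?_) fun ε hε => ?_
  · rw [W.proj_succ (hj.trans hl) hh.bdd hx, add_sub_cancel_left]
    exact (W.abs_detail_le hM hh.coef (hj.trans hl) hx).trans (le_of_eq (by ring))
  · exact (W.eventually_abs_proj_sub_le hh.bdd hh.unif hε).mono fun l hl => hl x hx

theorem CDVBasis.HolderFn.abs_le {W : CDVBasis S} {a M : ℝ} (ha : 0 < a) (hM : 0 ≤ M)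
    {h : (Fin d → ℝ) → ℝ} (hh : W.HolderFn a M h) {x : Fin d → ℝ}
    (hx : x ∈ cube d) : |h x| ≤ M * W.D d * (1 + geo a) := by
  have hD := W.D_pos d
  have hg := geo_pos ha
  have h1 := hh.abs_sub_proj_le ha hM le_rfl hx
  have h2 := W.abs_proj_J₀_le hM hh.coef hx
  have h3 := dw_le_one W.J₀ ha.le
  have h4 := abs_add_le (h x - W.proj W.J₀ h x) (W.proj W.J₀ h x)
  rw [sub_add_cancel] at h4
  have h5 : M * W.D d * geo a * dw W.J₀ a ≤ M * W.D d * geo a :=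
    mul_le_of_le_one_right (by positivity) h3
  have h6 : M * dw W.J₀ a * W.D d ≤ M * W.D d := by
    rw [mul_right_comm]; exact mul_le_of_le_one_right (by positivity) h3
  linarith

/-- The part of `h` of scale `2 ^ (-l)`; the scaling functions are added to the coarsest level. -/
def CDVBasis.block (W : CDVBasis S) (l : ℕ) (h : (Fin d → ℝ) → ℝ) (x : Fin d → ℝ) : ℝ :=
  ∑ ι ∈ if l = W.J₀ then Finset.univ else Finset.univ.filter (fun ι => ι ≠ fun _ => false), ∑ m,
    (∫ y in cube d, h y * W.Psi l ι m y) * W.Psi l ι m x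

theorem CDVBasis.cubeBdd_block (l : ℕ) (h : (Fin d → ℝ) → ℝ) : CubeBdd (W.block l h) :=
  CubeBdd.sum fun ι _ => CubeBdd.sum fun m _ => (W.cubeBdd_Psi l ι m).const_mul _

theorem CDVBasis.proj_succ_eq_sum_block {h : (Fin d → ℝ) → ℝ} (hh : CubeBdd h) {L : ℕ}
    (hL : W.J₀ ≤ L) {x : Fin d → ℝ} (hx : x ∈ cube d) :
    W.proj (L + 1) h x = ∑ l ∈ Finset.Icc W.J₀ L, W.block l h x := by
  induction L, hL using Nat.le_induction with
  | base =>
    rw [Finset.Icc_self, Finset.sum_singleton, W.proj_succ le_rfl hh hx, CDVBasis.block,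
      if_pos rfl, ← Finset.sum_filter_not_add_sum_filter _ fun ι : Fin d → Bool =>
      ι ≠ fun _ => false, CDVData.detail]
    congr 1
    have h3 : (Finset.univ.filter fun ι : Fin d → Bool => ¬ (ι ≠ fun _ => false)) =
        {fun _ => false} := by ext ι; simp
    rw [h3, Finset.sum_singleton, CDVData.proj, projOn]
    simp_rw [CDVData.Phi_eq]
  | succ L hL ih =>
    rw [Finset.sum_Icc_succ_top (by omega), ← ih,
      W.proj_succ (by omega) hh hx, CDVBasis.block, if_neg (by omega), CDVData.detail]

/-- Bernstein inequality for the blocks of a Hölder function. -/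
theorem CDVBasis.HolderFn.dirSmooth_block {W : CDVBasis S} {a M : ℝ} (hM : 0 ≤ M)
    {h : (Fin d → ℝ) → ℝ} (hh : W.HolderFn a M h) {l : ℕ} (hl : W.J₀ ≤ l) (i : Fin d) :
    DirSmooth S i (M * dw l a * W.D d) (2 ^ l) (W.block l h) := by
  have h0 := dw_pos l a
  have h2 := pow_pos (sqrt_two_pow_pos l) d
  rw [← W.scale_eq l]
  refine W.dirSmooth_sum_Psi l i _ _ (by positivity) fun ι hι m => ?_
  by_cases hι0 : ι = fun _ => false
  · have hl' : l = W.J₀ := by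
      by_contra hne
      rw [if_neg hne] at hι
      simp [hι0] at hι
    subst hl' hι0
    rw [← CDVData.Phi_eq]
    exact hh.coef.phi m
  · exact hh.coef.psi l hl ι hι0 m

end

theorem sum_dw_neg_le {b : ℝ} (hb : 0 < b) (j l : ℕ) :
    ∑ k ∈ Finset.Icc j l, dw k (-b) ≤ geo b * dw l (-b) := by
  have hg := geo_pos hb
  have hlt : (2 : ℝ) ^ (-b) < 1 := Real.rpow_lt_one_of_one_lt_of_neg one_lt_two (by linarith)
  have key : ∀ l, j ≤ l → ∑ k ∈ Finset.Icc j l, dw k (-b) ≤ geo b * dw l (-b) := by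
    have hg1 : 1 ≤ geo b := by
      rw [geo]
      exact (one_le_inv₀ (by linarith)).2 (by linarith [Real.rpow_pos_of_pos two_pos (-b)])
    intro l hl
    induction l, hl using Nat.le_induction with
    | base => rw [Finset.Icc_self, Finset.sum_singleton]; nlinarith [dw_pos j (-b)]
    | succ l hl ih =>
      rw [Finset.sum_Icc_succ_top (by omega)]
      have h1 : dw l (-b) = dw (l + 1) (-b) * 2 ^ (-b) := by
        rw [dw_succ, mul_assoc, ← Real.rpow_add two_pos]; simp
      have h2 : geo b * 2 ^ (-b) + 1 = geo b := by
        have : (1 : ℝ) - 2 ^ (-b) ≠ 0 := by linarith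
        rw [geo]; field_simp; ring
      rw [h1] at ih
      calc _ ≤ dw (l + 1) (-b) + geo b * (dw (l + 1) (-b) * 2 ^ (-b)) := by linarith
        _ = dw (l + 1) (-b) * (geo b * 2 ^ (-b) + 1) := by ring
        _ = _ := by rw [h2, mul_comm]
  rcases le_or_gt j l with h | h
  · exact key l h
  · rw [Finset.Icc_eq_empty (by omega), Finset.sum_empty]
    have := dw_pos l (-b)
    positivity

theorem sum_dw_le {a : ℝ} (ha : 0 < a) (j l : ℕ) :
    ∑ k ∈ Finset.Icc j l, dw k a ≤ geo a := by
  have hg := geo_pos ha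
  rcases le_or_gt j l with h | h
  · have key : ∀ l, j ≤ l → ∑ k ∈ Finset.Icc j l, dw k a = geo a * (dw j a - dw (l + 1) a) := by
      intro l hl
      induction l, hl using Nat.le_induction with
      | base => rw [Finset.Icc_self, Finset.sum_singleton]; exact dw_eq_geo_mul j ha
      | succ l hl ih =>
        have h1 := dw_eq_geo_mul (l + 1) ha
        rw [Finset.sum_Icc_succ_top (by omega), ih]
        linarith
    rw [key l h]
    nlinarith [dw_le_one j ha.le, dw_pos (l + 1) a]
  · rw [Finset.Icc_eq_empty (by omega), Finset.sum_empty]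
    exact hg.le

/-! ### Products of Hölder functions and the approximation bias -/

theorem CubeBdd.abs_integral_mul_le_mul {d : ℕ} {u e : (Fin d → ℝ) → ℝ} (hu : CubeBdd u)
    (he : CubeBdd e) {K K' : ℝ} (hK : ∀ x ∈ cube d, |u x| ≤ K) (hK0 : 0 ≤ K)
    (he' : ∫ x in cube d, |e x| ≤ K') :
    |∫ x in cube d, u x * e x| ≤ K * K' := by
  rw [integral_cube_congr (h := fun x => e x * u x) fun x _ => mul_comm _ _, mul_comm]
  exact (CubeBdd.abs_integral_mul_le_integral_abs he hu fun y hy _ => hK y hy).trans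
    (mul_le_mul_of_nonneg_right he' hK0)

section

variable {S d : ℕ} (W : CDVBasis S)

/-- A product of blocks varies on the scale `2 ^ (-max l₁ l₂)` and has `S` derivatives, so that its
wavelet coefficients of level `l` gain `2 ^ ((max l₁ l₂ - l) S)`. -/
theorem CDVBasis.abs_integral_block_mul_block_le {a γ M : ℝ} (hM : 0 ≤ M)
    {g f : (Fin d → ℝ) → ℝ} (hg : W.HolderFn a M g) (hf : W.HolderFn γ M f) {l l₁ l₂ : ℕ}
    (hl : W.J₀ ≤ l) (h₁ : W.J₀ ≤ l₁) (h₂ : W.J₀ ≤ l₂) {ι : Fin d → Bool}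
    (hι : ι ≠ fun _ => false) (m : Fin d → Fin (2 ^ l)) :
    |∫ x in cube d, W.block l₁ g x * W.block l₂ f x * W.Psi l ι m x| ≤
      (2 * W.R * W.B / √(2 ^ l)) ^ d * ((M * W.D d) ^ 2 * (4 * W.R) ^ S *
        ((dw l₁ (-(S - a)) * dw l₂ γ + dw l₁ a * dw l₂ (-(S - γ))) * dw l S)) := by
  have hR := W.one_le_R
  have hB := W.one_le_B
  have hD := W.D_pos d
  have p1 := dw_pos l₁ a
  have p2 := dw_pos l₂ γ
  obtain ⟨i, hi⟩ : ∃ i, ι i = true := by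
    by_contra hc
    push Not at hc
    exact hι (funext fun i => by simpa using hc i)
  have h := W.abs_integral_mul_Psi_le hl hi m ((W.cubeBdd_block l₁ g).mul (W.cubeBdd_block l₂ f))
    (K := M * dw l₁ a * W.D d * (M * dw l₂ γ * W.D d)) (lam := 2 ^ l₁ + 2 ^ l₂)
    (by positivity) (by positivity)
    ((hg.dirSmooth_block hM h₁ i).mul (hf.dirSmooth_block hM h₂ i) (by positivity) (by positivity))
  refine h.trans (mul_le_mul_of_nonneg_left ?_ (by positivity))
  have e1 : dw l₁ (-(S - a)) = dw l₁ a * (2 ^ l₁) ^ S := by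
    rw [← dw_neg_nat, ← dw_add]; congr 1; ring
  have e2 : dw l₂ (-(S - γ)) = dw l₂ γ * (2 ^ l₂) ^ S := by
    rw [← dw_neg_nat, ← dw_add]; congr 1; ring
  have h3 : ((2 : ℝ) ^ l₁ + 2 ^ l₂) ^ S ≤ 2 ^ S * ((2 ^ l₁) ^ S + (2 ^ l₂) ^ S) :=
    (add_pow_le (by positivity) (by positivity) S).trans
      (mul_le_mul_of_nonneg_right (pow_le_pow_right₀ one_le_two (Nat.sub_le S 1)) (by positivity))
  have h4 : (2 * W.R * (2 ^ l₁ + 2 ^ l₂) / 2 ^ l) ^ S =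
      (2 * W.R) ^ S * (2 ^ l₁ + 2 ^ l₂) ^ S * dw l S := by
    rw [dw_nat, div_pow, mul_pow, div_eq_mul_inv]
  have h5 : (4 * W.R) ^ S = (2 * W.R) ^ S * 2 ^ S := by rw [← mul_pow]; ring
  rw [h4, e1, e2, h5]
  have p3 := dw_pos l S
  calc _ ≤ M * dw l₁ a * W.D d * (M * dw l₂ γ * W.D d) *
        ((2 * W.R) ^ S * (2 ^ S * ((2 ^ l₁) ^ S + (2 ^ l₂) ^ S)) * dw l S) := by gcongr
    _ = _ := by ring

/-- Wavelet coefficients of the product of two Hölder functions decay at the rate that belongs to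
the rougher factor. -/
theorem CDVBasis.exists_abs_integral_mul_mul_Psi_le {a γ M : ℝ} (ha : 0 < a) (haγ : a ≤ γ)
    (hγS : γ < S) (hM : 0 ≤ M) :
    ∃ C, 0 ≤ C ∧ ∀ g f : (Fin d → ℝ) → ℝ, W.HolderFn a M g → W.HolderFn γ M f →
      ∀ l, W.J₀ ≤ l → ∀ ι ≠ (fun _ => false), ∀ m,
        |∫ x in cube d, g x * f x * W.Psi l ι m x| ≤ C * dw l a / √(2 ^ l) ^ d := by
  have hR := W.one_le_R
  have hB := W.one_le_B
  have hD := W.D_pos d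
  have hA := W.A_pos d
  have hγ : 0 < γ := ha.trans_le haγ
  have g1 := geo_pos ha
  have g2 := geo_pos hγ
  have g3 := geo_pos (sub_pos.2 (haγ.trans_lt hγS))
  have g4 := geo_pos (sub_pos.2 hγS)
  set Kg : ℝ := M * W.D d
  set G : ℝ := Kg * (1 + geo a)
  set F : ℝ := Kg * (1 + geo γ)
  refine ⟨(2 * W.R * W.B) ^ d * (Kg * geo a * F + W.A d * G * (Kg * geo γ) +
    Kg ^ 2 * (4 * W.R) ^ S * (geo (S - a) * geo γ + geo a * geo (S - γ))), by positivity,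
    fun g f hg hf l hl ι hι m => ?_⟩
  have hΨ := W.integral_abs_Psi_le l ι m
  have bΨ := W.cubeBdd_Psi l ι m
  have bP := W.cubeBdd_proj (d := d) (l + 1) g
  have bQ := W.cubeBdd_proj (d := d) (l + 1) f
  have q1 := dw_pos l a
  have q2 : dw l γ ≤ dw l a := dw_anti_right l haγ
  set w : ℝ := (2 * W.R * W.B / √(2 ^ l)) ^ d with hw
  -- tails beyond the level of the wavelet are uniformly small; the rest is smooth
  have hsplit : ∫ x in cube d, g x * f x * W.Psi l ι m x =
      (∫ x in cube d, (g x - W.proj (l + 1) g x) * f x * W.Psi l ι m x) +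
      (∫ x in cube d, W.proj (l + 1) g x * (f x - W.proj (l + 1) f x) * W.Psi l ι m x) +
      ∫ x in cube d, W.proj (l + 1) g x * W.proj (l + 1) f x * W.Psi l ι m x := by
    rw [← integral_add, ← integral_add]
    · exact integral_cube_congr fun x _ => by ring
    · exact ((((hg.bdd.sub bP).mul hf.bdd).mul bΨ).add
        ((bP.mul (hf.bdd.sub bQ)).mul bΨ)).integrable
    · exact ((bP.mul bQ).mul bΨ).integrable
    · exact (((hg.bdd.sub bP).mul hf.bdd).mul bΨ).integrable
    · exact ((bP.mul (hf.bdd.sub bQ)).mul bΨ).integrable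
  have i1 : |∫ x in cube d, (g x - W.proj (l + 1) g x) * f x *
      W.Psi l ι m x| ≤ Kg * geo a * dw l a * F * w := by
    refine CubeBdd.abs_integral_mul_le_mul ((hg.bdd.sub bP).mul hf.bdd) bΨ (fun x hx => ?_)
      (by positivity) hΨ
    rw [abs_mul]
    refine mul_le_mul ((hg.abs_sub_proj_le ha hM (by omega) hx).trans ?_) (hf.abs_le hγ hM hx)
      (abs_nonneg _) (by positivity)
    exact mul_le_mul_of_nonneg_left (dw_anti_left (Nat.le_succ l) ha.le) (by positivity)
  have i2 : |∫ x in cube d, W.proj (l + 1) g x * (f x - W.proj (l + 1) f x) * W.Psi l ι m x| ≤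
      W.A d * G * (Kg * geo γ * dw l a) * w := by
    refine CubeBdd.abs_integral_mul_le_mul (bP.mul (hf.bdd.sub bQ)) bΨ (fun x hx => ?_)
      (by positivity) hΨ
    rw [abs_mul]
    refine mul_le_mul (W.abs_proj_le (l + 1) hg.bdd (fun x hx => hg.abs_le ha hM hx) hx)
      ((hf.abs_sub_proj_le hγ hM (by omega) hx).trans ?_) (abs_nonneg _) (by positivity)
    exact mul_le_mul_of_nonneg_left ((dw_anti_left (Nat.le_succ l) hγ.le).trans q2) (by positivity)
  have i3 : |∫ x in cube d, W.proj (l + 1) g x * W.proj (l + 1) f x *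
      W.Psi l ι m x| ≤ w * (Kg ^ 2 * (4 * W.R) ^ S *
        ((geo (S - a) * geo γ + geo a * geo (S - γ)) * dw l a)) := by
    -- the low-frequency part: for blocks of levels `l₁`, `l₂` there are `S` derivatives to gain
    have h1 : ∫ x in cube d, W.proj (l + 1) g x * W.proj (l + 1) f x *
        W.Psi l ι m x = ∑ l₁ ∈ Finset.Icc W.J₀ l, ∑ l₂ ∈ Finset.Icc W.J₀ l,
          ∫ x in cube d, W.block l₁ g x * W.block l₂ f x * W.Psi l ι m x := by
      have hb : ∀ l₁ l₂, CubeBdd fun x => W.block l₁ g x * W.block l₂ f x *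
          W.Psi l ι m x := fun l₁ l₂ => ((W.cubeBdd_block l₁ g).mul (W.cubeBdd_block l₂ f)).mul bΨ
      have h2 : ∀ l₁, ∑ l₂ ∈ Finset.Icc W.J₀ l,
          ∫ x in cube d, W.block l₁ g x * W.block l₂ f x * W.Psi l ι m x =
          ∫ x in cube d, ∑ l₂ ∈ Finset.Icc W.J₀ l,
            W.block l₁ g x * W.block l₂ f x * W.Psi l ι m x := fun l₁ =>
        (integral_finsetSum _ fun l₂ _ => (hb l₁ l₂).integrable).symm
      simp_rw [h2]
      rw [← integral_finsetSum _ fun l₁ _ => (CubeBdd.sum fun l₂ _ => hb l₁ l₂).integrable]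
      refine integral_cube_congr fun x hx => ?_
      rw [W.proj_succ_eq_sum_block hg.bdd hl hx, W.proj_succ_eq_sum_block hf.bdd hl hx,
        Finset.sum_mul_sum, sum_mul]
      simp_rw [sum_mul]
    rw [h1]
    have h2 : ∀ l₁ ∈ Finset.Icc W.J₀ l, ∀ l₂ ∈ Finset.Icc W.J₀ l,
        |∫ x in cube d, W.block l₁ g x * W.block l₂ f x * W.Psi l ι m x| ≤
        w * (Kg ^ 2 * (4 * W.R) ^ S *
          ((dw l₁ (-(S - a)) * dw l₂ γ + dw l₁ a * dw l₂ (-(S - γ))) * dw l S)) :=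
      fun l₁ h₁ l₂ h₂ => W.abs_integral_block_mul_block_le hM hg hf hl (Finset.mem_Icc.1 h₁).1
        (Finset.mem_Icc.1 h₂).1 hι m
    refine (abs_sum_le_sum_abs _ _).trans ((sum_le_sum fun l₁ h₁ =>
      (abs_sum_le_sum_abs _ _).trans (sum_le_sum (h2 l₁ h₁))).trans ?_)
    simp_rw [← mul_sum, ← sum_mul, sum_add_distrib, ← mul_sum, ← sum_mul]
    refine mul_le_mul_of_nonneg_left (mul_le_mul_of_nonneg_left ?_ (by positivity)) (by positivity)
    have p3 := dw_pos l S
    have s1 := sum_dw_neg_le (sub_pos.2 (haγ.trans_lt hγS)) W.J₀ l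
    have s2 := sum_dw_le hγ W.J₀ l
    have s3 := sum_dw_le ha W.J₀ l
    have s4 := sum_dw_neg_le (sub_pos.2 hγS) W.J₀ l
    have n1 : ∀ c, 0 ≤ ∑ k ∈ Finset.Icc W.J₀ l, dw k c := fun c =>
      sum_nonneg fun k _ => (dw_pos k c).le
    have e1 : dw l (-(S - a)) * dw l S = dw l a := by rw [← dw_add]; congr 1; ring
    have e2 : dw l (-(S - γ)) * dw l S = dw l γ := by rw [← dw_add]; congr 1; ring
    have p4 := dw_pos l (-(S - a))
    calc _ ≤ (geo (S - a) * dw l (-(S - a)) * geo γ + geo a * (geo (S - γ) * dw l (-(S - γ)))) *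
          dw l S := by
          refine mul_le_mul_of_nonneg_right (add_le_add ?_ ?_) p3.le
          · exact mul_le_mul s1 s2 (n1 _) (by positivity)
          · exact mul_le_mul s3 s4 (n1 _) (by positivity)
      _ = geo (S - a) * geo γ * (dw l (-(S - a)) * dw l S) +
          geo a * geo (S - γ) * (dw l (-(S - γ)) * dw l S) := by ring
      _ = geo (S - a) * geo γ * dw l a + geo a * geo (S - γ) * dw l γ := by rw [e1, e2]
      _ ≤ geo (S - a) * geo γ * dw l a + geo a * geo (S - γ) * dw l a := by gcongr
      _ = _ := by ring
  rw [hsplit]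
  refine (abs_add_three _ _ _).trans ((add_le_add (add_le_add i1 i2) i3).trans (le_of_eq ?_))
  rw [hw, div_pow]
  ring

/-- The error of the projection of a Hölder function is small when tested against a function with
decaying wavelet coefficients. -/
theorem CDVBasis.HolderFn.abs_integral_mul_sub_proj_le {W : CDVBasis S} {a b M C : ℝ}
    (hab : 0 < a + b) (hM : 0 ≤ M) (hC : 0 ≤ C) {h G : (Fin d → ℝ) → ℝ} (hh : W.HolderFn b M h)
    (hG : CubeBdd G) {j : ℕ} (hj : W.J₀ ≤ j)
    (hcG : ∀ l, W.J₀ ≤ l → ∀ ι ≠ (fun _ => false), ∀ m,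
      |∫ x in cube d, G x * W.Psi l ι m x| ≤ C * dw l a / √(2 ^ l) ^ d) :
    |∫ x in cube d, G x * (h x - W.proj j h x)| ≤ 2 ^ d * M * C * geo (a + b) * dw j (a + b) := by
  have bp := fun l => W.cubeBdd_proj (d := d) l h
  have h1 : ∫ x in cube d, G x * (h x - W.proj j h x) =
      (∫ x in cube d, G x * h x) - ∫ x in cube d, G x * W.proj j h x := by
    simp_rw [mul_sub]
    exact integral_sub (hG.mul hh.bdd).integrable (hG.mul (bp j)).integrable
  rw [h1]
  refine abs_sub_le_of_dyadic_increments
    (v := fun l => ∫ x in cube d, G x * W.proj l h x) hab (by positivity)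
    (fun l hl => ?_) fun ε hε => ?_
  -- one level: `2 ^ (l d)` products of coefficients, by orthogonality
  · have hl0 := hj.trans hl
    have p2 := dw_pos l b
    have h2 : (∫ x in cube d, G x * W.proj (l + 1) h x) - ∫ x in cube d, G x * W.proj l h x =
        ∫ x in cube d, G x * W.detail l h x := by
      rw [← integral_sub (hG.mul (bp _)).integrable (hG.mul (bp l)).integrable]
      exact integral_cube_congr fun x hx => by rw [W.proj_succ hl0 hh.bdd hx]; ring
    have h3 : ∫ x in cube d, G x * W.detail l h x = ∑ ι : Fin d → Bool with ι ≠ fun _ => false, ∑ m,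
          (∫ y in cube d, h y * W.Psi l ι m y) * ∫ x in cube d, G x * W.Psi l ι m x := by
      simp only [CDVData.detail, mul_sum]
      rw [integral_finsetSum _ fun ι _ => (CubeBdd.sum fun m _ =>
        hG.mul ((W.cubeBdd_Psi l ι m).const_mul _)).integrable]
      refine sum_congr rfl fun ι _ => ?_
      rw [integral_finsetSum _ fun m _ => (hG.mul ((W.cubeBdd_Psi l ι m).const_mul _)).integrable]
      refine sum_congr rfl fun m _ => ?_
      rw [← integral_const_mul]
      exact integral_cube_congr fun x _ => by ring
    rw [h2, h3]
    have h4 : ∀ ι ∈ Finset.univ.filter (fun ι : Fin d → Bool => ι ≠ fun _ => false),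
        |∑ m, (∫ y in cube d, h y * W.Psi l ι m y) *
            ∫ x in cube d, G x * W.Psi l ι m x| ≤ M * C * dw l (a + b) := by
      intro ι hι
      have hι' : ι ≠ fun _ => false := by simpa using hι
      have h5 : ∀ m, |(∫ y in cube d, h y * W.Psi l ι m y) * ∫ x in cube d, G x * W.Psi l ι m x| ≤
            (M * dw l b / √(2 ^ l) ^ d) * (C * dw l a / √(2 ^ l) ^ d) := fun m => by
        rw [abs_mul]
        exact mul_le_mul (hh.coef.psi l hl0 ι hι' m) (hcG l hl0 ι hι' m) (abs_nonneg _)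
          (by positivity)
      refine (abs_sum_le_sum_abs _ _).trans ((sum_le_sum fun m _ => h5 m).trans ?_)
      rw [sum_const, nsmul_eq_mul, div_mul_div_comm, sqrt_pow_mul_self, dw_add]
      have h6 : ((Finset.univ : Finset (Fin d → Fin (2 ^ l))).card : ℝ) = 2 ^ (l * d) := by
        simp [pow_mul]
      rw [h6, mul_div_cancel₀ _ (by positivity)]
      exact le_of_eq (by ring)
    refine (abs_sum_le_sum_abs _ _).trans ((sum_le_sum h4).trans ?_)
    rw [sum_const, nsmul_eq_mul]
    have := dw_pos l (a + b)
    calc _ ≤ 2 ^ d * (M * C * dw l (a + b)) :=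
          mul_le_mul_of_nonneg_right (card_le_two_pow _) (by positivity)
      _ = _ := by ring
  · obtain ⟨B, hB⟩ := hG.bdd
    have hB' : ∀ x ∈ cube d, |G x| ≤ |B| + 1 := fun x hx =>
      (hB x hx).trans ((le_abs_self B).trans (by linarith))
    filter_upwards [W.eventually_abs_proj_sub_le hh.bdd hh.unif
      (div_pos hε (by positivity : (0 : ℝ) < |B| + 1))] with l hl
    rw [← integral_sub (hG.mul (bp l)).integrable (hG.mul hh.bdd).integrable]
    refine CubeBdd.abs_integral_le ((hG.mul (bp l)).sub (hG.mul hh.bdd)) fun x hx => ?_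
    rw [← mul_sub, abs_mul]
    refine (mul_le_mul (hB' x hx) (hl x hx) (abs_nonneg _) (by positivity)).trans (le_of_eq ?_)
    field_simp

theorem CDVBasis.continuousOn_Psi (j : ℕ) (ι : Fin d → Bool) (m : Fin d → Fin (2 ^ j)) :
    ContinuousOn (W.Psi j ι m) (cube d) := by
  rw [funext (W.Psi_eq j ι m)]
  refine continuousOn_finsetProd _ fun i _ => ?_
  have h1 : ContinuousOn (W.fn (ι i) j (m i)) (Set.Icc 0 1) :=
    (W.ext_spec (ι i) j (m i)).contDiff.continuous.continuousOn.congr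
      (W.ext_spec (ι i) j (m i)).eq_on
  exact h1.comp (continuous_apply i).continuousOn fun x hx => mem_cube.1 hx i

theorem CDVBasis.uniformContinuousOn_of_continuousOn {h : (Fin d → ℝ) → ℝ}
    (hh : ContinuousOn h (cube d)) : UniformContinuousOn h (cube d) :=
  (isCompact_Icc : IsCompact (cube d)).uniformContinuousOn_of_continuous hh

/-- Projections stay in the Hölder ball. -/
theorem CDVBasis.HolderFn.proj {W : CDVBasis S} {a M : ℝ} (hM : 0 ≤ M) {h : (Fin d → ℝ) → ℝ}
    (hh : W.HolderFn a M h) {j : ℕ} (hj : W.J₀ ≤ j) : W.HolderFn a M (W.proj j h) where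
  bdd := W.cubeBdd_proj j h
  unif := by
    refine CDVBasis.uniformContinuousOn_of_continuousOn ?_
    refine continuousOn_finsetSum _ fun m _ => continuousOn_const.mul ?_
    rw [CDVData.Phi_eq]
    exact W.continuousOn_Psi _ _ _
  coef := by
    have key : ∀ (l : ℕ) (ι : Fin d → Bool) (m : Fin d → Fin (2 ^ l)), W.J₀ ≤ l →
        (l < j ∨ l = j ∧ ι = fun _ => false) → ∫ x in cube d, W.proj j h x * W.Psi l ι m x =
          ∫ x in cube d, h x * W.Psi l ι m x := by
      intro l ι m hl hlj
      refine ((W.orthoFamily_Phi hj).integral_projOn_mul_comm hh.bdd (W.cubeBdd_Psi l ι m)).trans ?_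
      refine integral_cube_congr fun x hx => ?_
      have := W.proj_Psi hl hlj m hx
      rw [CDVData.proj] at this
      rw [this]
    refine ⟨fun m => ?_, fun l hl ι hι m => ?_⟩
    · rw [CDVData.Phi_eq, key W.J₀ _ m le_rfl, ← CDVData.Phi_eq]
      · exact hh.coef.phi m
      · rcases hj.lt_or_eq with h | h
        · exact Or.inl h
        · exact Or.inr ⟨h, rfl⟩
    · rcases lt_or_ge l j with hlj | hlj
      · rw [key l ι m hl (Or.inl hlj)]
        exact hh.coef.psi l hl ι hι m
      · have h0 : ∫ x in cube d, W.proj j h x * W.Psi l ι m x = 0 := by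
          refine ((W.orthoFamily_Phi hj).integral_projOn_mul (W.cubeBdd_Psi l ι m)).trans ?_
          refine sum_eq_zero fun m' _ => ?_
          have := W.integral_Psi_mul_Psi_eq_zero (ι := fun _ => false) hj
            (by rcases hlj.lt_or_eq with h | h
                · exact Or.inl h
                · exact Or.inr ⟨h, rfl⟩) hι m' m
          rw [← CDVData.Phi_eq] at this
          rw [integral_cube_congr (g := fun x => W.Psi l ι m x * W.Phi j m' x)
            (h := fun x => W.Phi j m' x * W.Psi l ι m x)
            fun x _ => mul_comm _ _, this, mul_zero]
        rw [h0, abs_zero]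
        have := dw_pos l a
        positivity

/-- The approximation bias: the projection error of a Hölder function, tested against the product of
a Hölder function and a smooth one. -/
theorem CDVBasis.exists_abs_integral_bias_le {a b γ M : ℝ} (ha : 0 < a) (hb : 0 < b) (haγ : a ≤ γ)
    (hγS : γ < S) (hM : 0 ≤ M) :
    ∃ C, 0 ≤ C ∧ ∀ g f h : (Fin d → ℝ) → ℝ, W.HolderFn a M g → W.HolderFn γ M f →
      W.HolderFn b M h → ∀ j, W.J₀ ≤ j →
        |∫ x in cube d, g x * f x * (h x - W.proj j h x)| ≤ C * dw j (a + b) := by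
  obtain ⟨C, hC, H⟩ := W.exists_abs_integral_mul_mul_Psi_le (d := d) ha haγ hγS hM
  have hg := geo_pos (add_pos ha hb)
  exact ⟨2 ^ d * M * C * geo (a + b), by positivity, fun g f h hg hf hh j hj =>
    hh.abs_integral_mul_sub_proj_le (add_pos ha hb) hM hC (hg.bdd.mul hf.bdd) hj
      fun l hl ι hι m => H g f hg hf l hl ι hι m⟩

end

/-! ### Averages over a sample and splitting of samples -/

theorem lintegral_ofReal_eq {Ω : Type*} [MeasurableSpace Ω] {μ : Measure Ω} {g : Ω → ℝ}
    (hg : Integrable g μ) (h0 : ∀ x, 0 ≤ g x) :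
    ∫⁻ x, ofReal (g x) ∂μ = ofReal (∫ x, g x ∂μ) :=
  (ofReal_integral_eq_lintegral_ofReal hg (ae_of_all _ h0)).symm

/-- Second moment of an average of independent copies, shifted by a constant. -/
theorem lintegral_sq_add_average {Ω : Type*} [MeasurableSpace Ω] {P : Measure Ω}
    [IsProbabilityMeasure P] {g : Ω → ℝ} (hg : MemLp g 2 P) {n : ℕ} (hn : 1 ≤ n) (c : ℝ) :
    ∫⁻ D, ofReal ((c + 1 / (n : ℝ) * ∑ i, g (D i)) ^ 2)
      ∂P^⊗n =
    ofReal ((c + ∫ o, g o ∂P) ^ 2 + 1 / (n : ℝ) * (∫ o, g o ^ 2 ∂P - (∫ o, g o ∂P) ^ 2)) := by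
  have hn0 : (n : ℝ) ≠ 0 := by positivity
  set Q := P^⊗n
  have hi : ∀ i, MemLp (fun D : Fin n → Ω => g (D i)) 2 Q := fun i =>
    hg.comp_measurePreserving (measurePreserving_eval (fun _ : Fin n => P) i)
  have hS : MemLp (∑ i, fun D : Fin n → Ω => g (D i)) 2 Q := memLp_finsetSum' _ fun i _ => hi i
  have hT : MemLp (fun D : Fin n → Ω => c + 1 / (n : ℝ) * ∑ i, g (D i)) 2 Q := by
    have := (memLp_const c).add (hS.const_mul (1 / (n : ℝ)))
    convert this using 2
    simp [Finset.sum_apply]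
  have hm : ∀ i, ∫ D : Fin n → Ω, g (D i) ∂Q = ∫ o, g o ∂P := fun i => by
    have := (measurePreserving_eval (fun _ : Fin n => P) i)
    rw [← this.map_eq, integral_map this.measurable.aemeasurable]
    · rw [this.map_eq]; exact hg.aestronglyMeasurable
  have hmean : ∫ D, (c + 1 / (n : ℝ) * ∑ i, g (D i)) ∂Q = c + ∫ o, g o ∂P := by
    rw [integral_add (integrable_const c), integral_const_mul, integral_finsetSum]
    · simp_rw [hm]
      simp [hn0]
    · exact fun i _ => (hi i).integrable one_le_two
    · exact (integrable_finsetSum _ fun i _ => (hi i).integrable one_le_two).const_mul _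
  have hvar : ProbabilityTheory.variance (fun D : Fin n → Ω => c + 1 / (n : ℝ) * ∑ i, g (D i)) Q =
      1 / (n : ℝ) * (∫ o, g o ^ 2 ∂P - (∫ o, g o ∂P) ^ 2) := by
    have h1 := ProbabilityTheory.variance_sum_pi (μ := fun _ : Fin n => P) (X := fun _ => g)
      fun _ => hg
    have h2 := ProbabilityTheory.variance_eq_sub hg
    have h3 : ProbabilityTheory.variance (fun D : Fin n → Ω => c + 1 / (n : ℝ) * ∑ i, g (D i)) Q =
        ProbabilityTheory.variance (fun D : Fin n → Ω => 1 / (n : ℝ) * ∑ i, g (D i)) Q :=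
      ProbabilityTheory.variance_const_add
        ((hS.const_mul (1 / (n : ℝ))).aestronglyMeasurable.congr (ae_of_all _ fun D => by
          simp [Finset.sum_apply])) c
    rw [h3, ProbabilityTheory.variance_const_mul]
    have h4 : ProbabilityTheory.variance (fun D : Fin n → Ω => ∑ i, g (D i)) Q =
        n * ProbabilityTheory.variance g P := by
      have : (fun D : Fin n → Ω => ∑ i, g (D i)) = ∑ i, fun D : Fin n → Ω => g (D i) := by
        ext D; simp
      rw [this, h1]
      simp
    rw [h4, h2]
    simp only [Pi.pow_apply]
    field_simp
  have h5 := ProbabilityTheory.variance_eq_sub hT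
  rw [hvar, hmean] at h5
  rw [lintegral_ofReal_eq hT.integrable_sq fun _ => sq_nonneg _]
  congr 1
  simp only [Pi.pow_apply] at h5
  linarith

/-- The samples with index set `Fin m × Fin n`, as `m` independent samples. -/
theorem measurePreserving_uncurry_pi {Ω : Type*} [MeasurableSpace Ω] (P : Measure Ω)
    [IsProbabilityMeasure P] (m n : ℕ) :
    MeasurePreserving (fun (E : Fin m → Fin n → Ω) (q : Fin m × Fin n) => E q.1 q.2)
      (Measure.pi fun _ => Measure.pi fun _ => P) (Measure.pi fun _ => P) := by
  have hm : Measurable fun (E : Fin m → Fin n → Ω) (q : Fin m × Fin n) => E q.1 q.2 := by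
    fun_prop
  refine ⟨hm, (Measure.pi_eq fun s hs => ?_).symm⟩
  rw [Measure.map_apply hm (MeasurableSet.univ_pi hs)]
  have : (fun (E : Fin m → Fin n → Ω) (q : Fin m × Fin n) => E q.1 q.2) ⁻¹' Set.univ.pi s =
      Set.univ.pi fun j => Set.univ.pi fun i => s (j, i) := by
    ext E; simp [Set.mem_pi]
  rw [this, Measure.pi_pi, Fintype.prod_prod_type]
  simp_rw [Measure.pi_pi]

theorem lintegral_pi_perm {Ω : Type*} [MeasurableSpace Ω] (Q : Measure Ω) [IsProbabilityMeasure Q]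
    {m : ℕ} (σ : Equiv.Perm (Fin m)) {F : (Fin m → Ω) → ℝ≥0∞} :
    ∫⁻ E, F (fun j => E (σ j)) ∂(Measure.pi fun _ => Q) = ∫⁻ E, F E ∂(Measure.pi fun _ => Q) := by
  have h := measurePreserving_piCongrLeft (α := fun _ : Fin m => Ω) (fun _ => Q) σ.symm
  rw [← h.lintegral_comp_emb (MeasurableEquiv.measurableEmbedding _) F]
  refine lintegral_congr fun E => ?_
  congr 1
  ext j
  have := MeasurableEquiv.piCongrLeft_apply_apply (β := fun _ : Fin m => Ω) σ.symm E (σ j)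
  rw [Equiv.symm_apply_apply] at this
  exact this.symm

@[fun_prop]
theorem measurable_finCons {Ω : Type*} [MeasurableSpace Ω] {m : ℕ} (a : Ω) :
    Measurable fun E : Fin m → Ω => (Fin.cons a E : Fin (m + 1) → Ω) := by
  refine measurable_pi_iff.2 fun j => ?_
  refine Fin.cases ?_ (fun i => ?_) j
  · simp
  · simpa using measurable_pi_apply i

theorem lintegral_pi_succ {Ω : Type*} [MeasurableSpace Ω] (Q : Measure Ω) [IsProbabilityMeasure Q]
    {m : ℕ} {F : (Fin (m + 1) → Ω) → ℝ≥0∞} (hF : Measurable F) :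
    ∫⁻ E, F E ∂(Measure.pi fun _ => Q) =
      ∫⁻ a, ∫⁻ E, F (Fin.cons a E) ∂(Measure.pi fun _ => Q) ∂Q := by
  have h := (measurePreserving_piFinSuccAbove (α := fun _ : Fin (m + 1) => Ω) (fun _ => Q) 0).symm
  rw [← h.lintegral_comp_emb (MeasurableEquiv.measurableEmbedding _), lintegral_prod]
  · refine lintegral_congr fun a => lintegral_congr fun E => congrArg F ?_
    exact Fin.insertNth_zero' a E
  · exact (hF.comp (MeasurableEquiv.measurable _)).aemeasurable

theorem lintegral_pi_zero {Ω : Type*} [MeasurableSpace Ω] (Q : Measure Ω) [IsProbabilityMeasure Q]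
    {F : (Fin 0 → Ω) → ℝ≥0∞} :
    ∫⁻ E, F E ∂(Measure.pi fun _ => Q) = F Fin.elim0 := by
  rw [Measure.pi_of_empty _ Fin.elim0, lintegral_dirac]

theorem lintegral_pi_three {Ω : Type*} [MeasurableSpace Ω] (Q : Measure Ω)
    [IsProbabilityMeasure Q] {F : (Fin 3 → Ω) → ℝ≥0∞} (hF : Measurable F) :
    ∫⁻ E, F E ∂(Measure.pi fun _ => Q) = ∫⁻ a, ∫⁻ b, ∫⁻ c, F ![a, b, c] ∂Q ∂Q ∂Q := by
  rw [lintegral_pi_succ Q hF]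
  refine lintegral_congr fun a => ?_
  rw [lintegral_pi_succ Q (by fun_prop)]
  refine lintegral_congr fun b => ?_
  rw [lintegral_pi_succ Q (by fun_prop)]
  refine lintegral_congr fun c => ?_
  rw [lintegral_pi_zero]
  congr 1

theorem lintegral_pi_five {Ω : Type*} [MeasurableSpace Ω] (Q : Measure Ω)
    [IsProbabilityMeasure Q] {F : (Fin 5 → Ω) → ℝ≥0∞} (hF : Measurable F) :
    ∫⁻ E, F E ∂(Measure.pi fun _ => Q) =
      ∫⁻ a, ∫⁻ b, ∫⁻ c, ∫⁻ e, ∫⁻ f, F ![a, b, c, e, f] ∂Q ∂Q ∂Q ∂Q ∂Q := by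
  rw [lintegral_pi_succ Q hF]
  refine lintegral_congr fun a => ?_
  rw [lintegral_pi_succ Q (by fun_prop)]
  refine lintegral_congr fun b => ?_
  rw [lintegral_pi_three Q (by fun_prop)]
  rfl

theorem lintegral_pi_six {Ω : Type*} [MeasurableSpace Ω] (Q : Measure Ω)
    [IsProbabilityMeasure Q] {F : (Fin 6 → Ω) → ℝ≥0∞} (hF : Measurable F) :
    ∫⁻ E, F E ∂(Measure.pi fun _ => Q) =
      ∫⁻ a, ∫⁻ b, ∫⁻ c, ∫⁻ e, ∫⁻ f, ∫⁻ g, F ![a, b, c, e, f, g] ∂Q ∂Q ∂Q ∂Q ∂Q ∂Q := by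
  rw [lintegral_pi_succ Q hF]
  refine lintegral_congr fun a => ?_
  rw [lintegral_pi_five Q (by fun_prop)]
  rfl

/-! ### Consequences of the model assumptions -/

/-- The covariates have density `f ≤ K` on the cube. -/
structure CovLaw {d : ℕ} (P : Measure (Obs d)) (f : (Fin d → ℝ) → ℝ) (K : ℝ) : Prop where
  prob : IsProbabilityMeasure P
  mem_cube : ∀ᵐ o ∂P, o.X ∈ cube d
  bdd : CubeBdd f
  nonneg : ∀ x ∈ cube d, 0 ≤ f x
  le : ∀ x ∈ cube d, f x ≤ K
  integral : ∀ φ, CubeBdd φ → ∫ o, φ o.X ∂P = ∫ x in cube d, φ x * f x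

/-- The response `Z`, bounded by `K`, has regression function `r` on the covariates, whose density
is `f`. -/
structure Regr {d : ℕ} (P : Measure (Obs d)) (f : (Fin d → ℝ) → ℝ) (K : ℝ) (Z : Obs d → ℝ)
    (r : (Fin d → ℝ) → ℝ) : Prop where
  meas : Measurable Z
  abs_le : ∀ᵐ o ∂P, |Z o| ≤ K
  bdd : CubeBdd r
  abs_r_le : ∀ x ∈ cube d, |r x| ≤ K
  integral : ∀ φ, CubeBdd φ → ∫ o, Z o * φ o.X ∂P = ∫ x in cube d, r x * φ x * f x

theorem Obs.measurable_X {d : ℕ} : Measurable (Obs.X (d := d)) := measurable_fst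

theorem Obs.measurable_A {d : ℕ} : Measurable (Obs.A (d := d)) := measurable_fst.comp measurable_snd

theorem Obs.measurable_Y {d : ℕ} : Measurable (Obs.Y (d := d)) := measurable_snd.comp measurable_snd

theorem Obs.sigmaX_le (d : ℕ) : Obs.sigmaX d ≤ (inferInstance : MeasurableSpace (Obs d)) :=
  Obs.measurable_X.comap_le

theorem Obs.stronglyMeasurable_comp_X {d : ℕ} {φ : (Fin d → ℝ) → ℝ} (hφ : Measurable φ) :
    StronglyMeasurable[Obs.sigmaX d] fun o : Obs d => φ o.X :=
  (hφ.comp (comap_measurable _)).stronglyMeasurable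

theorem integrable_comp_X {d : ℕ} {P : Measure (Obs d)} [IsProbabilityMeasure P]
    (hc : ∀ᵐ o ∂P, o.X ∈ cube d) {φ : (Fin d → ℝ) → ℝ} (hφ : CubeBdd φ) :
    Integrable (fun o => φ o.X) P := by
  obtain ⟨B, hB⟩ := hφ.bdd
  exact Integrable.of_bound (hφ.meas.comp Obs.measurable_X).aestronglyMeasurable B
    (hc.mono fun o ho => hB _ ho)

theorem integrable_mul_comp_X {d : ℕ} {P : Measure (Obs d)} [IsProbabilityMeasure P]
    (hc : ∀ᵐ o ∂P, o.X ∈ cube d) {φ : (Fin d → ℝ) → ℝ} (hφ : CubeBdd φ) {Z : Obs d → ℝ} {K : ℝ}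
    (hZ : Measurable Z) (hZK : ∀ᵐ o ∂P, |Z o| ≤ K) : Integrable (fun o => Z o * φ o.X) P :=
  (integrable_comp_X hc hφ).bdd_mul hZ.aestronglyMeasurable (c := K) hZK

section

variable {d : ℕ} {W : CDVData} {θ : ModelParams} {P : Measure (Obs d)} {p b f : (Fin d → ℝ) → ℝ}

theorem covLaw_of_density [IsProbabilityMeasure P] {K : ℝ} (hf : CubeBdd f)
    (h0 : ∀ x ∈ cube d, 0 ≤ f x) (hK : ∀ x ∈ cube d, f x ≤ K)
    (hd : P.map Obs.X = (volume.restrict (cube d)).withDensity (fun x => ofReal (f x))) :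
    CovLaw P f K where
  prob := inferInstance
  mem_cube := by
    have h1 : ∀ᵐ x ∂(P.map Obs.X), x ∈ cube d := by
      rw [hd]
      exact (withDensity_absolutelyContinuous _ _).ae_le (ae_mem_cube d)
    exact ae_of_ae_map Obs.measurable_X.aemeasurable h1
  bdd := hf
  nonneg := h0
  le := hK
  integral φ hφ := by
    rw [← integral_map (φ := Obs.X) (f := φ) Obs.measurable_X.aemeasurable
      hφ.meas.aestronglyMeasurable, hd,
      integral_withDensity_eq_integral_toReal_smul hf.meas.ennreal_ofReal
      (ae_of_all _ fun _ => ENNReal.ofReal_lt_top)]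
    refine integral_cube_congr fun x hx => ?_
    rw [ENNReal.toReal_ofReal (h0 x hx), smul_eq_mul, mul_comm]

theorem regr_of_condExp {K : ℝ} (hP : CovLaw P f K) {Z : Obs d → ℝ} (hZ : Measurable Z)
    (hZK : ∀ᵐ o ∂P, |Z o| ≤ K) {r : (Fin d → ℝ) → ℝ} (hr : CubeBdd r)
    (hrK : ∀ x ∈ cube d, |r x| ≤ K) (hc : P[Z | Obs.sigmaX d] =ᵐ[P] fun o => r o.X) :
    Regr P f K Z r where
  meas := hZ
  abs_le := hZK
  bdd := hr
  abs_r_le := hrK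
  integral φ hφ := by
    have := hP.prob
    have hZi : Integrable Z P := Integrable.of_bound hZ.aestronglyMeasurable K hZK
    have h1 := condExp_mul_of_stronglyMeasurable_right (μ := P)
      (Obs.stronglyMeasurable_comp_X hφ.meas)
      (integrable_mul_comp_X hP.mem_cube hφ hZ hZK) hZi
    rw [← integral_condExp (Obs.sigmaX_le d)]
    have h2 : ∫ o, r o.X * φ o.X ∂P = ∫ x in cube d, r x * φ x * f x :=
      hP.integral (fun x => r x * φ x) (hr.mul hφ)
    rw [← h2]
    refine integral_congr_ae (h1.trans ?_)
    filter_upwards [hc] with o ho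
    simp only [Pi.mul_apply, ho]

theorem psi_eq {K : ℝ} (hP : CovLaw P f K) (hA : Regr P f K Obs.A p) (hY : Regr P f K Obs.Y b)
    (hcA : P[Obs.A | Obs.sigmaX d] =ᵐ[P] fun o => p o.X)
    (hcY : P[Obs.Y | Obs.sigmaX d] =ᵐ[P] fun o => b o.X) :
    psi P = ∫ o, o.A * o.Y ∂P - ∫ x in cube d, p x * b x * f x := by
  have := hP.prob
  have iAb := integrable_mul_comp_X hP.mem_cube hY.bdd hA.meas hA.abs_le
  have iYp := integrable_mul_comp_X hP.mem_cube hA.bdd hY.meas hY.abs_le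
  have ipb := integrable_comp_X hP.mem_cube (hA.bdd.mul hY.bdd)
  have iAY : Integrable (fun o : Obs d => o.A * o.Y) P :=
    (Integrable.of_bound hY.meas.aestronglyMeasurable K hY.abs_le).bdd_mul
      hA.meas.aestronglyMeasurable hA.abs_le
  rw [psi]
  simp only [condCovAY]
  rw [integral_condExp (Obs.sigmaX_le d)]
  have h1 : ∫ o, (o.A - (P[Obs.A | Obs.sigmaX d]) o) * (o.Y - (P[Obs.Y | Obs.sigmaX d]) o) ∂P =
      ∫ o, (o.A * o.Y - o.A * b o.X) - (o.Y * p o.X - p o.X * b o.X) ∂P := by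
    refine integral_congr_ae ?_
    filter_upwards [hcA, hcY] with o h1 h2
    rw [h1, h2]; ring
  rw [h1]
  rw [integral_sub (f := fun o : Obs d => o.A * o.Y - o.A * b o.X)
    (g := fun o : Obs d => o.Y * p o.X - p o.X * b o.X) (iAY.sub iAb) (iYp.sub ipb), integral_sub iAY iAb, integral_sub iYp ipb,
    hA.integral _ hY.bdd, hY.integral _ hA.bdd, hP.integral (fun x => p x * b x) (hA.bdd.mul hY.bdd)]
  have h2 : ∫ x in cube d, b x * p x * f x = ∫ x in cube d, p x * b x * f x :=
    integral_cube_congr fun x _ => by ring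
  rw [h2]; ring

end

/-! ### Moments of the regression estimators given the density estimates -/

theorem lintegral_lintegral_lintegral_mul {Ω E : Type*} [MeasurableSpace Ω] [MeasurableSpace E]
    {μ : Measure Ω} {ν : Measure E} [SFinite μ] [SFinite ν] {G₁ G₂ : Ω × E → ℝ≥0∞} {g : E → ℝ≥0∞}
    (h₁ : Measurable G₁) (h₂ : Measurable G₂) (hg : Measurable g) :
    ∫⁻ D, ∫⁻ D', ∫⁻ x, G₁ (D, x) * G₂ (D', x) * g x ∂ν ∂μ ∂μ =
      ∫⁻ x, (∫⁻ D, G₁ (D, x) ∂μ) * (∫⁻ D, G₂ (D, x) ∂μ) * g x ∂ν := by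
  have h3 : ∀ D, ∫⁻ D', ∫⁻ x, G₁ (D, x) * G₂ (D', x) * g x ∂ν ∂μ =
      ∫⁻ x, G₁ (D, x) * (∫⁻ D', G₂ (D', x) ∂μ) * g x ∂ν := by
    intro D
    rw [lintegral_lintegral_swap]
    · refine lintegral_congr fun x => ?_
      rw [lintegral_mul_const _ (by fun_prop), lintegral_const_mul _ (by fun_prop)]
    · exact Measurable.aemeasurable (by fun_prop)
  simp_rw [h3]
  rw [lintegral_lintegral_swap]
  · refine lintegral_congr fun x => ?_
    rw [lintegral_mul_const _ (by fun_prop), lintegral_mul_const _ (by fun_prop)]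
  · exact Measurable.aemeasurable (by fun_prop)

/-- The wavelet projection estimator of the regression function of `Z`, with weights `1 / q`. -/
def regEst {d n : ℕ} (W : CDVData) (q : (Fin d → ℝ) → ℝ) (Z : Obs d → ℝ) (j : ℕ)
    (D : Fin n → Obs d) (x : Fin d → ℝ) : ℝ :=
  (1 / (n : ℝ)) * ∑ i, Z (D i) * W.kernel j (D i).X x / q (D i).X

/-- The mean of `regEst`, for a response with regression function `r` and covariate density `f`. -/
def regMean {d : ℕ} (W : CDVData) (q f : (Fin d → ℝ) → ℝ) (j : ℕ) (r : (Fin d → ℝ) → ℝ) :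
    (Fin d → ℝ) → ℝ :=
  W.proj j fun x => r x * f x / q x

theorem res_pos (d j : ℕ) : 0 < res d j := by unfold res; positivity

theorem card_eq_res (d j : ℕ) : (Fintype.card (Fin d → Fin (2 ^ j)) : ℝ) = res d j := by
  simp [res, pow_mul]

/-- Admissible weights: measurable with values in `[c₁, c₂]` on the cube, `c₁ > 0`. -/
structure IsWeight {d : ℕ} (c₁ c₂ : ℝ) (q : (Fin d → ℝ) → ℝ) : Prop where
  pos : 0 < c₁
  meas : Measurable q
  mem : ∀ x ∈ cube d, q x ∈ Set.Icc c₁ c₂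

theorem IsWeight.cubeBdd {d : ℕ} {c₁ c₂ : ℝ} {q : (Fin d → ℝ) → ℝ} (hq : IsWeight c₁ c₂ q) :
    CubeBdd q :=
  ⟨hq.meas, c₂, fun x hx => abs_le.2 ⟨by linarith [(hq.mem x hx).1, (hq.mem x hx).2, hq.pos],
    (hq.mem x hx).2⟩⟩

theorem IsWeight.cubeBdd_div {d : ℕ} {c₁ c₂ : ℝ} {q g : (Fin d → ℝ) → ℝ} (hq : IsWeight c₁ c₂ q)
    (hg : CubeBdd g) : CubeBdd fun x => g x / q x :=
  hg.div hq.meas hq.pos fun x hx => (hq.mem x hx).1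

theorem IsWeight.abs_div_le {d : ℕ} {c₁ c₂ : ℝ} {q : (Fin d → ℝ) → ℝ} (hq : IsWeight c₁ c₂ q)
    {x : Fin d → ℝ} (hx : x ∈ cube d) {z B : ℝ} (hz : |z| ≤ B) : |z / q x| ≤ B / c₁ := by
  have h1 := hq.mem x hx
  rw [abs_div, abs_of_pos (hq.pos.trans_le h1.1)]
  exact div_le_div₀ ((abs_nonneg _).trans hz) hz hq.pos h1.1

section

variable {S d n : ℕ} {W : CDVBasis S} {P : Measure (Obs d)} {f q r : (Fin d → ℝ) → ℝ}
  {K c₁ c₂ : ℝ} {Z : Obs d → ℝ} {j : ℕ}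

theorem CovLaw.K_nonneg (hP : CovLaw P f K) : 0 ≤ K :=
  have h0 : (0 : Fin d → ℝ) ∈ cube d := _root_.mem_cube.2 fun i => by simp
  (hP.nonneg 0 h0).trans (hP.le 0 h0)

theorem CovLaw.abs_le (hP : CovLaw P f K) {x : Fin d → ℝ} (hx : x ∈ cube d) : |f x| ≤ K := by
  rw [abs_of_nonneg (hP.nonneg x hx)]; exact hP.le x hx

theorem CDVBasis.cubeBdd_regEst (W : CDVBasis S) (q : (Fin d → ℝ) → ℝ) (Z : Obs d → ℝ) (j : ℕ)
    (D : Fin n → Obs d) : CubeBdd (regEst W q Z j D) := by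
  refine (CubeBdd.sum fun i _ => ?_).const_mul _
  have := (W.cubeBdd_kernel j (D i).X).const_mul (Z (D i) / q (D i).X)
  convert this using 2
  ring

theorem CDVBasis.integral_regEst_mul (W : CDVBasis S) {u : (Fin d → ℝ) → ℝ} (hu : CubeBdd u)
    (D : Fin n → Obs d) :
    ∫ x in cube d, regEst W q Z j D x * u x =
      1 / (n : ℝ) * ∑ i, Z (D i) * (W.proj j u (D i).X / q (D i).X) := by
  have h1 : ∀ x, regEst W q Z j D x * u x =
      1 / (n : ℝ) * ∑ i, Z (D i) / q (D i).X * (W.kernel j (D i).X x * u x) := fun x => by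
    rw [regEst, mul_assoc, sum_mul]
    congr 1
    exact sum_congr rfl fun i _ => by ring
  simp_rw [h1]
  rw [integral_const_mul, integral_finsetSum _ fun i _ =>
    (((W.cubeBdd_kernel j (D i).X).mul hu).const_mul _).integrable]
  congr 1
  refine sum_congr rfl fun i _ => ?_
  rw [integral_const_mul, ← W.proj_eq_integral_kernel j hu]
  ring

theorem CDVBasis.cubeBdd_regMean (W : CDVBasis S) (q f : (Fin d → ℝ) → ℝ) (j : ℕ)
    (r : (Fin d → ℝ) → ℝ) : CubeBdd (regMean W q f j r) := W.cubeBdd_proj j _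

theorem CDVBasis.integral_regMean_mul (W : CDVBasis S) (hj : W.J₀ ≤ j) (hr : CubeBdd r)
    (hf : CubeBdd f) (hq : IsWeight c₁ c₂ q) {u : (Fin d → ℝ) → ℝ} (hu : CubeBdd u) :
    ∫ x in cube d, regMean W q f j r x * u x = ∫ x in cube d, r x * f x / q x * W.proj j u x :=
  (W.orthoFamily_Phi hj).integral_projOn_mul_comm (hq.cubeBdd_div (hr.mul hf)) hu

theorem Regr.abs_regMean_le (hP : CovLaw P f K) (hZ : Regr P f K Z r) (hq : IsWeight c₁ c₂ q)
    (j : ℕ) {x : Fin d → ℝ} (hx : x ∈ cube d) :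
    |regMean W q f j r x| ≤ W.A d * (K ^ 2 / c₁) := by
  refine W.abs_proj_le j (hq.cubeBdd_div (hZ.bdd.mul hP.bdd)) (fun y hy => ?_) hx
  refine hq.abs_div_le hy ?_
  rw [abs_mul, sq]
  exact mul_le_mul (hZ.abs_r_le y hy) (hP.abs_le hy) (abs_nonneg _) hP.K_nonneg

/-- The variance factor `K (K / c₁) ^ 2`. -/
def varFactor (K c₁ : ℝ) : ℝ := K * (K / c₁) ^ 2

theorem varFactor_nonneg (hP : CovLaw P f K) (c₁ : ℝ) : 0 ≤ varFactor K c₁ :=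
  mul_nonneg hP.K_nonneg (sq_nonneg _)

theorem Regr.memLp (hP : CovLaw P f K) (hZ : Regr P f K Z r) {φ : (Fin d → ℝ) → ℝ}
    (hφ : CubeBdd φ) : MemLp (fun o => Z o * φ o.X) 2 P := by
  have := hP.prob
  obtain ⟨B, hB⟩ := hφ.bdd
  refine MemLp.of_bound (hZ.meas.mul (hφ.meas.comp Obs.measurable_X)).aestronglyMeasurable (K * B) ?_
  filter_upwards [hZ.abs_le, hP.mem_cube] with o h1 h2
  rw [Real.norm_eq_abs, abs_mul]
  exact mul_le_mul h1 (hB _ h2) (abs_nonneg _) hP.K_nonneg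

theorem Regr.integral_sq_le (hP : CovLaw P f K) (hZ : Regr P f K Z r) (hq : IsWeight c₁ c₂ q)
    {φ : (Fin d → ℝ) → ℝ} (hφ : CubeBdd φ) :
    ∫ o, (Z o * (φ o.X / q o.X)) ^ 2 ∂P ≤ varFactor K c₁ * ∫ x in cube d, φ x ^ 2 := by
  have := hP.prob
  have h1 : ∫ o, (Z o * (φ o.X / q o.X)) ^ 2 ∂P ≤ ∫ o, (K / c₁) ^ 2 * φ o.X ^ 2 ∂P := by
    refine integral_mono_ae (hZ.memLp hP (hq.cubeBdd_div hφ)).integrable_sq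
      ((integrable_comp_X hP.mem_cube hφ.pow).const_mul _) ?_
    filter_upwards [hZ.abs_le, hP.mem_cube] with o h1 h2
    have h3 : Z o * (φ o.X / q o.X) = (Z o / q o.X) * φ o.X := by ring
    rw [h3, mul_pow]
    refine mul_le_mul_of_nonneg_right ?_ (sq_nonneg _)
    rw [← sq_abs (Z o / _)]
    exact pow_le_pow_left₀ (abs_nonneg _) (hq.abs_div_le h2 h1) 2
  refine h1.trans ?_
  rw [integral_const_mul, hP.integral _ hφ.pow, varFactor, mul_comm K, mul_assoc]
  refine mul_le_mul_of_nonneg_left ?_ (sq_nonneg _)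
  rw [← integral_const_mul]
  refine CubeBdd.integral_mono (hφ.pow.mul hP.bdd) (hφ.pow.const_mul K) fun x hx => ?_
  rw [mul_comm]
  exact mul_le_mul_of_nonneg_right (hP.le x hx) (sq_nonneg _)

theorem Regr.lintegral_sq_average_le (hP : CovLaw P f K) (hZ : Regr P f K Z r)
    (hq : IsWeight c₁ c₂ q) (hn : 1 ≤ n) {φ : (Fin d → ℝ) → ℝ} (hφ : CubeBdd φ) (c : ℝ) :
    ∫⁻ D, ofReal ((c + 1 / (n : ℝ) * ∑ i, Z (D i) * (φ (D i).X / q (D i).X)) ^ 2)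
      ∂P^⊗n ≤ ofReal ((c + ∫ x in cube d, r x * f x / q x * φ x) ^ 2 +
      varFactor K c₁ / n * ∫ x in cube d, φ x ^ 2) := by
  have := hP.prob
  have hφq := hq.cubeBdd_div hφ
  rw [lintegral_sq_add_average (hZ.memLp hP hφq) hn, hZ.integral _ hφq]
  refine ofReal_le_ofReal ?_
  have h1 : ∫ x in cube d, r x * (φ x / q x) * f x = ∫ x in cube d, r x * f x / q x * φ x :=
    integral_cube_congr fun x _ => by ring
  rw [h1]
  have h2 := hZ.integral_sq_le hP hq hφ
  have h4 : varFactor K c₁ / n * ∫ x in cube d, φ x ^ 2 =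
      1 / (n : ℝ) * (varFactor K c₁ * ∫ x in cube d, φ x ^ 2) := by ring
  rw [h4]
  gcongr
  linarith [sq_nonneg (∫ x in cube d, r x * f x / q x * φ x)]

theorem Regr.lintegral_sq_add_integral_regEst_le (hP : CovLaw P f K) (hZ : Regr P f K Z r)
    (hq : IsWeight c₁ c₂ q) (hn : 1 ≤ n) (hj : W.J₀ ≤ j) {u : (Fin d → ℝ) → ℝ} (hu : CubeBdd u)
    (c : ℝ) :
    ∫⁻ D, ofReal ((c + ∫ x in cube d, regEst W q Z j D x * u x) ^ 2)
      ∂P^⊗n ≤ ofReal ((c + ∫ x in cube d, regMean W q f j r x * u x) ^ 2 +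
      varFactor K c₁ / n * ∫ x in cube d, W.proj j u x ^ 2) := by
  simp_rw [W.integral_regEst_mul hu]
  rw [W.integral_regMean_mul hj hZ.bdd hP.bdd hq hu]
  exact hZ.lintegral_sq_average_le hP hq hn (W.cubeBdd_proj j u) c

theorem Regr.measurable_integral_regEst_mul (hZ : Regr P f K Z r) (hq : IsWeight c₁ c₂ q)
    {u : (Fin d → ℝ) → ℝ} (hu : CubeBdd u) :
    Measurable fun D : Fin n → Obs d => ∫ x in cube d, regEst W q Z j D x * u x := by
  simp_rw [W.integral_regEst_mul hu]
  refine (Finset.measurable_fun_sum _ fun i _ => ?_).const_mul _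
  have h1 := hZ.meas
  have h2 := hq.meas
  have h3 := (W.cubeBdd_proj j u).meas
  have h4 := Obs.measurable_X (d := d)
  fun_prop

theorem CDVBasis.measurable_kernel (W : CDVBasis S) (j : ℕ) :
    Measurable fun z : (Fin d → ℝ) × (Fin d → ℝ) => W.kernel j z.1 z.2 :=
  Finset.measurable_fun_sum _ fun m _ => ((W.cubeBdd_Phi j m).meas.comp measurable_fst).mul
      ((W.cubeBdd_Phi j m).meas.comp measurable_snd)

theorem CDVBasis.measurable_regEst (W : CDVBasis S) (hZ : Measurable Z) (hq : Measurable q) :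
    Measurable fun z : (Fin n → Obs d) × (Fin d → ℝ) => regEst W q Z j z.1 z.2 := by
  refine (Finset.measurable_fun_sum _ fun i _ => ?_).const_mul _
  have h1 := W.measurable_kernel (d := d) j
  have h4 := Obs.measurable_X (d := d)
  fun_prop

/-- Second moment of the estimator at a point. -/
theorem Regr.lintegral_regEst_sq_le (hP : CovLaw P f K) (hZ : Regr P f K Z r)
    (hq : IsWeight c₁ c₂ q) (hn : 1 ≤ n) (hj : W.J₀ ≤ j) {x : Fin d → ℝ} (hx : x ∈ cube d) :
    ∫⁻ D, ofReal (regEst W q Z j D x ^ 2) ∂P^⊗n ≤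
    ofReal (((W.A d * (K ^ 2 / c₁)) ^ 2 + varFactor K c₁ * (3 * W.R * W.B ^ 2) ^ d) *
      (1 + res d j / n)) := by
  have hR := W.one_le_R
  have hB := W.one_le_B
  have h1 := hZ.lintegral_sq_average_le hP hq hn (W.cubeBdd_kernel j x) 0
  have h2 : ∀ D : Fin n → Obs d, regEst W q Z j D x = 0 + 1 / (n : ℝ) *
      ∑ i, Z (D i) * (W.kernel j x (D i).X / q (D i).X) := fun D => by
    rw [regEst, zero_add]
    simp_rw [CDVData.kernel_comm W j x, mul_div_assoc]
  simp_rw [h2]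
  refine h1.trans (ofReal_le_ofReal ?_)
  have h3 : ∫ y in cube d, r y * f y / q y * W.kernel j x y = regMean W q f j r x := by
    rw [regMean, W.proj_eq_integral_kernel j (hq.cubeBdd_div (hZ.bdd.mul hP.bdd))]
    exact integral_cube_congr fun y _ => mul_comm _ _
  rw [h3, zero_add, W.integral_kernel_sq hj]
  have h4 := hZ.abs_regMean_le (W := W) hP hq j hx
  have h5 : regMean W q f j r x ^ 2 ≤ (W.A d * (K ^ 2 / c₁)) ^ 2 := by
    rw [← sq_abs]; exact pow_le_pow_left₀ (abs_nonneg _) h4 2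
  have h6 := W.kernel_self_le j hx
  have hV := varFactor_nonneg hP c₁
  have h7 : varFactor K c₁ / n * W.kernel j x x ≤
      varFactor K c₁ / n * ((3 * W.R * W.B ^ 2) ^ d * res d j) :=
    mul_le_mul_of_nonneg_left h6 (by positivity)
  have h8 := (res_pos d j).le
  have h9 : 0 ≤ (W.A d * (K ^ 2 / c₁)) ^ 2 * (res d j / n) := by positivity
  have h10 : 0 ≤ varFactor K c₁ * (3 * W.R * W.B ^ 2) ^ d := by positivity
  calc _ ≤ (W.A d * (K ^ 2 / c₁)) ^ 2 + varFactor K c₁ / n * ((3 * W.R * W.B ^ 2) ^ d * res d j) :=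
        add_le_add h5 h7
    _ = (W.A d * (K ^ 2 / c₁)) ^ 2 +
        varFactor K c₁ * (3 * W.R * W.B ^ 2) ^ d * (res d j / n) := by ring
    _ ≤ _ := by nlinarith

/-- The squared Hilbert-Schmidt norm of `Π₁ w Π₂` is at most the smaller of the two dimensions, up
to a constant. -/
theorem CDVBasis.sum_integral_proj_sq_le (W : CDVBasis S) {j₁ j₂ : ℕ} (h₁ : W.J₀ ≤ j₁)
    (h₂ : W.J₀ ≤ j₂) {w : (Fin d → ℝ) → ℝ} (hw : CubeBdd w) (hwK : ∀ x ∈ cube d, |w x| ≤ K) :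
    ∑ m, ∫ x in cube d, W.proj j₁ (fun y => w y * W.Phi j₂ m y) x ^ 2 ≤
      K ^ 2 * min (res d j₁) (res d j₂) := by
  have key : ∀ i : ℕ, W.J₀ ≤ i → ∀ m : Fin d → Fin (2 ^ i),
      ∫ x in cube d, (w x * W.Phi i m x) ^ 2 ≤ K ^ 2 := by
    intro i hi m
    have h1 : ∫ x in cube d, (w x * W.Phi i m x) ^ 2 ≤ ∫ x in cube d, K ^ 2 * W.Phi i m x ^ 2 := by
      refine CubeBdd.integral_mono (hw.mul (W.cubeBdd_Phi i m)).pow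
        ((W.cubeBdd_Phi i m).pow.const_mul _) fun x hx => ?_
      rw [mul_pow, ← sq_abs (w x)]
      exact mul_le_mul_of_nonneg_right (pow_le_pow_left₀ (abs_nonneg _) (hwK x hx) 2) (sq_nonneg _)
    have h2 := (W.orthoFamily_Phi (d := d) hi).ortho m m
    rw [if_pos rfl] at h2
    rw [integral_const_mul] at h1
    simp_rw [sq (W.Phi i m _)] at h1
    rw [h2] at h1
    linarith
  have card : ∀ i : ℕ, ∑ _m : Fin d → Fin (2 ^ i), K ^ 2 = K ^ 2 * res d i := fun i => by
    rw [sum_const, nsmul_eq_mul, Finset.card_univ, card_eq_res, mul_comm]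
  rw [mul_min_of_nonneg _ _ (sq_nonneg K)]
  refine le_min ?_ ?_
  · have h1 : ∀ m : Fin d → Fin (2 ^ j₂), ∫ x in cube d,
        W.proj j₁ (fun y => w y * W.Phi j₂ m y) x ^ 2 =
        ∑ m', (∫ x in cube d, (w x * W.Phi j₁ m' x) * W.Phi j₂ m x) ^ 2 :=
      fun m => by
        refine ((W.orthoFamily_Phi h₁).integral_projOn_sq _).trans ?_
        refine sum_congr rfl fun m' _ => ?_
        congr 1
        exact integral_cube_congr fun x _ => by ring
    simp_rw [h1]
    rw [Finset.sum_comm, ← card]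
    refine sum_le_sum fun m' _ => ?_
    exact ((W.orthoFamily_Phi h₂).sum_sq_le (hw.mul (W.cubeBdd_Phi j₁ m'))).trans (key j₁ h₁ m')
  · rw [← card]
    refine sum_le_sum fun m _ => ?_
    exact ((W.orthoFamily_Phi h₁).integral_projOn_sq_le (hw.mul (W.cubeBdd_Phi j₂ m))).trans
      (key j₂ h₂ m)

/-- The bilinear form `∫ (p₀ - p̂) (b₀ - b̂) w` in two independent regression estimators: its second
moment is the square of its mean, up to `(1 + k / n) / n`, where `k` is the smaller resolution. -/
theorem Regr.lintegral_bilinear_sq_le {q₁ q₂ r₁ r₂ p₀ b₀ w : (Fin d → ℝ) → ℝ}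
    {Z₁ Z₂ : Obs d → ℝ} {j₁ j₂ : ℕ} {L : ℝ} (hP : CovLaw P f K) (hZ₁ : Regr P f K Z₁ r₁)
    (hZ₂ : Regr P f K Z₂ r₂) (hq₁ : IsWeight c₁ c₂ q₁) (hq₂ : IsWeight c₁ c₂ q₂) (hn : 1 ≤ n)
    (h₁ : W.J₀ ≤ j₁) (h₂ : W.J₀ ≤ j₂) (hp₀ : CubeBdd p₀) (hp₀L : ∀ x ∈ cube d, |p₀ x| ≤ L)
    (hb₀ : CubeBdd b₀) (hb₀L : ∀ x ∈ cube d, |b₀ x| ≤ L) (hw : CubeBdd w)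
    (hwL : ∀ x ∈ cube d, |w x| ≤ L) (κ : ℝ) :
    ∫⁻ D, ∫⁻ D', ofReal ((κ + ∫ x in cube d, (p₀ x - regEst W q₁ Z₁ j₁ D x) *
      (b₀ x - regEst W q₂ Z₂ j₂ D' x) * w x) ^ 2)
      ∂P^⊗n ∂P^⊗n ≤ ofReal ((κ + ∫ x in cube d, (p₀ x - regMean W q₁ f j₁ r₁ x) *
      (b₀ x - regMean W q₂ f j₂ r₂ x) * w x) ^ 2 +
      varFactor K c₁ * (2 * ((L + W.A d * (K ^ 2 / c₁)) * L) ^ 2 + varFactor K c₁ * L ^ 2) *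
        (1 / n * (1 + min (res d j₁) (res d j₂) / n))) := by
  set V := varFactor K c₁
  have hV0 : 0 ≤ V := varFactor_nonneg hP c₁
  have hVn : 0 ≤ V / n := by positivity
  set pe : (Fin n → Obs d) → (Fin d → ℝ) → ℝ := regEst W q₁ Z₁ j₁
  set be : (Fin n → Obs d) → (Fin d → ℝ) → ℝ := regEst W q₂ Z₂ j₂
  set pt := regMean W q₁ f j₁ r₁
  set bt := regMean W q₂ f j₂ r₂
  have bp : ∀ D, CubeBdd (pe D) := W.cubeBdd_regEst q₁ Z₁ j₁
  have bb : ∀ D, CubeBdd (be D) := W.cubeBdd_regEst q₂ Z₂ j₂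
  have bpt : CubeBdd pt := W.cubeBdd_regMean q₁ f j₁ r₁
  have bbt : CubeBdd bt := W.cubeBdd_regMean q₂ f j₂ r₂
  have e1 : ∀ D D', κ + ∫ x in cube d, (p₀ x - pe D x) * (b₀ x - be D' x) * w x =
      (κ + ∫ x in cube d, (p₀ x - pe D x) * b₀ x * w x) +
        ∫ x in cube d, be D' x * -((p₀ x - pe D x) * w x) := fun D D' => by
    rw [add_assoc, ← integral_add (((hp₀.sub (bp D)).mul hb₀).mul hw).integrable
      ((bb D').mul ((hp₀.sub (bp D)).mul hw).neg).integrable]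
    congr 1
    exact integral_cube_congr fun x _ => by ring
  have e2 : ∀ D, (κ + ∫ x in cube d, (p₀ x - pe D x) * b₀ x * w x) +
        ∫ x in cube d, bt x * -((p₀ x - pe D x) * w x) =
      (κ + ∫ x in cube d, p₀ x * (b₀ x - bt x) * w x) +
        ∫ x in cube d, pe D x * -((b₀ x - bt x) * w x) := fun D => by
    rw [add_assoc, add_assoc, ← integral_add (((hp₀.sub (bp D)).mul hb₀).mul hw).integrable
      (bbt.mul ((hp₀.sub (bp D)).mul hw).neg).integrable,
      ← integral_add ((hp₀.mul (hb₀.sub bbt)).mul hw).integrable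
      ((bp D).mul ((hb₀.sub bbt).mul hw).neg).integrable]
    congr 1
    exact integral_cube_congr fun x _ => by ring
  have e3 : (κ + ∫ x in cube d, p₀ x * (b₀ x - bt x) * w x) +
        ∫ x in cube d, pt x * -((b₀ x - bt x) * w x) =
      κ + ∫ x in cube d, (p₀ x - pt x) * (b₀ x - bt x) * w x := by
    rw [add_assoc, ← integral_add ((hp₀.mul (hb₀.sub bbt)).mul hw).integrable
      (bpt.mul ((hb₀.sub bbt).mul hw).neg).integrable]
    congr 1
    exact integral_cube_congr fun x _ => by ring
  have e4 : ∀ D, ∫ x in cube d, W.proj j₂ (fun y => -((p₀ y - pe D y) * w y)) x ^ 2 =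
      ∑ m, ((-∫ x in cube d, p₀ x * (w x * W.Phi j₂ m x)) +
        ∫ x in cube d, pe D x * (w x * W.Phi j₂ m x)) ^ 2 := fun D => by
    refine ((W.orthoFamily_Phi h₂).integral_projOn_sq _).trans ?_
    refine sum_congr rfl fun m _ => ?_
    have bm := hw.mul (W.cubeBdd_Phi j₂ m)
    rw [← integral_neg, ← integral_add (hp₀.mul bm).neg.integrable ((bp D).mul bm).integrable]
    congr 1
    exact integral_cube_congr fun x _ => by ring
  have e5 : ∑ m, ((-∫ x in cube d, p₀ x * (w x * W.Phi j₂ m x)) +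
        ∫ x in cube d, pt x * (w x * W.Phi j₂ m x)) ^ 2 ≤ ((L + W.A d * (K ^ 2 / c₁)) * L) ^ 2 := by
    have h1 := (W.orthoFamily_Phi (d := d) h₂).sum_sq_le ((hp₀.sub bpt).mul hw).neg
    refine le_trans (le_of_eq ?_) (h1.trans (((hp₀.sub bpt).mul hw).neg.integral_sq_le ?_))
    · refine sum_congr rfl fun m _ => ?_
      have bm := hw.mul (W.cubeBdd_Phi j₂ m)
      rw [← integral_neg, ← integral_add (hp₀.mul bm).neg.integrable (bpt.mul bm).integrable]
      congr 1
      exact integral_cube_congr fun x _ => by ring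
    · intro x hx
      rw [abs_neg, abs_mul]
      have h3 := hZ₁.abs_regMean_le (W := W) hP hq₁ j₁ hx
      have h4 := hp₀L x hx
      have h5 := abs_sub (p₀ x) (pt x)
      exact mul_le_mul (by linarith) (hwL x hx) (abs_nonneg _)
        (by linarith [abs_nonneg (p₀ x - pt x)])
  have hmeas : ∀ {u : (Fin d → ℝ) → ℝ}, CubeBdd u →
      Measurable fun D => ∫ x in cube d, pe D x * u x := fun hu =>
    hZ₁.measurable_integral_regEst_mul hq₁ hu
  have bu := ((hb₀.sub bbt).mul hw).neg
  -- average over the second sample: bias in `b̂` and a sum of squared coefficients of `p₀ - p̂`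
  have hinner : ∀ D, ∫⁻ D', ofReal ((κ + ∫ x in cube d, (p₀ x - pe D x) *
      (b₀ x - be D' x) * w x) ^ 2) ∂P^⊗n ≤
      ofReal (((κ + ∫ x in cube d, p₀ x * (b₀ x - bt x) * w x) +
        ∫ x in cube d, pe D x * -((b₀ x - bt x) * w x)) ^ 2) + ofReal (V / n) * ∑ m, ofReal (
        ((-∫ x in cube d, p₀ x * (w x * W.Phi j₂ m x)) +
        ∫ x in cube d, pe D x * (w x * W.Phi j₂ m x)) ^ 2) := by
    intro D
    simp_rw [e1]
    refine (hZ₂.lintegral_sq_add_integral_regEst_le hP hq₂ hn h₂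
      (((hp₀.sub (bp D)).mul hw).neg) _).trans (le_of_eq ?_)
    rw [e2, e4, ofReal_add (sq_nonneg _)
      (mul_nonneg hVn (sum_nonneg fun _ _ => sq_nonneg _)), ofReal_mul hVn,
      ENNReal.ofReal_sum_of_nonneg fun _ _ => sq_nonneg _]
  refine (lintegral_mono hinner).trans ?_
  have hm1 : ∀ m, Measurable fun D => ofReal (((-∫ x in cube d, p₀ x * (w x * W.Phi j₂ m x)) +
        ∫ x in cube d, pe D x * (w x * W.Phi j₂ m x)) ^ 2) := fun m =>
    (((hmeas (hw.mul (W.cubeBdd_Phi j₂ m))).const_add _).pow_const 2).ennreal_ofReal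
  rw [lintegral_add_left (((hmeas bu).const_add _).pow_const 2).ennreal_ofReal,
    lintegral_const_mul _ (Finset.measurable_fun_sum _ fun m _ => hm1 m),
    lintegral_finsetSum _ fun m _ => hm1 m]
  -- average over the first sample, in the bias term and in each of the coefficients
  have houter := hZ₁.lintegral_sq_add_integral_regEst_le (W := W) hP hq₁ hn h₁ bu
    (κ + ∫ x in cube d, p₀ x * (b₀ x - bt x) * w x)
  have hcoef := sum_le_sum (s := Finset.univ) fun m _ =>
    hZ₁.lintegral_sq_add_integral_regEst_le (W := W) hP hq₁ hn h₁ (hw.mul (W.cubeBdd_Phi j₂ m))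
      (-∫ x in cube d, p₀ x * (w x * W.Phi j₂ m x))
  refine (add_le_add houter (mul_le_mul_right hcoef _)).trans ?_
  have nn : ∀ u : (Fin d → ℝ) → ℝ, 0 ≤ ∫ x in cube d, W.proj j₁ u x ^ 2 := fun u =>
    integral_nonneg fun _ => sq_nonneg _
  rw [← ENNReal.ofReal_sum_of_nonneg fun m _ => add_nonneg (sq_nonneg _)
      (mul_nonneg hVn (nn _)), ← ofReal_mul hVn,
    ← ofReal_add (add_nonneg (sq_nonneg _) (mul_nonneg hVn (nn _)))
      (mul_nonneg hVn (sum_nonneg fun m _ => add_nonneg (sq_nonneg _)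
      (mul_nonneg hVn (nn _)))), e3]
  refine ofReal_le_ofReal ?_
  rw [sum_add_distrib, ← mul_sum, add_assoc]
  -- the fluctuations of the coefficients add up to a squared Hilbert-Schmidt norm
  have f1 := W.sum_integral_proj_sq_le h₁ h₂ hw hwL
  have f2 : ∫ x in cube d, W.proj j₁ (fun y => -((b₀ y - bt y) * w y)) x ^ 2 ≤
      ((L + W.A d * (K ^ 2 / c₁)) * L) ^ 2 := by
    refine ((W.orthoFamily_Phi h₁).integral_projOn_sq_le bu).trans (bu.integral_sq_le ?_)
    intro x hx
    rw [abs_neg, abs_mul]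
    have h3 := hZ₂.abs_regMean_le (W := W) hP hq₂ j₂ hx
    have h4 := hb₀L x hx
    have h5 := abs_sub (b₀ x) (bt x)
    exact mul_le_mul (by linarith) (hwL x hx) (abs_nonneg _)
      (by linarith [abs_nonneg (b₀ x - bt x)])
  set G := ((L + W.A d * (K ^ 2 / c₁)) * L) ^ 2 with hG
  have hmin : 0 ≤ min (res d j₁) (res d j₂) := le_min (res_pos d j₁).le (res_pos d j₂).le
  set k := min (res d j₁) (res d j₂)
  have hkn : 0 ≤ k / n := by positivity
  refine add_le_add le_rfl ?_
  calc _ ≤ V / n * G + V / n * (G + V / n * (L ^ 2 * k)) := by gcongr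
    _ = V / n * (2 * G + V * L ^ 2 * (k / n)) := by ring
    _ ≤ V / n * ((2 * G + V * L ^ 2) * (1 + k / n)) := by
        refine mul_le_mul_of_nonneg_left ?_ hVn
        nlinarith
    _ = _ := by ring

/-- Two independent estimators: the second moments at a point multiply after integration. -/
theorem lintegral_lintegral_integral_mul {q₁ q₂ g : (Fin d → ℝ) → ℝ} {F₁ F₂ : ℝ → ℝ}
    {Z₁ Z₂ : Obs d → ℝ} {j₁ j₂ : ℕ} [IsProbabilityMeasure P] (hZ₁ : Measurable Z₁)
    (hZ₂ : Measurable Z₂) (hq₁ : Measurable q₁) (hq₂ : Measurable q₂)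
    (hF₁ : Measurable F₁) (hF₂ : Measurable F₂) (hF₁0 : ∀ t, 0 ≤ F₁ t) (hF₂0 : ∀ t, 0 ≤ F₂ t)
    (hg : Measurable g) (hg0 : ∀ x ∈ cube d, 0 ≤ g x)
    (hi : ∀ D D' : Fin n → Obs d, CubeBdd fun x => F₁ (regEst W q₁ Z₁ j₁ D x) *
      F₂ (regEst W q₂ Z₂ j₂ D' x) * g x) :
    ∫⁻ D, ∫⁻ D', ofReal (∫ x in cube d, F₁ (regEst W q₁ Z₁ j₁ D x) *
      F₂ (regEst W q₂ Z₂ j₂ D' x) * g x)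
      ∂P^⊗n ∂P^⊗n = ∫⁻ x in cube d, (∫⁻ D, ofReal (F₁ (regEst W q₁ Z₁ j₁ D x))
        ∂P^⊗n) * (∫⁻ D, ofReal (F₂ (regEst W q₂ Z₂ j₂ D x))
        ∂P^⊗n) * ofReal (g x) := by
  refine Eq.trans ?_ (lintegral_lintegral_lintegral_mul (μ := P^⊗n)
    (ν := cubeMeasure d)
    ((hF₁.comp (W.measurable_regEst (j := j₁) hZ₁ hq₁)).ennreal_ofReal)
    ((hF₂.comp (W.measurable_regEst (j := j₂) hZ₂ hq₂)).ennreal_ofReal) hg.ennreal_ofReal)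
  refine lintegral_congr fun D => lintegral_congr fun D' => ?_
  rw [ofReal_integral_eq_lintegral_ofReal (hi D D').integrable
      ((ae_mem_cube d).mono fun x hx => mul_nonneg (mul_nonneg (hF₁0 _) (hF₂0 _)) (hg0 x hx))]
  refine lintegral_congr fun x => ?_
  rw [ofReal_mul (mul_nonneg (hF₁0 _) (hF₂0 _)), ofReal_mul (hF₁0 _)]
  rfl

end

/-! ### Bias of the estimators -/

/-- A law of the model, with versions of the regression functions and of the covariate density that
are measurable on the whole space. -/
structure ModelLaw {S d : ℕ} (W : CDVBasis S) (θ : ModelParams) (K : ℝ) (P : Measure (Obs d))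
    (p b f : (Fin d → ℝ) → ℝ) : Prop where
  cov : CovLaw P f K
  regA : Regr P f K Obs.A p
  regY : Regr P f K Obs.Y b
  psi : psi P = ∫ o, o.A * o.Y ∂P - ∫ x in cube d, p x * b x * f x
  holder_p : W.HolderFn θ.α θ.M p
  holder_b : W.HolderFn θ.β θ.M b
  holder_f : W.HolderFn θ.γ θ.M f

section

variable {S d : ℕ} {W : CDVBasis S} {θ : ModelParams}

theorem NonDegenerate.M_pos (h : NonDegenerate d W θ) : 0 < θ.M := by
  obtain ⟨c, -, -, h1, -⟩ := h.regression
  exact ENNReal.ofReal_pos.1 (zero_le.trans_lt h1)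

theorem CDVData.holderNorm_congr (W : CDVData) (a : ℝ) {g h : (Fin d → ℝ) → ℝ}
    (H : ∀ x ∈ cube d, g x = h x) : W.holderNorm a g = W.holderNorm a h := by
  have h1 : ∀ u : (Fin d → ℝ) → ℝ, ∫ x in cube d, g x * u x = ∫ x in cube d, h x * u x := fun u =>
    integral_cube_congr fun x hx => by rw [H x hx]
  simp only [CDVData.holderNorm, h1]

theorem CDVBasis.holderFn_indicator {a M : ℝ} (hM : 0 ≤ M) {h : (Fin d → ℝ) → ℝ}
    (hh : h ∈ W.HolderBall d a M) : W.HolderFn a M ((cube d).indicator h) where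
  bdd := CubeBdd.indicator hh.1.continuousOn
  unif := hh.1.congr fun x hx => (Set.indicator_of_mem hx h).symm
  coef := W.holderCoef_of_holderNorm_le hM <| by
    rw [CDVData.holderNorm_congr _ _ fun x hx => Set.indicator_of_mem hx h]
    exact hh.2

/-- The bound `K` depends on the model only. -/
theorem exists_modelLaw (hα : 0 < θ.α) (hβ : 0 < θ.β) (hnd : NonDegenerate d W θ) :
    ∃ K : ℝ, 1 ≤ K ∧ ∀ (P : Measure (Obs d)) (p b f : (Fin d → ℝ) → ℝ),
      InModel W θ P p b f → ∃ p' b' f', ModelLaw W θ K P p' b' f' ∧ ∀ x ∈ cube d, f' x = f x := by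
  have hM := hnd.M_pos
  have hD := W.D_pos d
  have ga := geo_pos hα
  have gb := geo_pos hβ
  have h1 := le_abs_self θ.C₁
  have h2 := le_abs_self θ.C₂
  have h1' := neg_abs_le θ.C₁
  have h2' := neg_abs_le θ.C₂
  have h3 := le_abs_self θ.M₂
  have t1 : 0 ≤ θ.M * W.D d * (1 + geo θ.α) := by positivity
  have t2 : 0 ≤ θ.M * W.D d * (1 + geo θ.β) := by positivity
  set K := 1 + |θ.C₁| + |θ.C₂| + |θ.M₂| + θ.M * W.D d * (1 + geo θ.α) + θ.M * W.D d * (1 + geo θ.β)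
  have p3 := abs_nonneg θ.M₂
  refine ⟨K, by linarith, fun P p b f hP => ?_⟩
  have := hP.prob
  have Hp := W.holderFn_indicator hM.le hP.holder_p
  have Hb := W.holderFn_indicator hM.le hP.holder_b
  have Hf := W.holderFn_indicator hM.le hP.holder_f
  have ef : ∀ x ∈ cube d, (cube d).indicator f x = f x := fun x hx => Set.indicator_of_mem hx f
  have hcov : CovLaw P ((cube d).indicator f) K := by
    refine covLaw_of_density Hf.bdd (fun x hx => ?_) (fun x hx => ?_) ?_
    · rw [ef x hx]; exact hnd.M₁_pos.le.trans (hP.bounded_f x hx).1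
    · rw [ef x hx]; linarith [(hP.bounded_f x hx).2]
    · rw [hP.density]
      refine withDensity_congr_ae ?_
      filter_upwards [ae_mem_cube d] with x hx
      rw [ef x hx]
  have bA : ∀ᵐ o ∂P, |o.A| ≤ K := hP.bounded.mono fun o ho =>
    abs_le.2 ⟨by linarith [ho.1.1], by linarith [ho.1.2]⟩
  have bY : ∀ᵐ o ∂P, |o.Y| ≤ K := hP.bounded.mono fun o ho =>
    abs_le.2 ⟨by linarith [ho.2.1], by linarith [ho.2.2]⟩
  have cA : P[Obs.A | Obs.sigmaX d] =ᵐ[P] fun o => (cube d).indicator p o.X := by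
    filter_upwards [hP.reg_p, hcov.mem_cube] with o h1 h2
    rw [h1, Set.indicator_of_mem h2]
  have cY : P[Obs.Y | Obs.sigmaX d] =ᵐ[P] fun o => (cube d).indicator b o.X := by
    filter_upwards [hP.reg_b, hcov.mem_cube] with o h1 h2
    rw [h1, Set.indicator_of_mem h2]
  have rA := regr_of_condExp hcov Obs.measurable_A bA Hp.bdd
    (fun x hx => (Hp.abs_le hα hM.le hx).trans (by linarith)) cA
  have rY := regr_of_condExp hcov Obs.measurable_Y bY Hb.bdd
    (fun x hx => (Hb.abs_le hβ hM.le hx).trans (by linarith)) cY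
  exact ⟨_, _, _, ⟨hcov, rA, rY, psi_eq hcov rA rY cA cY, Hp, Hb, Hf⟩, ef⟩

/-- Squared `L²` distance on the cube. -/
def sqDist {d : ℕ} (q f : (Fin d → ℝ) → ℝ) : ℝ := ∫ x in cube d, (q x - f x) ^ 2

theorem sqDist_nonneg (q f : (Fin d → ℝ) → ℝ) : 0 ≤ sqDist q f :=
  integral_nonneg fun _ => sq_nonneg _

theorem CubeBdd.abs_integral_mul_le_of_le {e u : (Fin d → ℝ) → ℝ} (he : CubeBdd e)
    (hu : CubeBdd u) {U T : ℝ} (hU0 : 0 ≤ U) (hU : ∀ x ∈ cube d, |u x| ≤ U)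
    (hT : ∫ x in cube d, e x ^ 2 ≤ T) : |∫ x in cube d, e x * u x| ≤ √T * U := by
  refine (he.abs_integral_mul_le hu).trans (mul_le_mul (Real.sqrt_le_sqrt hT) ?_
    (Real.sqrt_nonneg _) (Real.sqrt_nonneg _))
  rw [← Real.sqrt_sq hU0]
  exact Real.sqrt_le_sqrt (hu.integral_sq_le hU)

variable {P : Measure (Obs d)} {p b f q q₁ q₂ r w : (Fin d → ℝ) → ℝ} {K c₁ c₂ : ℝ}
  {Z : Obs d → ℝ} {j j₁ j₂ : ℕ}

/-- The mean of the regression estimator is the projection of `r f / f̂`. -/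
theorem Regr.integral_regMean_sub_proj_sq_le (hP : CovLaw P f K) (hZ : Regr P f K Z r)
    (hq : IsWeight c₁ c₂ q) (hj : W.J₀ ≤ j) :
    ∫ x in cube d, (regMean W q f j r x - W.proj j r x) ^ 2 ≤ (K / c₁) ^ 2 * sqDist q f := by
  have bq := hq.cubeBdd
  have b1 := hq.cubeBdd_div (hZ.bdd.mul hP.bdd)
  have h1 : ∀ x, regMean W q f j r x - W.proj j r x =
      W.proj j (fun x => r x * f x / q x - r x) x := fun x =>
    (projOn_sub (W.cubeBdd_Phi j) b1 hZ.bdd x).symm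
  simp_rw [h1]
  refine ((W.orthoFamily_Phi hj).integral_projOn_sq_le (b1.sub hZ.bdd)).trans ?_
  rw [sqDist, ← integral_const_mul]
  refine CubeBdd.integral_mono (b1.sub hZ.bdd).pow ((bq.sub hP.bdd).pow.const_mul _)
    fun x hx => ?_
  have h0 := (hq.mem x hx).1
  have hq0 : q x ≠ 0 := (hq.pos.trans_le h0).ne'
  have h2 : r x * f x / q x - r x = -(r x / q x) * (q x - f x) := by field_simp; ring
  rw [h2, mul_pow, neg_sq, ← sq_abs (r x / q x)]
  exact mul_le_mul_of_nonneg_right (pow_le_pow_left₀ (abs_nonneg _)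
    (hq.abs_div_le hx (hZ.abs_r_le x hx)) 2) (sq_nonneg _)

/-- Replacing `f̂` by the true density in the mean of the regression estimator. -/
theorem Regr.abs_integral_regMean_sub_proj_mul_le (hP : CovLaw P f K) (hZ : Regr P f K Z r)
    (hq : IsWeight c₁ c₂ q) (hj : W.J₀ ≤ j) {u : (Fin d → ℝ) → ℝ} (hu : CubeBdd u) {U : ℝ}
    (hU0 : 0 ≤ U) (hU : ∀ x ∈ cube d, |u x| ≤ U) :
    |∫ x in cube d, (regMean W q f j r x - W.proj j r x) * u x| ≤ K / c₁ * U * √(sqDist q f) := by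
  have h1 := ((W.cubeBdd_regMean q f j r).sub (W.cubeBdd_proj j r)).abs_integral_mul_le_of_le hu
    hU0 hU (hZ.integral_regMean_sub_proj_sq_le hP hq hj)
  rw [Real.sqrt_mul (sq_nonneg _), Real.sqrt_sq (div_nonneg hP.K_nonneg hq.pos.le)] at h1
  linarith

/-- The approximation errors that remain when the covariate density is known. -/
theorem exists_abs_integral_bias_le_both (hα : 0 < θ.α) (hβ : 0 < θ.β) (hαγ : θ.α ≤ θ.γ)
    (hβγ : θ.β ≤ θ.γ) (hγS : θ.γ < S) (hM : 0 ≤ θ.M) :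
    ∃ C, 0 ≤ C ∧ (∀ g f h : (Fin d → ℝ) → ℝ, W.HolderFn θ.α θ.M g → W.HolderFn θ.γ θ.M f →
      W.HolderFn θ.β θ.M h → ∀ j, W.J₀ ≤ j →
        |∫ x in cube d, g x * f x * (h x - W.proj j h x)| ≤ C * dw j (θ.α + θ.β)) ∧
      ∀ g f h : (Fin d → ℝ) → ℝ, W.HolderFn θ.β θ.M g → W.HolderFn θ.γ θ.M f →
      W.HolderFn θ.α θ.M h → ∀ j, W.J₀ ≤ j →
        |∫ x in cube d, g x * f x * (h x - W.proj j h x)| ≤ C * dw j (θ.α + θ.β) := by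
  obtain ⟨C, hC, H⟩ := W.exists_abs_integral_bias_le (d := d) hα hβ hαγ hγS hM
  obtain ⟨C', hC', H'⟩ := W.exists_abs_integral_bias_le (d := d) hβ hα hβγ hγS hM
  refine ⟨max C C', hC.trans (le_max_left _ _), fun g f h hg hf hh j hj => ?_,
    fun g f h hg hf hh j hj => ?_⟩
  · exact (H g f h hg hf hh j hj).trans
      (mul_le_mul_of_nonneg_right (le_max_left _ _) (dw_pos _ _).le)
  · refine (H' g f h hg hf hh j hj).trans ?_
    rw [add_comm θ.β]
    exact mul_le_mul_of_nonneg_right (le_max_right _ _) (dw_pos _ _).le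

/-- Bias of the plug-in estimators: the coarser projection dominates. -/
theorem exists_abs_bias_plugin_le (hα : 0 < θ.α) (hβ : 0 < θ.β) (hαγ : θ.α ≤ θ.γ)
    (hβγ : θ.β ≤ θ.γ) (hγS : θ.γ < S) (hM : 0 ≤ θ.M) (hK : 1 ≤ K) (hc₁ : 0 < c₁) :
    ∃ C, 0 ≤ C ∧ ∀ (P : Measure (Obs d)) (p b f q₁ q₂ w : (Fin d → ℝ) → ℝ) (j₁ j₂ : ℕ),
      ModelLaw W θ K P p b f → IsWeight c₁ c₂ q₁ → IsWeight c₁ c₂ q₂ → CubeBdd w →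
      W.J₀ ≤ j₁ → W.J₀ ≤ j₂ →
      |-(∫ x in cube d, p x * b x * f x) + ∫ x in cube d, (0 - regMean W q₁ f j₁ p x) *
        (0 - regMean W q₂ f j₂ b x) * w x| ≤
      C * (dw (min j₁ j₂) (θ.α + θ.β) + √(sqDist q₁ f) + √(sqDist q₂ f) + √(sqDist w f)) := by
  obtain ⟨C, hC, H1, H2⟩ := exists_abs_integral_bias_le_both (d := d) (W := W) hα hβ hαγ hβγ hγS hM
  have hA := W.A_pos d
  set T := W.A d * (K ^ 2 / c₁)
  have hT0 : 0 ≤ T := by positivity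
  refine ⟨2 * C + T * T + K / c₁ * (T * K) + K / c₁ * (W.A d * K * K), by positivity,
    fun P p b f q₁ q₂ w j₁ j₂ hP hq₁ hq₂ hw h₁ h₂ => ?_⟩
  set pt := regMean W q₁ f j₁ p
  set bt := regMean W q₂ f j₂ b
  have bpt : CubeBdd pt := W.cubeBdd_regMean _ _ _ _
  have bbt : CubeBdd bt := W.cubeBdd_regMean _ _ _ _
  have bP := W.cubeBdd_proj (d := d) j₁ p
  have bB := W.cubeBdd_proj (d := d) j₂ b
  have bp := hP.regA.bdd
  have bb := hP.regY.bdd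
  have bf := hP.cov.bdd
  have hpt : ∀ x ∈ cube d, |pt x| ≤ T := fun x hx => hP.regA.abs_regMean_le hP.cov hq₁ j₁ hx
  have hbt : ∀ x ∈ cube d, |bt x| ≤ T := fun x hx => hP.regY.abs_regMean_le hP.cov hq₂ j₂ hx
  have hPP : ∀ x ∈ cube d, |W.proj j₁ p x| ≤ W.A d * K := fun x hx =>
    W.abs_proj_le j₁ bp hP.regA.abs_r_le hx
  -- replace `w` by `f`, then the means by projections, then the projections by `p` and `b`
  have dec : -(∫ x in cube d, p x * b x * f x) + ∫ x in cube d, (0 - pt x) * (0 - bt x) * w x =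
      (∫ x in cube d, (w x - f x) * (pt x * bt x)) +
      (∫ x in cube d, (pt x - W.proj j₁ p x) * (bt x * f x)) +
      (∫ x in cube d, (bt x - W.proj j₂ b x) * (W.proj j₁ p x * f x)) -
      (∫ x in cube d, b x * f x * (p x - W.proj j₁ p x)) -
      ∫ x in cube d, W.proj j₁ p x * f x * (b x - W.proj j₂ b x) := by
    have i1 := (hw.sub bf).mul (bpt.mul bbt)
    have i2 := (bpt.sub bP).mul (bbt.mul bf)
    have i3 := (bbt.sub bB).mul (bP.mul bf)
    have i4 := (bb.mul bf).mul (bp.sub bP)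
    have i5 := (bP.mul bf).mul (bb.sub bB)
    rw [← integral_neg, ← integral_add ((bp.mul bb).mul bf).neg.integrable
      ((((CubeBdd.const 0).sub bpt).mul ((CubeBdd.const 0).sub bbt)).mul hw).integrable,
      ← integral_add i1.integrable i2.integrable, ← integral_add (i1.add i2).integrable
      i3.integrable, ← integral_sub ((i1.add i2).add i3).integrable i4.integrable,
      ← integral_sub (((i1.add i2).add i3).sub i4).integrable i5.integrable]
    exact integral_cube_congr fun x _ => by ring
  have k1 : |∫ x in cube d, (w x - f x) * (pt x * bt x)| ≤ √(sqDist w f) * (T * T) :=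
    (hw.sub bf).abs_integral_mul_le_of_le (bpt.mul bbt) (by positivity) (fun x hx => by
      rw [abs_mul]; exact mul_le_mul (hpt x hx) (hbt x hx) (abs_nonneg _) hT0) le_rfl
  have k2 := hP.regA.abs_integral_regMean_sub_proj_mul_le (W := W) hP.cov hq₁ h₁ (bbt.mul bf)
    (U := T * K) (by positivity) fun x hx => by
      rw [abs_mul]; exact mul_le_mul (hbt x hx) (hP.cov.abs_le hx) (abs_nonneg _) hT0
  have k3 := hP.regY.abs_integral_regMean_sub_proj_mul_le (W := W) hP.cov hq₂ h₂ (bP.mul bf)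
    (U := W.A d * K * K) (by positivity) fun x hx => by
      rw [abs_mul]
      exact mul_le_mul (hPP x hx) (hP.cov.abs_le hx) (abs_nonneg _) (by positivity)
  have k4 := H2 b f p hP.holder_b hP.holder_f hP.holder_p j₁ h₁
  have k5 := H1 _ f b (hP.holder_p.proj hM h₁) hP.holder_f hP.holder_b j₂ h₂
  have hs : 0 ≤ θ.α + θ.β := by positivity
  have d1 : C * dw j₁ (θ.α + θ.β) ≤ C * dw (min j₁ j₂) (θ.α + θ.β) :=
    mul_le_mul_of_nonneg_left (dw_anti_left (min_le_left _ _) hs) hC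
  have d2 : C * dw j₂ (θ.α + θ.β) ≤ C * dw (min j₁ j₂) (θ.α + θ.β) :=
    mul_le_mul_of_nonneg_left (dw_anti_left (min_le_right _ _) hs) hC
  rw [dec]
  have s0 := dw_pos (min j₁ j₂) (θ.α + θ.β)
  set X := √(sqDist q₁ f)
  set Y := √(sqDist q₂ f)
  set Z := √(sqDist w f)
  set V := dw (min j₁ j₂) (θ.α + θ.β)
  calc _ ≤ Z * (T * T) + K / c₁ * (T * K) * X + K / c₁ * (W.A d * K * K) * Y + C * V + C * V := by
        refine (abs_sub _ _).trans (add_le_add ((abs_sub _ _).trans (add_le_add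
          ((abs_add_three _ _ _).trans (add_le_add (add_le_add k1 k2) k3)) (k4.trans d1)))
          (k5.trans d2))
    _ ≤ _ := by
        set u := T * T
        set v := K / c₁ * (T * K)
        set t := K / c₁ * (W.A d * K * K)
        have e1 : 0 ≤ u * (V + X + Y) := by positivity
        have e2 : 0 ≤ v * (V + Y + Z) := by positivity
        have e3 : 0 ≤ t * (V + X + Z) := by positivity
        have e4 : 0 ≤ C * (X + Y + Z) := by positivity
        nlinarith

/-- Bias of the first-order corrected estimator: the finer projection dominates. -/
theorem exists_abs_bias_corrected_le (hα : 0 < θ.α) (hβ : 0 < θ.β) (hαγ : θ.α ≤ θ.γ)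
    (hβγ : θ.β ≤ θ.γ) (hγS : θ.γ < S) (hM : 0 ≤ θ.M) (hK : 1 ≤ K) (hc₁ : 0 < c₁) :
    ∃ C, 0 ≤ C ∧ ∀ (P : Measure (Obs d)) (p b f q₁ q₂ : (Fin d → ℝ) → ℝ) (j₁ j₂ : ℕ),
      ModelLaw W θ K P p b f → IsWeight c₁ c₂ q₁ → IsWeight c₁ c₂ q₂ → W.J₀ ≤ j₁ → W.J₀ ≤ j₂ →
      |∫ x in cube d, (p x - regMean W q₁ f j₁ p x) * (b x - regMean W q₂ f j₂ b x) * f x| ≤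
      C * (dw (max j₁ j₂) (θ.α + θ.β) + √(sqDist q₁ f) + √(sqDist q₂ f)) := by
  obtain ⟨C, hC, H1, H2⟩ := exists_abs_integral_bias_le_both (d := d) (W := W) hα hβ hαγ hβγ hγS hM
  have hA := W.A_pos d
  set T := W.A d * (K ^ 2 / c₁)
  refine ⟨2 * C + K / c₁ * ((K + T) * K) + K / c₁ * ((K + W.A d * K) * K), by positivity,
    fun P p b f q₁ q₂ j₁ j₂ hP hq₁ hq₂ h₁ h₂ => ?_⟩
  set pt := regMean W q₁ f j₁ p
  set bt := regMean W q₂ f j₂ b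
  have bpt : CubeBdd pt := W.cubeBdd_regMean _ _ _ _
  have bbt : CubeBdd bt := W.cubeBdd_regMean _ _ _ _
  have bP := W.cubeBdd_proj (d := d) j₁ p
  have bB := W.cubeBdd_proj (d := d) j₂ b
  have bp := hP.regA.bdd
  have bb := hP.regY.bdd
  have bf := hP.cov.bdd
  have hbt : ∀ x ∈ cube d, |bt x| ≤ T := fun x hx => hP.regY.abs_regMean_le hP.cov hq₂ j₂ hx
  have hPP : ∀ x ∈ cube d, |W.proj j₁ p x| ≤ W.A d * K := fun x hx =>
    W.abs_proj_le j₁ bp hP.regA.abs_r_le hx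
  have i1 := ((bp.sub bP).mul (bb.sub bB)).mul bf
  -- the means are replaced by projections, one factor at a time
  have dec : ∫ x in cube d, (p x - pt x) * (b x - bt x) * f x =
      (∫ x in cube d, (p x - W.proj j₁ p x) * (b x - W.proj j₂ b x) * f x) -
      (∫ x in cube d, (pt x - W.proj j₁ p x) * ((b x - bt x) * f x)) -
      ∫ x in cube d, (bt x - W.proj j₂ b x) * ((p x - W.proj j₁ p x) * f x) := by
    have i2 := (bpt.sub bP).mul ((bb.sub bbt).mul bf)
    have i3 := (bbt.sub bB).mul ((bp.sub bP).mul bf)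
    rw [← integral_sub i1.integrable i2.integrable, ← integral_sub (i1.sub i2).integrable
      i3.integrable]
    exact integral_cube_congr fun x _ => by ring
  -- only the error of the finer projection is used; the other factor stays in the Hölder ball
  have k1 : |∫ x in cube d, (p x - W.proj j₁ p x) * (b x - W.proj j₂ b x) *
      f x| ≤ 2 * C * dw (max j₁ j₂) (θ.α + θ.β) := by
    rcases le_total j₁ j₂ with h | h
    · rw [max_eq_right h]
      have a1 := H1 p f b hP.holder_p hP.holder_f hP.holder_b j₂ h₂
      have a2 := H1 _ f b (hP.holder_p.proj hM h₁) hP.holder_f hP.holder_b j₂ h₂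
      have a3 : ∫ x in cube d, (p x - W.proj j₁ p x) * (b x - W.proj j₂ b x) *
          f x = (∫ x in cube d, p x * f x * (b x - W.proj j₂ b x)) -
          ∫ x in cube d, W.proj j₁ p x * f x * (b x - W.proj j₂ b x) := by
        rw [← integral_sub ((bp.mul bf).mul (bb.sub bB)).integrable
          ((bP.mul bf).mul (bb.sub bB)).integrable]
        exact integral_cube_congr fun x _ => by ring
      rw [a3]
      exact (abs_sub _ _).trans (by linarith)
    · rw [max_eq_left h]
      have a1 := H2 b f p hP.holder_b hP.holder_f hP.holder_p j₁ h₁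
      have a2 := H2 _ f p (hP.holder_b.proj hM h₂) hP.holder_f hP.holder_p j₁ h₁
      have a3 : ∫ x in cube d, (p x - W.proj j₁ p x) * (b x - W.proj j₂ b x) *
          f x = (∫ x in cube d, b x * f x * (p x - W.proj j₁ p x)) -
          ∫ x in cube d, W.proj j₂ b x * f x * (p x - W.proj j₁ p x) := by
        rw [← integral_sub ((bb.mul bf).mul (bp.sub bP)).integrable
          ((bB.mul bf).mul (bp.sub bP)).integrable]
        exact integral_cube_congr fun x _ => by ring
      rw [a3]
      exact (abs_sub _ _).trans (by linarith)
  have k2 := hP.regA.abs_integral_regMean_sub_proj_mul_le (W := W) hP.cov hq₁ h₁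
    ((bb.sub bbt).mul bf) (U := (K + T) * K) (by positivity) fun x hx => by
      rw [abs_mul]
      exact mul_le_mul ((abs_sub _ _).trans (add_le_add (hP.regY.abs_r_le x hx) (hbt x hx)))
        (hP.cov.abs_le hx) (abs_nonneg _) (by positivity)
  have k3 := hP.regY.abs_integral_regMean_sub_proj_mul_le (W := W) hP.cov hq₂ h₂
    ((bp.sub bP).mul bf) (U := (K + W.A d * K) * K) (by positivity) fun x hx => by
      rw [abs_mul]
      exact mul_le_mul ((abs_sub _ _).trans (add_le_add (hP.regA.abs_r_le x hx) (hPP x hx)))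
        (hP.cov.abs_le hx) (abs_nonneg _) (by positivity)
  rw [dec]
  have s0 := dw_pos (max j₁ j₂) (θ.α + θ.β)
  set X := √(sqDist q₁ f)
  set Y := √(sqDist q₂ f)
  set V := dw (max j₁ j₂) (θ.α + θ.β)
  calc _ ≤ 2 * C * V + K / c₁ * ((K + T) * K) * X + K / c₁ * ((K + W.A d * K) * K) * Y :=
        (abs_sub _ _).trans (add_le_add ((abs_sub _ _).trans (add_le_add k1 k2)) k3)
    _ ≤ _ := by
        set v := K / c₁ * ((K + T) * K)
        set t := K / c₁ * ((K + W.A d * K) * K)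
        have e2 : 0 ≤ v * (V + Y) := by positivity
        have e3 : 0 ≤ t * (V + X) := by positivity
        have e4 : 0 ≤ C * (X + Y) := by positivity
        nlinarith

/-- Bias of the Newey-Robins estimator. -/
theorem exists_abs_bias_one_sided_le (hα : 0 < θ.α) (hβ : 0 < θ.β) (hαγ : θ.α ≤ θ.γ)
    (hβγ : θ.β ≤ θ.γ) (hγS : θ.γ < S) (hM : 0 ≤ θ.M) (hK : 1 ≤ K) (hc₁ : 0 < c₁) :
    ∃ C, 0 ≤ C ∧ ∀ (P : Measure (Obs d)) (p b f q : (Fin d → ℝ) → ℝ) (j : ℕ),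
      ModelLaw W θ K P p b f → IsWeight c₁ c₂ q → W.J₀ ≤ j →
      |-(∫ x in cube d, p x * b x * f x) + ∫ x in cube d, regMean W q f j b x * (p x * f x)| ≤
      C * (dw j (θ.α + θ.β) + √(sqDist q f)) := by
  obtain ⟨C, hC, H1, -⟩ := exists_abs_integral_bias_le_both (d := d) (W := W) hα hβ hαγ hβγ hγS hM
  refine ⟨C + K / c₁ * (K * K), by positivity, fun P p b f q j hP hq hj => ?_⟩
  set bt := regMean W q f j b
  have bbt : CubeBdd bt := W.cubeBdd_regMean _ _ _ _
  have bB := W.cubeBdd_proj (d := d) j b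
  have bp := hP.regA.bdd
  have bb := hP.regY.bdd
  have bf := hP.cov.bdd
  have dec : -(∫ x in cube d, p x * b x * f x) + ∫ x in cube d, bt x * (p x * f x) =
      (∫ x in cube d, (bt x - W.proj j b x) * (p x * f x)) -
      ∫ x in cube d, p x * f x * (b x - W.proj j b x) := by
    rw [← integral_neg, ← integral_add ((bp.mul bb).mul bf).neg.integrable
      (bbt.mul (bp.mul bf)).integrable, ← integral_sub ((bbt.sub bB).mul (bp.mul bf)).integrable
      ((bp.mul bf).mul (bb.sub bB)).integrable]
    exact integral_cube_congr fun x _ => by ring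
  have k1 := hP.regY.abs_integral_regMean_sub_proj_mul_le (W := W) hP.cov hq hj (bp.mul bf)
    (U := K * K) (by positivity) fun x hx => by
      rw [abs_mul]
      exact mul_le_mul (hP.regA.abs_r_le x hx) (hP.cov.abs_le hx) (abs_nonneg _) (by positivity)
  have k2 := H1 p f b hP.holder_p hP.holder_f hP.holder_b j hj
  rw [dec]
  have s0 := dw_pos j (θ.α + θ.β)
  have e1 : 0 ≤ C * √(sqDist q f) := by positivity
  have e2 : 0 ≤ K / c₁ * (K * K) * dw j (θ.α + θ.β) := by positivity
  refine (abs_sub _ _).trans ?_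
  linarith

end

/-! ### Risk of the estimators given the density estimates -/

theorem lintegral_sq_add_average_le {Ω : Type*} [MeasurableSpace Ω] {P : Measure Ω}
    [IsProbabilityMeasure P] {g : Ω → ℝ} (hg : MemLp g 2 P) {n : ℕ} (hn : 1 ≤ n) (c : ℝ) {B : ℝ}
    (hB : ∫ o, g o ^ 2 ∂P ≤ B) :
    ∫⁻ D, ofReal ((c + 1 / (n : ℝ) * ∑ i, g (D i)) ^ 2)
      ∂P^⊗n ≤ ofReal ((c + ∫ o, g o ∂P) ^ 2) + ofReal (1 / (n : ℝ) * B) := by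
  rw [lintegral_sq_add_average hg hn]
  refine (ofReal_le_ofReal ?_).trans ENNReal.ofReal_add_le
  refine add_le_add le_rfl (mul_le_mul_of_nonneg_left ?_ (by positivity))
  linarith [sq_nonneg (∫ o, g o ∂P)]

section

variable {S d n : ℕ} {W : CDVBasis S} {θ : ModelParams} {P : Measure (Obs d)}
  {p b f q q₁ q₂ w u v : (Fin d → ℝ) → ℝ} {K c₁ c₂ : ℝ} {j j₁ j₂ : ℕ}

theorem ModelLaw.memLp_AY (hP : ModelLaw W θ K P p b f) :
    MemLp (fun o : Obs d => o.A * o.Y) 2 P := by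
  have := hP.cov.prob
  refine MemLp.of_bound (hP.regA.meas.mul hP.regY.meas).aestronglyMeasurable (K * K) ?_
  filter_upwards [hP.regA.abs_le, hP.regY.abs_le] with o h1 h2
  rw [Real.norm_eq_abs, abs_mul]
  exact mul_le_mul h1 h2 (abs_nonneg _) hP.cov.K_nonneg

theorem ModelLaw.integral_AY_sq_le (hP : ModelLaw W θ K P p b f) :
    ∫ o, (o.A * o.Y) ^ 2 ∂P ≤ K ^ 4 := by
  have := hP.cov.prob
  have h1 : ∫ o, (o.A * o.Y) ^ 2 ∂P ≤ ∫ _o : Obs d, K ^ 4 ∂P := by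
    refine integral_mono_ae hP.memLp_AY.integrable_sq (integrable_const _) ?_
    filter_upwards [hP.regA.abs_le, hP.regY.abs_le] with o h1 h2
    have h3 : |o.A * o.Y| ≤ K * K := by
      rw [abs_mul]; exact mul_le_mul h1 h2 (abs_nonneg _) hP.cov.K_nonneg
    have h4 := pow_le_pow_left₀ (abs_nonneg _) h3 2
    rw [sq_abs] at h4
    exact h4.trans (le_of_eq (by ring))
  simpa using h1

theorem CovLaw.memLp_comp_X (hP : CovLaw P f K) (hu : CubeBdd u) :
    MemLp (fun o : Obs d => u o.X) 2 P := by
  have := hP.prob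
  obtain ⟨B, hB⟩ := hu.bdd
  exact MemLp.of_bound (hu.meas.comp Obs.measurable_X).aestronglyMeasurable B
    (hP.mem_cube.mono fun o ho => hB _ ho)

/-- Averaging over the last two subsamples of the Monte Carlo estimator, exactly. -/
theorem ModelLaw.lintegral_MC_eq (hP : ModelLaw W θ K P p b f) (hn : 1 ≤ n) (hu : CubeBdd u)
    (hv : CubeBdd v) :
    ∫⁻ D, ∫⁻ D', ofReal ((1 / (n : ℝ) * ∑ i, (D i).A * (D i).Y -
      1 / (n : ℝ) * ∑ i, u (D' i).X * v (D' i).X - _root_.psi P) ^ 2)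
      ∂P^⊗n ∂P^⊗n =
    ofReal ((-(∫ x in cube d, p x * b x * f x) + ∫ x in cube d, u x * v x * f x) ^ 2 +
      1 / (n : ℝ) * (∫ o, (o.A * o.Y) ^ 2 ∂P - (∫ o, o.A * o.Y ∂P) ^ 2)) +
    ofReal (1 / (n : ℝ) * ((∫ x in cube d, (u x * v x) ^ 2 * f x) -
      (∫ x in cube d, u x * v x * f x) ^ 2)) := by
  have := hP.cov.prob
  have huv := hu.mul hv
  have hg := hP.cov.memLp_comp_X huv.neg
  have i1 : ∫ o, -(u o.X * v o.X) ∂P = -∫ x in cube d, u x * v x * f x := by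
    rw [integral_neg, hP.cov.integral _ huv]
  have i2 : ∫ o, (-(u o.X * v o.X)) ^ 2 ∂P = ∫ x in cube d, (u x * v x) ^ 2 * f x := by
    simp_rw [neg_sq]
    exact hP.cov.integral _ huv.pow
  have h1 : ∀ D : Fin n → Obs d, ∫⁻ D', ofReal ((1 / (n : ℝ) * ∑ i, (D i).A * (D i).Y -
      1 / (n : ℝ) * ∑ i, u (D' i).X * v (D' i).X - _root_.psi P) ^ 2)
      ∂P^⊗n = ofReal (((-_root_.psi P - ∫ x in cube d, u x * v x * f x) +
        1 / (n : ℝ) * ∑ i, (D i).A * (D i).Y) ^ 2) +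
      ofReal (1 / (n : ℝ) * ((∫ x in cube d, (u x * v x) ^ 2 * f x) -
        (∫ x in cube d, u x * v x * f x) ^ 2)) := by
    intro D
    have h2 := lintegral_sq_add_average hg hn (1 / (n : ℝ) * ∑ i, (D i).A * (D i).Y - _root_.psi P)
    rw [i1, i2, ofReal_add (sq_nonneg _)] at h2
    · refine Eq.trans (lintegral_congr fun D' => ?_) (h2.trans ?_)
      · rw [Finset.sum_neg_distrib]; congr 2; ring
      · congr 3
        · ring
        · ring
    · rw [← i1, ← i2]
      refine mul_nonneg (by positivity) ?_
      have := ProbabilityTheory.variance_nonneg (fun o : Obs d => -(u o.X * v o.X)) P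
      rw [ProbabilityTheory.variance_eq_sub hg] at this
      simpa using this
  simp_rw [h1]
  rw [lintegral_add_right _ measurable_const, lintegral_const, measure_univ, mul_one,
    lintegral_sq_add_average hP.memLp_AY hn]
  congr 3
  rw [hP.psi]
  ring

theorem ModelLaw.lintegral_INT_le (hP : ModelLaw W θ K P p b f) (hn : 1 ≤ n) (I : ℝ) :
    ∫⁻ D, ofReal ((1 / (n : ℝ) * ∑ i, (D i).A * (D i).Y - I - _root_.psi P) ^ 2)
      ∂P^⊗n ≤ ofReal ((-(∫ x in cube d, p x * b x * f x) + I) ^ 2) +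
      ofReal (1 / (n : ℝ) * K ^ 4) := by
  have := hP.cov.prob
  have h1 := lintegral_sq_add_average_le hP.memLp_AY hn (-I - _root_.psi P) hP.integral_AY_sq_le
  refine Eq.trans_le (lintegral_congr fun D => ?_) (h1.trans (le_of_eq ?_))
  · congr 2; ring
  · congr 2
    rw [hP.psi]
    ring

/-- The bounds for the second moments at a point. -/
def momentBound (W : CDVBasis S) (d : ℕ) (K c₁ : ℝ) : ℝ :=
  2 * K ^ 2 + 2 * ((W.A d * (K ^ 2 / c₁)) ^ 2 + varFactor K c₁ * (3 * W.R * W.B ^ 2) ^ d)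

theorem momentBound_nonneg (hK : 0 ≤ K) : 0 ≤ momentBound W d K c₁ := by
  have hR := W.one_le_R
  have hB := W.one_le_B
  unfold momentBound varFactor
  positivity

theorem Regr.lintegral_moment_le {r : (Fin d → ℝ) → ℝ} {Z : Obs d → ℝ} (hP : CovLaw P f K)
    (hZ : Regr P f K Z r) (hq : IsWeight c₁ c₂ q) (hn : 1 ≤ n) (hj : W.J₀ ≤ j) {x : Fin d → ℝ}
    (hx : x ∈ cube d) :
    ∫⁻ D, ofReal (2 * K ^ 2 + 2 * regEst W q Z j D x ^ 2)
      ∂P^⊗n ≤ ofReal (momentBound W d K c₁ * (1 + res d j / n)) := by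
  have := hP.prob
  have hR := W.one_le_R
  have hB := W.one_le_B
  have hV := varFactor_nonneg hP c₁
  have h1 := hZ.lintegral_regEst_sq_le (W := W) hP hq hn hj hx
  set T := (W.A d * (K ^ 2 / c₁)) ^ 2 + varFactor K c₁ * (3 * W.R * W.B ^ 2) ^ d with hT
  have hr : 0 ≤ res d j / n := div_nonneg (res_pos d j).le (Nat.cast_nonneg n)
  have h2 : ∀ D : Fin n → Obs d, ofReal (2 * K ^ 2 + 2 * regEst W q Z j D x ^ 2) =
      ofReal (2 * K ^ 2) + 2 * ofReal (regEst W q Z j D x ^ 2) := by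
    intro D
    rw [ofReal_add (by positivity) (by positivity), ofReal_mul zero_le_two]
    simp
  simp_rw [h2]
  rw [lintegral_add_left measurable_const, lintegral_const, measure_univ, mul_one,
    lintegral_const_mul' _ _ (by simp)]
  refine (add_le_add le_rfl (mul_le_mul_right h1 2)).trans (le_of_eq_of_le (b :=
    ofReal (2 * K ^ 2 + 2 * (T * (1 + res d j / n)))) ?_ (ofReal_le_ofReal ?_))
  · rw [ofReal_add (by positivity) (by positivity), ofReal_mul zero_le_two]
    simp
  · rw [momentBound, ← hT]
    nlinarith [mul_nonneg (sq_nonneg K) hr]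

theorem CDVBasis.cubeBdd_moment (W : CDVBasis S) (c : ℝ) (q : (Fin d → ℝ) → ℝ) (Z : Obs d → ℝ)
    (j : ℕ) (D : Fin n → Obs d) :
    CubeBdd fun x => 2 * c ^ 2 + 2 * regEst W q Z j D x ^ 2 :=
  (CubeBdd.const _).add ((W.cubeBdd_regEst q Z j D).pow.const_mul 2)

theorem lintegral_lintegral_moment_le {r₁ r₂ : (Fin d → ℝ) → ℝ} {Z₁ Z₂ : Obs d → ℝ}
    (hP : CovLaw P f K) (hZ₁ : Regr P f K Z₁ r₁) (hZ₂ : Regr P f K Z₂ r₂)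
    (hq₁ : IsWeight c₁ c₂ q₁) (hq₂ : IsWeight c₁ c₂ q₂) (hn : 1 ≤ n) (h₁ : W.J₀ ≤ j₁)
    (h₂ : W.J₀ ≤ j₂) :
    ∫⁻ D, ∫⁻ D', ofReal (∫ x in cube d, (2 * K ^ 2 + 2 * regEst W q₁ Z₁ j₁ D x ^ 2) *
      (2 * K ^ 2 + 2 * regEst W q₂ Z₂ j₂ D' x ^ 2) * f x)
      ∂P^⊗n ∂P^⊗n ≤
    ofReal (momentBound W d K c₁ ^ 2 * K * ((1 + res d j₁ / n) * (1 + res d j₂ / n))) := by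
  have := hP.prob
  have hK := hP.K_nonneg
  have hm := momentBound_nonneg (W := W) (d := d) (c₁ := c₁) hK
  have hr₁ : 0 ≤ res d j₁ / n := div_nonneg (res_pos d j₁).le (Nat.cast_nonneg n)
  rw [lintegral_lintegral_integral_mul (W := W) (P := P) (F₁ := fun t => 2 * K ^ 2 + 2 * t ^ 2)
    (F₂ := fun t => 2 * K ^ 2 + 2 * t ^ 2) hZ₁.meas hZ₂.meas hq₁.meas hq₂.meas (by fun_prop)
    (by fun_prop) (fun t => by positivity) (fun t => by positivity) hP.bdd.meas hP.nonneg
    fun D D' => ((W.cubeBdd_moment K q₁ Z₁ j₁ D).mul (W.cubeBdd_moment K q₂ Z₂ j₂ D')).mul hP.bdd]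
  have h1 : ∀ᵐ x ∂cubeMeasure d, (∫⁻ D, ofReal (2 * K ^ 2 + 2 * regEst W q₁ Z₁ j₁ D x ^ 2)
        ∂P^⊗n) * (∫⁻ D, ofReal (2 * K ^ 2 + 2 * regEst W q₂ Z₂ j₂ D x ^ 2)
        ∂P^⊗n) * ofReal (f x) ≤ ofReal (momentBound W d K c₁ ^ 2 * K *
        ((1 + res d j₁ / n) * (1 + res d j₂ / n))) := by
    filter_upwards [ae_mem_cube d] with x hx
    refine (mul_le_mul' (mul_le_mul' (hZ₁.lintegral_moment_le hP hq₁ hn h₁ hx)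
      (hZ₂.lintegral_moment_le hP hq₂ hn h₂ hx)) (ofReal_le_ofReal (hP.le x hx))).trans ?_
    rw [← ofReal_mul (by positivity), ← ENNReal.ofReal_mul' hK]
    exact ofReal_le_ofReal (le_of_eq (by ring))
  refine (lintegral_mono_ae h1).trans ?_
  rw [lintegral_const, measure_univ, mul_one]

theorem Regr.lintegral_integral_moment_le {r : (Fin d → ℝ) → ℝ} {Z : Obs d → ℝ}
    (hP : CovLaw P f K) (hZ : Regr P f K Z r) (hq : IsWeight c₁ c₂ q) (hn : 1 ≤ n)
    (hj : W.J₀ ≤ j) :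
    ∫⁻ D, ofReal (∫ x in cube d, (2 * K ^ 2 + 2 * regEst W q Z j D x ^ 2) * f x) ∂P^⊗n ≤
    ofReal (momentBound W d K c₁ * K * (1 + res d j / n)) := by
  have := hP.prob
  have hK := hP.K_nonneg
  have h0 := lintegral_lintegral_integral_mul (W := W) (P := P) (n := n) (j₁ := j) (j₂ := j)
    (F₁ := fun _ => 1)
    (F₂ := fun t => 2 * K ^ 2 + 2 * t ^ 2) hZ.meas hZ.meas hq.meas hq.meas (by fun_prop)
    (by fun_prop) (fun t => zero_le_one) (fun t => by positivity) hP.bdd.meas hP.nonneg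
    fun D D' => ((CubeBdd.const 1).mul (W.cubeBdd_moment K q Z j D')).mul hP.bdd
  simp only [one_mul, lintegral_const, measure_univ, mul_one, ENNReal.ofReal_one] at h0
  rw [h0]
  have h1 : ∀ᵐ x ∂cubeMeasure d, (∫⁻ D, ofReal (2 * K ^ 2 + 2 * regEst W q Z j D x ^ 2)
        ∂P^⊗n) * ofReal (f x) ≤ ofReal (momentBound W d K c₁ * K * (1 + res d j / n)) := by
    filter_upwards [ae_mem_cube d] with x hx
    refine (mul_le_mul' (hZ.lintegral_moment_le hP hq hn hj hx)
      (ofReal_le_ofReal (hP.le x hx))).trans ?_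
    rw [← ENNReal.ofReal_mul' hK]
    exact ofReal_le_ofReal (le_of_eq (by ring))
  refine (lintegral_mono_ae h1).trans ?_
  rw [lintegral_const, measure_univ, mul_one]

theorem ModelLaw.lintegral_NR_le (hP : ModelLaw W θ K P p b f) (hn : 1 ≤ n) (hv : CubeBdd v) :
    ∫⁻ D, ofReal ((1 / (n : ℝ) * ∑ i, (D i).A * ((D i).Y - v (D i).X) - _root_.psi P) ^ 2)
      ∂P^⊗n ≤ ofReal ((-(∫ x in cube d, p x * b x * f x) + ∫ x in cube d, v x * (p x * f x)) ^ 2) +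
      ofReal (1 / (n : ℝ) * (K ^ 2 * ∫ x in cube d, (2 * K ^ 2 + 2 * v x ^ 2) * f x)) := by
  have := hP.cov.prob
  have m1 := hP.regA.memLp hP.cov hv
  have m2 : MemLp (fun o : Obs d => o.A * (o.Y - v o.X)) 2 P := by
    convert hP.memLp_AY.sub m1 using 1
    ext o; simp [mul_sub]
  have bG : CubeBdd fun x => K ^ 2 * (2 * K ^ 2 + 2 * v x ^ 2) :=
    ((CubeBdd.const _).add (hv.pow.const_mul 2)).const_mul _
  have h2 : ∫ o, (o.A * (o.Y - v o.X)) ^ 2 ∂P ≤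
      K ^ 2 * ∫ x in cube d, (2 * K ^ 2 + 2 * v x ^ 2) * f x := by
    have h3 := hP.cov.integral _ bG
    rw [← integral_const_mul]
    simp_rw [← mul_assoc]
    rw [← h3]
    refine integral_mono_ae m2.integrable_sq (integrable_comp_X hP.cov.mem_cube bG) ?_
    filter_upwards [hP.regA.abs_le, hP.regY.abs_le] with o h4 h5
    rw [mul_pow]
    have h6 : o.A ^ 2 ≤ K ^ 2 := sq_le_sq' (by linarith [(abs_le.1 h4).1]) (abs_le.1 h4).2
    have h7 : o.Y ^ 2 ≤ K ^ 2 := sq_le_sq' (by linarith [(abs_le.1 h5).1]) (abs_le.1 h5).2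
    refine mul_le_mul h6 ?_ (sq_nonneg _) (sq_nonneg _)
    nlinarith [sq_nonneg (o.Y + v o.X)]
  have h1 := lintegral_sq_add_average_le m2 hn (-_root_.psi P) h2
  refine Eq.trans_le (lintegral_congr fun D => ?_) (h1.trans (le_of_eq ?_))
  · congr 2; ring
  · congr 2
    have h8 : ∫ o, o.A * (o.Y - v o.X) ∂P = ∫ o, o.A * o.Y ∂P - ∫ x in cube d, p x * v x * f x := by
      simp_rw [mul_sub]
      rw [integral_sub (hP.memLp_AY.integrable one_le_two) (m1.integrable one_le_two),
        hP.regA.integral _ hv]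
    have h9 : ∫ x in cube d, v x * (p x * f x) = ∫ x in cube d, p x * v x * f x :=
      integral_cube_congr fun x _ => by ring
    rw [h8, hP.psi, h9]
    ring

theorem ModelLaw.lintegral_IF_le (hP : ModelLaw W θ K P p b f) (hn : 1 ≤ n) (hu : CubeBdd u)
    (hv : CubeBdd v) :
    ∫⁻ D, ofReal ((1 / (n : ℝ) * ∑ i, ((D i).A - u (D i).X) * ((D i).Y - v (D i).X) -
      _root_.psi P) ^ 2) ∂P^⊗n ≤ ofReal ((0 + ∫ x in cube d, (p x - u x) * (b x - v x) * f x) ^ 2) +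
      ofReal (1 / (n : ℝ) *
        ∫ x in cube d, (2 * K ^ 2 + 2 * u x ^ 2) * (2 * K ^ 2 + 2 * v x ^ 2) * f x) := by
  have := hP.cov.prob
  have m1 := hP.regA.memLp hP.cov hv
  have m3 := hP.regY.memLp hP.cov hu
  have m4 := hP.cov.memLp_comp_X (hu.mul hv)
  have m2 : MemLp (fun o : Obs d => (o.A - u o.X) * (o.Y - v o.X)) 2 P := by
    convert (hP.memLp_AY.sub m1).sub (m3.sub m4) using 1
    ext o; simp; ring
  have bG : CubeBdd fun x => (2 * K ^ 2 + 2 * u x ^ 2) * (2 * K ^ 2 + 2 * v x ^ 2) :=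
    ((CubeBdd.const _).add (hu.pow.const_mul 2)).mul ((CubeBdd.const _).add (hv.pow.const_mul 2))
  have h2 : ∫ o, ((o.A - u o.X) * (o.Y - v o.X)) ^ 2 ∂P ≤
      ∫ x in cube d, (2 * K ^ 2 + 2 * u x ^ 2) * (2 * K ^ 2 + 2 * v x ^ 2) * f x := by
    rw [← hP.cov.integral _ bG]
    refine integral_mono_ae m2.integrable_sq (integrable_comp_X hP.cov.mem_cube bG) ?_
    filter_upwards [hP.regA.abs_le, hP.regY.abs_le] with o h4 h5
    rw [mul_pow]
    have h6 : o.A ^ 2 ≤ K ^ 2 := sq_le_sq' (by linarith [(abs_le.1 h4).1]) (abs_le.1 h4).2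
    have h7 : o.Y ^ 2 ≤ K ^ 2 := sq_le_sq' (by linarith [(abs_le.1 h5).1]) (abs_le.1 h5).2
    refine mul_le_mul ?_ ?_ (sq_nonneg _) (by positivity)
    · nlinarith [sq_nonneg (o.A + u o.X)]
    · nlinarith [sq_nonneg (o.Y + v o.X)]
  have h1 := lintegral_sq_add_average_le m2 hn (-_root_.psi P) h2
  refine Eq.trans_le (lintegral_congr fun D => ?_) (h1.trans (le_of_eq ?_))
  · congr 2; ring
  · congr 3
    have e1 : ∀ o : Obs d, (o.A - u o.X) * (o.Y - v o.X) =
        (o.A * o.Y - o.A * v o.X) - (o.Y * u o.X - u o.X * v o.X) := fun o => by ring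
    have bp := hP.regA.bdd
    have bb := hP.regY.bdd
    have bf := hP.cov.bdd
    have e2 : ∫ x in cube d, (p x - u x) * (b x - v x) * f x =
        ((∫ x in cube d, p x * b x * f x) - ∫ x in cube d, p x * v x * f x) -
        ((∫ x in cube d, b x * u x * f x) - ∫ x in cube d, u x * v x * f x) := by
      rw [← integral_sub ((bp.mul bb).mul bf).integrable ((bp.mul hv).mul bf).integrable,
        ← integral_sub ((bb.mul hu).mul bf).integrable ((hu.mul hv).mul bf).integrable,
        ← integral_sub (((bp.mul bb).mul bf).sub ((bp.mul hv).mul bf)).integrable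
          (((bb.mul hu).mul bf).sub ((hu.mul hv).mul bf)).integrable]
      exact integral_cube_congr fun x _ => by ring
    have i1 := hP.memLp_AY.integrable one_le_two
    have i2 := m1.integrable one_le_two
    have i3 := m3.integrable one_le_two
    have i4 := m4.integrable one_le_two
    simp_rw [e1]
    rw [integral_sub (f := fun o : Obs d => o.A * o.Y - o.A * v o.X)
      (g := fun o : Obs d => o.Y * u o.X - u o.X * v o.X) (i1.sub i2) (i3.sub i4),
      integral_sub i1 i2, integral_sub i3 i4,
      hP.regA.integral _ hv, hP.regY.integral _ hu, hP.cov.integral _ (hu.mul hv), e2, hP.psi]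
    ring

end

theorem lintegral_lintegral_add_le {Ω : Type*} [MeasurableSpace Ω] {μ : Measure Ω}
    [IsProbabilityMeasure μ] {F G : Ω → Ω → ℝ≥0∞} {a b c c' : ℝ≥0∞}
    (hG : Measurable fun z : Ω × Ω => G z.1 z.2) (hF : ∫⁻ D, ∫⁻ D', F D D' ∂μ ∂μ ≤ a)
    (hG' : ∫⁻ D, ∫⁻ D', G D D' ∂μ ∂μ ≤ b) :
    ∫⁻ D, ∫⁻ D', (F D D' + (c + c' * G D D')) ∂μ ∂μ ≤ a + (c + c' * b) := by
  have h1 : ∀ D, ∫⁻ D', (F D D' + (c + c' * G D D')) ∂μ =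
      ∫⁻ D', F D D' ∂μ + (c + c' * ∫⁻ D', G D D' ∂μ) := fun D => by
    have : Measurable (G D) := hG.comp (measurable_const.prodMk measurable_id)
    rw [lintegral_add_right _ (by fun_prop), lintegral_add_left measurable_const,
      lintegral_const_mul _ this, lintegral_const, measure_univ, mul_one]
  have h2 : Measurable fun D => ∫⁻ D', G D D' ∂μ := Measurable.lintegral_prod_right' hG
  simp_rw [h1]
  rw [lintegral_add_right _ (by fun_prop), lintegral_add_left measurable_const,
    lintegral_const_mul _ h2, lintegral_const, measure_univ, mul_one]
  gcongr

theorem sq_le_of_abs_le_sum {B C V x y z : ℝ} (hC : 0 ≤ C) (hx : 0 ≤ x) (hy : 0 ≤ y) (hz : 0 ≤ z)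
    (h : |B| ≤ C * (V + √x + √y + √z)) : B ^ 2 ≤ 4 * C ^ 2 * (V ^ 2 + x + y + z) := by
  have h1 := pow_le_pow_left₀ (abs_nonneg _) h 2
  rw [sq_abs, mul_pow] at h1
  have h2 : (V + √x + √y + √z) ^ 2 ≤ 4 * (V ^ 2 + x + y + z) := by
    have e1 := Real.sq_sqrt hx
    have e2 := Real.sq_sqrt hy
    have e3 := Real.sq_sqrt hz
    nlinarith [sq_nonneg (V - √x), sq_nonneg (V - √y), sq_nonneg (V - √z), sq_nonneg (√x - √y),
      sq_nonneg (√x - √z), sq_nonneg (√y - √z)]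
  calc B ^ 2 ≤ C ^ 2 * (V + √x + √y + √z) ^ 2 := h1
    _ ≤ C ^ 2 * (4 * (V ^ 2 + x + y + z)) := mul_le_mul_of_nonneg_left h2 (sq_nonneg _)
    _ = _ := by ring

section

variable {S d : ℕ} {W : CDVBasis S} {θ : ModelParams} {K c₁ c₂ : ℝ}

theorem CDVBasis.measurable_integral_moment (W : CDVBasis S) {n : ℕ} {q₁ q₂ f : (Fin d → ℝ) → ℝ}
    {Z₁ Z₂ : Obs d → ℝ} (j₁ j₂ : ℕ) (hZ₁ : Measurable Z₁) (hZ₂ : Measurable Z₂)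
    (hq₁ : Measurable q₁) (hq₂ : Measurable q₂) (hf : Measurable f) (c : ℝ) :
    Measurable fun z : (Fin n → Obs d) × (Fin n → Obs d) => ofReal (∫ x in cube d,
      (2 * c ^ 2 + 2 * regEst W q₁ Z₁ j₁ z.1 x ^ 2) *
      (2 * c ^ 2 + 2 * regEst W q₂ Z₂ j₂ z.2 x ^ 2) * f x) := by
  have h1 := W.measurable_regEst (n := n) (j := j₁) hZ₁ hq₁
  have h2 := W.measurable_regEst (n := n) (j := j₂) hZ₂ hq₂
  have h4 : Measurable fun y : ((Fin n → Obs d) × (Fin n → Obs d)) × (Fin d → ℝ) =>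
      regEst W q₂ Z₂ j₂ y.1.2 y.2 :=
    h2.comp ((measurable_snd.comp measurable_fst).prodMk measurable_snd)
  have h5 : Measurable fun y : ((Fin n → Obs d) × (Fin n → Obs d)) × (Fin d → ℝ) =>
      (2 * c ^ 2 + 2 * regEst W q₁ Z₁ j₁ y.1.1 y.2 ^ 2) *
      (2 * c ^ 2 + 2 * regEst W q₂ Z₂ j₂ y.1.2 y.2 ^ 2) * f y.2 := by fun_prop
  exact (h5.stronglyMeasurable.integral_prod_right' (ν := cubeMeasure d)).measurable.ennreal_ofReal

theorem one_add_min_div_le {n j₁ j₂ : ℕ} :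
    1 + min (res d j₁) (res d j₂) / (n : ℝ) ≤ (1 + res d j₁ / n) * (1 + res d j₂ / n) := by
  have h1 : 0 ≤ res d j₁ / n := div_nonneg (res_pos d j₁).le (Nat.cast_nonneg n)
  have h2 : 0 ≤ res d j₂ / n := div_nonneg (res_pos d j₂).le (Nat.cast_nonneg n)
  have h3 : min (res d j₁) (res d j₂) / (n : ℝ) ≤ res d j₁ / n :=
    div_le_div_of_nonneg_right (min_le_left _ _) (Nat.cast_nonneg n)
  nlinarith [mul_nonneg h1 h2]

/-- Risk of the Monte Carlo estimator given the density estimates. -/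
theorem exists_lintegral_MC_le (hα : 0 < θ.α) (hβ : 0 < θ.β) (hαγ : θ.α ≤ θ.γ)
    (hβγ : θ.β ≤ θ.γ) (hγS : θ.γ < S) (hM : 0 ≤ θ.M) (hK : 1 ≤ K) (hc₁ : 0 < c₁) :
    ∃ C, 0 ≤ C ∧ ∀ (P : Measure (Obs d)) (p b f q₁ q₂ : (Fin d → ℝ) → ℝ) (n j₁ j₂ : ℕ),
      ModelLaw W θ K P p b f → IsWeight c₁ c₂ q₁ → IsWeight c₁ c₂ q₂ → 1 ≤ n →
      W.J₀ ≤ j₁ → W.J₀ ≤ j₂ →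
      ∫⁻ D₀, ∫⁻ D₂, ∫⁻ D₄, ∫⁻ D₅, ofReal ((1 / (n : ℝ) * ∑ i, (D₄ i).A * (D₄ i).Y -
        1 / (n : ℝ) * ∑ i, regEst W q₁ Obs.A j₁ D₀ (D₅ i).X *
          regEst W q₂ Obs.Y j₂ D₂ (D₅ i).X - psi P) ^ 2)
        ∂P^⊗n ∂P^⊗n ∂P^⊗n ∂P^⊗n ≤ ofReal (C * (dw (min j₁ j₂) (θ.α + θ.β) ^ 2 +
        1 / n * ((1 + res d j₁ / n) * (1 + res d j₂ / n)) + sqDist q₁ f + sqDist q₂ f)) := by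
  obtain ⟨C, hC, H⟩ := exists_abs_bias_plugin_le (d := d) (W := W) (c₂ := c₂) hα hβ hαγ hβγ hγS hM
    hK hc₁
  have hA := W.A_pos d
  have hV : 0 ≤ varFactor K c₁ := mul_nonneg (by linarith) (sq_nonneg _)
  set C1 := varFactor K c₁ * (2 * ((K + W.A d * (K ^ 2 / c₁)) * K) ^ 2 + varFactor K c₁ * K ^ 2)
  refine ⟨4 * C ^ 2 + (C1 + K ^ 4 + momentBound W d K c₁ ^ 2 * K), by positivity,
    fun P p b f q₁ q₂ n j₁ j₂ hP hq₁ hq₂ hn h₁ h₂ => ?_⟩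
  have := hP.cov.prob
  have b1 := W.cubeBdd_regEst (n := n) q₁ Obs.A j₁
  have b2 := W.cubeBdd_regEst (n := n) q₂ Obs.Y j₂
  have bf := hP.cov.bdd
  set r := (1 + res d j₁ / n) * (1 + res d j₂ / n)
  have hn0 : (0 : ℝ) ≤ 1 / n := by positivity
  have hr₁ : 0 ≤ res d j₁ / n := div_nonneg (res_pos d j₁).le (Nat.cast_nonneg n)
  have hr₂ : 0 ≤ res d j₂ / n := div_nonneg (res_pos d j₂).le (Nat.cast_nonneg n)
  have hr1 : 1 ≤ r := by nlinarith [mul_nonneg hr₁ hr₂]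
  -- integrate the last two subsamples
  have s1 : ∀ D₀ D₂ : Fin n → Obs d, ∫⁻ D₄, ∫⁻ D₅, ofReal ((1 / (n : ℝ) * ∑ i, (D₄ i).A * (D₄ i).Y -
        1 / (n : ℝ) * ∑ i, regEst W q₁ Obs.A j₁ D₀ (D₅ i).X *
          regEst W q₂ Obs.Y j₂ D₂ (D₅ i).X - psi P) ^ 2)
        ∂P^⊗n ∂P^⊗n ≤ ofReal ((-(∫ x in cube d, p x * b x * f x) + ∫ x in cube d,
        (0 - regEst W q₁ Obs.A j₁ D₀ x) * (0 - regEst W q₂ Obs.Y j₂ D₂ x) *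
          f x) ^ 2) + (ofReal (1 / n * K ^ 4) + ofReal (1 / n) * ofReal (∫ x in cube d,
        (2 * K ^ 2 + 2 * regEst W q₁ Obs.A j₁ D₀ x ^ 2) *
        (2 * K ^ 2 + 2 * regEst W q₂ Obs.Y j₂ D₂ x ^ 2) * f x)) := by
    intro D₀ D₂
    rw [hP.lintegral_MC_eq hn (b1 D₀) (b2 D₂), ← ofReal_mul hn0, ← add_assoc]
    simp only [zero_sub, neg_mul_neg]
    refine add_le_add ?_ (ofReal_le_ofReal (mul_le_mul_of_nonneg_left ?_ hn0))
    · refine (ofReal_le_ofReal ?_).trans ENNReal.ofReal_add_le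
      refine add_le_add le_rfl (mul_le_mul_of_nonneg_left ?_ hn0)
      linarith [hP.integral_AY_sq_le, sq_nonneg (∫ o, o.A * o.Y ∂P)]
    · refine (sub_le_self _ (sq_nonneg _)).trans ?_
      refine CubeBdd.integral_mono (((b1 D₀).mul (b2 D₂)).pow.mul bf)
        (((W.cubeBdd_moment K q₁ Obs.A j₁ D₀).mul (W.cubeBdd_moment K q₂ Obs.Y j₂ D₂)).mul bf)
        fun x hx => mul_le_mul_of_nonneg_right ?_ (hP.cov.nonneg x hx)
      rw [mul_pow]
      exact mul_le_mul (by nlinarith [sq_nonneg (regEst W q₁ Obs.A j₁ D₀ x)])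
        (by nlinarith [sq_nonneg (regEst W q₂ Obs.Y j₂ D₂ x)]) (sq_nonneg _)
        (by positivity)
  refine (lintegral_mono fun D₀ => lintegral_mono fun D₂ => s1 D₀ D₂).trans ?_
  have s2 := hP.regA.lintegral_bilinear_sq_le (W := W) (p₀ := fun _ => 0) (b₀ := fun _ => 0) (L := K)
    hP.cov hP.regY hq₁ hq₂ hn h₁ h₂ (CubeBdd.const 0) (fun x _ => by rw [abs_zero]; linarith) (CubeBdd.const 0)
    (fun x _ => by rw [abs_zero]; linarith) bf (fun x hx => hP.cov.abs_le hx) (-(∫ x in cube d, p x * b x * f x))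
  have s3 := lintegral_lintegral_moment_le (W := W) hP.cov hP.regA hP.regY hq₁ hq₂ hn h₁ h₂
  refine (lintegral_lintegral_add_le (W.measurable_integral_moment j₁ j₂ hP.regA.meas hP.regY.meas
    hq₁.meas hq₂.meas bf.meas K) s2 s3).trans ?_
  have hB := H P p b f q₁ q₂ f j₁ j₂ hP hq₁ hq₂ bf h₁ h₂
  have hB2 := sq_le_of_abs_le_sum hC (sqDist_nonneg q₁ f) (sqDist_nonneg q₂ f)
    (sqDist_nonneg f f) hB
  have hff : sqDist f f = 0 := by simp [sqDist]
  rw [hff, add_zero] at hB2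
  have n1 := sqDist_nonneg q₁ f
  have n2 := sqDist_nonneg q₂ f
  have hmin : 0 ≤ min (res d j₁) (res d j₂) / (n : ℝ) :=
    div_nonneg (le_min (res_pos d j₁).le (res_pos d j₂).le) (Nat.cast_nonneg n)
  rw [← ofReal_mul hn0, ← ofReal_add (by positivity) (by positivity),
    ← ofReal_add (by positivity) (by positivity)]
  refine ofReal_le_ofReal ?_
  have t1 : C1 * (1 / n * (1 + min (res d j₁) (res d j₂) / n)) ≤ C1 * (1 / n * r) :=
    mul_le_mul_of_nonneg_left (mul_le_mul_of_nonneg_left one_add_min_div_le hn0) (by positivity)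
  have t2 : 1 / n * K ^ 4 ≤ K ^ 4 * (1 / n * r) := by
    have : 1 / (n : ℝ) * 1 ≤ 1 / n * r := mul_le_mul_of_nonneg_left hr1 hn0
    nlinarith [pow_nonneg (zero_le_one.trans hK) 4]
  have t3 : 0 ≤ (C1 + K ^ 4 + momentBound W d K c₁ ^ 2 * K) *
      (dw (min j₁ j₂) (θ.α + θ.β) ^ 2 + sqDist q₁ f + sqDist q₂ f) := by positivity
  have t4 : 0 ≤ 4 * C ^ 2 * (1 / n * r) := by positivity
  linarith

/-- Risk of the integral-based estimator given the density estimates. -/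
theorem exists_lintegral_INT_le (hα : 0 < θ.α) (hβ : 0 < θ.β) (hαγ : θ.α ≤ θ.γ)
    (hβγ : θ.β ≤ θ.γ) (hγS : θ.γ < S) (hM : 0 ≤ θ.M) (hK : 1 ≤ K) (hc₁ : 0 < c₁) :
    ∃ C, 0 ≤ C ∧ ∀ (P : Measure (Obs d)) (p b f q₁ q₂ w : (Fin d → ℝ) → ℝ) (n j₁ j₂ : ℕ),
      ModelLaw W θ K P p b f → IsWeight c₁ c₂ q₁ → IsWeight c₁ c₂ q₂ → IsWeight c₁ c₂ w → 1 ≤ n →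
      W.J₀ ≤ j₁ → W.J₀ ≤ j₂ → ∫⁻ D₀, ∫⁻ D₂, ∫⁻ D₄, ofReal ((1 / (n : ℝ) * ∑ i, (D₄ i).A * (D₄ i).Y -
        (∫ x in cube d, regEst W q₁ Obs.A j₁ D₀ x * regEst W q₂ Obs.Y j₂ D₂ x * w x) - psi P) ^ 2)
        ∂P^⊗n ∂P^⊗n ∂P^⊗n ≤ ofReal (C * (dw (min j₁ j₂) (θ.α + θ.β) ^ 2 +
        1 / n * (1 + min (res d j₁) (res d j₂) / n) + sqDist q₁ f + sqDist q₂ f + sqDist w f)) := by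
  obtain ⟨C, hC, H⟩ := exists_abs_bias_plugin_le (d := d) (W := W) (c₂ := c₂) hα hβ hαγ hβγ hγS hM
    hK hc₁
  have hV : 0 ≤ varFactor K c₁ := mul_nonneg (by linarith) (sq_nonneg _)
  set L := |c₂| with hL
  set C1 := varFactor K c₁ * (2 * ((L + W.A d * (K ^ 2 / c₁)) * L) ^ 2 + varFactor K c₁ * L ^ 2)
  refine ⟨4 * C ^ 2 + (C1 + K ^ 4), by positivity,
    fun P p b f q₁ q₂ w n j₁ j₂ hP hq₁ hq₂ hw hn h₁ h₂ => ?_⟩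
  have := hP.cov.prob
  set r := 1 + min (res d j₁) (res d j₂) / (n : ℝ)
  have hn0 : (0 : ℝ) ≤ 1 / n := by positivity
  have hmin : 0 ≤ min (res d j₁) (res d j₂) / (n : ℝ) :=
    div_nonneg (le_min (res_pos d j₁).le (res_pos d j₂).le) (Nat.cast_nonneg n)
  have s1 : ∀ D₀ D₂ : Fin n → Obs d, ∫⁻ D₄, ofReal ((1 / (n : ℝ) *
        ∑ i, (D₄ i).A * (D₄ i).Y - (∫ x in cube d, regEst W q₁ Obs.A j₁ D₀ x *
          regEst W q₂ Obs.Y j₂ D₂ x * w x) - psi P) ^ 2)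
        ∂P^⊗n ≤ ofReal ((-(∫ x in cube d, p x * b x * f x) + ∫ x in cube d,
        (0 - regEst W q₁ Obs.A j₁ D₀ x) * (0 - regEst W q₂ Obs.Y j₂ D₂ x) *
          w x) ^ 2) + (ofReal (1 / n * K ^ 4) + 0 * 0) := by
    intro D₀ D₂
    rw [mul_zero, add_zero]
    simp only [zero_sub, neg_mul_neg]
    exact hP.lintegral_INT_le hn _
  refine (lintegral_mono fun D₀ => lintegral_mono fun D₂ => s1 D₀ D₂).trans ?_
  have hwL : ∀ x ∈ cube d, |w x| ≤ L := fun x hx => by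
    have h1 := hw.mem x hx
    have h2 := hw.pos.trans_le h1.1
    rw [abs_of_pos h2]
    exact h1.2.trans (le_abs_self _)
  have s2 := hP.regA.lintegral_bilinear_sq_le (W := W) (p₀ := fun _ => 0) (b₀ := fun _ => 0) (L := L)
    hP.cov hP.regY hq₁ hq₂ hn h₁ h₂ (CubeBdd.const 0) (by simp [hL]) (CubeBdd.const 0)
    (by simp [hL]) hw.cubeBdd hwL (-(∫ x in cube d, p x * b x * f x))
  refine (lintegral_lintegral_add_le (b := 0) measurable_const s2 (by simp)).trans ?_
  have hB2 := sq_le_of_abs_le_sum hC (sqDist_nonneg q₁ f) (sqDist_nonneg q₂ f)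
    (sqDist_nonneg w f) (H P p b f q₁ q₂ w j₁ j₂ hP hq₁ hq₂ hw.cubeBdd h₁ h₂)
  have n1 := sqDist_nonneg q₁ f
  have n2 := sqDist_nonneg q₂ f
  have n3 := sqDist_nonneg w f
  rw [mul_zero, add_zero, ← ofReal_add (by positivity) (by positivity)]
  refine ofReal_le_ofReal ?_
  have t2 : 1 / n * K ^ 4 ≤ K ^ 4 * (1 / n * r) := by
    have : 1 / (n : ℝ) * 1 ≤ 1 / n * r := mul_le_mul_of_nonneg_left (by linarith) hn0
    nlinarith [pow_nonneg (zero_le_one.trans hK) 4]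
  have t3 : 0 ≤ (C1 + K ^ 4) *
      (dw (min j₁ j₂) (θ.α + θ.β) ^ 2 + sqDist q₁ f + sqDist q₂ f + sqDist w f) := by positivity
  have t4 : 0 ≤ 4 * C ^ 2 * (1 / n * r) := by positivity
  linarith

/-- Risk of the first-order corrected estimator given the density estimates. -/
theorem exists_lintegral_IF_le (hα : 0 < θ.α) (hβ : 0 < θ.β) (hαγ : θ.α ≤ θ.γ)
    (hβγ : θ.β ≤ θ.γ) (hγS : θ.γ < S) (hM : 0 ≤ θ.M) (hK : 1 ≤ K) (hc₁ : 0 < c₁) :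
    ∃ C, 0 ≤ C ∧ ∀ (P : Measure (Obs d)) (p b f q₁ q₂ : (Fin d → ℝ) → ℝ) (n j₁ j₂ : ℕ),
      ModelLaw W θ K P p b f → IsWeight c₁ c₂ q₁ → IsWeight c₁ c₂ q₂ → 1 ≤ n →
      W.J₀ ≤ j₁ → W.J₀ ≤ j₂ → ∫⁻ D₀, ∫⁻ D₂, ∫⁻ D₄, ofReal ((1 / (n : ℝ) * ∑ i,
        ((D₄ i).A - regEst W q₁ Obs.A j₁ D₀ (D₄ i).X) *
        ((D₄ i).Y - regEst W q₂ Obs.Y j₂ D₂ (D₄ i).X) - psi P) ^ 2)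
        ∂P^⊗n ∂P^⊗n ∂P^⊗n ≤ ofReal (C * (dw (max j₁ j₂) (θ.α + θ.β) ^ 2 +
        1 / n * ((1 + res d j₁ / n) * (1 + res d j₂ / n)) + sqDist q₁ f + sqDist q₂ f)) := by
  obtain ⟨C, hC, H⟩ := exists_abs_bias_corrected_le (d := d) (W := W) (c₂ := c₂) hα hβ hαγ hβγ hγS
    hM hK hc₁
  have hA := W.A_pos d
  have hV : 0 ≤ varFactor K c₁ := mul_nonneg (by linarith) (sq_nonneg _)
  set C1 := varFactor K c₁ * (2 * ((K + W.A d * (K ^ 2 / c₁)) * K) ^ 2 + varFactor K c₁ * K ^ 2)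
  refine ⟨4 * C ^ 2 + (C1 + momentBound W d K c₁ ^ 2 * K), by positivity,
    fun P p b f q₁ q₂ n j₁ j₂ hP hq₁ hq₂ hn h₁ h₂ => ?_⟩
  have := hP.cov.prob
  have b1 := W.cubeBdd_regEst (n := n) q₁ Obs.A j₁
  have b2 := W.cubeBdd_regEst (n := n) q₂ Obs.Y j₂
  have bf := hP.cov.bdd
  set r := (1 + res d j₁ / n) * (1 + res d j₂ / n)
  have hn0 : (0 : ℝ) ≤ 1 / n := by positivity
  have hr₁ : 0 ≤ res d j₁ / n := div_nonneg (res_pos d j₁).le (Nat.cast_nonneg n)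
  have hr₂ : 0 ≤ res d j₂ / n := div_nonneg (res_pos d j₂).le (Nat.cast_nonneg n)
  have s1 : ∀ D₀ D₂ : Fin n → Obs d, ∫⁻ D₄, ofReal ((1 / (n : ℝ) * ∑ i,
        ((D₄ i).A - regEst W q₁ Obs.A j₁ D₀ (D₄ i).X) *
        ((D₄ i).Y - regEst W q₂ Obs.Y j₂ D₂ (D₄ i).X) - psi P) ^ 2)
        ∂P^⊗n ≤ ofReal ((0 + ∫ x in cube d,
        (p x - regEst W q₁ Obs.A j₁ D₀ x) * (b x - regEst W q₂ Obs.Y j₂ D₂ x) *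
          f x) ^ 2) + (0 + ofReal (1 / n) * ofReal (∫ x in cube d,
        (2 * K ^ 2 + 2 * regEst W q₁ Obs.A j₁ D₀ x ^ 2) *
        (2 * K ^ 2 + 2 * regEst W q₂ Obs.Y j₂ D₂ x ^ 2) * f x)) := by
    intro D₀ D₂
    rw [← ofReal_mul hn0, zero_add (ofReal _)]
    exact hP.lintegral_IF_le hn (b1 D₀) (b2 D₂)
  refine (lintegral_mono fun D₀ => lintegral_mono fun D₂ => s1 D₀ D₂).trans ?_
  have s2 := hP.regA.lintegral_bilinear_sq_le (W := W) (L := K)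
    hP.cov hP.regY hq₁ hq₂ hn h₁ h₂ hP.regA.bdd hP.regA.abs_r_le hP.regY.bdd
    hP.regY.abs_r_le bf (fun x hx => hP.cov.abs_le hx) 0
  have s3 := lintegral_lintegral_moment_le (W := W) hP.cov hP.regA hP.regY hq₁ hq₂ hn h₁ h₂
  refine (lintegral_lintegral_add_le (W.measurable_integral_moment j₁ j₂ hP.regA.meas hP.regY.meas
    hq₁.meas hq₂.meas bf.meas K) s2 s3).trans ?_
  have hB2 := sq_le_of_abs_le_sum hC (sqDist_nonneg q₁ f) (sqDist_nonneg q₂ f) le_rfl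
    (by rw [Real.sqrt_zero, add_zero]; exact H P p b f q₁ q₂ j₁ j₂ hP hq₁ hq₂ h₁ h₂)
  rw [add_zero] at hB2
  have n1 := sqDist_nonneg q₁ f
  have n2 := sqDist_nonneg q₂ f
  have hmin : 0 ≤ min (res d j₁) (res d j₂) / (n : ℝ) :=
    div_nonneg (le_min (res_pos d j₁).le (res_pos d j₂).le) (Nat.cast_nonneg n)
  rw [zero_add, zero_add, ← ofReal_mul hn0, ← ofReal_add (by positivity) (by positivity)]
  refine ofReal_le_ofReal ?_
  have t1 : C1 * (1 / n * (1 + min (res d j₁) (res d j₂) / n)) ≤ C1 * (1 / n * r) :=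
    mul_le_mul_of_nonneg_left (mul_le_mul_of_nonneg_left one_add_min_div_le hn0) (by positivity)
  have t3 : 0 ≤ (C1 + momentBound W d K c₁ ^ 2 * K) *
      (dw (max j₁ j₂) (θ.α + θ.β) ^ 2 + sqDist q₁ f + sqDist q₂ f) := by positivity
  have t4 : 0 ≤ 4 * C ^ 2 * (1 / n * r) := by positivity
  linarith

/-- Risk of the Newey-Robins estimator given the density estimate. -/
theorem exists_lintegral_NR_le (hα : 0 < θ.α) (hβ : 0 < θ.β) (hαγ : θ.α ≤ θ.γ)
    (hβγ : θ.β ≤ θ.γ) (hγS : θ.γ < S) (hM : 0 ≤ θ.M) (hK : 1 ≤ K) (hc₁ : 0 < c₁) :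
    ∃ C, 0 ≤ C ∧ ∀ (P : Measure (Obs d)) (p b f q : (Fin d → ℝ) → ℝ) (n j : ℕ),
      ModelLaw W θ K P p b f → IsWeight c₁ c₂ q → 1 ≤ n → W.J₀ ≤ j →
      ∫⁻ D₀, ∫⁻ D₂, ofReal ((1 / (n : ℝ) * ∑ i,
        (D₂ i).A * ((D₂ i).Y - regEst W q Obs.Y j D₀ (D₂ i).X) - psi P) ^ 2)
        ∂P^⊗n ∂P^⊗n ≤
      ofReal (C * (dw j (θ.α + θ.β) ^ 2 + 1 / n * (1 + res d j / n) + sqDist q f)) := by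
  obtain ⟨C, hC, H⟩ := exists_abs_bias_one_sided_le (d := d) (W := W) (c₂ := c₂) hα hβ hαγ hβγ hγS
    hM hK hc₁
  have hK0 : 0 ≤ K := zero_le_one.trans hK
  have hV : 0 ≤ varFactor K c₁ := mul_nonneg (by linarith) (sq_nonneg _)
  have hm := momentBound_nonneg (W := W) (d := d) (c₁ := c₁) (zero_le_one.trans hK)
  refine ⟨4 * C ^ 2 + (varFactor K c₁ * (K * K) ^ 2 + K ^ 2 * (momentBound W d K c₁ * K)),
    by positivity, fun P p b f q n j hP hq hn hj => ?_⟩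
  have b2 := W.cubeBdd_regEst (n := n) q Obs.Y j
  have bf := hP.cov.bdd
  have bpf := hP.regA.bdd.mul bf
  have hr₁ : 0 ≤ res d j / n := div_nonneg (res_pos d j).le (Nat.cast_nonneg n)
  refine (lintegral_mono fun D₀ => hP.lintegral_NR_le hn (b2 D₀)).trans ?_
  rw [lintegral_add_left]
  swap
  · exact (((hP.regY.measurable_integral_regEst_mul hq bpf).const_add _).pow_const 2).ennreal_ofReal
  have s2 := hP.regY.lintegral_sq_add_integral_regEst_le (W := W) hP.cov hq hn hj bpf
    (-(∫ x in cube d, p x * b x * f x))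
  have s3 := hP.regY.lintegral_integral_moment_le (W := W) hP.cov hq hn hj
  have s4 : ∫⁻ D₀ : Fin n → Obs d, ofReal (1 / (n : ℝ) * (K ^ 2 * ∫ x in cube d,
      (2 * K ^ 2 + 2 * regEst W q Obs.Y j D₀ x ^ 2) * f x))
      ∂P^⊗n ≤ ofReal (1 / n * K ^ 2) * ofReal (momentBound W d K c₁ * K * (1 + res d j / n)) := by
    simp_rw [← mul_assoc (1 / (n : ℝ))]
    have h0 : (0 : ℝ) ≤ 1 / n * K ^ 2 := by positivity
    simp_rw [ofReal_mul h0]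
    rw [lintegral_const_mul' _ _ ENNReal.ofReal_ne_top]
    exact mul_le_mul_right s3 _
  refine (add_le_add s2 s4).trans ?_
  have s5 : ∫ x in cube d, W.proj j (fun x => p x * f x) x ^ 2 ≤ (K * K) ^ 2 := by
    refine ((W.orthoFamily_Phi hj).integral_projOn_sq_le bpf).trans (bpf.integral_sq_le ?_)
    intro x hx
    rw [abs_mul]
    exact mul_le_mul (hP.regA.abs_r_le x hx) (hP.cov.abs_le hx) (abs_nonneg _) hK0
  have hB2 := sq_le_of_abs_le_sum hC (sqDist_nonneg q f) le_rfl le_rfl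
    (by rw [Real.sqrt_zero, add_zero, add_zero]; exact H P p b f q j hP hq hj)
  rw [add_zero, add_zero] at hB2
  have n1 := sqDist_nonneg q f
  rw [← ofReal_mul (by positivity), ← ofReal_add (by positivity) (by positivity)]
  refine ofReal_le_ofReal ?_
  have t1 : varFactor K c₁ / n * ∫ x in cube d, W.proj j (fun x => p x * f x) x ^ 2 ≤
      varFactor K c₁ * (K * K) ^ 2 * (1 / n * (1 + res d j / n)) := by
    have h1 : varFactor K c₁ / n * ∫ x in cube d, W.proj j (fun x => p x * f x) x ^ 2 ≤
      varFactor K c₁ / n * (K * K) ^ 2 := mul_le_mul_of_nonneg_left s5 (by positivity)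
    have h2 : 0 ≤ varFactor K c₁ / n * (K * K) ^ 2 * (res d j / n) := by positivity
    calc _ ≤ _ := h1
      _ ≤ varFactor K c₁ / n * (K * K) ^ 2 + varFactor K c₁ / n * (K * K) ^ 2 * (res d j / n) := by
          linarith
      _ = _ := by ring
  have t3 : 0 ≤ (varFactor K c₁ * (K * K) ^ 2 + K ^ 2 * (momentBound W d K c₁ * K)) *
      (dw j (θ.α + θ.β) ^ 2 + sqDist q f) := by positivity
  have t4 : 0 ≤ 4 * C ^ 2 * (1 / n * (1 + res d j / n)) := by positivity
  linarith

end

/-! ### Upper bounds for the risk of the estimators -/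

/-- A density estimator that is jointly measurable with values in `[c₁, c₂]`, `c₁ > 0`. -/
structure IsBoundedEstimator {d : ℕ} (c₁ c₂ : ℝ) (fhat : DensityEstimator d) : Prop where
  pos : 0 < c₁
  measurable : ∀ n, Measurable fun q : (Fin n → Obs d) × (Fin d → ℝ) => fhat n q.1 q.2
  mem : ∀ n D, ∀ x ∈ cube d, fhat n D x ∈ Set.Icc c₁ c₂

/-- Mean integrated squared error of the density estimator. -/
def densityRisk {d : ℕ} (fhat : DensityEstimator d) (n : ℕ) (P : Measure (Obs d))
    (f : (Fin d → ℝ) → ℝ) : ℝ≥0∞ :=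
  ∫⁻ D, ofReal (sqDist (fhat n D) f) ∂P^⊗n

section

variable {S d n m : ℕ} {W : CDVBasis S} {θ : ModelParams} {K c₁ c₂ : ℝ}
  {fhat : DensityEstimator d} {P : Measure (Obs d)} {p b f : (Fin d → ℝ) → ℝ}

theorem IsBoundedEstimator.isWeight (hf : IsBoundedEstimator c₁ c₂ fhat) (D : Fin n → Obs d) :
    IsWeight c₁ c₂ (fhat n D) :=
  ⟨hf.pos, (hf.measurable n).comp (measurable_const.prodMk measurable_id), hf.mem n D⟩

theorem IsBoundedEstimator.measurable_sqDist (hf : IsBoundedEstimator c₁ c₂ fhat)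
    (hfm : Measurable f) :
    Measurable fun D : Fin n → Obs d => ofReal (sqDist (fhat n D) f) := by
  have h1 := hf.measurable n
  have h2 : Measurable fun z : (Fin n → Obs d) × (Fin d → ℝ) => (fhat n z.1 z.2 - f z.2) ^ 2 := by
    fun_prop
  exact (h2.stronglyMeasurable.integral_prod_right' (ν := cubeMeasure d)).measurable.ennreal_ofReal

theorem densityRisk_le (hf : IsBoundedEstimator c₁ c₂ fhat) (hfb : CubeBdd f)
    {f' : (Fin d → ℝ) → ℝ} (hff : ∀ x ∈ cube d, f x = f' x) :
    densityRisk fhat n P f ≤ ∫⁻ D, cubeSupNorm (fun x => fhat n D x - f' x) ^ 2 ∂P^⊗n := by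
  refine lintegral_mono fun D => ?_
  have bq := (hf.isWeight D).cubeBdd
  rw [sqDist, ofReal_integral_eq_lintegral_ofReal (bq.sub hfb).pow.integrable
    (ae_of_all _ fun _ => sq_nonneg _)]
  have h1 : ∀ᵐ x ∂cubeMeasure d, ofReal ((fhat n D x - f x) ^ 2) ≤
      cubeSupNorm (fun x => fhat n D x - f' x) ^ 2 := by
    filter_upwards [ae_mem_cube d] with x hx
    rw [← sq_abs, ENNReal.ofReal_pow (abs_nonneg _), hff x hx]
    refine pow_le_pow_left' ?_ 2
    exact le_iSup₂ (f := fun x (_ : x ∈ cube d) => ofReal |fhat n D x - f' x|) x hx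
  refine (lintegral_mono_ae h1).trans ?_
  rw [lintegral_const, measure_univ, mul_one]

/-- The mean squared error as an integral over `m` independent subsamples, in any order. -/
theorem mse_eq_lintegral_perm [IsProbabilityMeasure P] {T : Sample d m n → ℝ} (hT : Measurable T)
    (σ : Equiv.Perm (Fin m)) :
    mse T P = ∫⁻ E : Fin m → Fin n → Obs d, ofReal ((T (fun q => E (σ q.1) q.2) - psi P) ^ 2)
      ∂(Measure.pi fun _ => Measure.pi fun _ => P) := by
  rw [lintegral_pi_perm (P^⊗n) σ (F := fun E : Fin m → Fin n → Obs d =>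
    ofReal ((T (fun q => E q.1 q.2) - psi P) ^ 2)), mse,
    ← (measurePreserving_uncurry_pi P m n).lintegral_comp (by fun_prop)]

theorem IsBoundedEstimator.measurable_nuisance (hf : IsBoundedEstimator c₁ c₂ fhat)
    (W : CDVBasis S) {Z : Obs d → ℝ} (hZ : Measurable Z) (j : ℕ) :
    Measurable fun z : ((Fin n → Obs d) × (Fin n → Obs d)) × (Fin d → ℝ) =>
      nuisance W fhat Z j z.1.1 z.1.2 z.2 := by
  have h1 := hf.measurable n
  have h2 := W.measurable_kernel (d := d) j
  have h3 := Obs.measurable_X (d := d)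
  refine (Finset.measurable_fun_sum _ fun i _ => ?_).const_mul _
  have e2 : Measurable fun z : ((Fin n → Obs d) × (Fin n → Obs d)) × (Fin d → ℝ) =>
    W.kernel j (z.1.1 i).X z.2 := h2.comp (f := fun z : ((Fin n → Obs d) ×
      (Fin n → Obs d)) × (Fin d → ℝ) => ((z.1.1 i).X, z.2)) (by fun_prop)
  fun_prop

theorem measurable_subsample (j : Fin m) :
    Measurable fun D : Sample d m n => subsample D j :=
  measurable_pi_lambda _ fun i => measurable_pi_apply (j, i)

theorem IsBoundedEstimator.measurable_nuisance_subsample (hf : IsBoundedEstimator c₁ c₂ fhat)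
    (W : CDVBasis S) {Z : Obs d → ℝ} (hZ : Measurable Z) (j : ℕ) (a a' : Fin m)
    {g : Sample d m n → (Fin d → ℝ)} (hg : Measurable g) :
    Measurable fun D : Sample d m n => nuisance W fhat Z j (subsample D a) (subsample D a') (g D) :=
  (hf.measurable_nuisance (n := n) W hZ j).comp
    (((measurable_subsample a).prodMk (measurable_subsample a')).prodMk hg)

theorem measurable_subsample_apply (j : Fin m) (i : Fin n) :
    Measurable fun D : Sample d m n => subsample D j i := measurable_pi_apply (j, i)

theorem IsBoundedEstimator.measurable_psiMC (hf : IsBoundedEstimator c₁ c₂ fhat) (W : CDVBasis S)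
    (j₁ j₂ : ℕ) : Measurable (psiMC (n := n) W fhat j₁ j₂) := by
  have hX := Obs.measurable_X (d := d)
  have hA := Obs.measurable_A (d := d)
  have hY := Obs.measurable_Y (d := d)
  have hs : ∀ (j : Fin 6) (i : Fin n), Measurable fun D : Sample d 6 n => subsample D j i :=
    measurable_subsample_apply
  refine Measurable.sub ?_ ?_
  · exact (Finset.measurable_fun_sum _ fun i _ =>
      (hA.comp (hs 4 i)).mul (hY.comp (hs 4 i))).const_mul _
  · exact (Finset.measurable_fun_sum _ fun i _ =>
      (hf.measurable_nuisance_subsample W hA j₁ 0 1 (hX.comp (hs 5 i))).mul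
      (hf.measurable_nuisance_subsample W hY j₂ 2 3 (hX.comp (hs 5 i)))).const_mul _

theorem IsBoundedEstimator.measurable_psiNR (hf : IsBoundedEstimator c₁ c₂ fhat) (W : CDVBasis S)
    (j : ℕ) : Measurable (psiNR (n := n) W fhat j) := by
  have hX := Obs.measurable_X (d := d)
  have hA := Obs.measurable_A (d := d)
  have hY := Obs.measurable_Y (d := d)
  have hs : ∀ (j : Fin 3) (i : Fin n), Measurable fun D : Sample d 3 n => subsample D j i :=
    measurable_subsample_apply
  exact (Finset.measurable_fun_sum _ fun i _ => (hA.comp (hs 2 i)).mul ((hY.comp (hs 2 i)).sub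
    (hf.measurable_nuisance_subsample W hY j 0 1 (hX.comp (hs 2 i))))).const_mul _

theorem IsBoundedEstimator.measurable_psiIF (hf : IsBoundedEstimator c₁ c₂ fhat) (W : CDVBasis S)
    (j₁ j₂ : ℕ) : Measurable (psiIF (n := n) W fhat j₁ j₂) := by
  have hX := Obs.measurable_X (d := d)
  have hA := Obs.measurable_A (d := d)
  have hY := Obs.measurable_Y (d := d)
  have hs : ∀ (j : Fin 5) (i : Fin n), Measurable fun D : Sample d 5 n => subsample D j i :=
    measurable_subsample_apply
  exact (Finset.measurable_fun_sum _ fun i _ => ((hA.comp (hs 4 i)).sub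
      (hf.measurable_nuisance_subsample W hA j₁ 0 1 (hX.comp (hs 4 i)))).mul
    ((hY.comp (hs 4 i)).sub
      (hf.measurable_nuisance_subsample W hY j₂ 2 3 (hX.comp (hs 4 i))))).const_mul _

theorem IsBoundedEstimator.measurable_psiINT (hf : IsBoundedEstimator c₁ c₂ fhat) (W : CDVBasis S)
    (j₁ j₂ : ℕ) : Measurable (psiINT (n := n) W fhat j₁ j₂) := by
  have hA := Obs.measurable_A (d := d)
  have hY := Obs.measurable_Y (d := d)
  have hs : ∀ (j : Fin 6) (i : Fin n), Measurable fun D : Sample d 6 n => subsample D j i :=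
    measurable_subsample_apply
  have hsub : ∀ (j : Fin 6), Measurable fun D : Sample d 6 n => subsample D j :=
    measurable_subsample
  refine Measurable.sub ?_ ?_
  · exact (Finset.measurable_fun_sum _ fun i _ =>
      (hA.comp (hs 4 i)).mul (hY.comp (hs 4 i))).const_mul _
  · have hz : ∀ k l : Fin 6, Measurable fun z : Sample d 6 n × (Fin d → ℝ) =>
        ((subsample z.1 k, subsample z.1 l), z.2) := fun k l =>
      (((hsub k).comp measurable_fst).prodMk ((hsub l).comp measurable_fst)).prodMk measurable_snd
    have h1 := (hf.measurable_nuisance (n := n) W hA j₁).comp (hz 0 1)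
    have h2 := (hf.measurable_nuisance (n := n) W hY j₂).comp (hz 2 3)
    have h3 := (hf.measurable n).comp (((hsub 5).comp measurable_fst).prodMk
      (measurable_snd (β := Fin d → ℝ)))
    exact (((h1.mul h2).mul h3).stronglyMeasurable.integral_prod_right'
      (ν := cubeMeasure d)).measurable

/-- The Monte Carlo estimator in terms of its subsamples. -/
theorem mse_psiMC_eq [IsProbabilityMeasure P] (hf : IsBoundedEstimator c₁ c₂ fhat)
    (W : CDVBasis S) (j₁ j₂ : ℕ) :
    mse (psiMC (n := n) W fhat j₁ j₂) P = ∫⁻ D₁, ∫⁻ D₃, ∫⁻ D₀, ∫⁻ D₂, ∫⁻ D₄, ∫⁻ D₅, ofReal (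
        (1 / (n : ℝ) * ∑ i, (D₄ i).A * (D₄ i).Y -
        1 / (n : ℝ) * ∑ i, regEst W (fhat n D₁) Obs.A j₁ D₀ (D₅ i).X *
          regEst W (fhat n D₃) Obs.Y j₂ D₂ (D₅ i).X - psi P) ^ 2)
        ∂P^⊗n ∂P^⊗n ∂P^⊗n ∂P^⊗n ∂P^⊗n ∂P^⊗n := by
  have hT := hf.measurable_psiMC (n := n) W j₁ j₂
  rw [mse_eq_lintegral_perm hT ⟨![2, 0, 3, 1, 4, 5], ![1, 3, 0, 2, 4, 5], by decide, by decide⟩,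
    lintegral_pi_six _ (by fun_prop)]
  rfl

theorem mse_psiINT_eq [IsProbabilityMeasure P] (hf : IsBoundedEstimator c₁ c₂ fhat)
    (W : CDVBasis S) (j₁ j₂ : ℕ) :
    mse (psiINT (n := n) W fhat j₁ j₂) P = ∫⁻ D₁, ∫⁻ D₃, ∫⁻ D₅, ∫⁻ D₀, ∫⁻ D₂, ∫⁻ D₄, ofReal (
        (1 / (n : ℝ) * ∑ i, (D₄ i).A * (D₄ i).Y -
        (∫ x in cube d, regEst W (fhat n D₁) Obs.A j₁ D₀ x *
          regEst W (fhat n D₃) Obs.Y j₂ D₂ x * fhat n D₅ x) - psi P) ^ 2)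
        ∂P^⊗n ∂P^⊗n ∂P^⊗n ∂P^⊗n ∂P^⊗n ∂P^⊗n := by
  have hT := hf.measurable_psiINT (n := n) W j₁ j₂
  rw [mse_eq_lintegral_perm hT ⟨![3, 0, 4, 1, 5, 2], ![1, 3, 5, 0, 2, 4], by decide, by decide⟩,
    lintegral_pi_six _ (by fun_prop)]
  rfl

theorem mse_psiIF_eq [IsProbabilityMeasure P] (hf : IsBoundedEstimator c₁ c₂ fhat)
    (W : CDVBasis S) (j₁ j₂ : ℕ) :
    mse (psiIF (n := n) W fhat j₁ j₂) P =
      ∫⁻ D₁, ∫⁻ D₃, ∫⁻ D₀, ∫⁻ D₂, ∫⁻ D₄, ofReal ((1 / (n : ℝ) * ∑ i,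
        ((D₄ i).A - regEst W (fhat n D₁) Obs.A j₁ D₀ (D₄ i).X) *
        ((D₄ i).Y - regEst W (fhat n D₃) Obs.Y j₂ D₂ (D₄ i).X) - psi P) ^ 2)
        ∂P^⊗n ∂P^⊗n ∂P^⊗n ∂P^⊗n ∂P^⊗n := by
  have hT := hf.measurable_psiIF (n := n) W j₁ j₂
  rw [mse_eq_lintegral_perm hT ⟨![2, 0, 3, 1, 4], ![1, 3, 0, 2, 4], by decide, by decide⟩,
    lintegral_pi_five _ (by fun_prop)]
  rfl

theorem mse_psiNR_eq [IsProbabilityMeasure P] (hf : IsBoundedEstimator c₁ c₂ fhat)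
    (W : CDVBasis S) (j : ℕ) :
    mse (psiNR (n := n) W fhat j) P = ∫⁻ D₁, ∫⁻ D₀, ∫⁻ D₂, ofReal ((1 / (n : ℝ) * ∑ i,
        (D₂ i).A * ((D₂ i).Y - regEst W (fhat n D₁) Obs.Y j D₀ (D₂ i).X) - psi P) ^ 2)
        ∂P^⊗n ∂P^⊗n ∂P^⊗n := by
  have hT := hf.measurable_psiNR (n := n) W j
  rw [mse_eq_lintegral_perm hT ⟨![1, 0, 2], ![1, 0, 2], by decide, by decide⟩,
    lintegral_pi_three _ (by fun_prop)]
  rfl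

theorem lintegral_ofReal_mul_add_le {Ω : Type*} [MeasurableSpace Ω] {Q : Measure Ω}
    [IsProbabilityMeasure Q] {C B : ℝ} (hC : 0 ≤ C) (hB : 0 ≤ B) {e : Ω → ℝ}
    (he0 : ∀ D, 0 ≤ e D) {G : Ω → ℝ≥0∞}
    (hG : ∀ D, G D ≤ ofReal (C * (B + e D))) :
    ∫⁻ D, G D ∂Q ≤ ofReal (C * B) + ofReal C * ∫⁻ D, ofReal (e D) ∂Q := by
  refine (lintegral_mono hG).trans ?_
  have h1 : ∀ D, ofReal (C * (B + e D)) = ofReal (C * B) + ofReal C * ofReal (e D) := fun D => by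
    rw [mul_add, ofReal_add (mul_nonneg hC hB) (mul_nonneg hC (he0 D)), ofReal_mul hC (q := e D)]
  simp_rw [h1]
  rw [lintegral_add_left measurable_const, lintegral_const, measure_univ, mul_one,
    lintegral_const_mul' _ _ ENNReal.ofReal_ne_top]

theorem lintegral_two_ofReal_mul_add_le {Ω : Type*} [MeasurableSpace Ω] {Q : Measure Ω}
    [IsProbabilityMeasure Q] {C B : ℝ} (hC : 0 ≤ C) (hB : 0 ≤ B) {e : Ω → ℝ}
    (he0 : ∀ D, 0 ≤ e D) {G : Ω → Ω → ℝ≥0∞}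
    (hG : ∀ D D', G D D' ≤ ofReal (C * (B + e D + e D'))) :
    ∫⁻ D, ∫⁻ D', G D D' ∂Q ∂Q ≤ ofReal (C * B) + 2 * (ofReal C * ∫⁻ D, ofReal (e D) ∂Q) := by
  set R := ∫⁻ D, ofReal (e D) ∂Q
  refine (lintegral_mono fun D => lintegral_ofReal_mul_add_le hC (add_nonneg hB (he0 D)) he0
    (hG D)).trans ?_
  rw [lintegral_add_right _ measurable_const, lintegral_const, measure_univ, mul_one, two_mul,
    ← add_assoc]
  exact add_le_add (lintegral_ofReal_mul_add_le hC hB he0 fun D => le_rfl) le_rfl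

theorem lintegral_three_ofReal_mul_add_le {Ω : Type*} [MeasurableSpace Ω] {Q : Measure Ω}
    [IsProbabilityMeasure Q] {C B : ℝ} (hC : 0 ≤ C) (hB : 0 ≤ B) {e : Ω → ℝ}
    (he0 : ∀ D, 0 ≤ e D) {G : Ω → Ω → Ω → ℝ≥0∞}
    (hG : ∀ D D' D'', G D D' D'' ≤ ofReal (C * (B + e D + e D' + e D''))) :
    ∫⁻ D, ∫⁻ D', ∫⁻ D'', G D D' D'' ∂Q ∂Q ∂Q ≤ ofReal (C * B) +
      3 * (ofReal C * ∫⁻ D, ofReal (e D) ∂Q) := by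
  set R := ∫⁻ D, ofReal (e D) ∂Q
  refine (lintegral_mono fun D => lintegral_two_ofReal_mul_add_le hC (add_nonneg hB (he0 D)) he0
    (hG D)).trans ?_
  rw [lintegral_add_right _ measurable_const, lintegral_const, measure_univ, mul_one]
  refine (add_le_add (lintegral_ofReal_mul_add_le hC hB he0 fun D => le_rfl) le_rfl).trans
    (le_of_eq ?_)
  ring

section

variable (hα : 0 < θ.α) (hβ : 0 < θ.β) (hαγ : θ.α ≤ θ.γ) (hβγ : θ.β ≤ θ.γ) (hγS : θ.γ < S)
  (hM : 0 ≤ θ.M) (hK : 1 ≤ K) (hf : IsBoundedEstimator c₁ c₂ fhat)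

include hα hβ hαγ hβγ hγS hM hK hf

/-- Plug-in: bias of the coarser level, variance `(1 + k₁ / n) (1 + k₂ / n) / n`. -/
theorem exists_mse_psiMC_le :
    ∃ C, 0 ≤ C ∧ ∀ (P : Measure (Obs d)) (p b f : (Fin d → ℝ) → ℝ) (n j₁ j₂ : ℕ),
      ModelLaw W θ K P p b f → 1 ≤ n → W.J₀ ≤ j₁ → W.J₀ ≤ j₂ → mse (psiMC (n := n) W fhat j₁ j₂) P ≤
        ofReal (C * (dw (min j₁ j₂) (θ.α + θ.β) ^ 2 +
          1 / n * ((1 + res d j₁ / n) * (1 + res d j₂ / n)))) +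
        3 * (ofReal C * densityRisk fhat n P f) := by
  obtain ⟨C, hC, H⟩ := exists_lintegral_MC_le (d := d) (W := W) (c₂ := c₂) hα hβ hαγ hβγ hγS hM hK
    hf.pos
  refine ⟨C, hC, fun P p b f n j₁ j₂ hP hn h₁ h₂ => ?_⟩
  have := hP.cov.prob
  have r1 := (res_pos d j₁).le
  have r2 := (res_pos d j₂).le
  rw [mse_psiMC_eq hf]
  refine (lintegral_two_ofReal_mul_add_le hC (by positivity) (fun D => sqDist_nonneg (fhat n D) f)
    fun D₁ D₃ => H P p b f _ _ n j₁ j₂ hP (hf.isWeight D₁) (hf.isWeight D₃) hn h₁ h₂).trans ?_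
  exact add_le_add le_rfl (mul_le_mul_left (by norm_num) _)

/-- Integrating instead of averaging leaves only the smaller resolution in the variance. -/
theorem exists_mse_psiINT_le :
    ∃ C, 0 ≤ C ∧ ∀ (P : Measure (Obs d)) (p b f : (Fin d → ℝ) → ℝ) (n j₁ j₂ : ℕ),
      ModelLaw W θ K P p b f → 1 ≤ n → W.J₀ ≤ j₁ → W.J₀ ≤ j₂ →
      mse (psiINT (n := n) W fhat j₁ j₂) P ≤ ofReal (C * (dw (min j₁ j₂) (θ.α + θ.β) ^ 2 +
          1 / n * (1 + min (res d j₁) (res d j₂) / n))) +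
        3 * (ofReal C * densityRisk fhat n P f) := by
  obtain ⟨C, hC, H⟩ := exists_lintegral_INT_le (d := d) (W := W) (c₂ := c₂) hα hβ hαγ hβγ hγS hM hK
    hf.pos
  refine ⟨C, hC, fun P p b f n j₁ j₂ hP hn h₁ h₂ => ?_⟩
  have := hP.cov.prob
  have r1 := (lt_min (res_pos d j₁) (res_pos d j₂)).le
  rw [mse_psiINT_eq hf]
  exact lintegral_three_ofReal_mul_add_le hC (by positivity)
    (fun D => sqDist_nonneg (fhat n D) f) fun D₁ D₃ D₅ =>
      H P p b f _ _ _ n j₁ j₂ hP (hf.isWeight D₁) (hf.isWeight D₃) (hf.isWeight D₅) hn h₁ h₂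

/-- First-order correction: bias of the finer level, at the variance of the plug-in estimator. -/
theorem exists_mse_psiIF_le :
    ∃ C, 0 ≤ C ∧ ∀ (P : Measure (Obs d)) (p b f : (Fin d → ℝ) → ℝ) (n j₁ j₂ : ℕ),
      ModelLaw W θ K P p b f → 1 ≤ n → W.J₀ ≤ j₁ → W.J₀ ≤ j₂ → mse (psiIF (n := n) W fhat j₁ j₂) P ≤
        ofReal (C * (dw (max j₁ j₂) (θ.α + θ.β) ^ 2 +
          1 / n * ((1 + res d j₁ / n) * (1 + res d j₂ / n)))) +
        3 * (ofReal C * densityRisk fhat n P f) := by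
  obtain ⟨C, hC, H⟩ := exists_lintegral_IF_le (d := d) (W := W) (c₂ := c₂) hα hβ hαγ hβγ hγS hM hK
    hf.pos
  refine ⟨C, hC, fun P p b f n j₁ j₂ hP hn h₁ h₂ => ?_⟩
  have := hP.cov.prob
  have r1 := (res_pos d j₁).le
  have r2 := (res_pos d j₂).le
  rw [mse_psiIF_eq hf]
  refine (lintegral_two_ofReal_mul_add_le hC (by positivity) (fun D => sqDist_nonneg (fhat n D) f)
    fun D₁ D₃ => H P p b f _ _ n j₁ j₂ hP (hf.isWeight D₁) (hf.isWeight D₃) hn h₁ h₂).trans ?_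
  exact add_le_add le_rfl (mul_le_mul_left (by norm_num) _)

theorem exists_mse_psiNR_le :
    ∃ C, 0 ≤ C ∧ ∀ (P : Measure (Obs d)) (p b f : (Fin d → ℝ) → ℝ) (n j : ℕ),
      ModelLaw W θ K P p b f → 1 ≤ n → W.J₀ ≤ j → mse (psiNR (n := n) W fhat j) P ≤
        ofReal (C * (dw j (θ.α + θ.β) ^ 2 + 1 / n * (1 + res d j / n))) +
        3 * (ofReal C * densityRisk fhat n P f) := by
  obtain ⟨C, hC, H⟩ := exists_lintegral_NR_le (d := d) (W := W) (c₂ := c₂) hα hβ hαγ hβγ hγS hM hK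
    hf.pos
  refine ⟨C, hC, fun P p b f n j hP hn hj => ?_⟩
  have := hP.cov.prob
  have r1 := (res_pos d j).le
  rw [mse_psiNR_eq hf]
  refine (lintegral_ofReal_mul_add_le hC (by positivity) (fun D => sqDist_nonneg (fhat n D) f)
    fun D₁ => H P p b f _ n j hP (hf.isWeight D₁) hn hj).trans ?_
  exact add_le_add le_rfl (le_mul_of_one_le_left' (by norm_num))

end

end

/-! ### Laws with binary responses -/

/-- The sign `± 1` of a Boolean. -/
def sg (b : Bool) : ℝ := if b then 1 else -1

@[simp] theorem sg_true : sg true = 1 := rfl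

@[simp] theorem sg_false : sg false = -1 := rfl

theorem sg_mul_self (b : Bool) : sg b * sg b = 1 := by cases b <;> norm_num [sg]

theorem abs_sg (b : Bool) : |sg b| = 1 := by cases b <;> norm_num [sg]

/-- Density, given the covariates, of a pair of signs with means `u` and `v`. -/
def signWeight {d : ℕ} (u v : (Fin d → ℝ) → ℝ) (b : Bool × Bool) (x : Fin d → ℝ) : ℝ :=
  (1 + u x * sg b.1 + v x * sg b.2) / 4

/-- The observation with covariates `x` and responses `c ± h`. -/
def signObs {d : ℕ} (c h : ℝ) (b : Bool × Bool) (x : Fin d → ℝ) : Obs d :=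
  (x, c + h * sg b.1, c + h * sg b.2)

/-- The law with uniform covariates and responses `c ± h`, whose signs are uncorrelated on the
whole and have means `u`, `v` given the covariates. -/
def signLaw {d : ℕ} (c h : ℝ) (u v : (Fin d → ℝ) → ℝ) : Measure (Obs d) :=
  ∑ b : Bool × Bool, ((cubeMeasure d).withDensity
    (fun x => ofReal (signWeight u v b x))).map (signObs c h b)

/-- Admissible means of the signs. -/
structure SignMeans {d : ℕ} (u v : (Fin d → ℝ) → ℝ) : Prop where
  left : CubeBdd u
  right : CubeBdd v
  le : ∀ x ∈ cube d, |u x| + |v x| ≤ 1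

section

variable {d : ℕ} {u v : (Fin d → ℝ) → ℝ} {c h : ℝ}

theorem SignMeans.weight_nonneg (H : SignMeans u v) (b : Bool × Bool) {x : Fin d → ℝ}
    (hx : x ∈ cube d) : 0 ≤ signWeight u v b x := by
  have h1 := H.le x hx
  have h2 : |u x * sg b.1| = |u x| := by rw [abs_mul, abs_sg, mul_one]
  have h3 : |v x * sg b.2| = |v x| := by rw [abs_mul, abs_sg, mul_one]
  have h4 := neg_abs_le (u x * sg b.1)
  have h5 := neg_abs_le (v x * sg b.2)
  unfold signWeight
  linarith

theorem SignMeans.cubeBdd_weight (H : SignMeans u v) (b : Bool × Bool) :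
    CubeBdd (signWeight u v b) := by
  have := (((CubeBdd.const 1).add ((H.left).mul (CubeBdd.const (sg b.1)))).add
    ((H.right).mul (CubeBdd.const (sg b.2)))).mul (CubeBdd.const (1 / 4))
  refine (funext fun x => ?_ : signWeight u v b = _) ▸ this
  simp only [signWeight]
  ring

theorem measurable_signObs (c h : ℝ) (b : Bool × Bool) :
    Measurable (signObs (d := d) c h b) := by
  unfold signObs; fun_prop

theorem sum_signWeight (x : Fin d → ℝ) : ∑ b, signWeight u v b x = 1 := by
  simp [Fintype.sum_prod_type, signWeight]; ring

theorem SignMeans.sum_ofReal_weight (H : SignMeans u v) {x : Fin d → ℝ} (hx : x ∈ cube d) :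
    ∑ b, ofReal (signWeight u v b x) = 1 := by
  rw [← ENNReal.ofReal_sum_of_nonneg fun b _ => H.weight_nonneg b hx, sum_signWeight,
    ENNReal.ofReal_one]

theorem SignMeans.integral_signLaw (H : SignMeans u v) {G : Obs d → ℝ} (hG : Measurable G)
    (hb : ∀ b, CubeBdd fun x => G (signObs c h b x)) :
    ∫ o, G o ∂(signLaw c h u v) = ∫ x in cube d, ∑ b, signWeight u v b x * G (signObs c h b x) := by
  have h1 : ∀ b, Integrable (fun x => (ofReal (signWeight u v b x)).toReal •
      G (signObs c h b x)) (cubeMeasure d) := fun b => by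
    refine ((H.cubeBdd_weight b).mul (hb b)).integrable.congr ?_
    filter_upwards [ae_mem_cube d] with x hx
    rw [ENNReal.toReal_ofReal (H.weight_nonneg b hx), smul_eq_mul]
  have h2 : ∀ b, Integrable (fun x => G (signObs c h b x)) ((cubeMeasure d).withDensity
      (fun x => ofReal (signWeight u v b x))) := fun b => by
    rw [integrable_withDensity_iff_integrable_smul' (H.cubeBdd_weight b).meas.ennreal_ofReal
      (ae_of_all _ fun _ => ENNReal.ofReal_lt_top)]
    exact h1 b
  rw [signLaw, integral_finsetSum_measure]
  · rw [integral_finsetSum _ fun b _ => ((H.cubeBdd_weight b).mul (hb b)).integrable]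
    refine sum_congr rfl fun b _ => ?_
    rw [integral_map (measurable_signObs c h b).aemeasurable hG.aestronglyMeasurable,
      integral_withDensity_eq_integral_toReal_smul (H.cubeBdd_weight b).meas.ennreal_ofReal
      (ae_of_all _ fun _ => ENNReal.ofReal_lt_top)]
    refine integral_cube_congr fun x hx => ?_
    rw [ENNReal.toReal_ofReal (H.weight_nonneg b hx), smul_eq_mul]
  · exact fun b _ => (integrable_map_measure hG.aestronglyMeasurable
      (measurable_signObs c h b).aemeasurable).2 (h2 b)

theorem SignMeans.signLaw_apply (H : SignMeans u v) {s : Set (Obs d)} (hs : MeasurableSet s) :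
    signLaw c h u v s = ∑ b, ∫⁻ x in cube d, ofReal (signWeight u v b x) *
      s.indicator 1 (signObs c h b x) := by
  rw [signLaw, Measure.finsetSum_apply]
  refine sum_congr rfl fun b _ => ?_
  have hm := measurable_signObs (d := d) c h b
  rw [Measure.map_apply hm hs, withDensity_apply _ (hm hs), ← lintegral_indicator (hm hs)]
  refine lintegral_congr fun x => ?_
  by_cases hx : signObs c h b x ∈ s
  · rw [Set.indicator_of_mem (by exact hx), Set.indicator_of_mem hx, Pi.one_apply, mul_one]
  · rw [Set.indicator_of_notMem (by exact hx), Set.indicator_of_notMem hx, mul_zero]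

theorem SignMeans.map_X (H : SignMeans u v) :
    (signLaw c h u v).map Obs.X = (volume.restrict (cube d)).withDensity fun _ => ofReal 1 := by
  ext s hs
  rw [Measure.map_apply Obs.measurable_X hs, H.signLaw_apply (Obs.measurable_X hs),
    ← lintegral_finsetSum, withDensity_apply _ hs, ← lintegral_indicator hs]
  · refine lintegral_congr_ae ?_
    filter_upwards [ae_mem_cube d] with x hx
    have h1 : ∀ b, (Obs.X ⁻¹' s).indicator (1 : Obs d → ℝ≥0∞) (signObs c h b x) =
        s.indicator 1 x := fun b => rfl
    simp_rw [h1]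
    rw [← sum_mul, H.sum_ofReal_weight hx, one_mul, ENNReal.ofReal_one]
    rfl
  · intro b _
    refine (H.cubeBdd_weight b).meas.ennreal_ofReal.mul ?_
    exact (measurable_one.indicator (Obs.measurable_X hs)).comp (measurable_signObs c h b)

theorem SignMeans.isProbabilityMeasure (H : SignMeans u v) :
    IsProbabilityMeasure (signLaw c h u v) := by
  refine ⟨?_⟩
  have h1 : (signLaw c h u v).map Obs.X Set.univ =
      ((volume.restrict (cube d)).withDensity fun _ => ofReal 1) Set.univ := by rw [H.map_X]
  rw [Measure.map_apply Obs.measurable_X MeasurableSet.univ, Set.preimage_univ] at h1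
  rw [h1]
  simp

theorem SignMeans.ae_signLaw (H : SignMeans u v) {p : Obs d → Prop}
    (hm : MeasurableSet {o | p o}) (hp : ∀ b x, p (signObs c h b x)) :
    ∀ᵐ o ∂signLaw c h u v, p o := by
  change signLaw c h u v {o | p o}ᶜ = 0
  rw [H.signLaw_apply hm.compl]
  refine sum_eq_zero fun b _ => ?_
  have : ∀ x, ({o : Obs d | p o}ᶜ).indicator (1 : Obs d → ℝ≥0∞) (signObs c h b x) = 0 := fun x =>
    Set.indicator_of_notMem (by simpa using hp b x) _
  simp [this]

theorem SignMeans.covLaw (H : SignMeans u v) {K : ℝ} (hK : 1 ≤ K) :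
    CovLaw (signLaw c h u v) (fun _ => 1) K :=
  have := H.isProbabilityMeasure (c := c) (h := h)
  covLaw_of_density (CubeBdd.const 1) (fun _ _ => zero_le_one) (fun _ _ => hK) H.map_X

/-- The regression function of a response that depends on the signs only. -/
theorem SignMeans.condExp (H : SignMeans u v) {G : Obs d → ℝ} (hG : Measurable G)
    {g : Bool × Bool → ℝ} (hg : ∀ b x, G (signObs c h b x) = g b) {r : (Fin d → ℝ) → ℝ}
    (hr : CubeBdd r) (hgr : ∀ x, ∑ b, signWeight u v b x * g b = r x) :
    (signLaw c h u v)[G | Obs.sigmaX d] =ᵐ[signLaw c h u v] fun o => r o.X := by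
  have hP := H.covLaw (c := c) (h := h) le_rfl
  have := hP.prob
  have hrX := integrable_comp_X hP.mem_cube hr
  have hGb : ∀ b, CubeBdd fun x => G (signObs c h b x) := fun b => by
    simp_rw [hg]; exact CubeBdd.const _
  have hGi : Integrable G (signLaw c h u v) := by
    refine Integrable.of_bound hG.aestronglyMeasurable (∑ b, |g b|) ?_
    refine H.ae_signLaw (measurableSet_le hG.norm measurable_const) fun b x => ?_
    rw [hg, Real.norm_eq_abs]
    exact Finset.single_le_sum (f := fun b => |g b|) (fun b _ => abs_nonneg _) (Finset.mem_univ b)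
  refine (ae_eq_condExp_of_forall_setIntegral_eq (Obs.sigmaX_le d) hGi
    (fun s _ _ => hrX.integrableOn) (fun s hs _ => ?_)
    (Obs.stronglyMeasurable_comp_X hr.meas).aestronglyMeasurable).symm
  obtain ⟨t, ht, rfl⟩ := hs
  have hmt : MeasurableSet (Obs.X ⁻¹' t : Set (Obs d)) := Obs.measurable_X ht
  rw [← integral_indicator hmt, ← integral_indicator hmt]
  have b1 : CubeBdd fun x => t.indicator (fun _ => (1 : ℝ)) x :=
    ⟨measurable_const.indicator ht, 1, fun x _ => by
      by_cases hx : x ∈ t <;> simp [hx]⟩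
  have e1 : ∀ (F : Obs d → ℝ) (o : Obs d), (Obs.X ⁻¹' t).indicator F o =
      t.indicator (fun _ => (1 : ℝ)) o.X * F o := fun F o => by
    by_cases ho : o.X ∈ t
    · rw [Set.indicator_of_mem (by exact ho), Set.indicator_of_mem ho, one_mul]
    · rw [Set.indicator_of_notMem (by exact ho), Set.indicator_of_notMem ho, zero_mul]
  simp_rw [e1]
  have m1 : Measurable fun o : Obs d => t.indicator (fun _ => (1 : ℝ)) o.X :=
    b1.meas.comp Obs.measurable_X
  rw [H.integral_signLaw (G := fun o => t.indicator (fun _ => (1 : ℝ)) o.X * r o.X)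
      (m1.mul (hr.meas.comp Obs.measurable_X)) fun b => b1.mul hr,
    H.integral_signLaw (G := fun o => t.indicator (fun _ => (1 : ℝ)) o.X * G o)
      (m1.mul hG) fun b => b1.mul (hGb b)]
  refine integral_cube_congr fun x _ => ?_
  have e2 : ∀ b, (signObs c h b x).X = x := fun b => rfl
  simp only [e2, hg]
  rw [← sum_mul, sum_signWeight, one_mul, ← hgr, mul_sum]
  exact sum_congr rfl fun b _ => by ring

theorem SignMeans.condExp_A (H : SignMeans u v) :
    (signLaw c h u v)[Obs.A | Obs.sigmaX d] =ᵐ[signLaw c h u v] fun o => c + h * u o.X :=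
  H.condExp Obs.measurable_A (g := fun b => c + h * sg b.1) (fun _ _ => rfl)
    ((CubeBdd.const c).add (H.left.const_mul h)) fun x => by
      simp [Fintype.sum_prod_type, signWeight]; ring

theorem SignMeans.condExp_Y (H : SignMeans u v) :
    (signLaw c h u v)[Obs.Y | Obs.sigmaX d] =ᵐ[signLaw c h u v] fun o => c + h * v o.X :=
  H.condExp Obs.measurable_Y (g := fun b => c + h * sg b.2) (fun _ _ => rfl)
    ((CubeBdd.const c).add (H.right.const_mul h)) fun x => by
      simp [Fintype.sum_prod_type, signWeight]; ring

variable {S : ℕ} {W : CDVBasis S} {θ : ModelParams}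

theorem SignMeans.inModel (H : SignMeans u v) (hnd : NonDegenerate d W θ)
    (hh : 0 ≤ h) (h₁ : θ.C₁ ≤ c - h) (h₂ : c + h ≤ θ.C₂)
    (hp : (fun x => c + h * u x) ∈ W.HolderBall d θ.α θ.M)
    (hb : (fun x => c + h * v x) ∈ W.HolderBall d θ.β θ.M) :
    InModel W θ (signLaw c h u v) (fun x => c + h * u x) (fun x => c + h * v x)
      (fun _ => 1) where
  prob := H.isProbabilityMeasure
  bounded := by
    have h3 : ∀ b : Bool, c + h * sg b ∈ Set.Icc θ.C₁ θ.C₂ := fun b => by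
      cases b <;> simp <;> constructor <;> linarith
    exact H.ae_signLaw ((Obs.measurable_A measurableSet_Icc).inter
      (Obs.measurable_Y measurableSet_Icc)) fun b x => ⟨h3 b.1, h3 b.2⟩
  density := H.map_X
  reg_p := H.condExp_A
  reg_b := H.condExp_Y
  holder_p := hp
  holder_b := hb
  holder_f := ⟨uniformContinuous_const.uniformContinuousOn, hnd.uniform⟩
  bounded_f := fun _ _ => ⟨hnd.M₁_le, hnd.le_M₂⟩

theorem SignMeans.regr_A (H : SignMeans u v) {K : ℝ} (hK : 1 ≤ K) (hh : 0 ≤ h)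
    (hcK : |c| + h ≤ K) : Regr (signLaw c h u v) (fun _ => 1) K Obs.A (fun x => c + h * u x) := by
  refine regr_of_condExp (H.covLaw hK) Obs.measurable_A ?_
    ((CubeBdd.const c).add (H.left.const_mul h)) (fun x hx => ?_) H.condExp_A
  · refine H.ae_signLaw (measurableSet_le Obs.measurable_A.norm measurable_const) fun b x => ?_
    refine (abs_add_le c (h * sg b.1)).trans ?_
    rwa [abs_mul, abs_sg, abs_of_nonneg hh, mul_one]
  · refine (abs_add_le _ _).trans (le_trans ?_ hcK)
    rw [abs_mul, abs_of_nonneg hh]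
    have h1 : |u x| ≤ 1 := by linarith [H.le x hx, abs_nonneg (v x)]
    linarith [mul_le_mul_of_nonneg_left h1 hh]

theorem SignMeans.regr_Y (H : SignMeans u v) {K : ℝ} (hK : 1 ≤ K) (hh : 0 ≤ h)
    (hcK : |c| + h ≤ K) : Regr (signLaw c h u v) (fun _ => 1) K Obs.Y (fun x => c + h * v x) := by
  refine regr_of_condExp (H.covLaw hK) Obs.measurable_Y ?_
    ((CubeBdd.const c).add (H.right.const_mul h)) (fun x hx => ?_) H.condExp_Y
  · refine H.ae_signLaw (measurableSet_le Obs.measurable_Y.norm measurable_const) fun b x => ?_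
    refine (abs_add_le c (h * sg b.2)).trans ?_
    rwa [abs_mul, abs_sg, abs_of_nonneg hh, mul_one]
  · refine (abs_add_le _ _).trans (le_trans ?_ hcK)
    rw [abs_mul, abs_of_nonneg hh]
    have h1 : |v x| ≤ 1 := by linarith [H.le x hx, abs_nonneg (u x)]
    linarith [mul_le_mul_of_nonneg_left h1 hh]

theorem SignMeans.psi_signLaw (H : SignMeans u v) (hh : 0 ≤ h) :
    psi (signLaw c h u v) = -h ^ 2 * ∫ x in cube d, u x * v x := by
  have hK : (1 : ℝ) ≤ 1 + |c| + h := by linarith [abs_nonneg c]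
  have hK' : |c| + h ≤ 1 + |c| + h := by linarith
  have bu := H.left
  have bv := H.right
  rw [psi_eq (H.covLaw hK) (H.regr_A hK hh hK') (H.regr_Y hK hh hK') H.condExp_A H.condExp_Y,
    H.integral_signLaw (G := fun o => o.A * o.Y) (Obs.measurable_A.mul Obs.measurable_Y) fun b => CubeBdd.const
      ((c + h * sg b.1) * (c + h * sg b.2)), ← integral_sub, ← integral_const_mul]
  · refine integral_cube_congr fun x _ => ?_
    simp [Fintype.sum_prod_type, signWeight, signObs, Obs.A, Obs.Y]
    ring
  · exact (CubeBdd.sum fun b _ => (H.cubeBdd_weight b).mul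
      (CubeBdd.const ((c + h * sg b.1) * (c + h * sg b.2)))).integrable
  · exact ((((CubeBdd.const c).add (bu.const_mul h)).mul ((CubeBdd.const c).add
      (bv.const_mul h))).mul (CubeBdd.const 1)).integrable

end

theorem lintegral_pi_prod_eq_prod {E ι : Type*} [MeasurableSpace E] [Fintype ι]
    {μ : Measure E} [IsProbabilityMeasure μ] {f : ι → E → ℝ≥0∞} (hf : ∀ i, Measurable (f i)) :
    ∫⁻ x, ∏ i, f i (x i) ∂(Measure.pi fun _ : ι => μ) = ∏ i, ∫⁻ x, f i x ∂μ := by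
  rw [ProbabilityTheory.lintegral_prod_eq_prod_lintegral_of_indepFun Finset.univ
    (fun i (x : ι → E) => f i (x i)) (ProbabilityTheory.iIndepFun_pi fun i => (hf i).aemeasurable)
    fun i => (hf i).comp (measurable_pi_apply i)]
  exact prod_congr rfl fun i _ => (measurePreserving_eval (fun _ : ι => μ) i).lintegral_comp (hf i)

/-- The law of independent observations from a finite mixture. -/
theorem pi_sum_map_withDensity {E Ω B ι : Type*} [MeasurableSpace E] [MeasurableSpace Ω] [Fintype B]
    [Fintype ι] [DecidableEq ι] {μ : Measure E} [IsProbabilityMeasure μ] {w : B → E → ℝ≥0∞}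
    (hw : ∀ b, Measurable (w b)) {g : B → E → Ω} (hg : ∀ b, Measurable (g b))
    [SigmaFinite (∑ b, (μ.withDensity (w b)).map (g b))] :
    Measure.pi (fun _ : ι => ∑ b, (μ.withDensity (w b)).map (g b)) =
      ∑ σ : ι → B, ((Measure.pi fun _ : ι => μ).withDensity fun x => ∏ i, w (σ i) (x i)).map
        fun x i => g (σ i) (x i) := by
  refine Measure.pi_eq fun s hs => ?_
  have hG : ∀ σ : ι → B, Measurable fun (x : ι → E) i => g (σ i) (x i) := fun σ =>
    measurable_pi_lambda _ fun i => (hg (σ i)).comp (measurable_pi_apply i)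
  simp only [Measure.finsetSum_apply]
  rw [Fintype.prod_sum]
  refine sum_congr rfl fun σ _ => ?_
  rw [Measure.map_apply (hG σ) (MeasurableSet.univ_pi hs),
    withDensity_apply _ (hG σ (MeasurableSet.univ_pi hs)),
    ← lintegral_indicator (hG σ (MeasurableSet.univ_pi hs))]
  have h1 : ∀ x : ι → E, ((fun (x : ι → E) i => g (σ i) (x i)) ⁻¹' Set.univ.pi s).indicator
      (fun x => ∏ i, w (σ i) (x i)) x = ∏ i, (g (σ i) ⁻¹' s i).indicator (w (σ i)) (x i) := by
    intro x
    by_cases hx : ∀ i, g (σ i) (x i) ∈ s i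
    · rw [Set.indicator_of_mem (by simpa [Set.mem_pi] using hx)]
      exact prod_congr rfl fun i _ => (Set.indicator_of_mem (by exact hx i) _).symm
    · rw [Set.indicator_of_notMem (by simpa [Set.mem_pi] using hx)]
      push Not at hx
      obtain ⟨i, hi⟩ := hx
      exact (Finset.prod_eq_zero (Finset.mem_univ i)
        (Set.indicator_of_notMem (by exact hi) _)).symm
  simp_rw [h1]
  rw [lintegral_pi_prod_eq_prod]
  · refine prod_congr rfl fun i _ => ?_
    rw [Measure.map_apply (hg _) (hs i), withDensity_apply _ (hg _ (hs i)),
      lintegral_indicator (hg _ (hs i))]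
  · exact fun i => (hw _).indicator (hg _ (hs i))

/-! ### Affinity of mixtures of sign laws -/

/-- The sum of the densities of a sequence of pairs of signs, over the two global sign changes of
the pair of mean vectors `u`, `v`. -/
def cellMix {F : Type*} [Fintype F] (u v : F → ℝ) (σ : F → Bool × Bool) : ℝ :=
  ∑ l : Bool, ∏ i, (1 + sg l * u i * sg (σ i).1 + sg l * v i * sg (σ i).2) / 4

/-- The sum of the densities of a sequence of pairs of signs, over the sign changes of the mean
vectors that are constant on the level sets of `κ`. -/
def signMix {ι C : Type*} [Fintype ι] [Fintype C] [DecidableEq C] (κ : ι → C) (u v : ι → ℝ)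
    (σ : ι → Bool × Bool) : ℝ :=
  ∑ l : C → Bool, ∏ i, (1 + sg (l (κ i)) * u i * sg (σ i).1 + sg (l (κ i)) * v i * sg (σ i).2) / 4

section

variable {F : Type*} [Fintype F] {u v : F → ℝ} {A B : ℝ}

theorem sum_prod_signs (f : F → Bool × Bool → ℝ) [DecidableEq F] :
    ∑ σ : F → Bool × Bool, ∏ i, f i (σ i) = ∏ i, ∑ b, f i b :=
  (Fintype.prod_sum f).symm

theorem sum_cellMix (u v : F → ℝ) [DecidableEq F] : ∑ σ, cellMix u v σ = 2 := by
  unfold cellMix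
  rw [Finset.sum_comm]
  have : ∀ l : Bool, ∑ σ : F → Bool × Bool,
      ∏ i, (1 + sg l * u i * sg (σ i).1 + sg l * v i * sg (σ i).2) / 4 = 1 := fun l => by
    rw [sum_prod_signs fun i b => (1 + sg l * u i * sg b.1 + sg l * v i * sg b.2) / 4]
    refine Finset.prod_eq_one fun i _ => ?_
    simp [Fintype.sum_prod_type]; ring
  rw [sum_congr rfl fun l _ => this l]
  simp

theorem abs_sg_mul_mul (l b : Bool) (t : ℝ) : |sg l * t * sg b| = |t| := by
  rw [abs_mul, abs_mul, abs_sg, abs_sg, one_mul, mul_one]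

/-- Each pair of signs has density at least `(1 - 1 / 2) / 4`. -/
theorem le_cellMix (h : ∀ i, |u i| + |v i| ≤ 1 / 2) (σ : F → Bool × Bool) :
    2 * (1 / 8) ^ Fintype.card F ≤ cellMix u v σ := by
  have : ∀ l : Bool, (1 / 8 : ℝ) ^ Fintype.card F ≤
      ∏ i, (1 + sg l * u i * sg (σ i).1 + sg l * v i * sg (σ i).2) / 4 := fun l => by
    rw [← Finset.card_univ, ← prod_const]
    refine prod_le_prod (fun _ _ => by norm_num) fun i _ => ?_
    have h1 := neg_abs_le (sg l * u i * sg (σ i).1)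
    have h2 := neg_abs_le (sg l * v i * sg (σ i).2)
    rw [abs_sg_mul_mul] at h1 h2
    linarith [h i]
  unfold cellMix
  rw [Fintype.sum_bool]
  linarith [this true, this false]

theorem cellMix_nonneg (h : ∀ i, |u i| + |v i| ≤ 1 / 2) (σ : F → Bool × Bool) :
    0 ≤ cellMix u v σ :=
  le_trans (by positivity) (le_cellMix h σ)

/-- The four alternating sums of `∏ (1 ± aᵢ ± bᵢ)`: each alternation contributes the size of the
corresponding perturbation. -/
theorem alternating_prod_bounds {a b : F → ℝ} (hA : A ≤ 1) (hB : B ≤ 1)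
    (ha : ∀ i, 0 ≤ a i ∧ a i ≤ A) (hb : ∀ i, 0 ≤ b i ∧ b i ≤ B) (hA₀ : 0 ≤ A) (hB₀ : 0 ≤ B)
    (s : Finset F) (P : ℝ → ℝ → ℝ) (hP : ∀ x y, P x y = ∏ i ∈ s, (1 + x * a i + y * b i)) :
    (0 ≤ P 1 1 + P 1 (-1) + P (-1) 1 + P (-1) (-1) ∧
      P 1 1 + P 1 (-1) + P (-1) 1 + P (-1) (-1) ≤ 4 * 3 ^ s.card) ∧
    (0 ≤ P 1 1 + P 1 (-1) - P (-1) 1 - P (-1) (-1) ∧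
      P 1 1 + P 1 (-1) - P (-1) 1 - P (-1) (-1) ≤ 4 * 3 ^ s.card * A) ∧
    (0 ≤ P 1 1 - P 1 (-1) + P (-1) 1 - P (-1) (-1) ∧
      P 1 1 - P 1 (-1) + P (-1) 1 - P (-1) (-1) ≤ 4 * 3 ^ s.card * B) ∧
    (0 ≤ P 1 1 - P 1 (-1) - P (-1) 1 + P (-1) (-1) ∧
      P 1 1 - P 1 (-1) - P (-1) 1 + P (-1) (-1) ≤ 4 * 3 ^ s.card * (A * B)) := by
  classical
  induction s using Finset.induction_on generalizing P with
  | empty =>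
    simp only [hP, Finset.prod_empty, Finset.card_empty]
    refine ⟨⟨?_, ?_⟩, ⟨?_, ?_⟩, ⟨?_, ?_⟩, ?_, ?_⟩ <;> norm_num <;> positivity
  | insert i s hi ih =>
    obtain ⟨⟨e1, e2⟩, ⟨f1, f2⟩, ⟨g1, g2⟩, k1, k2⟩ := ih (fun x y => ∏ i ∈ s, (1 + x * a i + y * b i))
      fun _ _ => rfl
    have hP' : ∀ x y, P x y = (1 + x * a i + y * b i) * ∏ i ∈ s, (1 + x * a i + y * b i) :=
      fun x y => by rw [hP, Finset.prod_insert hi]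
    rw [Finset.card_insert_of_notMem hi, pow_succ]
    simp only [hP']
    clear hP' hP
    set p := ∏ i ∈ s, (1 + 1 * a i + 1 * b i)
    set q := ∏ i ∈ s, (1 + 1 * a i + -1 * b i)
    set r := ∏ i ∈ s, (1 + -1 * a i + 1 * b i)
    set t := ∏ i ∈ s, (1 + -1 * a i + -1 * b i)
    obtain ⟨ha0, ha1⟩ := ha i
    obtain ⟨hb0, hb1⟩ := hb i
    set E : ℝ := 4 * 3 ^ s.card
    have hE3 : 4 * (3 ^ s.card * 3) = 3 * E := by simp only [E]; ring
    rw [hE3]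
    have m1 := mul_nonneg ha0 e1
    have m2 := mul_nonneg ha0 f1
    have m3 := mul_nonneg ha0 g1
    have m4 := mul_nonneg ha0 k1
    have n1 := mul_nonneg hb0 e1
    have n2 := mul_nonneg hb0 f1
    have n3 := mul_nonneg hb0 g1
    have n4 := mul_nonneg hb0 k1
    have u1 := mul_le_mul ha1 e2 e1 hA₀
    have u2 := mul_le_mul ha1 f2 f1 hA₀
    have u3 := mul_le_mul ha1 g2 g1 hA₀
    have u4 := mul_le_mul ha1 k2 k1 hA₀
    have w1 := mul_le_mul hb1 e2 e1 hB₀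
    have w2 := mul_le_mul hb1 f2 f1 hB₀
    have w3 := mul_le_mul hb1 g2 g1 hB₀
    have w4 := mul_le_mul hb1 k2 k1 hB₀
    have z1 : A * (E * A) ≤ E := by
      nlinarith
    have z2 : B * (E * B) ≤ E := by
      nlinarith
    have z3 : A * (E * (A * B)) ≤ E * B := by nlinarith [mul_le_mul_of_nonneg_right z1 hB₀]
    have z4 : B * (E * (A * B)) ≤ E * A := by nlinarith [mul_le_mul_of_nonneg_right z2 hA₀]
    refine ⟨⟨?_, ?_⟩, ⟨?_, ?_⟩, ⟨?_, ?_⟩, ?_, ?_⟩ <;> linarith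

/-- Squared `L²` distance of the mixtures with means `u, v` and `u, -v`: a mixed second difference of
`∏ (1 ± u² ± v²)`. -/
theorem sum_sq_cellMix_sub [DecidableEq F] (P : ℝ → ℝ → ℝ)
    (hP : ∀ x y, P x y = ∏ i, (1 + x * u i ^ 2 + y * v i ^ 2)) :
    ∑ σ, (cellMix u v σ - cellMix u (fun i => -v i) σ) ^ 2 =
      4 / 4 ^ Fintype.card F * (P 1 1 - P 1 (-1) - P (-1) 1 + P (-1) (-1)) := by
  have h1 : ∀ σ : F → Bool × Bool, cellMix u v σ - cellMix u (fun i => -v i) σ =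
      ∑ l : Bool × Bool, sg l.1 * sg l.2 *
        ∏ i, (1 + sg l.1 * u i * sg (σ i).1 + sg l.2 * v i * sg (σ i).2) / 4 := fun σ => by
    simp only [cellMix, Fintype.sum_bool, Fintype.sum_prod_type, sg_true, sg_false, one_mul,
      neg_one_mul, mul_one, neg_mul, neg_neg, mul_neg]
    ring
  have h2 : ∀ l k : Bool × Bool, ∑ σ : F → Bool × Bool,
      (∏ i, (1 + sg l.1 * u i * sg (σ i).1 + sg l.2 * v i * sg (σ i).2) / 4) *
      (∏ i, (1 + sg k.1 * u i * sg (σ i).1 + sg k.2 * v i * sg (σ i).2) / 4) =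
      1 / 4 ^ Fintype.card F * P (sg l.1 * sg k.1) (sg l.2 * sg k.2) := fun l k => by
    simp_rw [← prod_mul_distrib]
    rw [sum_prod_signs fun i b => (1 + sg l.1 * u i * sg b.1 + sg l.2 * v i * sg b.2) / 4 *
      ((1 + sg k.1 * u i * sg b.1 + sg k.2 * v i * sg b.2) / 4), hP, ← Finset.card_univ,
      ← one_div_pow, ← prod_const, ← prod_mul_distrib]
    refine prod_congr rfl fun i _ => ?_
    simp [Fintype.sum_prod_type]; ring
  have h3 : ∀ σ : F → Bool × Bool, (cellMix u v σ - cellMix u (fun i => -v i) σ) ^ 2 =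
      ∑ l : Bool × Bool, ∑ k : Bool × Bool, sg l.1 * sg l.2 * (sg k.1 * sg k.2) *
        ((∏ i, (1 + sg l.1 * u i * sg (σ i).1 + sg l.2 * v i * sg (σ i).2) / 4) *
        ∏ i, (1 + sg k.1 * u i * sg (σ i).1 + sg k.2 * v i * sg (σ i).2) / 4) := fun σ => by
    rw [h1, sq, Finset.sum_mul_sum]
    exact sum_congr rfl fun l _ => sum_congr rfl fun k _ => mul_mul_mul_comm _ _ _ _
  have h4 : ∑ σ, (cellMix u v σ - cellMix u (fun i => -v i) σ) ^ 2 =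
      ∑ l : Bool × Bool, ∑ k : Bool × Bool, sg l.1 * sg l.2 * (sg k.1 * sg k.2) *
        (1 / 4 ^ Fintype.card F * P (sg l.1 * sg k.1) (sg l.2 * sg k.2)) := by
    rw [sum_congr rfl fun σ _ => h3 σ, Finset.sum_comm]
    refine sum_congr rfl fun l _ => ?_
    rw [Finset.sum_comm]
    refine sum_congr rfl fun k _ => ?_
    rw [← mul_sum, h2]
  rw [h4]
  simp only [Fintype.sum_prod_type, Fintype.sum_bool, sg_true, sg_false, one_mul, mul_one, neg_mul,
    mul_neg, neg_neg]
  ring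

theorem one_add_five_mul_le {r : ℕ} (h : 2 ≤ r) : (1 : ℝ) + 5 * r ≤ 6 ^ r / 2 := by
  induction r, h using Nat.le_induction with
  | base => norm_num
  | succ k hk ih =>
    rw [pow_succ]
    push_cast
    have : (2 : ℝ) ≤ k := by exact_mod_cast hk
    linarith

theorem sqrt_mul_ge {x y m : ℝ} (hm : 0 < m) (hx : m ≤ x) (hy : m ≤ y) :
    (x + y) / 2 - (x - y) ^ 2 / (4 * m) ≤ √(x * y) := by
  have hx0 : 0 ≤ x := hm.le.trans hx
  have hy0 : 0 ≤ y := hm.le.trans hy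
  rw [Real.sqrt_mul hx0]
  have ex := Real.mul_self_sqrt hx0
  have ey := Real.mul_self_sqrt hy0
  set a := √x
  set b := √y
  have ha : 0 ≤ a := Real.sqrt_nonneg _
  have hb : 0 ≤ b := Real.sqrt_nonneg _
  have h1 : (a - b) ^ 2 / 2 ≤ (x - y) ^ 2 / (4 * m) := by
    rw [div_le_div_iff₀ (by norm_num) (by positivity)]
    have h2 : x - y = (a - b) * (a + b) := by rw [← ex, ← ey]; ring
    have h3 : 4 * m ≤ 2 * (a + b) ^ 2 := by nlinarith [mul_nonneg ha hb]
    rw [h2, mul_pow]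
    nlinarith [mul_le_mul_of_nonneg_left h3 (sq_nonneg (a - b))]
  nlinarith

/-- The Hellinger affinity of the two mixtures in one cell. With fewer than two observations in
the cell the mixtures coincide, which is why the bound vanishes to second order. -/
theorem cell_affinity_ge [DecidableEq F] (h : ∀ i, |u i| + |v i| ≤ 1 / 2) (hA : A ≤ 1) (hB : B ≤ 1)
    (hA₀ : 0 ≤ A) (hB₀ : 0 ≤ B) (hu : ∀ i, u i ^ 2 ≤ A) (hv : ∀ i, v i ^ 2 ≤ B) :
    2 * (1 - 2 * (A * B) * (6 ^ Fintype.card F - 1 - 5 * Fintype.card F)) ≤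
      ∑ σ, √(cellMix u v σ * cellMix u (fun i => -v i) σ) := by
  set r := Fintype.card F with hr
  have h' : ∀ i, |u i| + |-v i| ≤ 1 / 2 := fun i => by rw [abs_neg]; exact h i
  -- `m` bounds the densities from below, so that the squared distance controls the affinity
  set m : ℝ := 2 * (1 / 8) ^ r with hm
  have hm0 : 0 < m := by positivity
  have h1 : ∑ σ, ((cellMix u v σ + cellMix u (fun i => -v i) σ) / 2 -
      (cellMix u v σ - cellMix u (fun i => -v i) σ) ^ 2 / (4 * m)) ≤
      ∑ σ, √(cellMix u v σ * cellMix u (fun i => -v i) σ) :=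
    sum_le_sum fun σ _ => sqrt_mul_ge hm0 (le_cellMix h σ) (le_cellMix h' σ)
  refine le_trans ?_ h1
  set P : ℝ → ℝ → ℝ := fun x y => ∏ i, (1 + x * u i ^ 2 + y * v i ^ 2) with hP
  rw [Finset.sum_sub_distrib, ← Finset.sum_div, ← Finset.sum_div, sum_add_distrib,
    sum_cellMix, sum_cellMix, sum_sq_cellMix_sub P fun _ _ => rfl, ← hr]
  set D := P 1 1 - P 1 (-1) - P (-1) 1 + P (-1) (-1) with hD
  have hAB : 0 ≤ A * B := mul_nonneg hA₀ hB₀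
  have h2 : 4 / 4 ^ r * D / (4 * m) = D / 2 * 2 ^ r := by
    have : (4 : ℝ) ^ r * 2 ^ r = 8 ^ r := by rw [← mul_pow]; norm_num
    rw [hm, one_div_pow, ← this]
    field_simp
  have h3 : D / 2 * 2 ^ r ≤ 2 * (2 * (A * B) * (6 ^ r - 1 - 5 * r)) := by
    rcases Nat.lt_or_ge r 2 with h4 | h4
    -- products of at most one factor are affine in `(x, y)`: no second difference
    · have hD0 : D = 0 := by
        interval_cases h5 : r
        · have : IsEmpty F := Fintype.card_eq_zero_iff.1 h5
          simp [hD, hP]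
        · obtain ⟨i, hi⟩ := Fintype.card_eq_one_iff.1 h5
          have : (Finset.univ : Finset F) = {i} := by
            ext k; simpa using hi k
          simp only [hD, hP, this, Finset.prod_singleton]
          ring
      rw [hD0]
      interval_cases r <;> norm_num
    · have hDle := (alternating_prod_bounds hA hB (a := fun i => u i ^ 2) (b := fun i => v i ^ 2)
        (fun i => ⟨sq_nonneg _, hu i⟩) (fun i => ⟨sq_nonneg _, hv i⟩) hA₀ hB₀ Finset.univ P
        fun _ _ => rfl).2.2.2.2
      rw [Finset.card_univ, ← hr] at hDle
      have h6 := one_add_five_mul_le h4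
      calc D / 2 * 2 ^ r ≤ 4 * 3 ^ r * (A * B) / 2 * 2 ^ r := by gcongr
        _ = 2 * (A * B) * 6 ^ r := by
          rw [show (6 : ℝ) = 3 * 2 by norm_num, mul_pow]; ring
        _ ≤ _ := by nlinarith
  rw [h2]
  linarith

theorem cell_affinity_le [DecidableEq F] (h : ∀ i, |u i| + |v i| ≤ 1 / 2) :
    ∑ σ, √(cellMix u v σ * cellMix u (fun i => -v i) σ) ≤ 2 := by
  have h' : ∀ i, |u i| + |-v i| ≤ 1 / 2 := fun i => by rw [abs_neg]; exact h i
  have h1 : ∀ σ, √(cellMix u v σ * cellMix u (fun i => -v i) σ) ≤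
      (cellMix u v σ + cellMix u (fun i => -v i) σ) / 2 := fun σ => by
    have a1 : 0 ≤ cellMix u v σ := cellMix_nonneg h σ
    have a2 : 0 ≤ cellMix u (fun i => -v i) σ := cellMix_nonneg h' σ
    rw [Real.sqrt_le_left (by positivity)]
    nlinarith [sq_nonneg (cellMix u v σ - cellMix u (fun i => -v i) σ)]
  refine (sum_le_sum fun σ _ => h1 σ).trans ?_
  rw [← Finset.sum_div, sum_add_distrib, sum_cellMix, sum_cellMix]
  norm_num

end

section

variable {ι C : Type*} [Fintype ι] [DecidableEq ι] [Fintype C] [DecidableEq C]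

theorem sum_prod_fiber {B : Type*} [Fintype B] (κ : ι → C)
    (H : ∀ c, ({i // κ i = c} → B) → ℝ) :
    ∑ σ : ι → B, ∏ c, H c (fun i => σ i.1) = ∏ c, ∑ τ, H c τ := by
  rw [Fintype.prod_sum]
  exact Fintype.sum_equiv (((Equiv.sigmaFiberEquiv κ).symm.arrowCongr (Equiv.refl B)).trans
    (Equiv.piCurry fun _ _ => B)) _ _ fun σ => rfl

theorem signMix_eq_prod (κ : ι → C) (u v : ι → ℝ) (σ : ι → Bool × Bool) :
    signMix κ u v σ = ∏ c, cellMix (fun i : {i // κ i = c} => u i) (fun i => v i)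
      (fun i => σ i.1) := by
  unfold signMix cellMix
  rw [Fintype.prod_sum]
  refine sum_congr rfl fun l _ => ?_
  rw [← Fintype.prod_fiberwise κ]
  refine prod_congr rfl fun c _ => prod_congr rfl fun i _ => ?_
  rw [i.2]

theorem signMix_nonneg {κ : ι → C} {u v : ι → ℝ} (h : ∀ i, |u i| + |v i| ≤ 1 / 2)
    (σ : ι → Bool × Bool) : 0 ≤ signMix κ u v σ := by
  rw [signMix_eq_prod]
  exact Finset.prod_nonneg fun c _ => cellMix_nonneg (fun i : {i // κ i = c} => h i) _

theorem sum_signMix (κ : ι → C) (u v : ι → ℝ) :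
    ∑ σ, signMix κ u v σ = 2 ^ Fintype.card C := by
  simp_rw [signMix_eq_prod]
  rw [sum_prod_fiber κ fun c τ => cellMix (fun i : {i // κ i = c} => u i) (fun i => v i) τ]
  simp [sum_cellMix]

theorem one_sub_sum_le_prod {s : Finset C} {f : C → ℝ} (h0 : ∀ c, 0 ≤ f c) (h1 : ∀ c, f c ≤ 1) :
    1 - ∑ c ∈ s, (1 - f c) ≤ ∏ c ∈ s, f c := by
  induction s using Finset.induction_on with
  | empty => simp
  | insert i s hi ih =>
    rw [Finset.sum_insert hi, Finset.prod_insert hi]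
    have h2 : ∏ c ∈ s, f c ≤ 1 := Finset.prod_le_one (fun c _ => h0 c) fun c _ => h1 c
    nlinarith [h0 i, h1 i]

/-- The overlap of the two mixtures, from the Hellinger affinity, which factorizes over the
cells. -/
theorem sum_min_signMix_ge {κ : ι → C} {u v : ι → ℝ} {A B : ℝ}
    (h : ∀ i, |u i| + |v i| ≤ 1 / 2) (hA : A ≤ 1) (hB : B ≤ 1)
    (hA₀ : 0 ≤ A) (hB₀ : 0 ≤ B) (hu : ∀ i, u i ^ 2 ≤ A) (hv : ∀ i, v i ^ 2 ≤ B) :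
    2 ^ Fintype.card C * (1 / 2 - 2 * (A * B) * ∑ c, (6 ^ Fintype.card {i // κ i = c} - 1 -
      5 * (Fintype.card {i // κ i = c} : ℝ))) ≤
      ∑ σ, min (signMix κ u v σ) (signMix κ u (fun i => -v i) σ) := by
  have h' : ∀ i, |u i| + |-v i| ≤ 1 / 2 := fun i => by rw [abs_neg]; exact h i
  set a : ∀ c, ({i // κ i = c} → Bool × Bool) → ℝ := fun c τ =>
    √(cellMix (fun i : {i // κ i = c} => u i) (fun i => v i) τ *
      cellMix (fun i : {i // κ i = c} => u i) (fun i => -v i) τ) with ha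
  have h1 : ∀ σ, √(signMix κ u v σ * signMix κ u (fun i => -v i) σ) =
      ∏ c, a c (fun i => σ i.1) := fun σ => by
    rw [signMix_eq_prod, signMix_eq_prod, ← prod_mul_distrib, ha, Real.sqrt_prod]
    exact fun c _ => mul_nonneg (cellMix_nonneg (fun i : {i // κ i = c} => h i) _)
      (cellMix_nonneg (fun i : {i // κ i = c} => h' i) _)
  have h2 : 2 ^ Fintype.card C * (1 - 2 * (A * B) * ∑ c, (6 ^ Fintype.card {i // κ i = c} - 1 -
      5 * (Fintype.card {i // κ i = c} : ℝ))) ≤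
      ∑ σ, √(signMix κ u v σ * signMix κ u (fun i => -v i) σ) := by
    simp_rw [h1]
    rw [sum_prod_fiber κ a]
    have h3 : ∏ c, ∑ τ, a c τ = 2 ^ Fintype.card C * ∏ c, ((∑ τ, a c τ) / 2) := by
      rw [Finset.prod_div_distrib, prod_const, Finset.card_univ]
      field_simp
    rw [h3]
    refine mul_le_mul_of_nonneg_left (le_trans ?_ (one_sub_sum_le_prod (fun c => ?_) fun c => ?_))
      (by positivity)
    · rw [mul_sum]
      refine sub_le_sub_left (sum_le_sum fun c _ => ?_) _
      have := cell_affinity_ge (F := {i // κ i = c}) (u := fun i => u i) (v := fun i => v i)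
        (fun i => h i) hA hB hA₀ hB₀ (fun i => hu i) (fun i => hv i)
      simp only [ha]
      linarith
    · exact div_nonneg (sum_nonneg fun τ _ => Real.sqrt_nonneg _) (by norm_num)
    · have := cell_affinity_le (F := {i // κ i = c}) (u := fun i => u i) (v := fun i => v i)
        (fun i => h i)
      simp only [ha]
      linarith
  have h4 : ∀ σ, √(signMix κ u v σ * signMix κ u (fun i => -v i) σ) -
      (signMix κ u v σ + signMix κ u (fun i => -v i) σ) / 4 ≤
      min (signMix κ u v σ) (signMix κ u (fun i => -v i) σ) := fun σ => by
    have hx := signMix_nonneg (κ := κ) h σ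
    have hy := signMix_nonneg (κ := κ) h' σ
    rw [Real.sqrt_mul hx]
    have ex := Real.mul_self_sqrt hx
    have ey := Real.mul_self_sqrt hy
    -- `a * b - (a ^ 2 + b ^ 2) / 4` is at most `min (a ^ 2) (b ^ 2)`, by completing the square
    refine le_min ?_ ?_
    · nlinarith [sq_nonneg (√(signMix κ u (fun i => -v i) σ) - 2 * √(signMix κ u v σ))]
    · nlinarith [sq_nonneg (√(signMix κ u v σ) - 2 * √(signMix κ u (fun i => -v i) σ))]
  refine le_trans ?_ (sum_le_sum fun σ _ => h4 σ)
  have h5 : ∑ σ, (√(signMix κ u v σ * signMix κ u (fun i => -v i) σ) -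
      (signMix κ u v σ + signMix κ u (fun i => -v i) σ) / 4) =
      ∑ σ, √(signMix κ u v σ * signMix κ u (fun i => -v i) σ) - 2 ^ Fintype.card C / 2 := by
    rw [Finset.sum_sub_distrib, ← Finset.sum_div, sum_add_distrib, sum_signMix, sum_signMix]
    ring
  rw [h5]
  linarith

theorem measurable_signMix {E : Type*} [MeasurableSpace E] [MeasurableSpace C]
    [DiscreteMeasurableSpace C] {κ : E → C} {u v : E → ℝ} (hκ : Measurable κ) (hu : Measurable u)
    (hv : Measurable v) (σ : ι → Bool × Bool) :
    Measurable fun x : ι → E =>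
      signMix (fun i => κ (x i)) (fun i => u (x i)) (fun i => v (x i)) σ := by
  refine Finset.measurable_fun_sum _ fun l _ => Finset.measurable_fun_prod _ fun i _ => ?_
  have hi : Measurable fun x : ι → E => x i := measurable_pi_apply i
  have h1 : Measurable fun x : ι → E => sg (l (κ (x i))) :=
    (Measurable.of_discrete (f := fun k => sg (l k))).comp (hκ.comp hi)
  exact (((measurable_const.add ((h1.mul (hu.comp hi)).mul_const _)).add
    ((h1.mul (hv.comp hi)).mul_const _)).div_const 4)

/-- Expected size of the error terms, for independent observations. -/
theorem integral_pow_card_fiber {E : Type*} [MeasurableSpace E] {μ : Measure E}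
    [IsProbabilityMeasure μ] {κ : E → C} {c : C} (hκ : MeasurableSet (κ ⁻¹' {c})) :
    Integrable (fun x : ι → E => (6 : ℝ) ^ Fintype.card {i // κ (x i) = c} - 1 -
      5 * (Fintype.card {i // κ (x i) = c} : ℝ)) (Measure.pi fun _ : ι => μ) ∧
    ∫ x : ι → E, ((6 : ℝ) ^ Fintype.card {i // κ (x i) = c} - 1 -
      5 * (Fintype.card {i // κ (x i) = c} : ℝ)) ∂(Measure.pi fun _ : ι => μ) =
      (1 + 5 * μ.real (κ ⁻¹' {c})) ^ Fintype.card ι - 1 -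
        5 * (Fintype.card ι * μ.real (κ ⁻¹' {c})) := by
  set s := κ ⁻¹' {c} with hs
  have e1 : ∀ x : ι → E, (6 : ℝ) ^ Fintype.card {i // κ (x i) = c} =
      ∏ i, (1 + 5 * s.indicator (fun _ => (1 : ℝ)) (x i)) := fun x => by
    rw [Fintype.card_subtype, ← prod_const, Finset.prod_filter]
    refine prod_congr rfl fun i _ => ?_
    by_cases hi : κ (x i) = c
    · rw [if_pos hi, Set.indicator_of_mem (by simpa [hs] using hi)]; norm_num
    · rw [if_neg hi, Set.indicator_of_notMem (by simpa [hs] using hi)]; norm_num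
  have e2 : ∀ x : ι → E, (Fintype.card {i // κ (x i) = c} : ℝ) =
      ∑ i, s.indicator (fun _ => (1 : ℝ)) (x i) := fun x => by
    rw [Fintype.card_subtype, Finset.card_eq_sum_ones, Finset.sum_filter]
    push_cast
    refine sum_congr rfl fun i _ => ?_
    by_cases hi : κ (x i) = c
    · rw [if_pos hi, Set.indicator_of_mem (by simpa [hs] using hi)]
    · rw [if_neg hi, Set.indicator_of_notMem (by simpa [hs] using hi)]
  have hm : Measurable (s.indicator fun _ => (1 : ℝ)) := measurable_const.indicator hκ
  have hb : ∀ x, |s.indicator (fun _ => (1 : ℝ)) x| ≤ 1 := fun x => by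
    by_cases hx : x ∈ s <;> simp [hx]
  have hi0 : Integrable (s.indicator fun _ => (1 : ℝ)) μ :=
    Integrable.of_bound hm.aestronglyMeasurable 1 (ae_of_all _ hb)
  have i1 : Integrable (fun x : ι → E => ∏ i, (1 + 5 * s.indicator (fun _ => (1 : ℝ)) (x i)))
      (Measure.pi fun _ : ι => μ) :=
    Integrable.fintype_prod (f := fun _ y => 1 + 5 * s.indicator (fun _ => (1 : ℝ)) y)
      fun i => (integrable_const _).add (hi0.const_mul 5)
  have i2 : ∀ i, Integrable (fun x : ι → E => s.indicator (fun _ => (1 : ℝ)) (x i))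
      (Measure.pi fun _ : ι => μ) := fun i =>
    (measurePreserving_eval (fun _ : ι => μ) i).integrable_comp_of_integrable hi0
  have v1 : ∫ x, s.indicator (fun _ => (1 : ℝ)) x ∂μ = μ.real s := by
    rw [integral_indicator hκ, setIntegral_const, smul_eq_mul, mul_one]
  simp_rw [e1, e2]
  refine ⟨(i1.sub (integrable_const _)).sub
    ((integrable_finsetSum _ fun i _ => i2 i).const_mul 5), ?_⟩
  rw [integral_sub (f := fun x : ι → E =>
      (∏ i, (1 + 5 * s.indicator (fun _ => (1 : ℝ)) (x i))) - 1) (i1.sub (integrable_const _))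
    ((integrable_finsetSum _ fun i _ => i2 i).const_mul 5), integral_sub i1 (integrable_const _),
    integral_fintype_prod_eq_prod (f := fun _ y => 1 + 5 * s.indicator (fun _ => (1 : ℝ)) y),
    integral_const_mul, integral_finsetSum _ fun i _ => i2 i]
  have v2 : ∀ i : ι, ∫ x : ι → E, s.indicator (fun _ => (1 : ℝ)) (x i)
      ∂(Measure.pi fun _ : ι => μ) = μ.real s := fun i => by
    rw [← v1]
    conv_rhs => rw [← (measurePreserving_eval (fun _ : ι => μ) i).map_eq]
    rw [integral_map (measurable_pi_apply i).aemeasurable hm.aestronglyMeasurable]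
  simp_rw [v2]
  rw [integral_add (integrable_const _) (hi0.const_mul 5), integral_const_mul, v1]
  simp

theorem one_add_pow_sub_le {p : ℝ} {N : ℕ} (hp : 0 ≤ p) (h : 5 * (N * p) ≤ 1) :
    (1 + 5 * p) ^ N - 1 - 5 * (N * p) ≤ 25 * (N * p) ^ 2 := by
  have h1 : (1 + 5 * p) ^ N ≤ Real.exp (5 * (N * p)) := by
    have := pow_le_pow_left₀ (by positivity) (Real.add_one_le_exp (5 * p)) N
    rw [← Real.exp_nat_mul] at this
    calc _ = (5 * p + 1) ^ N := by rw [add_comm]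
      _ ≤ _ := this
      _ = _ := by ring_nf
  have h2 := Real.abs_exp_sub_one_sub_id_le (x := 5 * (N * p))
    (by rw [abs_of_nonneg (by positivity)]; exact h)
  have h3 := le_abs_self (Real.exp (5 * (N * p)) - 1 - 5 * (N * p))
  nlinarith

end

/-! ### Perturbations at a wavelet level -/

section

variable {S d : ℕ} (W : CDVBasis S)

/-- The combination of the wavelets of level `j` in all coordinates, with coefficients `ε`. -/
def CDVBasis.pert (j : ℕ) (ε : (Fin d → Fin (2 ^ j)) → ℝ) (x : Fin d → ℝ) : ℝ :=
  ∑ m, ε m * W.Psi j (fun _ => true) m x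

variable {j : ℕ} {ε ε' : (Fin d → Fin (2 ^ j)) → ℝ}

theorem CDVBasis.cubeBdd_pert (ε : (Fin d → Fin (2 ^ j)) → ℝ) : CubeBdd (W.pert j ε) :=
  CubeBdd.sum fun m _ => (W.cubeBdd_Psi j _ m).const_mul _

theorem CDVBasis.continuousOn_pert (ε : (Fin d → Fin (2 ^ j)) → ℝ) :
    ContinuousOn (W.pert j ε) (cube d) :=
  continuousOn_finsetSum _ fun m _ => continuousOn_const.mul (W.continuousOn_Psi j _ m)

theorem CDVBasis.abs_pert_le (hε : ∀ m, |ε m| ≤ 1) {x : Fin d → ℝ} (hx : x ∈ cube d) :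
    |W.pert j ε x| ≤ (3 * W.R * W.B * √(2 ^ j)) ^ d := by
  refine (abs_sum_le_sum_abs _ _).trans (le_trans (sum_le_sum fun m _ => ?_)
    (W.sum_abs_Psi_le j (fun _ => true) hx))
  rw [abs_mul]
  exact mul_le_of_le_one_left (abs_nonneg _) (hε m)

theorem CDVBasis.orthoFamily_top (hj : W.J₀ ≤ j) :
    OrthoFamily fun m : Fin d → Fin (2 ^ j) => W.Psi j (fun _ => true) m where
  bdd m := W.cubeBdd_Psi j _ m
  ortho m m' := by
    have := (W.orthoFamily_Psi (d := d) hj).ortho (fun _ => true, m) (fun _ => true, m')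
    simpa using this

theorem CDVBasis.integral_pert_mul_pert (hj : W.J₀ ≤ j) :
    ∫ x in cube d, W.pert j ε x * W.pert j ε' x = ∑ m, ε m * ε' m := by
  have h1 := CubeBdd.integral_sum_mul (W.orthoFamily_top hj).bdd (W.cubeBdd_pert ε) ε'
  refine h1.trans (sum_congr rfl fun m _ => ?_)
  rw [mul_comm]
  exact congrArg (· * _) ((W.orthoFamily_top hj).integral_sum_mul_self ε m)

theorem CDVBasis.integral_pert_mul {g : (Fin d → ℝ) → ℝ} (hg : CubeBdd g) :
    ∫ x in cube d, W.pert j ε x * g x =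
      ∑ m, ε m * ∫ x in cube d, W.Psi j (fun _ => true) m x * g x := by
  have h1 := CubeBdd.integral_sum_mul (fun m => W.cubeBdd_Psi (d := d) j (fun _ => true) m) hg ε
  rw [integral_cube_congr (h := fun x => g x * W.pert j ε x) fun x _ => mul_comm _ _]
  refine h1.trans (sum_congr rfl fun m _ => ?_)
  rw [integral_cube_congr fun x _ => mul_comm _ _]

theorem CDVBasis.integral_pert_mul_Psi_of_le (hd : 0 < d) {l : ℕ} (hl : W.J₀ ≤ l)
    {ι : Fin d → Bool} (h : l < j ∨ l = j ∧ ι = fun _ => false) (m : Fin d → Fin (2 ^ l)) :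
    ∫ x in cube d, W.pert j ε x * W.Psi l ι m x = 0 := by
  rw [W.integral_pert_mul (W.cubeBdd_Psi l ι m)]
  refine sum_eq_zero fun m' _ => ?_
  rw [integral_cube_congr fun x _ => mul_comm _ _, W.integral_Psi_mul_Psi_eq_zero hl h
    (fun h0 => by simpa using congrFun h0 ⟨0, hd⟩), mul_zero]

theorem CDVBasis.abs_integral_pert_mul_Psi_le (hd : 0 < d) (hj : W.J₀ ≤ j) (hε : ∀ m, |ε m| ≤ 1)
    {l : ℕ} (hl : W.J₀ ≤ l) {ι : Fin d → Bool} (hι : ι ≠ fun _ => false)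
    (m : Fin d → Fin (2 ^ l)) :
    |∫ x in cube d, W.pert j ε x * W.Psi l ι m x| ≤ if l = j then 1 else 0 := by
  rcases lt_trichotomy l j with h | rfl | h
  · rw [W.integral_pert_mul_Psi_of_le hd hl (Or.inl h), if_neg h.ne, abs_zero]
  · rw [if_pos rfl, W.integral_pert_mul (W.cubeBdd_Psi l ι m)]
    have h1 : ∀ m', ∫ x in cube d, W.Psi l (fun _ => true) m' x *
        W.Psi l ι m x = if ((fun _ => true : Fin d → Bool), m') = (ι, m) then 1 else 0 :=
      fun m' => (W.orthoFamily_Psi (d := d) hl).ortho (fun _ => true, m') (ι, m)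
    simp_rw [h1]
    by_cases h2 : (fun _ => true : Fin d → Bool) = ι
    · simpa [Prod.ext_iff, h2] using hε m
    · simp [Prod.ext_iff, h2]
  · rw [W.integral_pert_mul (W.cubeBdd_Psi l ι m), if_neg h.ne']
    rw [sum_eq_zero fun m' _ => by
      rw [W.integral_Psi_mul_Psi_eq_zero hj (Or.inl h) hι, mul_zero], abs_zero]

/-- Perturbations are orthogonal to the scaling spaces of all levels up to their own. -/
theorem CDVBasis.proj_pert (hd : 0 < d) {l : ℕ} (hl : W.J₀ ≤ l) (hlj : l ≤ j) (x : Fin d → ℝ) :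
    W.proj l (W.pert j ε) x = 0 := by
  refine sum_eq_zero fun m _ => ?_
  rw [CDVData.Phi_eq, W.integral_pert_mul_Psi_of_le hd hl (by
    rcases hlj.lt_or_eq with h | h
    · exact Or.inl h
    · exact Or.inr ⟨h, rfl⟩), zero_mul]

/-- The scaling that gives a perturbation of level `j` the Hölder norm `τ` of order `a`. -/
def amp (d : ℕ) (τ : ℝ) (j : ℕ) (a : ℝ) : ℝ := τ * dw j a / √(2 ^ j) ^ d

theorem amp_nonneg {τ : ℝ} (hτ : 0 ≤ τ) (j : ℕ) (a : ℝ) : 0 ≤ amp d τ j a := by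
  have := dw_pos j a
  unfold amp
  positivity

theorem CDVBasis.abs_amp_mul_pert_le {τ a : ℝ} (hτ : 0 ≤ τ) (hε : ∀ m, |ε m| ≤ 1)
    {x : Fin d → ℝ} (hx : x ∈ cube d) :
    |amp d τ j a * W.pert j ε x| ≤ τ * (3 * W.R * W.B) ^ d * dw j a := by
  have h1 := amp_nonneg (d := d) hτ j a
  rw [abs_mul, abs_of_nonneg h1]
  refine (mul_le_mul_of_nonneg_left (W.abs_pert_le hε hx) h1).trans (le_of_eq ?_)
  rw [amp, mul_pow _ (√(2 ^ j)) d]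
  field_simp

/-- A perturbation has wavelet coefficients at its own level only: scaled, its norm is at most `τ`. -/
theorem CDVBasis.add_pert_mem_holderBall (hd : 0 < d) (hj : W.J₀ ≤ j) (hε : ∀ m, |ε m| ≤ 1)
    {a M c τ h : ℝ} (hτ : 0 ≤ τ) (hh : 0 ≤ h)
    (hM : W.holderNorm a (fun _ : Fin d → ℝ => c) + ofReal (h * τ) ≤ ofReal M) :
    (fun x => c + h * (amp d τ j a * W.pert j ε x)) ∈ W.HolderBall d a M := by
  refine ⟨CDVBasis.uniformContinuousOn_of_continuousOn (continuousOn_const.add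
    (continuousOn_const.mul (continuousOn_const.mul (W.continuousOn_pert ε)))), le_trans ?_ hM⟩
  have h0 := amp_nonneg (d := d) hτ j a
  have key : ∀ l (ι : Fin d → Bool) (m : Fin d → Fin (2 ^ l)),
      ∫ x in cube d, (c + h * (amp d τ j a * W.pert j ε x)) * W.Psi l ι m x =
      (∫ x in cube d, c * W.Psi l ι m x) +
        h * amp d τ j a * ∫ x in cube d, W.pert j ε x * W.Psi l ι m x := by
    intro l ι m
    rw [← integral_const_mul, ← integral_add ((W.cubeBdd_Psi l ι m).const_mul c).integrable
      (((W.cubeBdd_pert ε).mul (W.cubeBdd_Psi l ι m)).const_mul _).integrable]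
    exact integral_cube_congr fun x _ => by ring
  unfold CDVData.holderNorm
  rw [add_assoc]
  refine add_le_add (iSup_mono fun m => le_of_eq ?_) ?_
  · rw [CDVData.Phi_eq, key, W.integral_pert_mul_Psi_of_le hd le_rfl, mul_zero, add_zero]
    rcases hj.lt_or_eq with h | h
    · exact Or.inl h
    · exact Or.inr ⟨h, rfl⟩
  · refine iSup_le fun l => iSup_le fun hl => iSup_le fun ι => iSup_le fun hι => iSup_le fun m => ?_
    rw [key]
    have h1 := W.abs_integral_pert_mul_Psi_le hd hj hε hl hι m
    have h3 : (0 : ℝ) < 2 ^ ((l : ℝ) * (a + d / 2)) := Real.rpow_pos_of_pos two_pos _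
    have h2 : (2 : ℝ) ^ ((l : ℝ) * (a + d / 2)) * (h * amp d τ j a *
        |∫ x in cube d, W.pert j ε x * W.Psi l ι m x|) ≤ h * τ := by
      by_cases hlj : l = j
      · subst hlj
        rw [if_pos rfl] at h1
        have h4 := mul_le_mul_of_nonneg_left h1
          (mul_nonneg h3.le (mul_nonneg hh h0))
        refine le_trans (le_of_eq (by ring)) (h4.trans (le_of_eq ?_))
        rw [holder_weight, amp]
        have := dw_pos l a
        field_simp
      · rw [if_neg hlj] at h1
        rw [le_antisymm h1 (abs_nonneg _)]
        simpa using mul_nonneg hh hτ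
    refine le_trans (b := ofReal (2 ^ ((l : ℝ) * (a + d / 2)) *
      |∫ x in cube d, c * W.Psi l ι m x|) + ofReal (h * τ)) ?_ ?_
    · rw [← ofReal_add (by positivity) (mul_nonneg hh hτ)]
      refine ofReal_le_ofReal (le_trans (mul_le_mul_of_nonneg_left (abs_add_le _ _) h3.le) ?_)
      rw [mul_add, abs_mul (h * _), abs_of_nonneg (mul_nonneg hh h0)]
      linarith
    · refine add_le_add ?_ le_rfl
      exact le_iSup_of_le l (le_iSup_of_le hl (le_iSup_of_le ι (le_iSup_of_le hι
        (le_iSup (fun m => ofReal (2 ^ ((l : ℝ) * (a + d / 2)) *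
          |∫ x in cube d, c * W.Psi l ι m x|)) m))))

/-! ### Cells -/

/-- Half of the width of the wavelets, in units of `2 ^ (-j)`. -/
def CDVBasis.rad : ℕ := ⌈W.R⌉₊

/-- The width of a cell, in units of `2 ^ (-j)`. -/
def CDVBasis.width : ℕ := 2 * W.rad + 1

theorem CDVBasis.width_pos : 0 < W.width := Nat.succ_pos _

/-- The cell of a point of the cube, at level `j`. -/
def CDVBasis.cellOf (j : ℕ) (x : Fin d → ℝ) : Fin d → Fin (2 ^ j / W.width + 1) :=
  fun i => Fin.ofNat _ (⌊2 ^ j * x i⌋₊ / W.width)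

/-- The cell of a wavelet position. -/
def CDVBasis.cellIdx (m : Fin d → Fin (2 ^ j)) : Fin d → Fin (2 ^ j / W.width + 1) :=
  fun i => Fin.ofNat _ ((m i : ℕ) / W.width)

/-- Positions in the middle of a cell, so that the wavelet lives in that cell only. -/
def CDVBasis.Central (m : Fin d → Fin (2 ^ j)) : Prop := ∀ i, (m i : ℕ) % W.width = W.rad

/-- Coefficients of the central wavelets, with a sign in each cell. -/
def CDVBasis.cellSign (l : (Fin d → Fin (2 ^ j / W.width + 1)) → Bool)
    (m : Fin d → Fin (2 ^ j)) : ℝ :=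
  open Classical in if W.Central m then sg (l (W.cellIdx m)) else 0

theorem CDVBasis.abs_cellSign_le (l : (Fin d → Fin (2 ^ j / W.width + 1)) → Bool)
    (m : Fin d → Fin (2 ^ j)) : |W.cellSign l m| ≤ 1 := by
  unfold CDVBasis.cellSign
  split_ifs
  · rw [abs_sg]
  · simp

/-- A central wavelet vanishes outside its cell. -/
theorem CDVBasis.cellOf_eq {m : Fin d → Fin (2 ^ j)} (hm : W.Central m) {x : Fin d → ℝ}
    (hx : x ∈ cube d) (h : W.Psi j (fun _ => true) m x ≠ 0) :
    W.cellOf j x = W.cellIdx m := by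
  rw [CDVData.Psi_eq] at h
  ext1 i
  have h1 := Finset.prod_ne_zero_iff.1 h i (Finset.mem_univ i)
  have h2 : |2 ^ j * x i - ((m i : ℕ) : ℝ)| ≤ W.rad := by
    by_contra h3
    exact h1 (W.fn_eq_zero true j (m i) (mem_cube.1 hx i)
      ((Nat.le_ceil W.R).trans_lt (not_le.1 h3)))
  rw [abs_le] at h2
  have h3 := Nat.div_add_mod (m i : ℕ) W.width
  rw [hm i] at h3
  set q := (m i : ℕ) / W.width with hq
  have h4 : W.width * q ≤ ⌊2 ^ j * x i⌋₊ := by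
    refine Nat.le_floor ?_
    have : ((m i : ℕ) : ℝ) = (W.width * q : ℕ) + W.rad := by rw [← h3]; push_cast; ring
    linarith [h2.1]
  have h5 : ⌊2 ^ j * x i⌋₊ ≤ (m i : ℕ) + W.rad := by
    refine Nat.floor_le_of_le ?_
    push_cast
    linarith [h2.2]
  have h6 : ⌊2 ^ j * x i⌋₊ / W.width = q := by
    refine Nat.div_eq_of_lt_le (by rw [mul_comm]; exact h4) ?_
    have : W.width = 2 * W.rad + 1 := rfl
    rw [add_mul, one_mul, mul_comm q]
    omega
  simp only [CDVBasis.cellOf, CDVBasis.cellIdx, h6, hq]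

theorem CDVBasis.pert_cellSign (l : (Fin d → Fin (2 ^ j / W.width + 1)) → Bool) {x : Fin d → ℝ}
    (hx : x ∈ cube d) : W.pert j (W.cellSign l) x =
      sg (l (W.cellOf j x)) * W.pert j (W.cellSign fun _ => true) x := by
  simp only [CDVBasis.pert, mul_sum]
  refine sum_congr rfl fun m _ => ?_
  unfold CDVBasis.cellSign
  by_cases hm : W.Central m
  · rw [if_pos hm, if_pos hm]
    by_cases h : W.Psi j (fun _ => true) m x = 0
    · simp [h]
    · rw [W.cellOf_eq hm hx h]; simp
  · rw [if_neg hm, if_neg hm]; simp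

theorem CDVBasis.measurable_cellOf : Measurable (W.cellOf (d := d) j) := by
  refine measurable_pi_lambda _ fun i => ?_
  have h1 : Measurable fun k : ℕ => Fin.ofNat (2 ^ j / W.width + 1) (k / W.width) :=
    measurable_from_top
  exact h1.comp (Nat.measurable_floor.comp ((measurable_pi_apply i).const_mul _))

theorem CDVBasis.cellMeasure_le (c : Fin d → Fin (2 ^ j / W.width + 1)) :
    (cubeMeasure d).real (W.cellOf j ⁻¹' {c}) ≤ (W.width / 2 ^ j) ^ d := by
  have hQ : (0 : ℝ) < W.width := by exact_mod_cast W.width_pos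
  set lo : Fin d → ℝ := fun i => (c i : ℕ) * W.width / 2 ^ j with hlo
  set hi : Fin d → ℝ := fun i => ((c i : ℕ) + 1) * W.width / 2 ^ j with hhi
  have h1 : W.cellOf j ⁻¹' {c} ∩ cube d ⊆ Set.Icc lo hi := by
    rintro x ⟨hx, hxc⟩
    have h2 : ∀ i, (c i : ℕ) = ⌊2 ^ j * x i⌋₊ / W.width := fun i => by
      have h3 : c i = Fin.ofNat _ (⌊2 ^ j * x i⌋₊ / W.width) := (congrFun hx i).symm
      rw [h3, Fin.val_ofNat, Nat.mod_eq_of_lt]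
      refine Nat.lt_succ_of_le (Nat.div_le_div_right ?_)
      refine Nat.floor_le_of_le ?_
      push_cast
      exact mul_le_of_le_one_right (by positivity) (mem_cube.1 hxc i).2
    have hy : ∀ i, 0 ≤ 2 ^ j * x i := fun i => mul_nonneg (by positivity) (mem_cube.1 hxc i).1
    constructor
    · intro i
      rw [hlo, div_le_iff₀ (by positivity), mul_comm (x i), h2 i]
      refine le_trans ?_ (Nat.floor_le (hy i))
      exact_mod_cast Nat.div_mul_le_self _ _
    · intro i
      rw [hhi, le_div_iff₀ (by positivity), mul_comm (x i), h2 i]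
      refine (Nat.lt_floor_add_one _).le.trans ?_
      have := Nat.lt_div_mul_add (a := ⌊2 ^ j * x i⌋₊) W.width_pos
      have h3 : ⌊2 ^ j * x i⌋₊ + 1 ≤ (⌊2 ^ j * x i⌋₊ / W.width + 1) * W.width := by
        rw [add_mul, one_mul]; exact this
      exact_mod_cast h3
  have h4 : volume (Set.Icc lo hi) = ofReal ((W.width / 2 ^ j) ^ d) := by
    rw [Real.volume_Icc_pi]
    have : ∀ i, hi i - lo i = W.width / 2 ^ j := fun i => by simp only [hhi, hlo]; ring
    simp_rw [this]
    rw [prod_const, Finset.card_univ, Fintype.card_fin, ENNReal.ofReal_pow (by positivity)]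
  rw [Measure.real, Measure.restrict_apply (W.measurable_cellOf (MeasurableSet.singleton c))]
  refine ENNReal.toReal_le_of_le_ofReal (by positivity) ?_
  rw [← h4]
  exact measure_mono h1

theorem CDVBasis.sum_cellSign_sq_ge (l : (Fin d → Fin (2 ^ j / W.width + 1)) → Bool) :
    ((2 ^ j / W.width : ℕ) : ℝ) ^ d ≤ ∑ m, W.cellSign l m * W.cellSign l m := by
  classical
  have h1 : ∀ m : Fin d → Fin (2 ^ j), W.cellSign l m * W.cellSign l m =
      if W.Central m then 1 else 0 := fun m => by
    unfold CDVBasis.cellSign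
    by_cases hm : W.Central m
    · rw [if_pos hm, if_pos hm, sg_mul_self]
    · rw [if_neg hm, if_neg hm, mul_zero]
  simp_rw [h1]
  rw [Finset.sum_boole]
  have hlt : ∀ q : Fin (2 ^ j / W.width), (q : ℕ) * W.width + W.rad < 2 ^ j := fun q => by
    have h2 : ((q : ℕ) + 1) * W.width ≤ 2 ^ j :=
      (Nat.mul_le_mul_right _ q.2).trans (Nat.div_mul_le_self _ _)
    have h3 : W.width = 2 * W.rad + 1 := rfl
    rw [add_mul, one_mul] at h2
    omega
  have h2 : (Finset.univ : Finset (Fin d → Fin (2 ^ j / W.width))).card ≤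
      (Finset.univ.filter fun m : Fin d → Fin (2 ^ j) => W.Central m).card := by
    refine Finset.card_le_card_of_injOn (fun q i => ⟨(q i : ℕ) * W.width + W.rad, hlt (q i)⟩)
      (fun q _ => ?_) fun q _ q' _ h => ?_
    · simp only [Finset.coe_filter, Finset.mem_univ, true_and, Set.mem_ofPred_eq]
      intro i
      have h3 : W.width = 2 * W.rad + 1 := rfl
      simp only [Nat.mul_add_mod_self_right]
      exact Nat.mod_eq_of_lt (by omega)
    · ext i
      have := congrArg Fin.val (congrFun h i)
      simp only [Nat.add_right_cancel_iff] at this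
      exact Nat.eq_of_mul_eq_mul_right W.width_pos this
  rw [Finset.card_univ, Fintype.card_fun, Fintype.card_fin, Fintype.card_fin] at h2
  exact_mod_cast h2

end

/-! ### Minimax lower bound -/

/-- Room in the model for perturbations of size `τ` of the constant regression functions `c`, for
responses `c ± h`. -/
structure CDVBasis.Room {S : ℕ} (W : CDVBasis S) (d : ℕ) (θ : ModelParams) (c h τ : ℝ) : Prop where
  h_pos : 0 < h
  τ_pos : 0 < τ
  lower : θ.C₁ ≤ c - h
  upper : c + h ≤ θ.C₂
  small : τ * (3 * W.R * W.B) ^ d ≤ 1 / 4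
  holder_α : W.holderNorm θ.α (fun _ : Fin d → ℝ => c) + ofReal (h * τ) ≤ ofReal θ.M
  holder_β : W.holderNorm θ.β (fun _ : Fin d → ℝ => c) + ofReal (h * τ) ≤ ofReal θ.M

theorem ofReal_integral_le_lintegral {Ω : Type*} [MeasurableSpace Ω] {μ : Measure Ω} {f : Ω → ℝ} :
    ofReal (∫ x, f x ∂μ) ≤ ∫⁻ x, ofReal (f x) ∂μ := by
  by_cases hf : Integrable f μ
  · rw [integral_eq_lintegral_pos_part_sub_lintegral_neg_part hf]
    refine (ofReal_le_ofReal (sub_le_self _ ENNReal.toReal_nonneg)).trans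
      ENNReal.ofReal_toReal_le
  · simp [integral_undef hf]

theorem sq_le_of_abs_le {a b : ℝ} (h : |a| ≤ b) : a ^ 2 ≤ b ^ 2 :=
  sq_le_sq' (abs_le.1 h).1 (abs_le.1 h).2

theorem ENNReal.exists_pos_add_ofReal_le {a b : ℝ≥0∞} (h : a < b) :
    ∃ ε : ℝ, 0 < ε ∧ a + ofReal ε ≤ b := by
  obtain ⟨r, hr0, hr⟩ := ENNReal.lt_iff_exists_add_pos_lt.1 h
  exact ⟨r, by exact_mod_cast hr0, by rw [ENNReal.ofReal_coe_nnreal]; exact hr.le⟩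

section

variable {S d : ℕ} {W : CDVBasis S} {θ : ModelParams}

/-- Non-degeneracy of the constants leaves room for perturbations. -/
theorem exists_room (hnd : NonDegenerate d W θ) : ∃ c h τ, W.Room d θ c h τ := by
  obtain ⟨c, h1, h2, h3, h4⟩ := hnd.regression
  obtain ⟨e₁, he₁, H₁⟩ := ENNReal.exists_pos_add_ofReal_le h3
  obtain ⟨e₂, he₂, H₂⟩ := ENNReal.exists_pos_add_ofReal_le h4
  have hR := W.one_le_R
  have hB := W.one_le_B
  set h := min (c - θ.C₁) (θ.C₂ - c)
  have hh : 0 < h := lt_min (by linarith) (by linarith)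
  set D : ℝ := (3 * W.R * W.B) ^ d
  have hD : 0 < D := by positivity
  set τ := min (1 / 4 / D) (min (e₁ / h) (e₂ / h))
  have hτ : 0 < τ := lt_min (by positivity) (lt_min (by positivity) (by positivity))
  have t1 : τ ≤ 1 / 4 / D := min_le_left _ _
  have t2 : τ ≤ e₁ / h := (min_le_right _ _).trans (min_le_left _ _)
  have t3 : τ ≤ e₂ / h := (min_le_right _ _).trans (min_le_right _ _)
  rw [le_div_iff₀ hD] at t1
  rw [le_div_iff₀ hh, mul_comm] at t2 t3
  have l1 : h ≤ c - θ.C₁ := min_le_left _ _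
  have l2 : h ≤ θ.C₂ - c := min_le_right _ _
  exact ⟨c, h, τ, hh, hτ, by linarith, by linarith, t1,
    (add_le_add le_rfl (ofReal_le_ofReal t2)).trans H₁,
    (add_le_add le_rfl (ofReal_le_ofReal t3)).trans H₂⟩

variable {c h τ : ℝ} {j : ℕ} {ε ε' : (Fin d → Fin (2 ^ j)) → ℝ}

theorem CDVBasis.Room.abs_le (R : W.Room d θ c h τ) {a : ℝ} (hε : ∀ m, |ε m| ≤ 1)
    {x : Fin d → ℝ} (hx : x ∈ cube d) : |amp d τ j a * W.pert j ε x| ≤ 1 / 4 * dw j a :=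
  (W.abs_amp_mul_pert_le R.τ_pos.le hε hx).trans
    (mul_le_mul_of_nonneg_right R.small (dw_pos j a).le)

theorem CDVBasis.Room.signMeans (R : W.Room d θ c h τ) {a b : ℝ} (ha : 0 ≤ a) (hb : 0 ≤ b)
    (hε : ∀ m, |ε m| ≤ 1) (hε' : ∀ m, |ε' m| ≤ 1) :
    SignMeans (fun x => amp d τ j a * W.pert j ε x) (fun x => amp d τ j b * W.pert j ε' x) where
  left := (W.cubeBdd_pert ε).const_mul _
  right := (W.cubeBdd_pert ε').const_mul _
  le x hx := by
    have := R.abs_le (a := a) hε hx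
    have := R.abs_le (a := b) hε' hx
    linarith [dw_le_one j ha, dw_le_one j hb]

theorem CDVBasis.Room.inModel (R : W.Room d θ c h τ) (hd : 0 < d)
    (hnd : NonDegenerate d W θ) (hα : 0 ≤ θ.α) (hβ : 0 ≤ θ.β) (hj : W.J₀ ≤ j)
    (hε : ∀ m, |ε m| ≤ 1) (hε' : ∀ m, |ε' m| ≤ 1) :
    InModel W θ (signLaw c h (fun x => amp d τ j θ.α * W.pert j ε x)
      (fun x => amp d τ j θ.β * W.pert j ε' x)) (fun x => c + h * (amp d τ j θ.α * W.pert j ε x))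
      (fun x => c + h * (amp d τ j θ.β * W.pert j ε' x)) (fun _ => 1) :=
  (R.signMeans hα hβ hε hε').inModel hnd R.h_pos.le R.lower R.upper
    (W.add_pert_mem_holderBall hd hj hε R.τ_pos.le R.h_pos.le R.holder_α)
    (W.add_pert_mem_holderBall hd hj hε' R.τ_pos.le R.h_pos.le R.holder_β)

theorem CDVBasis.Room.psi_eq (R : W.Room d θ c h τ) {a b : ℝ} (ha : 0 ≤ a) (hb : 0 ≤ b)
    (hj : W.J₀ ≤ j) (hε : ∀ m, |ε m| ≤ 1) (hε' : ∀ m, |ε' m| ≤ 1) :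
    psi (signLaw c h (fun x => amp d τ j a * W.pert j ε x)
      (fun x => amp d τ j b * W.pert j ε' x)) =
      -(h ^ 2 * (amp d τ j a * amp d τ j b) * ∑ m, ε m * ε' m) := by
  rw [(R.signMeans ha hb hε hε').psi_signLaw R.h_pos.le, ← W.integral_pert_mul_pert hj,
    neg_mul, mul_assoc, ← integral_const_mul (amp d τ j a * amp d τ j b)]
  congr 2
  exact integral_cube_congr fun x _ => by ring

theorem SignMeans.mse_eq {u v : (Fin d → ℝ) → ℝ} (H : SignMeans u v) {ι : Type} [Fintype ι]
    [DecidableEq ι] {T : (ι → Obs d) → ℝ} (hT : Measurable T) :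
    mse T (signLaw c h u v) = ∑ σ : ι → Bool × Bool,
      ∫⁻ x, ofReal (∏ i, signWeight u v (σ i) (x i)) * ofReal
        ((T (fun i => signObs c h (σ i) (x i)) - psi (signLaw c h u v)) ^ 2)
        ∂(Measure.pi fun _ : ι => cubeMeasure d) := by
  have := H.isProbabilityMeasure (c := c) (h := h)
  have hw : ∀ b, Measurable fun x => ofReal (signWeight u v b x) := fun b =>
    (H.cubeBdd_weight b).meas.ennreal_ofReal
  have hsig : SigmaFinite (∑ b, ((cubeMeasure d).withDensity
      fun x => ofReal (signWeight u v b x)).map (signObs c h b)) :=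
    inferInstanceAs (SigmaFinite (signLaw c h u v))
  have hF : Measurable fun D => ofReal ((T D - psi (signLaw c h u v)) ^ 2) :=
    ((hT.sub_const _).pow_const 2).ennreal_ofReal
  unfold mse
  generalize psi (signLaw c h u v) = ψ₀ at hF ⊢
  rw [signLaw, pi_sum_map_withDensity hw (fun b => measurable_signObs c h b),
    lintegral_finsetSum_measure]
  refine sum_congr rfl fun σ _ => ?_
  have hG : Measurable fun (x : ι → Fin d → ℝ) i => signObs c h (σ i) (x i) :=
    measurable_pi_lambda _ fun i => (measurable_signObs c h _).comp (measurable_pi_apply i)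
  have hW : Measurable fun x : ι → Fin d → ℝ => ∏ i, ofReal (signWeight u v (σ i) (x i)) :=
    Finset.measurable_fun_prod _ fun i _ => (hw (σ i)).comp (measurable_pi_apply i)
  rw [lintegral_map hF hG, lintegral_withDensity_eq_lintegral_mul
    (g := fun x : ι → Fin d → ℝ =>
      ofReal ((T (fun i => signObs c h (σ i) (x i)) - ψ₀) ^ 2)) _ hW (hF.comp hG)]
  refine lintegral_congr_ae ?_
  have hae : ∀ᵐ x ∂(Measure.pi fun _ : ι => cubeMeasure d), ∀ i, x i ∈ cube d :=
    ae_all_iff.2 fun i => (measurePreserving_eval (fun _ : ι => cubeMeasure d) i).quasiMeasurePreserving.ae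
      (ae_mem_cube d)
  filter_upwards [hae] with x hx
  rw [Pi.mul_apply, ENNReal.ofReal_prod_of_nonneg fun i _ => H.weight_nonneg _ (hx i)]

set_option maxHeartbeats 800000 in
/-- Two-point bound over mixtures: averaging over the signs of the cells, the laws with
`ψ = δ` and with `ψ = - δ` cannot be told apart. -/
theorem CDVBasis.Room.le_maxRisk (R : W.Room d θ c h τ) (hd : 0 < d)
    (hnd : NonDegenerate d W θ) (hα : 0 ≤ θ.α) (hβ : 0 ≤ θ.β) (hj : W.J₀ ≤ j)
    {ι : Type} [Fintype ι] {T : (ι → Obs d) → ℝ} (hT : Measurable T)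
    (h₁ : 5 * (Fintype.card ι * ((W.width : ℝ) / 2 ^ j) ^ d) ≤ 1)
    (h₂ : Fintype.card ι ^ 2 * dw j (θ.α + θ.β) ^ 2 * ((W.width : ℝ) / 2 ^ j) ^ d ≤ 1) :
    ofReal ((h ^ 2 * (amp d τ j θ.α * amp d τ j θ.β) *
      ((2 ^ j / W.width : ℕ) : ℝ) ^ d) ^ 2 / 4) ≤ maxRisk W θ T := by
  classical
  set C := Fin d → Fin (2 ^ j / W.width + 1)
  set N := Fintype.card ι
  set V := ((W.width : ℝ) / 2 ^ j) ^ d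
  set κ : (Fin d → ℝ) → C := W.cellOf j with hκ
  set μ := Measure.pi fun _ : ι => cubeMeasure d
  -- the number of central positions; `∓ δ` are the values of `ψ` under the two hypotheses
  set z : ℝ := ∑ m, W.cellSign (j := j) (d := d) (fun _ => true) m * W.cellSign (fun _ => true) m
    with hz
  have hA0 := amp_nonneg (d := d) R.τ_pos.le j θ.α
  have hB0 := amp_nonneg (d := d) R.τ_pos.le j θ.β
  set δ := h ^ 2 * (amp d τ j θ.α * amp d τ j θ.β) * z with hδ
  have hle : (h ^ 2 * (amp d τ j θ.α * amp d τ j θ.β) *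
      ((2 ^ j / W.width : ℕ) : ℝ) ^ d) ^ 2 / 4 ≤ δ ^ 2 / 4 := by
    have := W.sum_cellSign_sq_ge (d := d) (j := j) fun _ => true
    refine div_le_div_of_nonneg_right (pow_le_pow_left₀ (by positivity) ?_ 2) (by norm_num)
    exact mul_le_mul_of_nonneg_left this (by positivity)
  refine (ofReal_le_ofReal hle).trans ?_
  set u : (Fin d → ℝ) → ℝ := fun x => amp d τ j θ.α * W.pert j (W.cellSign fun _ => true) x with hu
  set v : (Fin d → ℝ) → ℝ := fun x => amp d τ j θ.β * W.pert j (W.cellSign fun _ => true) x with hv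
  have hcs := fun l : C → Bool => W.abs_cellSign_le l
  have hcs' : ∀ (s : Bool) (l : C → Bool) m, |sg s * W.cellSign l m| ≤ 1 := fun s l m => by
    rw [abs_mul, abs_sg, one_mul]; exact hcs l m
  set P : Bool → (C → Bool) → Measure (Obs d) := fun s l =>
    signLaw c h (fun x => amp d τ j θ.α * W.pert j (W.cellSign l) x)
      (fun x => amp d τ j θ.β * W.pert j (fun m => sg s * W.cellSign l m) x) with hP
  have hψ : ∀ s l, psi (P s l) = -(sg s * δ) := fun s l => by
    rw [hP]
    have e : ∀ m, W.cellSign l m * (sg s * W.cellSign l m) =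
        sg s * (W.cellSign (j := j) (d := d) (fun _ => true) m * W.cellSign (fun _ => true) m) :=
      fun m => by
        unfold CDVBasis.cellSign
        split_ifs
        · rw [mul_left_comm, sg_mul_self, sg_mul_self]
        · simp
    simp only
    rw [R.psi_eq hα hβ hj (hcs l) (hcs' s l), hδ, hz]
    simp_rw [e]
    rw [← mul_sum]
    ring
  have hrisk : ∀ s l, mse T (P s l) ≤ maxRisk W θ T := fun s l =>
    le_iSup₂_of_le (P s l) ⟨_, _, _, R.inModel hd hnd hα hβ hj (hcs l) (hcs' s l)⟩ le_rfl
  -- the mixtures over the signs, given the covariates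
  set q : Bool → (ι → Bool × Bool) → (ι → Fin d → ℝ) → ℝ := fun s σ x =>
    signMix (fun i => κ (x i)) (fun i => u (x i)) (fun i => sg s * v (x i)) σ with hq
  have hae : ∀ᵐ x ∂μ, ∀ i, x i ∈ cube d :=
    ae_all_iff.2 fun i => (measurePreserving_eval (fun _ : ι => cubeMeasure d)
      i).quasiMeasurePreserving.ae (ae_mem_cube d)
  set T' : (ι → Bool × Bool) → (ι → Fin d → ℝ) → ℝ := fun σ x => T fun i => signObs c h (σ i) (x i)
  have hmT' : ∀ σ, Measurable (T' σ) := fun σ => hT.comp (measurable_pi_lambda _ fun i =>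
    (measurable_signObs c h _).comp (measurable_pi_apply i))
  have hsum : ∀ s, ∑ l, mse T (P s l) = ∑ σ, ∫⁻ x, ofReal (q s σ x) *
      ofReal ((T' σ x + sg s * δ) ^ 2) ∂μ := fun s => by
    have hm := fun l => R.signMeans (j := j) hα hβ (hcs l) (hcs' s l)
    have hwm : ∀ (σ : ι → Bool × Bool) (l : C → Bool), Measurable fun x : ι → Fin d → ℝ => ∏ i,
        signWeight (fun x => amp d τ j θ.α * W.pert j (W.cellSign l) x)
        (fun x => amp d τ j θ.β * W.pert j (fun m => sg s * W.cellSign l m) x) (σ i) (x i) :=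
      fun σ l => Finset.measurable_fun_prod _ fun i _ =>
        ((hm l).cubeBdd_weight (σ i)).meas.comp (measurable_pi_apply i)
    rw [sum_congr rfl fun l _ => (hm l).mse_eq hT, Finset.sum_comm]
    refine sum_congr rfl fun σ _ => ?_
    refine (lintegral_finsetSum _ fun l _ => ((hwm σ l).ennreal_ofReal).mul
      (((hmT' σ).sub_const _).pow_const 2).ennreal_ofReal).symm.trans ?_
    refine lintegral_congr_ae ?_
    filter_upwards [hae] with x hx
    have e1 : ∀ l, psi (signLaw c h (fun x => amp d τ j θ.α * W.pert j (W.cellSign l) x)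
      (fun x => amp d τ j θ.β * W.pert j (fun m => sg s * W.cellSign l m) x)) = -(sg s * δ) := hψ s
    simp_rw [e1, sub_neg_eq_add]
    simp only [Pi.mul_apply]
    rw [← sum_mul, ← ENNReal.ofReal_sum_of_nonneg fun l _ =>
      Finset.prod_nonneg fun i _ => (hm l).weight_nonneg _ (hx i)]
    congr 2
    refine sum_congr rfl fun l _ => prod_congr rfl fun i _ => ?_
    have e2 : W.pert j (fun m => sg s * W.cellSign l m) (x i) =
        sg s * W.pert j (W.cellSign l) (x i) := by
      simp only [CDVBasis.pert, mul_sum, mul_assoc]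
    simp only [signWeight]
    rw [e2, W.pert_cellSign l (hx i)]
    simp only [hu, hv, hκ]
    ring
  -- the overlap of the mixtures
  -- `E` measures the loss of affinity; its mean is of order `N ^ 2 V`, since first-order terms cancel
  set E : (ι → Fin d → ℝ) → ℝ := fun x => ∑ k : C,
    (6 ^ Fintype.card {i // κ (x i) = k} - 1 - 5 * (Fintype.card {i // κ (x i) = k} : ℝ)) with hE
  have hdα := dw_pos j θ.α
  have hdβ := dw_pos j θ.β
  have hlα := dw_le_one j hα
  have hlβ := dw_le_one j hβ
  set G : ℝ := 1 / 256 * dw j (θ.α + θ.β) ^ 2 with hG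
  have hover : ∀ x : ι → Fin d → ℝ, (∀ i, x i ∈ cube d) →
      2 ^ Fintype.card C * (1 / 2 - 2 * G * E x) ≤ ∑ σ, min (q true σ x) (q false σ x) := by
    intro x hx
    have := sum_min_signMix_ge (κ := fun i => κ (x i)) (u := fun i => u (x i))
      (v := fun i => v (x i)) (A := (1 / 4 * dw j θ.α) ^ 2) (B := (1 / 4 * dw j θ.β) ^ 2)
      (fun i => by
        have a1 := R.abs_le (j := j) (a := θ.α) (hcs fun _ => true) (hx i)
        have a2 := R.abs_le (j := j) (a := θ.β) (hcs fun _ => true) (hx i)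
        simp only [hu, hv]
        linarith) (by nlinarith) (by nlinarith) (sq_nonneg _) (sq_nonneg _)
      (fun i => sq_le_of_abs_le (R.abs_le (hcs _) (hx i)))
      (fun i => sq_le_of_abs_le (R.abs_le (hcs _) (hx i)))
    have e : (1 / 4 * dw j θ.α) ^ 2 * (1 / 4 * dw j θ.β) ^ 2 = G := by rw [hG, dw_add]; ring
    rw [e] at this
    simpa [hq, hE] using this
  have hmC : ∀ k : C, MeasurableSet (κ ⁻¹' {k}) := fun k =>
    W.measurable_cellOf (MeasurableSet.singleton k)
  set p : C → ℝ := fun k => (cubeMeasure d).real (κ ⁻¹' {k}) with hp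
  have hpV : ∀ k, p k ≤ V := fun k => W.cellMeasure_le k
  have hp0 : ∀ k, 0 ≤ p k := fun k => measureReal_nonneg
  have hp1 : ∑ k, p k = 1 := by
    rw [hp, sum_measureReal_preimage_singleton _ fun k _ => hmC k]
    simp
  have hEint : ∫ x, E x ∂μ = ∑ k, ((1 + 5 * p k) ^ N - 1 - 5 * (N * p k)) ∧ Integrable E μ := by
    have hi := fun k : C => integral_pow_card_fiber (ι := ι) (μ := cubeMeasure d) (hmC k)
    refine ⟨?_, integrable_finsetSum _ fun k _ => (hi k).1⟩
    rw [hE, integral_finsetSum _ fun k _ => (hi k).1]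
    exact sum_congr rfl fun k _ => (hi k).2
  have hEle : ∫ x, E x ∂μ ≤ 25 * (N ^ 2 * V) := by
    rw [hEint.1]
    calc ∑ k, ((1 + 5 * p k) ^ N - 1 - 5 * (N * p k)) ≤ ∑ k, 25 * (N ^ 2 * V) * p k := by
          refine sum_le_sum fun k _ => (one_add_pow_sub_le (hp0 k) (le_trans ?_ h₁)).trans ?_
          · have := hpV k
            gcongr
          · have := mul_le_mul_of_nonneg_left (hpV k) (hp0 k)
            nlinarith [mul_le_mul_of_nonneg_left this (by positivity : (0 : ℝ) ≤ 25 * N ^ 2)]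
      _ = 25 * (N ^ 2 * V) := by rw [← mul_sum, hp1, mul_one]
  have hfin : ofReal (2 ^ Fintype.card C * (2 * δ ^ 2) * (1 / 4)) ≤
      2 * 2 ^ Fintype.card C * maxRisk W θ T := by
    calc ofReal (2 ^ Fintype.card C * (2 * δ ^ 2) * (1 / 4))
        ≤ ofReal (∫ x, 2 ^ Fintype.card C * (2 * δ ^ 2) * (1 / 2 - 2 * G * E x) ∂μ) := by
          refine ofReal_le_ofReal ?_
          rw [integral_const_mul, integral_sub (integrable_const _) (hEint.2.const_mul _),
            integral_const_mul]
          refine mul_le_mul_of_nonneg_left ?_ (by positivity)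
          simp only [integral_const, probReal_univ, smul_eq_mul, one_mul]
          have hG0 : 0 ≤ G := by positivity
          have := mul_le_mul_of_nonneg_left hEle hG0
          have e : G * (25 * (N ^ 2 * V)) =
            25 / 256 * (N ^ 2 * dw j (θ.α + θ.β) ^ 2 * V) := by rw [hG]; ring
          linarith
      _ ≤ ∫⁻ x, ofReal (2 ^ Fintype.card C * (2 * δ ^ 2) * (1 / 2 - 2 * G * E x)) ∂μ :=
          ofReal_integral_le_lintegral
      _ ≤ ∫⁻ x, ∑ σ, (ofReal (q true σ x) * ofReal ((T' σ x + sg true * δ) ^ 2) +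
            ofReal (q false σ x) * ofReal ((T' σ x + sg false * δ) ^ 2)) ∂μ := by
          refine lintegral_mono_ae ?_
          filter_upwards [hae] with x hx
          have hq0 : ∀ s σ, 0 ≤ q s σ x := fun s σ => signMix_nonneg (κ := fun i => κ (x i))
            (u := fun i => u (x i)) (v := fun i => sg s * v (x i)) (fun i => by
            have a1 := R.abs_le (j := j) (a := θ.α) (hcs fun _ => true) (hx i)
            have a2 := R.abs_le (j := j) (a := θ.β) (hcs fun _ => true) (hx i)
            rw [abs_mul (sg s), abs_sg, one_mul]
            simp only [hu, hv]
            linarith) σ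
          have e1 : ∀ σ, ofReal (q true σ x) * ofReal ((T' σ x + sg true * δ) ^ 2) +
              ofReal (q false σ x) * ofReal ((T' σ x + sg false * δ) ^ 2) =
              ofReal (q true σ x * (T' σ x + δ) ^ 2 + q false σ x * (T' σ x - δ) ^ 2) := fun σ => by
            rw [← ofReal_mul (hq0 _ _), ← ofReal_mul (hq0 _ _),
              ← ofReal_add (mul_nonneg (hq0 _ _) (sq_nonneg _))
                (mul_nonneg (hq0 _ _) (sq_nonneg _)), sg_true, sg_false, one_mul, neg_one_mul,
              ← sub_eq_add_neg]
          simp_rw [e1]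
          rw [← ENNReal.ofReal_sum_of_nonneg fun σ _ => add_nonneg
            (mul_nonneg (hq0 _ _) (sq_nonneg _)) (mul_nonneg (hq0 _ _) (sq_nonneg _))]
          refine ofReal_le_ofReal ?_
          have h3 := mul_le_mul_of_nonneg_left (hover x hx) (by positivity : 0 ≤ 2 * δ ^ 2)
          rw [mul_sum (f := fun σ => min (q true σ x) (q false σ x))] at h3
          refine le_trans (le_of_eq (by ring)) (h3.trans (sum_le_sum fun σ _ => ?_))
          -- `q (T + δ) ^ 2 + q' (T - δ) ^ 2 ≥ min q q' * 2 δ ^ 2`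
          have m1 := min_le_left (q true σ x) (q false σ x)
          have m2 := min_le_right (q true σ x) (q false σ x)
          have m0 := le_min (hq0 true σ) (hq0 false σ)
          nlinarith [mul_le_mul_of_nonneg_right m1 (sq_nonneg (T' σ x + δ)),
            mul_le_mul_of_nonneg_right m2 (sq_nonneg (T' σ x - δ)),
            mul_nonneg m0 (sq_nonneg (T' σ x))]
      _ ≤ ∑ l, mse T (P true l) + ∑ l, mse T (P false l) := by
          have hqm : ∀ s σ, Measurable (q s σ) := fun s σ => by
            exact measurable_signMix W.measurable_cellOf ((W.cubeBdd_pert _).const_mul _).meas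
              (((W.cubeBdd_pert _).const_mul _).const_mul _).meas σ
          have hmm : ∀ s σ, Measurable fun x => ofReal (q s σ x) *
              ofReal ((T' σ x + sg s * δ) ^ 2) := fun s σ =>
            (hqm s σ).ennreal_ofReal.mul (((hmT' σ).add_const _).pow_const 2).ennreal_ofReal
          rw [hsum, hsum, ← sum_add_distrib]
          refine (lintegral_finsetSum _ fun σ _ => (hmm true σ).add (hmm false σ)).le.trans ?_
          exact sum_le_sum fun σ _ => (lintegral_add_left (hmm true σ) _).le
      _ ≤ ∑ _l : C → Bool, maxRisk W θ T + ∑ _l : C → Bool, maxRisk W θ T :=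
          add_le_add (sum_le_sum fun l _ => hrisk _ _)
            (sum_le_sum fun l _ => hrisk _ _)
      _ = _ := by
          rw [sum_const, Finset.card_univ, Fintype.card_fun, Fintype.card_bool, nsmul_eq_mul]
          push_cast
          ring
  have e3 : ofReal (2 ^ Fintype.card C * (2 * δ ^ 2) * (1 / 4)) =
      2 * 2 ^ Fintype.card C * ofReal (δ ^ 2 / 4) := by
    have e4 : (2 : ℝ≥0∞) * 2 ^ Fintype.card C = ofReal (2 * 2 ^ Fintype.card C) := by
      rw [ofReal_mul (by norm_num), ENNReal.ofReal_pow (by norm_num)]; simp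
    rw [e4, ← ofReal_mul (by positivity)]
    congr 1
    ring
  rw [e3] at hfin
  exact (ENNReal.mul_le_mul_iff_right (by simp) (ENNReal.mul_ne_top (by simp) (by simp))).1 hfin

end

/-! ### Lower bounds for the Monte Carlo estimator -/

theorem sq_integral_le {Ω : Type*} [MeasurableSpace Ω] {P : Measure Ω} [IsProbabilityMeasure P]
    {g : Ω → ℝ} (hg : MemLp g 2 P) : (∫ o, g o ∂P) ^ 2 ≤ ∫ o, g o ^ 2 ∂P := by
  have h1 := ProbabilityTheory.variance_nonneg g P
  rw [ProbabilityTheory.variance_eq_sub hg] at h1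
  simpa using h1

section

variable {S d n : ℕ} {W : CDVBasis S} {θ : ModelParams} {P : Measure (Obs d)}
  {p b f q r : (Fin d → ℝ) → ℝ} {K c₁ c₂ c h τ : ℝ} {Z : Obs d → ℝ} {j : ℕ}

theorem Regr.le_lintegral_sq_add_integral_regEst (hP : CovLaw P f K) (hZ : Regr P f K Z r)
    (hq : IsWeight c₁ c₂ q) (hn : 1 ≤ n) (hj : W.J₀ ≤ j) {u : (Fin d → ℝ) → ℝ} (hu : CubeBdd u)
    (c : ℝ) :
    ofReal ((c + ∫ x in cube d, regMean W q f j r x * u x) ^ 2) ≤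
    ∫⁻ D, ofReal ((c + ∫ x in cube d, regEst W q Z j D x * u x) ^ 2)
      ∂P^⊗n := by
  have := hP.prob
  have hφq := hq.cubeBdd_div (W.cubeBdd_proj j u)
  simp_rw [W.integral_regEst_mul hu]
  rw [W.integral_regMean_mul hj hZ.bdd hP.bdd hq hu, lintegral_sq_add_average (hZ.memLp hP hφq) hn]
  have h0 := sq_integral_le (hZ.memLp hP hφq)
  rw [hZ.integral _ hφq] at h0 ⊢
  have h1 : ∫ x in cube d, r x * (W.proj j u x / q x) * f x =
      ∫ x in cube d, r x * f x / q x * W.proj j u x :=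
    integral_cube_congr fun x _ => by ring
  rw [h1] at h0 ⊢
  have h3 : 0 ≤ 1 / (n : ℝ) := by positivity
  exact ofReal_le_ofReal (le_add_of_nonneg_right (mul_nonneg h3 (sub_nonneg.2 h0)))

/-- Jensen's inequality, one subsample at a time: the risk is at least the squared conditional
bias, given the density estimates. -/
theorem ModelLaw.sq_bias_le (hP : ModelLaw W θ K P p b f) {q₁ q₂ : (Fin d → ℝ) → ℝ} {j₁ j₂ : ℕ}
    (hq₁ : IsWeight c₁ c₂ q₁) (hq₂ : IsWeight c₁ c₂ q₂) (hn : 1 ≤ n) (h₁ : W.J₀ ≤ j₁)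
    (h₂ : W.J₀ ≤ j₂) :
    ofReal ((-(∫ x in cube d, p x * b x * f x) + ∫ x in cube d,
      regMean W q₁ f j₁ p x * (regMean W q₂ f j₂ b x * f x)) ^ 2) ≤
    ∫⁻ D₀, ∫⁻ D₂, ∫⁻ D₄, ∫⁻ D₅, ofReal ((1 / (n : ℝ) * ∑ i, (D₄ i).A * (D₄ i).Y -
        1 / (n : ℝ) * ∑ i, regEst W q₁ Obs.A j₁ D₀ (D₅ i).X *
          regEst W q₂ Obs.Y j₂ D₂ (D₅ i).X - _root_.psi P) ^ 2)
        ∂P^⊗n ∂P^⊗n ∂P^⊗n ∂P^⊗n := by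
  have := hP.cov.prob
  have b1 := W.cubeBdd_regEst (n := n) q₁ Obs.A j₁
  have b2 := W.cubeBdd_regEst (n := n) q₂ Obs.Y j₂
  have bf := hP.cov.bdd
  have m2 := W.cubeBdd_regMean q₂ f j₂ b
  refine (hP.regA.le_lintegral_sq_add_integral_regEst hP.cov hq₁ hn h₁ (m2.mul bf) _).trans
    (lintegral_mono fun D₀ => ?_)
  have e1 : ∫ x in cube d, regEst W q₁ Obs.A j₁ D₀ x *
      (regMean W q₂ f j₂ b x * f x) = ∫ x in cube d, regMean W q₂ f j₂ b x *
        (regEst W q₁ Obs.A j₁ D₀ x * f x) :=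
    integral_cube_congr fun x _ => by ring
  simp only [e1]
  refine (hP.regY.le_lintegral_sq_add_integral_regEst hP.cov hq₂ hn h₂ ((b1 D₀).mul bf) _).trans
    (lintegral_mono fun D₂ => ?_)
  have e2 : ∫ x in cube d, regEst W q₂ Obs.Y j₂ D₂ x *
      (regEst W q₁ Obs.A j₁ D₀ x * f x) = ∫ x in cube d,
        regEst W q₁ Obs.A j₁ D₀ x * regEst W q₂ Obs.Y j₂ D₂ x * f x :=
    integral_cube_congr fun x _ => by ring
  rw [hP.lintegral_MC_eq hn (b1 D₀) (b2 D₂), e2]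
  refine le_trans (ofReal_le_ofReal ?_) le_self_add
  have h3 : 0 ≤ 1 / (n : ℝ) := by positivity
  exact le_add_of_nonneg_right (mul_nonneg h3 (sub_nonneg.2 (sq_integral_le hP.memLp_AY)))

theorem CDVBasis.integral_pert (hd : 0 < d) (hj : W.J₀ ≤ j) (ε : (Fin d → Fin (2 ^ j)) → ℝ) :
    ∫ x in cube d, W.pert j ε x = 0 := by
  have h1 := (W.orthoFamily_Phi (d := d) hj).integral_projOn_mul_comm (W.cubeBdd_pert ε)
    (CubeBdd.const 1)
  rw [integral_cube_congr (h := fun _ => (0 : ℝ)) fun x _ => by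
      rw [show projOn (W.Phi j) (W.pert j ε) x = 0 from W.proj_pert hd hj le_rfl x, zero_mul]] at h1
  rw [integral_cube_congr (h := fun x => W.pert j ε x * projOn (W.Phi j)
      (fun _ => 1) x) fun x hx => by
      rw [show projOn (W.Phi j) (fun _ => (1 : ℝ)) x = 1 from W.proj_const hj 1 hx, mul_one], ← h1]
  simp

theorem CDVBasis.Room.modelLaw (R : W.Room d θ c h τ) (hd : 0 < d)
    (hnd : NonDegenerate d W θ) (hα : 0 ≤ θ.α) (hβ : 0 ≤ θ.β) (hj : W.J₀ ≤ j)
    {ε ε' : (Fin d → Fin (2 ^ j)) → ℝ} (hε : ∀ m, |ε m| ≤ 1) (hε' : ∀ m, |ε' m| ≤ 1) :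
    ModelLaw W θ (1 + |c| + h) (signLaw c h (fun x => amp d τ j θ.α * W.pert j ε x)
      (fun x => amp d τ j θ.β * W.pert j ε' x)) (fun x => c + h * (amp d τ j θ.α * W.pert j ε x))
      (fun x => c + h * (amp d τ j θ.β * W.pert j ε' x)) (fun _ => 1) := by
  have H := R.signMeans (j := j) hα hβ hε hε'
  have hI := R.inModel hd hnd hα hβ hj hε hε'
  have hM := hnd.M_pos.le
  have hK : (1 : ℝ) ≤ 1 + |c| + h := by linarith [abs_nonneg c, R.h_pos]
  have hK' : |c| + h ≤ 1 + |c| + h := by linarith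
  have hA := H.regr_A hK R.h_pos.le hK'
  have hY := H.regr_Y hK R.h_pos.le hK'
  exact ⟨H.covLaw hK, hA, hY, _root_.psi_eq (H.covLaw hK) hA hY H.condExp_A H.condExp_Y,
    ⟨hA.bdd, hI.holder_p.1, W.holderCoef_of_holderNorm_le hM hI.holder_p.2⟩,
    ⟨hY.bdd, hI.holder_b.1, W.holderCoef_of_holderNorm_le hM hI.holder_b.2⟩,
    ⟨CubeBdd.const 1, hI.holder_f.1, W.holderCoef_of_holderNorm_le hM hI.holder_f.2⟩⟩

/-- The wavelets of level `min j₁ j₂` are invisible to one of the two projections, so that the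
product of the projections misses the whole of `∫ p b - c ^ 2`. -/
theorem CDVBasis.Room.integral_proj_mul_proj (hd : 0 < d) {j₁ j₂ : ℕ} (h₁ : W.J₀ ≤ j₁)
    (h₂ : W.J₀ ≤ j₂) (ε ε' : (Fin d → Fin (2 ^ min j₁ j₂)) → ℝ) (a a' : ℝ) :
    ∫ x in cube d, W.proj j₁ (fun x => c + a * W.pert (min j₁ j₂) ε x) x *
      W.proj j₂ (fun x => c + a' * W.pert (min j₁ j₂) ε' x) x = c ^ 2 := by
  have hj : W.J₀ ≤ min j₁ j₂ := le_min h₁ h₂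
  have key : ∀ {l : ℕ} (_ : W.J₀ ≤ l) (e : (Fin d → Fin (2 ^ min j₁ j₂)) → ℝ) (t : ℝ),
      (l = min j₁ j₂ → ∀ x ∈ cube d, W.proj l (fun x => c + t * W.pert (min j₁ j₂) e x) x = c) ∧
      ∫ x in cube d, W.proj l (fun x => c + t * W.pert (min j₁ j₂) e x) x = c := by
    intro l hl e t
    have bu := (CubeBdd.const c).add ((W.cubeBdd_pert e).const_mul t)
    constructor
    · rintro rfl x hx
      have h1 := projOn_add (W.orthoFamily_Phi (d := d) hl).bdd (CubeBdd.const c)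
        ((W.cubeBdd_pert e).const_mul t) x
      rw [projOn_const_mul, show projOn (W.Phi (min j₁ j₂)) (W.pert (min j₁ j₂) e) x = 0
        from W.proj_pert hd hl le_rfl x, mul_zero, add_zero] at h1
      exact h1.trans (W.proj_const hl c hx)
    · have h1 := (W.orthoFamily_Phi (d := d) hl).integral_projOn_mul_comm bu (CubeBdd.const 1)
      have h2 : ∫ x in cube d, (c + t * W.pert (min j₁ j₂) e x) = c := by
        rw [integral_add (CubeBdd.const c).integrable ((W.cubeBdd_pert e).const_mul t).integrable,
          integral_const_mul, W.integral_pert hd hj]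
        simp
      simp only [mul_one] at h1
      refine h1.trans ((integral_cube_congr fun x hx => ?_).trans h2)
      rw [show projOn (W.Phi l) (fun _ => (1 : ℝ)) x = 1 from W.proj_const hl 1 hx, mul_one]
  rcases min_choice j₁ j₂ with hm | hm
  · rw [integral_cube_congr fun x hx => by rw [(key h₁ ε a).1 hm.symm x hx], integral_const_mul,
      (key h₂ ε' a').2, sq]
  · rw [integral_cube_congr fun x hx => by rw [(key h₂ ε' a').1 hm.symm x hx], integral_mul_const,
      (key h₁ ε a).2, sq]

theorem amp_mul_amp (d : ℕ) (τ : ℝ) (j : ℕ) (a b : ℝ) :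
    amp d τ j a * amp d τ j b * res d j = τ ^ 2 * dw j (a + b) := by
  have h1 : (√(2 ^ j : ℝ) ^ d) * √(2 ^ j) ^ d = res d j := by
    rw [← mul_pow, Real.mul_self_sqrt (by positivity), res, pow_mul]
  rw [← h1, dw_add, amp, amp]
  field_simp

/-- Perturbations of level `min j₁ j₂` with all coefficients one: the bias of the Monte Carlo estimator
is of order `2 ^ (-j s)`, up to density errors. -/
theorem CDVBasis.Room.exists_bias_le (R : W.Room d θ c h τ) (hd : 0 < d)
    (hnd : NonDegenerate d W θ) (hα : 0 ≤ θ.α) (hβ : 0 ≤ θ.β)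
    {fhat : DensityEstimator d} (hf : IsBoundedEstimator c₁ c₂ fhat) :
    ∃ C, 0 ≤ C ∧ ∀ n j₁ j₂, 1 ≤ n → W.J₀ ≤ j₁ → W.J₀ ≤ j₂ →
      ∃ P p b, InModel W θ P p b (fun _ => 1) ∧
      ofReal ((h ^ 2 * τ ^ 2 * dw (min j₁ j₂) (θ.α + θ.β)) ^ 2 / 2) ≤
        mse (psiMC (n := n) W fhat j₁ j₂) P + ofReal C * densityRisk fhat n P (fun _ => 1) := by
  set K := 1 + |c| + h
  have hA := W.A_pos d
  have hc₁ := hf.pos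
  have hK0 : 0 ≤ K := by have := R.h_pos; positivity
  set U := W.A d * (K ^ 2 / c₁) + W.A d * K
  have hU0 : 0 ≤ U := by positivity
  set C := K / c₁ * U
  refine ⟨4 * C ^ 2, by positivity, fun n j₁ j₂ hn h₁ h₂ => ?_⟩
  set j := min j₁ j₂
  have hj : W.J₀ ≤ j := le_min h₁ h₂
  set ε : (Fin d → Fin (2 ^ j)) → ℝ := fun _ => 1 with hε
  have hε1 : ∀ m, |ε m| ≤ 1 := fun m => by simp [hε]
  set P := signLaw c h (fun x => amp d τ j θ.α * W.pert j ε x)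
    (fun x => amp d τ j θ.β * W.pert j ε x)
  set p : (Fin d → ℝ) → ℝ := fun x => c + h * (amp d τ j θ.α * W.pert j ε x) with hp
  set b : (Fin d → ℝ) → ℝ := fun x => c + h * (amp d τ j θ.β * W.pert j ε x) with hb
  have hP : ModelLaw W θ K P p b fun _ => 1 := R.modelLaw hd hnd hα hβ hj hε1 hε1
  have := hP.cov.prob
  refine ⟨P, p, b, R.inModel hd hnd hα hβ hj hε1 hε1, ?_⟩
  set δ := h ^ 2 * τ ^ 2 * dw j (θ.α + θ.β) with hδ
  have bpert := W.cubeBdd_pert ε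
  -- `δ` is what the projections miss of `∫ p b`
  have epb : ∫ x in cube d, p x * b x * 1 = c ^ 2 + δ := by
    have e1 : ∀ x, p x * b x * 1 = c ^ 2 + (c * h * (amp d τ j θ.α + amp d τ j θ.β) * W.pert j ε x +
        h ^ 2 * (amp d τ j θ.α * amp d τ j θ.β) * (W.pert j ε x * W.pert j ε x)) := fun x => by
      simp only [hp, hb]; ring
    simp_rw [e1]
    rw [integral_add (CubeBdd.const _).integrable ((bpert.const_mul _).add
      ((bpert.mul bpert).const_mul _)).integrable, integral_add (bpert.const_mul _).integrable
      ((bpert.mul bpert).const_mul _).integrable, integral_const_mul, integral_const_mul,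
      W.integral_pert hd hj, W.integral_pert_mul_pert hj]
    simp only [hε, mul_one, sum_const, Finset.card_univ, nsmul_eq_mul, card_eq_res, hδ]
    rw [mul_assoc (h ^ 2), amp_mul_amp]
    simp
    ring
  have key : ∀ D₁ D₃ : Fin n → Obs d, ofReal (δ ^ 2 / 2) ≤
      (∫⁻ D₀, ∫⁻ D₂, ∫⁻ D₄, ∫⁻ D₅, ofReal ((1 / (n : ℝ) * ∑ i, (D₄ i).A * (D₄ i).Y -
        1 / (n : ℝ) * ∑ i, regEst W (fhat n D₁) Obs.A j₁ D₀ (D₅ i).X *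
          regEst W (fhat n D₃) Obs.Y j₂ D₂ (D₅ i).X - psi P) ^ 2)
        ∂P^⊗n ∂P^⊗n ∂P^⊗n ∂P^⊗n) + (ofReal (2 * C ^ 2) * ofReal (sqDist (fhat n D₁) fun _ => 1) +
        ofReal (2 * C ^ 2) * ofReal (sqDist (fhat n D₃) fun _ => 1)) := by
    intro D₁ D₃
    have hq₁ := hf.isWeight D₁
    have hq₂ := hf.isWeight D₃
    set q₁ := fhat n D₁
    set q₂ := fhat n D₃
    have s1 := sqDist_nonneg q₁ fun _ : Fin d → ℝ => 1
    have s2 := sqDist_nonneg q₂ fun _ : Fin d → ℝ => 1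
    refine le_trans ?_ (add_le_add (hP.sq_bias_le hq₁ hq₂ hn h₁ h₂) le_rfl)
    rw [← ofReal_mul (by positivity), ← ofReal_mul (by positivity),
      ← ofReal_add (by positivity) (by positivity), ← ofReal_add (sq_nonneg _) (by positivity)]
    refine ofReal_le_ofReal ?_
    set p₁ := regMean W q₁ (fun _ => 1) j₁ p
    set b₁ := regMean W q₂ (fun _ => 1) j₂ b
    have bp₁ : CubeBdd p₁ := W.cubeBdd_regMean _ _ _ _
    have bb₁ : CubeBdd b₁ := W.cubeBdd_regMean _ _ _ _
    have bp₂ := W.cubeBdd_proj j₁ p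
    have bb₂ := W.cubeBdd_proj j₂ b
    have e1 := hP.regA.abs_integral_regMean_sub_proj_mul_le hP.cov hq₁ h₁ bb₁ hU0 fun x hx =>
      (hP.regY.abs_regMean_le (W := W) hP.cov hq₂ j₂ hx).trans
        (le_add_of_nonneg_right (by positivity))
    have e2 := hP.regY.abs_integral_regMean_sub_proj_mul_le hP.cov hq₂ h₂ bp₂ hU0 fun x hx =>
      (W.abs_proj_le j₁ hP.regA.bdd hP.regA.abs_r_le hx).trans
        (le_add_of_nonneg_left (by positivity))
    have e3 : ∫ x in cube d, p₁ x * (b₁ x * 1) = (∫ x in cube d, (p₁ x - W.proj j₁ p x) * b₁ x) +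
        ((∫ x in cube d, (b₁ x - W.proj j₂ b x) * W.proj j₁ p x) + c ^ 2) := by
      have e4 : ∫ x in cube d, W.proj j₁ p x * W.proj j₂ b x = c ^ 2 := by
        have := CDVBasis.Room.integral_proj_mul_proj (W := W) (c := c) hd h₁ h₂ ε ε
          (h * amp d τ j θ.α) (h * amp d τ j θ.β)
        simp only [mul_assoc] at this
        exact this
      rw [← e4, ← integral_add ((bb₁.sub bb₂).mul bp₂).integrable (bp₂.mul bb₂).integrable,
        ← integral_add ((bp₁.sub bp₂).mul bb₁).integrable
          ((((bb₁.sub bb₂).mul bp₂).add (bp₂.mul bb₂)).integrable)]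
      exact integral_cube_congr fun x _ => by ring
    rw [e3, epb]
    set x := ∫ x in cube d, (p₁ x - W.proj j₁ p x) * b₁ x
    set y := ∫ x in cube d, (b₁ x - W.proj j₂ b x) * W.proj j₁ p x
    have hx : x ^ 2 ≤ C ^ 2 * sqDist q₁ fun _ => 1 := by
      have := sq_le_of_abs_le e1
      rwa [mul_pow, Real.sq_sqrt s1] at this
    have hy : y ^ 2 ≤ C ^ 2 * sqDist q₂ fun _ => 1 := by
      have := sq_le_of_abs_le e2
      rwa [mul_pow, Real.sq_sqrt s2] at this
    -- `(δ - t) ^ 2 + t ^ 2 ≥ δ ^ 2 / 2` with `t = x + y`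
    nlinarith [sq_nonneg (δ - 2 * (x + y)), sq_nonneg (x - y)]
  have hm := hf.measurable_sqDist (n := n) (f := fun _ => 1) measurable_const
  have h4 := lintegral_mono (μ := P^⊗n) fun D₁ => lintegral_mono (μ := P^⊗n) fun D₃ => key D₁ D₃
  simp only [lintegral_const, measure_univ, mul_one] at h4
  refine h4.trans ?_
  rw [mse_psiMC_eq hf]
  have h5 : ∀ D₁ : Fin n → Obs d, ∫⁻ D₃, (ofReal (2 * C ^ 2) *
      ofReal (sqDist (fhat n D₁) fun _ => 1) + ofReal (2 * C ^ 2) *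
        ofReal (sqDist (fhat n D₃) fun _ => 1)) ∂P^⊗n =
      ofReal (2 * C ^ 2) * ofReal (sqDist (fhat n D₁) fun _ => 1) +
        ofReal (2 * C ^ 2) * densityRisk fhat n P fun _ => 1 := fun D₁ => by
    rw [lintegral_add_left measurable_const, lintegral_const, measure_univ, mul_one,
      lintegral_const_mul _ hm]
    rfl
  refine (lintegral_congr fun D₁ => (lintegral_add_right _ (measurable_const.add
    (hm.const_mul _))).trans (congrArg _ (h5 D₁))).le.trans ?_
  rw [lintegral_add_right _ ((hm.const_mul _).add_const _),
    lintegral_add_left (hm.const_mul _), lintegral_const, measure_univ, mul_one,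
    lintegral_const_mul _ hm]
  refine add_le_add le_rfl (le_of_eq ?_)
  change ofReal (2 * C ^ 2) * densityRisk fhat n P _ + _ = _
  rw [← add_mul, ← ofReal_add (by positivity) (by positivity)]
  congr 2
  ring

end

section

variable {S d n : ℕ} {W : CDVBasis S} {θ : ModelParams} {K c₁ c₂ c h τ : ℝ} {j : ℕ}

/-- With constant regression functions, a regression estimator has variance of order `k / n`. -/
theorem le_lintegral_regEst_sq {P : Measure (Obs d)} {Z : Obs d → ℝ} {q : (Fin d → ℝ) → ℝ}
    (hP : CovLaw P (fun _ => 1) K) (hZ : Regr P (fun _ => 1) K Z fun _ => c)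
    (hZ2 : ∀ φ, CubeBdd φ → ∫ o, (Z o * φ o.X) ^ 2 ∂P = (c ^ 2 + h ^ 2) * ∫ x in cube d, φ x ^ 2)
    (hq : IsWeight c₁ c₂ q) (hn : 1 ≤ n) (hj : W.J₀ ≤ j) {x : Fin d → ℝ} (hx : x ∈ cube d) :
    ofReal (h ^ 2 / (c₂ ^ 2 * (4 * W.R) ^ d) * (res d j / n)) ≤
    ∫⁻ D, ofReal (regEst W q Z j D x ^ 2) ∂P^⊗n := by
  have := hP.prob
  have hR := W.one_le_R
  have hc₂ : 0 < c₂ := hq.pos.trans_le ((hq.mem x hx).1.trans (hq.mem x hx).2)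
  have bk := W.cubeBdd_kernel j x
  have bφ := hq.cubeBdd_div bk
  set φ : (Fin d → ℝ) → ℝ := fun y => W.kernel j x y / q y with hφ
  have h2 : ∀ D : Fin n → Obs d, regEst W q Z j D x = 0 + 1 / (n : ℝ) *
      ∑ i, Z (D i) * φ (D i).X := fun D => by
    rw [regEst, zero_add]
    simp_rw [hφ, CDVData.kernel_comm W j x, mul_div_assoc]
  simp_rw [h2]
  rw [lintegral_sq_add_average (hZ.memLp hP bφ) hn, hZ2 φ bφ, hZ.integral φ bφ, zero_add]
  refine ofReal_le_ofReal ?_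
  have h3 : (∫ y in cube d, c * φ y * 1) ^ 2 ≤ c ^ 2 * ∫ y in cube d, φ y ^ 2 := by
    simp_rw [mul_one]
    rw [integral_const_mul, mul_pow]
    refine mul_le_mul_of_nonneg_left (sq_integral_le (P := cubeMeasure d) ?_) (sq_nonneg _)
    obtain ⟨B, hB⟩ := bφ.bdd
    exact MemLp.of_bound bφ.meas.aestronglyMeasurable B
      ((ae_mem_cube d).mono fun y hy => hB y hy)
  have h4 : res d j / (c₂ ^ 2 * (4 * W.R) ^ d) ≤ ∫ y in cube d, φ y ^ 2 := by
    have h5 : ∫ y in cube d, W.kernel j x y ^ 2 * (1 / c₂ ^ 2) ≤ ∫ y in cube d, φ y ^ 2 := by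
      refine CubeBdd.integral_mono (bk.pow.mul (CubeBdd.const _)) bφ.pow fun y hy => ?_
      have hqy := hq.mem y hy
      have := hq.pos.trans_le hqy.1
      rw [hφ, div_pow, div_eq_mul_one_div (_ ^ 2) (q y ^ 2)]
      refine mul_le_mul_of_nonneg_left (one_div_le_one_div_of_le (by positivity) ?_) (sq_nonneg _)
      exact pow_le_pow_left₀ this.le hqy.2 2
    rw [integral_mul_const, W.integral_kernel_sq hj] at h5
    refine le_trans ?_ h5
    have h6 := mul_le_mul_of_nonneg_right (W.le_kernel_self (d := d) hj hx)
      (by positivity : 0 ≤ 1 / c₂ ^ 2)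
    refine le_trans (le_of_eq ?_) h6
    rw [res]
    field_simp
  have hn0 : 0 ≤ 1 / (n : ℝ) := by positivity
  calc h ^ 2 / (c₂ ^ 2 * (4 * W.R) ^ d) * (res d j / n)
      = 1 / n * (h ^ 2 * (res d j / (c₂ ^ 2 * (4 * W.R) ^ d))) := by ring
    _ ≤ 1 / n * ((c ^ 2 + h ^ 2) * (∫ y in cube d, φ y ^ 2) -
          (∫ y in cube d, c * φ y * 1) ^ 2) := by
        refine mul_le_mul_of_nonneg_left ?_ hn0
        nlinarith [mul_le_mul_of_nonneg_left h4 (sq_nonneg h)]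
    _ ≤ _ := le_add_of_nonneg_left (sq_nonneg _)

set_option maxHeartbeats 1600000 in
/-- With constant regression functions, the variance of the average over the last subsample is the
integrated product of two second moments, of order `k₁ k₂ / n ^ 3`, up to lower order terms. -/
theorem CDVBasis.Room.exists_variance_le (R : W.Room d θ c h τ) (hd : 0 < d)
    (hnd : NonDegenerate d W θ) (hα : 0 ≤ θ.α) (hβ : 0 ≤ θ.β)
    {fhat : DensityEstimator d} (hf : IsBoundedEstimator c₁ c₂ fhat) :
    ∃ c' C, 0 < c' ∧ 0 ≤ C ∧ ∀ n j₁ j₂ : ℕ, 1 ≤ n → W.J₀ ≤ j₁ → W.J₀ ≤ j₂ →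
      ofReal (1 / (n : ℝ) * (c' * (res d j₁ / n * (res d j₂ / n)))) ≤
        maxRisk W θ (psiMC (n := n) W fhat j₁ j₂) +
          ofReal (1 / (n : ℝ) * (C * (1 + min (res d j₁) (res d j₂) / n))) := by
  set K := 1 + |c| + h with hK
  have hA := W.A_pos d
  have hc₁ := hf.pos
  have hR := W.one_le_R
  have hh := R.h_pos
  have hK1 : 1 ≤ K := by linarith [abs_nonneg c]
  have hK0 : 0 ≤ K := zero_le_one.trans hK1
  have h0 : (0 : Fin d → ℝ) ∈ cube d := mem_cube.2 fun i => by simp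
  have hc₂ : 0 < c₂ := hc₁.trans_le ((hf.mem 0 (fun i => i.elim0) 0 h0).1.trans
    (hf.mem 0 (fun i => i.elim0) 0 h0).2)
  set c' := h ^ 2 / (c₂ ^ 2 * (4 * W.R) ^ d)
  set U := W.A d * (K ^ 2 / c₁)
  have hU0 : 0 ≤ U := by positivity
  have hV : 0 ≤ varFactor K c₁ := mul_nonneg hK0 (sq_nonneg _)
  set C1 := varFactor K c₁ * (2 * ((1 + W.A d * (K ^ 2 / c₁)) * 1) ^ 2 + varFactor K c₁ * 1 ^ 2)
  have hC10 : 0 ≤ C1 := by positivity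
  refine ⟨c' ^ 2, (U * U) ^ 2 + C1, by positivity, by positivity, fun n j₁ j₂ hn h₁ h₂ => ?_⟩
  have hn0 : (0 : ℝ) ≤ 1 / (n : ℝ) := by positivity
  have hr₁ : 0 ≤ res d j₁ / n := div_nonneg (res_pos d j₁).le (Nat.cast_nonneg n)
  have hmin : 0 ≤ min (res d j₁) (res d j₂) / (n : ℝ) :=
    div_nonneg (le_min (res_pos d j₁).le (res_pos d j₂).le) (Nat.cast_nonneg n)
  -- the unperturbed law: independent fair signs
  set ε : (Fin d → Fin (2 ^ W.J₀)) → ℝ := fun _ => 0 with hε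
  have hε1 : ∀ m, |ε m| ≤ 1 := fun m => by simp [hε]
  have hpert : ∀ x, W.pert W.J₀ ε x = 0 := fun x => by simp [CDVBasis.pert, hε]
  have H := R.signMeans hα hβ hε1 hε1
  have hI := R.inModel hd hnd hα hβ le_rfl hε1 hε1
  have hP := R.modelLaw hd hnd hα hβ le_rfl hε1 hε1
  simp only [hpert, mul_zero, add_zero] at H hI hP
  set P := signLaw c h (fun _ : Fin d → ℝ => (0 : ℝ)) (fun _ => 0) with hPdef
  rw [← hK] at hP
  have := hP.cov.prob
  have hsec : ∀ (Z : Obs d → ℝ) (e : Bool × Bool → Bool), Measurable Z →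
      (∀ b x, Z (signObs c h b x) = c + h * sg (e b)) → (e = Prod.fst ∨ e = Prod.snd) →
      ∀ φ, CubeBdd φ → ∫ o, (Z o * φ o.X) ^ 2 ∂P = (c ^ 2 + h ^ 2) * ∫ x in cube d, φ x ^ 2 := by
    intro Z e hZ hZe he φ hφ
    rw [hPdef, H.integral_signLaw (G := fun o => (Z o * φ o.X) ^ 2)
      ((hZ.mul (hφ.meas.comp Obs.measurable_X)).pow_const 2) fun b => by
        simp_rw [hZe]; exact ((hφ.const_mul _).pow), ← integral_const_mul]
    refine integral_cube_congr fun x _ => ?_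
    have e2 : ∀ b, (signObs c h b x).X = x := fun b => rfl
    simp only [hZe, e2]
    rcases he with rfl | rfl <;> simp [Fintype.sum_prod_type, signWeight] <;> ring
  have hA2 := hsec Obs.A Prod.fst Obs.measurable_A (fun _ _ => rfl) (Or.inl rfl)
  have hY2 := hsec Obs.Y Prod.snd Obs.measurable_Y (fun _ _ => rfl) (Or.inr rfl)
  have hmse : ofReal (1 / (n : ℝ) * (c' ^ 2 * (res d j₁ / n * (res d j₂ / n)))) ≤
      mse (psiMC (n := n) W fhat j₁ j₂) P +
        ofReal (1 / (n : ℝ) * (((U * U) ^ 2 + C1) * (1 + min (res d j₁) (res d j₂) / n))) := by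
    have key : ∀ D₁ D₃ : Fin n → Obs d,
        ofReal (1 / (n : ℝ) * (c' ^ 2 * (res d j₁ / n * (res d j₂ / n)))) ≤
        (∫⁻ D₀, ∫⁻ D₂, ∫⁻ D₄, ∫⁻ D₅, ofReal ((1 / (n : ℝ) * ∑ i, (D₄ i).A * (D₄ i).Y -
          1 / (n : ℝ) * ∑ i, regEst W (fhat n D₁) Obs.A j₁ D₀ (D₅ i).X *
            regEst W (fhat n D₃) Obs.Y j₂ D₂ (D₅ i).X - psi P) ^ 2)
          ∂P^⊗n ∂P^⊗n ∂P^⊗n ∂P^⊗n) +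
        ofReal (1 / (n : ℝ) * (((U * U) ^ 2 + C1) * (1 + min (res d j₁) (res d j₂) / n))) := by
      intro D₁ D₃
      have hq₁ := hf.isWeight D₁
      have hq₂ := hf.isWeight D₃
      set q₁ := fhat n D₁
      set q₂ := fhat n D₃
      have b1 := W.cubeBdd_regEst (n := n) q₁ Obs.A j₁
      have b2 := W.cubeBdd_regEst (n := n) q₂ Obs.Y j₂
      -- the mean of the squared integral
      have s2 := hP.regA.lintegral_bilinear_sq_le (W := W) (n := n) (p₀ := fun _ => 0)
        (b₀ := fun _ => 0) (w := fun _ => 1) (L := 1) hP.cov hP.regY hq₁ hq₂ hn h₁ h₂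
        (CubeBdd.const 0) (fun x _ => by simp) (CubeBdd.const 0) (fun x _ => by simp)
        (CubeBdd.const 1) (fun x _ => by simp) 0
      simp only [zero_sub, neg_mul_neg, zero_add, mul_one] at s2
      have hmG : Measurable fun z : (Fin n → Obs d) × (Fin n → Obs d) => ofReal
          ((∫ x in cube d, regEst W q₁ Obs.A j₁ z.1 x * regEst W q₂ Obs.Y j₂ z.2 x) ^ 2) := by
        have h3 : Measurable fun y : ((Fin n → Obs d) × (Fin n → Obs d)) × (Fin d → ℝ) =>
            regEst W q₁ Obs.A j₁ y.1.1 y.2 * regEst W q₂ Obs.Y j₂ y.1.2 y.2 :=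
          ((W.measurable_regEst (n := n) (j := j₁) hP.regA.meas hq₁.meas).comp
            ((measurable_fst.comp measurable_fst).prodMk measurable_snd)).mul
          ((W.measurable_regEst (n := n) (j := j₂) hP.regY.meas hq₂.meas).comp
            ((measurable_snd.comp measurable_fst).prodMk measurable_snd))
        exact ((h3.stronglyMeasurable.integral_prod_right' (ν := cubeMeasure d)).measurable.pow_const
          2).ennreal_ofReal
      have s3 := lintegral_lintegral_add_le (c := 0) (c' := ofReal (1 / n)) hmG
        (le_refl (∫⁻ D₀, ∫⁻ D₂, ∫⁻ D₄, ∫⁻ D₅, ofReal ((1 / (n : ℝ) * ∑ i, (D₄ i).A * (D₄ i).Y -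
          1 / (n : ℝ) * ∑ i, regEst W q₁ Obs.A j₁ D₀ (D₅ i).X *
            regEst W q₂ Obs.Y j₂ D₂ (D₅ i).X - psi P) ^ 2)
          ∂P^⊗n ∂P^⊗n ∂P^⊗n ∂P^⊗n)) s2
      rw [zero_add, ← ofReal_mul hn0] at s3
      -- the mean of the integrated square
      have s4 : ofReal (1 / (n : ℝ) * (c' ^ 2 * (res d j₁ / n * (res d j₂ / n)))) ≤
          ∫⁻ D₀, ∫⁻ D₂, ofReal (1 / n) * ofReal (∫ x in cube d,
            regEst W q₁ Obs.A j₁ D₀ x ^ 2 * regEst W q₂ Obs.Y j₂ D₂ x ^ 2 * 1)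
            ∂P^⊗n ∂P^⊗n := by
        simp_rw [lintegral_const_mul' _ _ ENNReal.ofReal_ne_top]
        rw [lintegral_lintegral_integral_mul (F₁ := fun t => t ^ 2) (F₂ := fun t => t ^ 2)
          (g := fun _ => 1) hP.regA.meas hP.regY.meas hq₁.meas hq₂.meas (by fun_prop) (by fun_prop)
          (fun t => sq_nonneg t) (fun t => sq_nonneg t) measurable_const (fun _ _ => zero_le_one)
          fun D D' => ((b1 D).pow.mul (b2 D').pow).mul (CubeBdd.const 1), ofReal_mul hn0]
        refine mul_le_mul' le_rfl ?_
        calc ofReal (c' ^ 2 * (res d j₁ / n * (res d j₂ / n)))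
            = ∫⁻ _x in cube d, ofReal (c' * (res d j₁ / n)) *
                ofReal (c' * (res d j₂ / n)) * ofReal 1 := by
              rw [lintegral_const, measure_univ, mul_one, ENNReal.ofReal_one, mul_one,
                ← ofReal_mul (by positivity)]
              congr 1
              ring
          _ ≤ _ := by
              refine lintegral_mono_ae ?_
              filter_upwards [ae_mem_cube d] with x hx
              exact mul_le_mul' (mul_le_mul'
                (le_lintegral_regEst_sq hP.cov hP.regA hA2 hq₁ hn h₁ hx)
                (le_lintegral_regEst_sq hP.cov hP.regY hY2 hq₂ hn h₂ hx)) le_rfl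
      refine s4.trans (le_trans (lintegral_mono fun D₀ => lintegral_mono fun D₂ => ?_)
        (s3.trans (add_le_add le_rfl (ofReal_le_ofReal ?_))))
      · rw [hP.lintegral_MC_eq hn (b1 D₀) (b2 D₂), zero_add, ← ofReal_mul hn0, ← ofReal_mul hn0]
        refine le_trans ?_ (add_le_add le_add_self le_rfl)
        refine le_trans (ofReal_le_ofReal (le_of_eq ?_)) ENNReal.ofReal_add_le
        simp only [mul_pow, mul_one]
        ring
      · refine mul_le_mul_of_nonneg_left ?_ hn0
        have bm₁ := W.cubeBdd_regMean q₁ (fun _ => 1) j₁ fun _ => c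
        have bm₂ := W.cubeBdd_regMean q₂ (fun _ => 1) j₂ fun _ => c
        have h5 := (bm₁.mul bm₂).abs_integral_le (B := U * U) fun x hx => by
          rw [abs_mul]
          exact mul_le_mul (hP.regA.abs_regMean_le (W := W) hP.cov hq₁ j₁ hx)
            (hP.regY.abs_regMean_le (W := W) hP.cov hq₂ j₂ hx) (abs_nonneg _) hU0
        have h6 := sq_le_of_abs_le h5
        have h7 : 1 / (n : ℝ) ≤ 1 := by
          rw [div_le_one (by positivity)]; exact_mod_cast hn
        have h8 : 1 / (n : ℝ) * (1 + min (res d j₁) (res d j₂) / n) ≤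
            1 + min (res d j₁) (res d j₂) / n := mul_le_of_le_one_left (by positivity) h7
        have h9 := mul_le_mul_of_nonneg_left h8 hC10
        nlinarith [mul_nonneg (sq_nonneg (U * U)) hmin]
    have h4 := lintegral_mono (μ := P^⊗n) fun D₁ => lintegral_mono (μ := P^⊗n) fun D₃ => key D₁ D₃
    simp only [lintegral_const, measure_univ, mul_one, lintegral_add_right _ measurable_const] at h4
    rwa [mse_psiMC_eq hf]
  exact hmse.trans (add_le_add (le_iSup₂_of_le P ⟨_, _, _, hI⟩ le_rfl) le_rfl)

end

/-! ### Orders of magnitude -/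

section

variable {a b : ℕ → ℝ≥0∞} {r e : ℝ}

theorem AsympLE.trans {c : ℕ → ℝ≥0∞} (h : AsympLE a b) (h' : AsympLE b c) : AsympLE a c := by
  obtain ⟨C, hC, H⟩ := h
  obtain ⟨C', hC', H'⟩ := h'
  refine ⟨C * C', mul_pos hC hC', ?_⟩
  filter_upwards [H, H'] with n h1 h2
  rw [ENNReal.coe_mul, mul_assoc]
  exact h1.trans (mul_le_mul' le_rfl h2)

theorem AsympLE.of_le (h : ∀ᶠ n in atTop, a n ≤ b n) : AsympLE a b :=
  ⟨1, one_pos, h.mono fun n hn => by simpa using hn⟩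

theorem asympLE_of_ofReal_le {c : ℝ} (hc : 0 < c)
    (h : ∀ᶠ n : ℕ in atTop, ofReal (c * (n : ℝ) ^ r) ≤ b n) : AsympLE (powSeq r) b := by
  refine ⟨(1 / c).toNNReal, by simpa using hc, h.mono fun n hn => ?_⟩
  refine le_trans (le_of_eq ?_) (mul_le_mul' le_rfl hn)
  rw [← ofReal, ← ofReal_mul (by positivity), powSeq]
  congr 1
  field_simp

theorem asympLE_of_le_add {D : ℕ → ℝ≥0∞} {u : ℕ → ℝ} {C : ℝ}
    (h : ∀ᶠ n in atTop, a n ≤ ofReal (u n) + ofReal C * D n)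
    (hu : u =O[atTop] fun n : ℕ => (n : ℝ) ^ r) (hD : AsympLE D (powSeq r)) :
    AsympLE a (powSeq r) := by
  obtain ⟨c, hc, H⟩ := hu.exists_pos
  obtain ⟨C', hC', H'⟩ := hD
  refine ⟨c.toNNReal + C.toNNReal * C', add_pos_of_pos_of_nonneg (by simpa) zero_le, ?_⟩
  filter_upwards [h, H.bound, H'] with n h1 h2 h3
  rw [ENNReal.coe_add, ENNReal.coe_mul, add_mul, mul_assoc]
  refine h1.trans (add_le_add ?_ (mul_le_mul' le_rfl h3))
  rw [← ofReal, powSeq, ← ofReal_mul hc.le]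
  refine ofReal_le_ofReal ((le_abs_self _).trans (h2.trans_eq ?_))
  rw [Real.norm_of_nonneg (by positivity)]

theorem natCast_rpow_isBigO (h : r ≤ e) :
    (fun n : ℕ => (n : ℝ) ^ r) =O[atTop] fun n : ℕ => (n : ℝ) ^ e := by
  refine Asymptotics.IsBigO.of_bound 1 ((eventually_ge_atTop 1).mono fun n hn => ?_)
  rw [one_mul, Real.norm_of_nonneg (by positivity), Real.norm_of_nonneg (by positivity)]
  exact Real.rpow_le_rpow_of_exponent_le (by exact_mod_cast hn) h

theorem asympLE_powSeq (h : r ≤ e) : AsympLE (powSeq r) (powSeq e) :=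
  AsympLE.of_le ((eventually_ge_atTop 1).mono fun n hn => ofReal_le_ofReal
    (Real.rpow_le_rpow_of_exponent_le (by exact_mod_cast hn) h))

theorem eventually_le_natCast_rpow (he : 0 < e) (C : ℝ) : ∀ᶠ n : ℕ in atTop, C ≤ (n : ℝ) ^ e :=
  ((tendsto_rpow_atTop he).comp tendsto_natCast_atTop_atTop).eventually_ge_atTop C

theorem not_asympLE_powSeq (h : r < e) : ¬ AsympLE (powSeq e) (powSeq r) := by
  rintro ⟨C, hC, H⟩
  obtain ⟨n, h1, h2, h3⟩ := (H.and ((eventually_le_natCast_rpow (sub_pos.2 h) (C + 1)).and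
    (eventually_ge_atTop 1))).exists
  have hn : (0 : ℝ) < n := by exact_mod_cast h3
  rw [powSeq, powSeq, ← ENNReal.ofReal_coe_nnreal, ← ofReal_mul C.coe_nonneg,
    ENNReal.ofReal_le_ofReal_iff (by positivity)] at h1
  rw [Real.rpow_sub hn, le_div_iff₀ (by positivity)] at h2
  nlinarith [Real.rpow_pos_of_pos hn r]

theorem natCast_rpow_mul_isBigO {u v : ℕ → ℝ} (hu : u =O[atTop] fun n : ℕ => (n : ℝ) ^ r)
    (hv : v =O[atTop] fun n : ℕ => (n : ℝ) ^ e) :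
    (fun n => u n * v n) =O[atTop] fun n : ℕ => (n : ℝ) ^ (r + e) := by
  refine (hu.mul hv).congr' .rfl ((eventually_ge_atTop 1).mono fun n hn => ?_)
  exact (Real.rpow_add (by exact_mod_cast hn) r e).symm

theorem one_div_natCast_isBigO :
    (fun n : ℕ => 1 / (n : ℝ)) =O[atTop] fun n : ℕ => (n : ℝ) ^ (-1 : ℝ) := by
  simp_rw [Real.rpow_neg_one, one_div]
  exact Asymptotics.isBigO_refl _ _

theorem one_add_div_isBigO {u : ℕ → ℝ} (hu : u =O[atTop] fun n : ℕ => (n : ℝ) ^ r) (hr : 1 ≤ r) :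
    (fun n : ℕ => 1 + u n / n) =O[atTop] fun n : ℕ => (n : ℝ) ^ (r - 1) := by
  refine Asymptotics.IsBigO.add ?_ ?_
  · simpa using natCast_rpow_isBigO (r := 0) (e := r - 1) (by linarith)
  · simpa only [mul_one_div, ← sub_eq_add_neg] using
      natCast_rpow_mul_isBigO hu one_div_natCast_isBigO

/-- Logarithms are absorbed by a strictly better polynomial rate. -/
theorem div_log_rpow_isBigO {ρ g : ℝ} (h : ρ < g) :
    (fun n : ℕ => ((n : ℝ) / Real.log n) ^ (-g)) =O[atTop] fun n : ℕ => (n : ℝ) ^ (-ρ) := by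
  have h1 := ((isLittleO_log_rpow_rpow_atTop g (sub_pos.2 h)).isBigO).comp_tendsto
    tendsto_natCast_atTop_atTop
  have h2 := natCast_rpow_mul_isBigO (Asymptotics.isBigO_refl (fun n : ℕ => (n : ℝ) ^ (-g)) _) h1
  refine h2.congr' ((eventually_ge_atTop 1).mono fun n hn => ?_) ?_
  · have h4 := Real.log_nonneg (by exact_mod_cast hn : (1 : ℝ) ≤ n)
    simp only [Function.comp_apply]
    rw [Real.div_rpow (by positivity) h4, Real.rpow_neg h4, div_inv_eq_mul]
  · exact Eventually.of_forall fun n => by ring_nf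

theorem dw_eq_rpow (j : ℕ) (s : ℝ) : dw j s = ((2 : ℝ) ^ j) ^ (-s) := by
  rw [dw, ← Real.rpow_natCast, ← Real.rpow_mul two_pos.le, mul_neg]

theorem res_eq_pow (d j : ℕ) : res d j = ((2 : ℝ) ^ j) ^ d := by rw [res, pow_mul]

theorem dw_sq_eq_res_rpow {d : ℕ} (hd : 0 < d) (j : ℕ) (s : ℝ) :
    dw j s ^ 2 = res d j ^ (-(2 * s / d)) := by
  rw [dw_eq_rpow, res_eq_pow, ← Real.rpow_natCast _ 2, ← Real.rpow_natCast _ d,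
    ← Real.rpow_mul (by positivity), ← Real.rpow_mul (by positivity)]
  congr 1
  push_cast
  field_simp

theorem dw_sq_isBigO {d : ℕ} (hd : 0 < d) {j : ℕ → ℕ} {s : ℝ} (hs : 0 ≤ s)
    (h : (fun n : ℕ => (n : ℝ) ^ r) =O[atTop] fun n => res d (j n)) :
    (fun n => dw (j n) s ^ 2) =O[atTop] fun n : ℕ => (n : ℝ) ^ (-(r * (2 * s / d))) := by
  have h1 := (h.rpow (r := 2 * s / d) (by positivity)
    (Eventually.of_forall fun n => (res_pos d (j n)).le)).inv_rev ?_
  · refine h1.congr (fun n => ?_) fun n => ?_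
    · rw [dw_sq_eq_res_rpow hd, Real.rpow_neg (res_pos d _).le]
    · rw [Real.rpow_neg (by positivity), Real.rpow_mul (by positivity)]
  · refine (eventually_ge_atTop 1).mono fun n hn h0 => absurd h0 ?_
    positivity

theorem res_mono (d : ℕ) : Monotone (res d) := fun _ _ h =>
  pow_le_pow_right₀ one_le_two (Nat.mul_le_mul_right d h)

/-- Dyadic levels approximate any number from above, up to a constant. -/
theorem exists_level (J : ℕ) {y : ℝ} (hy : 1 ≤ y) :
    ∃ j ≥ J, y ≤ (2 : ℝ) ^ j ∧ (2 : ℝ) ^ j ≤ 2 ^ J * 2 * y := by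
  obtain ⟨k, h1, h2⟩ := exists_nat_pow_near hy one_lt_two
  refine ⟨J + (k + 1), Nat.le_add_right _ _, h2.le.trans ?_, ?_⟩
  · exact pow_le_pow_right₀ one_le_two (Nat.le_add_left _ _)
  · rw [pow_add, pow_succ]
    nlinarith [pow_pos (two_pos : (0 : ℝ) < 2) J]

/-- There are levels whose resolutions grow like any given power. -/
theorem exists_levels (J : ℕ) {d : ℕ} (hd : 0 < d) (hr : 0 ≤ r) :
    ∃ j : ℕ → ℕ, (∀ n, J ≤ j n) ∧ (fun n => res d (j n)) =Θ[atTop] fun n : ℕ => (n : ℝ) ^ r := by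
  have h (n : ℕ) : ∃ j ≥ J, 1 ≤ n → (n : ℝ) ^ (r / d) ≤ (2 : ℝ) ^ j ∧
      (2 : ℝ) ^ j ≤ 2 ^ J * 2 * (n : ℝ) ^ (r / d) := by
    rcases Nat.lt_or_ge n 1 with hn | hn
    · exact ⟨J, le_rfl, fun h => absurd h hn.not_ge⟩
    · obtain ⟨j, h1, h2⟩ := exists_level J
        (Real.one_le_rpow (by exact_mod_cast hn : (1 : ℝ) ≤ n) (by positivity : 0 ≤ r / d))
      exact ⟨j, h1, fun _ => h2⟩
  choose j hj H using h
  have hd' : (d : ℝ) ≠ 0 := by exact_mod_cast hd.ne'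
  have e1 (n : ℕ) : ((n : ℝ) ^ (r / d)) ^ d = (n : ℝ) ^ r := by
    rw [← Real.rpow_natCast, ← Real.rpow_mul (by positivity), div_mul_cancel₀ _ hd']
  refine ⟨j, hj, Asymptotics.IsBigO.of_bound ((2 ^ J * 2) ^ d) ?_, Asymptotics.IsBigO.of_bound 1 ?_⟩
  all_goals
    refine (eventually_ge_atTop 1).mono fun n hn => ?_
    rw [Real.norm_of_nonneg (res_pos _ _).le, Real.norm_of_nonneg (by positivity), res_eq_pow, ← e1]
  · rw [← mul_pow]
    exact pow_le_pow_left₀ (by positivity) (H n hn).2 d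
  · rw [one_mul]
    exact pow_le_pow_left₀ (by positivity) (H n hn).1 d

theorem ofReal_half_le_of_le_add {x y : ℝ} {z : ℝ≥0∞} (hx : 0 ≤ x)
    (h : ofReal x ≤ z + ofReal y) (hy : y ≤ x / 2) : ofReal (x / 2) ≤ z := by
  refine (ENNReal.add_le_add_iff_right (a := ofReal (x / 2)) ENNReal.ofReal_ne_top).1 ?_
  rw [← ofReal_add (by linarith) (by linarith), add_halves]
  exact h.trans (add_le_add le_rfl (ofReal_le_ofReal hy))

end

/-! ### Rates of the maximal and minimax risk -/

/-- Maximal risk of a density estimator over the model, in supremum norm. -/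
def maxDensityRisk {d : ℕ} (W : CDVData) (θ : ModelParams) (fhat : DensityEstimator d) (n : ℕ) :
    ℝ≥0∞ :=
  ⨆ (P : Measure (Obs d)) (p) (b) (f) (_ : InModel W θ P p b f),
    ∫⁻ D, cubeSupNorm (fun x => fhat n D x - f x) ^ 2 ∂P^⊗n

section

variable {S d m : ℕ} {W : CDVBasis S} {θ : ModelParams} {K c₁ c₂ c h τ r C : ℝ}
  {fhat : DensityEstimator d}

theorem IsDensityEstimator.asympLE {ρ : ℝ} (hf : IsDensityEstimator W θ fhat)
    (h : ρ < 2 * θ.γ / (2 * θ.γ + d)) :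
    AsympLE (maxDensityRisk W θ fhat) (powSeq (-ρ)) := by
  refine AsympLE.trans hf.rate (asympLE_of_le_add (C := 0) (D := 0) (Eventually.of_forall fun n =>
    le_self_add) (div_log_rpow_isBigO h) ⟨1, one_pos, Eventually.of_forall fun n => zero_le⟩)

theorem densityRisk_le_maxDensityRisk (hf : IsBoundedEstimator c₁ c₂ fhat) {n : ℕ}
    {P : Measure (Obs d)} {p b f f' : (Fin d → ℝ) → ℝ} (hP : InModel W θ P p b f)
    (hb : CubeBdd f') (hff : ∀ x ∈ cube d, f' x = f x) :
    densityRisk fhat n P f' ≤ maxDensityRisk W θ fhat n :=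
  (densityRisk_le hf hb hff).trans <| le_iSup_of_le P <| le_iSup_of_le p <| le_iSup_of_le b <|
    le_iSup_of_le f <| le_iSup_of_le hP le_rfl

/-- From risk bounds for single laws to the rate of the maximal risk. -/
theorem asympLE_maxRisk (hf : IsBoundedEstimator c₁ c₂ fhat)
    (hK : ∀ (P : Measure (Obs d)) (p b f : (Fin d → ℝ) → ℝ),
      InModel W θ P p b f → ∃ p' b' f', ModelLaw W θ K P p' b' f' ∧ ∀ x ∈ cube d, f' x = f x)
    {T : ∀ n, Sample d m n → ℝ} {B : ℕ → ℝ}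
    (H : ∀ P p b f n, ModelLaw W θ K P p b f → 1 ≤ n → mse (T n) P ≤
      ofReal (C * B n) + 3 * (ofReal C * densityRisk fhat n P f))
    (hB : B =O[atTop] fun n : ℕ => (n : ℝ) ^ r)
    (hD : AsympLE (maxDensityRisk W θ fhat) (powSeq r)) :
    AsympLE (fun n => maxRisk W θ (T n)) (powSeq r) := by
  refine asympLE_of_le_add (C := 3 * C) ((eventually_ge_atTop 1).mono fun n hn => ?_)
    (hB.const_mul_left C) hD
  refine iSup₂_le fun P hP => ?_
  obtain ⟨p, b, f, hP⟩ := hP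
  obtain ⟨p', b', f', hL, hff⟩ := hK P p b f hP
  refine (H P p' b' f' n hL hn).trans (add_le_add le_rfl ?_)
  rw [ofReal_mul (by norm_num), ENNReal.ofReal_ofNat, mul_assoc]
  exact mul_le_mul' le_rfl (mul_le_mul' le_rfl
    (densityRisk_le_maxDensityRisk hf hP hL.holder_f.1 hff))

/-- The lower bound on the minimax risk: signs on cells of side `2 ^ (-j)` with
`2 ^ j ≍ n ^ (2 / (2α + 2β + d))` are not detected by `m n` observations. -/
theorem CDVBasis.Room.asympLE_minimaxRisk (R : W.Room d θ c h τ) (hd : 0 < d)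
    (hnd : NonDegenerate d W θ) (hα : 0 ≤ θ.α) (hβ : 0 ≤ θ.β)
    (hs : 2 * (θ.α + θ.β) ≤ d) (hm : 0 < m) :
    AsympLE (powSeq (-(4 * (θ.α + θ.β) / (2 * (θ.α + θ.β) + d))))
      fun n => minimaxRisk d (Fin m × Fin n) W θ := by
  set s := θ.α + θ.β
  have hh := R.h_pos
  have hτ := R.τ_pos
  set t := 2 * s + d with ht
  have ht0 : 0 < t := by positivity
  have hw : (1 : ℝ) ≤ W.width := by exact_mod_cast W.width_pos
  set w := (W.width : ℝ) with hwdef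
  -- `L` and `y` are chosen so that both conditions of `le_maxRisk` hold for `2 ^ j ≥ y`
  set L := 5 * w ^ d with hL
  have hwd : w ^ d ≤ L := by nlinarith [pow_nonneg (zero_le_one.trans hw) d]
  have hL1 : 1 ≤ L := (one_le_pow₀ hw).trans hwd
  set A := (2 : ℝ) ^ W.J₀ * 2 * (L * m) ^ (2 / t) with hA
  set κ := h ^ 2 * (τ ^ 2 * A ^ (-s) / (2 * w) ^ d) with hκ
  have hA0 : 0 < A := by positivity
  refine asympLE_of_ofReal_le (c := κ ^ 2 / 4) (by positivity)
    ((eventually_ge_atTop 1).mono fun n hn => le_iInf₂ fun T hT => ?_)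
  have hn' : (0 : ℝ) < n := by exact_mod_cast hn
  set N : ℝ := m * n with hN
  have hN1 : 1 ≤ N := by
    rw [hN]; exact_mod_cast Nat.mul_pos hm hn
  have hcard : (Fintype.card (Fin m × Fin n) : ℝ) = N := by simp [hN]
  have hLN : 1 ≤ L * N := one_le_mul_of_one_le_of_one_le hL1 hN1
  set y := (L * N) ^ (2 / t) with hy
  have hy1 : 1 ≤ y := Real.one_le_rpow hLN (by positivity)
  obtain ⟨j, hj, h1, h2⟩ := exists_level W.J₀ hy1
  set x := (2 : ℝ) ^ j with hx
  have hx0 : 0 < x := by positivity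
  have hyd : L * N ≤ x ^ d := by
    refine le_trans ?_ (pow_le_pow_left₀ (by positivity) h1 d)
    rw [hy, ← Real.rpow_natCast, ← Real.rpow_mul (by positivity)]
    refine Real.self_le_rpow_of_one_le hLN ?_
    rw [div_mul_eq_mul_div, le_div_iff₀ ht0]
    linarith
  have hyt : (L * N) ^ 2 ≤ x ^ t := by
    refine le_trans (le_of_eq ?_) (Real.rpow_le_rpow (by positivity) h1 ht0.le)
    rw [hy, ← Real.rpow_mul (by positivity), div_mul_cancel₀ _ ht0.ne', Real.rpow_two]
  have hwx : w ≤ x := by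
    refine le_of_pow_le_pow_left₀ hd.ne' hx0.le (hwd.trans (le_trans ?_ hyd))
    exact le_mul_of_one_le_right (by positivity) hN1
  refine le_trans (ofReal_le_ofReal ?_) (R.le_maxRisk hd hnd hα hβ hj hT ?_ ?_)
  · have hq : x / (2 * w) ≤ ((2 ^ j / W.width : ℕ) : ℝ) := by
      have h3 := Nat.lt_mul_div_succ (2 ^ j) W.width_pos
      have h4 : 1 ≤ 2 ^ j / W.width := by
        rw [Nat.le_div_iff_mul_le W.width_pos, one_mul]
        exact (Nat.cast_le (α := ℝ)).1 (by simpa using hwx)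
      have h3' : x ≤ w * ((2 ^ j / W.width : ℕ) + 1) := by
        rw [hx, hwdef]; exact_mod_cast h3.le
      have h4' : (1 : ℝ) ≤ ((2 ^ j / W.width : ℕ) : ℝ) := by exact_mod_cast h4
      rw [div_le_iff₀ (by positivity)]
      nlinarith
    have hamp : amp d τ j θ.α * amp d τ j θ.β = τ ^ 2 * x ^ (-s) / x ^ d := by
      rw [eq_div_iff (by positivity), ← res_eq_pow, amp_mul_amp, dw_eq_rpow]
    have hdw : A ^ (-s) * ((n : ℝ) ^ (2 / t)) ^ (-s) ≤ x ^ (-s) := by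
      rw [← Real.mul_rpow hA0.le (by positivity)]
      refine Real.rpow_le_rpow_of_nonpos hx0 (h2.trans_eq ?_) (by linarith)
      rw [hA, hy, hN, ← mul_assoc L, Real.mul_rpow (by positivity) hn'.le]
      ring
    have e1 : (n : ℝ) ^ (-(4 * s / t)) = (((n : ℝ) ^ (2 / t)) ^ (-s)) ^ 2 := by
      rw [← Real.rpow_natCast _ 2, ← Real.rpow_mul hn'.le, ← Real.rpow_mul hn'.le]
      congr 1
      push_cast
      ring
    rw [e1, hamp, div_mul_eq_mul_div, ← mul_pow]
    refine div_le_div_of_nonneg_right (pow_le_pow_left₀ (by positivity) ?_ 2) (by norm_num)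
    calc κ * ((n : ℝ) ^ (2 / t)) ^ (-s)
        = h ^ 2 * (τ ^ 2 * (A ^ (-s) * ((n : ℝ) ^ (2 / t)) ^ (-s)) / x ^ d) *
            (x / (2 * w)) ^ d := by
          rw [hκ, div_pow]; field_simp
      _ ≤ _ := by gcongr
  · rw [hcard, div_pow, ← mul_div_assoc, ← mul_div_assoc, div_le_one (by positivity)]
    refine le_trans (le_of_eq ?_) hyd
    rw [hL]; ring
  · have e2 : x ^ t = (x ^ s) ^ 2 * x ^ d := by
      rw [ht, Real.rpow_add hx0, Real.rpow_natCast, mul_comm 2 s, Real.rpow_mul hx0.le,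
        Real.rpow_two]
    rw [hcard, dw_eq_rpow, ← hx, Real.rpow_neg hx0.le, inv_pow, div_pow, ← div_eq_mul_inv,
      div_mul_div_comm, ← e2, div_le_one (by positivity)]
    refine le_trans ?_ hyt
    rw [mul_pow L N, mul_comm]
    refine mul_le_mul_of_nonneg_right (hwd.trans ?_) (by positivity)
    exact le_self_pow₀ hL1 two_ne_zero

end

section

variable {S d m : ℕ} {W : CDVBasis S} {θ : ModelParams} {K c₁ c₂ c h τ r C : ℝ}
  {fhat : DensityEstimator d}

/-- Below the resolution `n ^ (3d / (2α + 2β + 2d))` the bias of the Monte Carlo estimator is too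
large, above it the variance: the variance contains the term `k₁ k₂ / n ^ 3`. -/
theorem CDVBasis.Room.asympLE_maxRisk_psiMC (R : W.Room d θ c h τ) (hd : 0 < d)
    (hnd : NonDegenerate d W θ) (hα : 0 ≤ θ.α) (hβ : 0 ≤ θ.β)
    (hs : 2 * (θ.α + θ.β) < d) (hf : IsBoundedEstimator c₁ c₂ fhat) {ρ : ℝ}
    (hρ : 3 * (θ.α + θ.β) / (θ.α + θ.β + d) < ρ)
    (hD : AsympLE (maxDensityRisk W θ fhat) (powSeq (-ρ))) {j₁ j₂ : ℕ → ℕ}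
    (h₁ : ∀ n, W.J₀ ≤ j₁ n) (h₂ : ∀ n, W.J₀ ≤ j₂ n) :
    AsympLE (powSeq (-(3 * (θ.α + θ.β) / (θ.α + θ.β + d))))
      fun n => maxRisk W θ (psiMC (n := n) W fhat (j₁ n) (j₂ n)) := by
  obtain ⟨C, hC, HB⟩ := R.exists_bias_le hd hnd hα hβ hf
  obtain ⟨c', C', hc', hC', HV⟩ := R.exists_variance_le hd hnd hα hβ hf
  obtain ⟨C₀, hC₀, H₀⟩ := hD
  set s := θ.α + θ.β
  have hs0 : 0 ≤ s := add_nonneg hα hβ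
  set e := 3 * s / (s + d) with he
  set r := 3 * d / (2 * (s + d)) with hr
  have hr1 : 0 < r - 1 := by
    rw [hr, sub_pos, lt_div_iff₀ (by positivity)]; linarith
  have hre : -1 + 2 * (r - 1) = -e := by
    rw [hr, he]; field_simp; ring
  have hre' : r * (-(2 * s / d)) = -e := by
    rw [hr, he]; field_simp
  have hh := R.h_pos
  have hτ := R.τ_pos
  set κ := (h ^ 2 * τ ^ 2) ^ 2 / 2 with hκ
  have hκ0 : 0 < κ := by positivity
  refine asympLE_of_ofReal_le (c := min κ c' / 2) (half_pos (lt_min hκ0 hc')) ?_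
  filter_upwards [H₀, eventually_ge_atTop 1, eventually_le_natCast_rpow hr1 (1 + 4 * C' / c'),
    eventually_le_natCast_rpow (sub_pos.2 hρ) (2 * (C * C₀) / κ)] with n hn₀ hn hn₁ hn₂
  have hn' : (0 : ℝ) < n := by exact_mod_cast hn
  have hmin : res d (min (j₁ n) (j₂ n)) = min (res d (j₁ n)) (res d (j₂ n)) :=
    (res_mono d).map_min
  set k := res d (min (j₁ n) (j₂ n)) with hk
  have hk0 : 0 < k := res_pos _ _
  rcases le_total k ((n : ℝ) ^ r) with hkn | hkn
  -- low resolution: the bias is too large; density errors are negligible as `e < ρ`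
  · obtain ⟨P, p, b, hI, H⟩ := HB n (j₁ n) (j₂ n) hn (h₁ n) (h₂ n)
    rw [mul_pow _ (dw _ _), dw_sq_eq_res_rpow hd, ← hk] at H
    have h3 : (n : ℝ) ^ (-e) ≤ k ^ (-(2 * s / d)) := by
      rw [← hre', Real.rpow_mul hn'.le]
      exact Real.rpow_le_rpow_of_nonpos hk0 hkn (neg_nonpos.2 (by positivity))
    have h4 : ofReal C * densityRisk fhat n P (fun _ => 1) ≤ ofReal (C * C₀ * (n : ℝ) ^ (-ρ)) := by
      rw [mul_assoc, ofReal_mul hC, ofReal_mul C₀.coe_nonneg, ENNReal.ofReal_coe_nnreal]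
      exact mul_le_mul' le_rfl ((densityRisk_le_maxDensityRisk hf hI (CubeBdd.const 1)
        fun _ _ => rfl).trans hn₀)
    have h5 : C * C₀ * (n : ℝ) ^ (-ρ) ≤ κ * (n : ℝ) ^ (-e) / 2 := by
      have e1 : (n : ℝ) ^ (-e) = (n : ℝ) ^ (ρ - e) * (n : ℝ) ^ (-ρ) := by
        rw [← Real.rpow_add hn']; congr 1; ring
      rw [div_le_iff₀ hκ0] at hn₂
      rw [e1]
      nlinarith [Real.rpow_pos_of_pos hn' (-ρ)]
    have h6 : ofReal (κ * (n : ℝ) ^ (-e)) ≤ maxRisk W θ (psiMC (n := n) W fhat (j₁ n) (j₂ n)) +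
          ofReal (C * C₀ * (n : ℝ) ^ (-ρ)) := by
      refine (ofReal_le_ofReal ?_).trans (H.trans (add_le_add
        (le_iSup₂_of_le P ⟨_, _, _, hI⟩ le_rfl) h4))
      rw [hκ]
      nlinarith [sq_nonneg (h ^ 2 * τ ^ 2)]
    refine le_trans (ofReal_le_ofReal ?_) (ofReal_half_le_of_le_add (by positivity) h6 h5)
    rw [div_mul_eq_mul_div]
    gcongr
    exact min_le_left _ _
  -- high resolution: `k₁ k₂ / n ^ 3` is too large, and exceeds `(1 + k / n) / n` since `r > 1`
  · have H := HV n (j₁ n) (j₂ n) hn (h₁ n) (h₂ n)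
    rw [← hmin] at H
    set q := k / n with hq
    have h3 : (n : ℝ) ^ (r - 1) ≤ q := by
      rw [Real.rpow_sub_one hn'.ne']
      exact div_le_div_of_nonneg_right hkn hn'.le
    have h4 : 0 ≤ 4 * C' / c' := by positivity
    have h5 : C' * (1 + q) ≤ c' * q ^ 2 / 2 := by
      have h6 : 4 * C' / c' ≤ q := by linarith
      rw [div_le_iff₀ hc'] at h6
      nlinarith
    have h6 : q ^ 2 ≤ res d (j₁ n) / n * (res d (j₂ n) / n) := by
      rw [sq]
      refine mul_le_mul ?_ ?_ (by positivity) (div_nonneg (res_pos _ _).le hn'.le) <;>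
        rw [hq, hmin] <;> gcongr
      exacts [min_le_left _ _, min_le_right _ _]
    have h7 : (n : ℝ) ^ (-e) ≤ 1 / n * q ^ 2 := by
      rw [← hre, Real.rpow_add hn', Real.rpow_neg_one, one_div, mul_comm 2 (r - 1),
        Real.rpow_mul hn'.le, Real.rpow_two]
      gcongr
    refine le_trans (ofReal_le_ofReal ?_) (ofReal_half_le_of_le_add
      (x := 1 / n * (c' * q ^ 2)) (by positivity)
      (le_trans (ofReal_le_ofReal ?_) H) ?_)
    · have h8 := mul_le_mul (min_le_right κ c') h7 (by positivity) hc'.le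
      linarith
    · gcongr
    · rw [mul_div_assoc]
      gcongr

theorem rateOptimal_and_hasRate {T : ∀ n, Sample d m n → ℝ} (hT : ∀ n, Measurable (T n))
    (hlow : AsympLE (powSeq r) fun n => minimaxRisk d (Fin m × Fin n) W θ)
    (hup : AsympLE (fun n => maxRisk W θ (T n)) (powSeq r)) :
    RateOptimal W θ T ∧ HasRate W θ T r := by
  have h : AsympLE (fun n => minimaxRisk d (Fin m × Fin n) W θ)
      fun n => maxRisk W θ (T n) :=
    AsympLE.of_le (Eventually.of_forall fun n => iInf₂_le (T n) (hT n))
  exact ⟨⟨hup.trans hlow, h⟩, hup, hlow.trans h⟩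

end

theorem mainTheorem12 (d : ℕ) (α β : ℝ) (hα : 0 < α) (hβ : 0 < β)
    (hlow : (α + β) / 2 < (d : ℝ) / 4) :
    ∃ γ₀ : ℝ, ∀ γ : ℝ, 0 < γ → γ₀ < γ →
      ∀ (S : ℕ) (W : CDVBasis S), α < S → β < S → γ < S →
      ∀ (C₁ C₂ M M₁ M₂ : ℝ) (θ : ModelParams), θ = ⟨α, β, γ, C₁, C₂, M, M₁, M₂⟩ →
      NonDegenerate d W.toCDVData θ →
      ∀ fhat : DensityEstimator d, IsDensityEstimator W.toCDVData θ fhat →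
      -- the integral-based plug-in estimator
      (∀ j₁ j₂ : ℕ → ℕ, (∀ n, W.J₀ ≤ j₁ n) → (∀ n, W.J₀ ≤ j₂ n) →
        ((fun n => min (res d (j₁ n)) (res d (j₂ n))) =Θ[Filter.atTop]
          fun n : ℕ => (n : ℝ) ^ (2 * (d : ℝ) / (2 * α + 2 * β + d))) →
        RateOptimal W.toCDVData θ
          (fun n => psiINT (n := n) W.toCDVData fhat (j₁ n) (j₂ n)) ∧
        HasRate W.toCDVData θ
          (fun n => psiINT (n := n) W.toCDVData fhat (j₁ n) (j₂ n))
          (-((4 * α + 4 * β) / (2 * α + 2 * β + d)))) ∧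
      -- the Monte Carlo-based plug-in estimator: never rate optimal, best rate, attained
      (∀ j₁ j₂ : ℕ → ℕ, (∀ n, W.J₀ ≤ j₁ n) → (∀ n, W.J₀ ≤ j₂ n) →
        ¬ RateOptimal W.toCDVData θ
          (fun n => psiMC (n := n) W.toCDVData fhat (j₁ n) (j₂ n)) ∧
        AsympLE (powSeq (-((3 * α + 3 * β) / (α + β + d))))
          (fun n => maxRisk W.toCDVData θ (psiMC (n := n) W.toCDVData fhat (j₁ n) (j₂ n)))) ∧
      (∀ j₁ j₂ : ℕ → ℕ, (∀ n, W.J₀ ≤ j₁ n) → (∀ n, W.J₀ ≤ j₂ n) →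
        ((fun n => res d (j₁ n)) =Θ[Filter.atTop]
          fun n : ℕ => (n : ℝ) ^ (3 * (d : ℝ) / (2 * α + 2 * β + 2 * d))) →
        ((fun n => res d (j₂ n)) =Θ[Filter.atTop]
          fun n : ℕ => (n : ℝ) ^ (3 * (d : ℝ) / (2 * α + 2 * β + 2 * d))) →
        HasRate W.toCDVData θ
          (fun n => psiMC (n := n) W.toCDVData fhat (j₁ n) (j₂ n))
          (-((3 * α + 3 * β) / (α + β + d)))) ∧
      -- the Newey and Robins plug-in estimator
      (∀ j : ℕ → ℕ, (∀ n, W.J₀ ≤ j n) →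
        ((fun n => res d (j n)) =Θ[Filter.atTop]
          fun n : ℕ => (n : ℝ) ^ (2 * (d : ℝ) / (2 * α + 2 * β + d))) →
        RateOptimal W.toCDVData θ
          (fun n => psiNR (n := n) W.toCDVData fhat (j n)) ∧
        HasRate W.toCDVData θ
          (fun n => psiNR (n := n) W.toCDVData fhat (j n))
          (-((4 * α + 4 * β) / (2 * α + 2 * β + d)))) ∧
      -- the first-order bias-corrected estimator
      (∀ j₁ j₂ : ℕ → ℕ, (∀ n, W.J₀ ≤ j₁ n) → (∀ n, W.J₀ ≤ j₂ n) →
        ((fun n => max (res d (j₁ n)) (res d (j₂ n))) =Θ[Filter.atTop]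
          fun n : ℕ => (n : ℝ) ^ (2 * (d : ℝ) / (2 * α + 2 * β + d))) →
        ((fun n => min (res d (j₁ n)) (res d (j₂ n))) =O[Filter.atTop]
          fun n : ℕ => (n : ℝ)) →
        RateOptimal W.toCDVData θ
          (fun n => psiIF (n := n) W.toCDVData fhat (j₁ n) (j₂ n)) ∧
        HasRate W.toCDVData θ
          (fun n => psiIF (n := n) W.toCDVData fhat (j₁ n) (j₂ n))
          (-((4 * α + 4 * β) / (2 * α + 2 * β + d)))) := by
  have hd : 0 < d := by
    by_contra h
    obtain rfl : d = 0 := by omega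
    norm_num at hlow
    linarith
  have hd' : (0 : ℝ) < d := by exact_mod_cast hd
  refine ⟨2 * (α + β) * d / (d - 2 * (α + β)), ?_⟩
  intro γ hγ hγ₀ S W hαS hβS hγS C₁ C₂ M M₁ M₂ θ hθ hnd fhat hfhat
  have hθα : α = θ.α := by rw [hθ]
  have hθβ : β = θ.β := by rw [hθ]
  have hθγ : γ = θ.γ := by rw [hθ]
  clear hθ
  subst hθα hθβ hθγ
  set s := θ.α + θ.β with hs
  have hs0 : 0 < s := add_pos hα hβ
  have hsd : 2 * s < d := by linarith
  have hγs : 2 * s * d < θ.γ * (d - 2 * s) := by rwa [div_lt_iff₀ (by linarith)] at hγ₀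
  have hγ2 : 2 * s < θ.γ := by nlinarith
  set ρ := 4 * s / (2 * s + d) with hρ
  set e := 3 * s / (s + d) with he
  set r := 2 * d / (2 * s + d) with hr
  set r' := 3 * d / (2 * s + 2 * d) with hr'
  have eρ : (4 * θ.α + 4 * θ.β) / (2 * θ.α + 2 * θ.β + d) = ρ := by rw [hρ, hs]; ring
  have ee : (3 * θ.α + 3 * θ.β) / (s + d) = e := by rw [he, hs]; ring
  have er : 2 * d / (2 * θ.α + 2 * θ.β + d) = r := by rw [hr, hs]; ring
  have er' : 3 * d / (2 * θ.α + 2 * θ.β + 2 * d) = r' := by rw [hr', hs]; ring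
  simp only [eρ, ee, er, er']
  -- the Monte Carlo rate is slower because `2 s < d`
  have heρ : e < ρ := by
    rw [he, hρ, div_lt_div_iff₀ (by linarith) (by linarith)]
    nlinarith
  -- density errors are negligible because `γ > γ₀`
  have hργ : ρ < 2 * θ.γ / (2 * θ.γ + d) := by
    rw [hρ, div_lt_div_iff₀ (by linarith) (by linarith)]
    nlinarith
  have hr1 : 1 ≤ r := by rw [hr, le_div_iff₀ (by linarith)]; linarith
  have hr1' : 1 ≤ r' := by rw [hr', le_div_iff₀ (by linarith)]; linarith
  have e₁ : -(r * (2 * s / d)) = -ρ := by rw [hr, hρ]; field_simp; norm_num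
  have e₂ : -(r' * (2 * s / d)) = -e := by rw [hr', he]; field_simp
  have e₃ : -1 + (r - 1) = -ρ := by
    have : 2 * s + d ≠ 0 := by linarith
    rw [hr, hρ]; field_simp; ring
  have e₄ : -1 + ((r' - 1) + (r' - 1)) = -e := by
    have : s + d ≠ 0 := by linarith
    rw [hr', he, ← mul_add]; field_simp; ring
  obtain ⟨c₁, c₂, hc₁, hb⟩ := hfhat.bounded
  have hf : IsBoundedEstimator c₁ c₂ fhat := ⟨hc₁, hfhat.measurable, hb⟩
  obtain ⟨K, hK, HK⟩ := exists_modelLaw hα hβ hnd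
  obtain ⟨c, h, τ, R⟩ := exists_room hnd
  have hD := hfhat.asympLE hργ
  have hM := hnd.M_pos.le
  have hαγ : θ.α ≤ θ.γ := by linarith
  have hβγ : θ.β ≤ θ.γ := by linarith
  have hmm (m : ℕ) (hm : 0 < m) := R.asympLE_minimaxRisk (m := m) hd hnd hα.le hβ.le hsd.le hm
  have hvar := one_div_natCast_isBigO
  have hmin (j₁ j₂ : ℕ) : min (res d j₁) (res d j₂) = res d (min j₁ j₂) :=
    ((res_mono d).map_min).symm
  have hmax (j₁ j₂ : ℕ) : max (res d j₁) (res d j₂) = res d (max j₁ j₂) :=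
    ((res_mono d).map_max).symm
  have hbias (j : ℕ → ℕ) (x : ℝ) (h : (fun n : ℕ => (n : ℝ) ^ x) =O[atTop] fun n => res d (j n)) :=
    dw_sq_isBigO hd hs0.le h
  have hINT (j₁ j₂ : ℕ → ℕ) (h₁ : ∀ n, W.J₀ ≤ j₁ n) (h₂ : ∀ n, W.J₀ ≤ j₂ n)
      (hj : (fun n => min (res d (j₁ n)) (res d (j₂ n))) =Θ[atTop] fun n : ℕ => (n : ℝ) ^ r) :
      AsympLE (fun n => maxRisk W θ (psiINT (n := n) W fhat (j₁ n) (j₂ n)))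
        (powSeq (-ρ)) := by
    obtain ⟨C, hC, H⟩ := exists_mse_psiINT_le (d := d) (W := W) hα hβ hαγ hβγ hγS hM hK hf
    refine asympLE_maxRisk hf HK (fun P p b f n hP hn =>
      H P p b f n _ _ hP hn (h₁ n) (h₂ n)) (.add ?_ ?_) hD
    · rw [← e₁]
      exact hbias _ r (by simpa only [hmin] using hj.2)
    · rw [← e₃]
      exact natCast_rpow_mul_isBigO hvar (one_add_div_isBigO hj.1 hr1)
  have hMC {j₁ j₂ : ℕ → ℕ} (h₁ : ∀ n, W.J₀ ≤ j₁ n) (h₂ : ∀ n, W.J₀ ≤ j₂ n) :=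
    R.asympLE_maxRisk_psiMC hd hnd hα.le hβ.le hsd hf heρ hD h₁ h₂
  refine ⟨fun j₁ j₂ h₁ h₂ hj => ?_, fun j₁ j₂ h₁ h₂ => ⟨fun hopt => ?_, hMC h₁ h₂⟩,
    fun j₁ j₂ h₁ h₂ hj₁ hj₂ => ⟨?_, hMC h₁ h₂⟩, fun j h₁ hj => ?_,
    fun j₁ j₂ h₁ h₂ hj hj' => ?_⟩
  · exact rateOptimal_and_hasRate (fun n => hf.measurable_psiINT W _ _) (hmm 6 (by norm_num))
      (hINT j₁ j₂ h₁ h₂ hj)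
  -- a rate optimal estimator would be as good as the integral-based one
  · obtain ⟨j, hj₀, hj⟩ := exists_levels W.J₀ hd (zero_le_one.trans hr1)
    refine not_asympLE_powSeq (neg_lt_neg heρ) ((hMC h₁ h₂).trans (hopt.1.trans (AsympLE.trans
      (AsympLE.of_le (Eventually.of_forall fun n => ?_)) (hINT j j hj₀ hj₀ (by simpa using hj)))))
    exact iInf₂_le (psiINT (n := n) W fhat (j n) (j n)) (hf.measurable_psiINT W _ _)
  · obtain ⟨C, hC, H⟩ := exists_mse_psiMC_le (d := d) (W := W) hα hβ hαγ hβγ hγS hM hK hf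
    refine asympLE_maxRisk hf HK (fun P p b f n hP hn =>
      H P p b f n _ _ hP hn (h₁ n) (h₂ n)) (.add ?_ ?_)
      (hD.trans (asympLE_powSeq (neg_le_neg heρ.le)))
    · rw [← e₂]
      refine hbias _ r' ?_
      obtain ⟨C₁, hC₁, H₁⟩ := hj₁.2.exists_pos
      obtain ⟨C₂, hC₂, H₂⟩ := hj₂.2.exists_pos
      refine Asymptotics.IsBigO.of_bound (max C₁ C₂) ?_
      filter_upwards [H₁.bound, H₂.bound] with n hn₁ hn₂
      rcases min_choice (j₁ n) (j₂ n) with h | h <;> rw [h]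
      · exact hn₁.trans (mul_le_mul_of_nonneg_right (le_max_left _ _) (norm_nonneg _))
      · exact hn₂.trans (mul_le_mul_of_nonneg_right (le_max_right _ _) (norm_nonneg _))
    · rw [← e₄]
      exact natCast_rpow_mul_isBigO hvar (natCast_rpow_mul_isBigO
        (one_add_div_isBigO hj₁.1 hr1') (one_add_div_isBigO hj₂.1 hr1'))
  · refine rateOptimal_and_hasRate (fun n => hf.measurable_psiNR W _) (hmm 3 (by norm_num)) ?_
    obtain ⟨C, hC, H⟩ := exists_mse_psiNR_le (d := d) (W := W) hα hβ hαγ hβγ hγS hM hK hf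
    refine asympLE_maxRisk hf HK (fun P p b f n hP hn => H P p b f n _ hP hn (h₁ n))
      (.add ?_ ?_) hD
    · rw [← e₁]
      exact hbias _ r hj.2
    · rw [← e₃]
      exact natCast_rpow_mul_isBigO hvar (one_add_div_isBigO hj.1 hr1)
  · refine rateOptimal_and_hasRate (fun n => hf.measurable_psiIF W _ _) (hmm 5 (by norm_num)) ?_
    obtain ⟨C, hC, H⟩ := exists_mse_psiIF_le (d := d) (W := W) hα hβ hαγ hβγ hγS hM hK hf
    refine asympLE_maxRisk hf HK (fun P p b f n hP hn =>
      H P p b f n _ _ hP hn (h₁ n) (h₂ n)) (.add ?_ ?_) hD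
    · rw [← e₁]
      exact hbias _ r (by simpa only [hmax] using hj.2)
    · have h5 := natCast_rpow_mul_isBigO hvar (natCast_rpow_mul_isBigO
        (one_add_div_isBigO hj.1 hr1) (one_add_div_isBigO (r := 1) (by simpa using hj') le_rfl))
      rw [sub_self, add_zero, e₃] at h5
      refine h5.congr_left fun n => ?_
      rcases le_total (res d (j₁ n)) (res d (j₂ n)) with h | h
      · rw [max_eq_right h, min_eq_left h, mul_comm (1 + res d (j₂ n) / n)]
      · rw [max_eq_left h, min_eq_right h]
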